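/- Let $k$ be a field of arbitrary characteristic, and write $[x:y:z]$ for the homogeneous coordinates on $\mathbb{P}^2_k$. For a smooth conic $Q=\{q=0\}\subset\mathbb{P}^2_k$ with a $k$-rational point $p$, let $\ell=0$ be an equation of the tangent line $T_pQ$, let $S=\mathbb{P}^2_k\setminus Q$, and let $\rho_p:S\to\mathbb{A}^1_k=\mathrm{Spec}(k[t])$, $t\mapsto \ell^2/q$, be the $\mathbb{A}^1$-fibration induced by the pencil generated by $Q$ and $2T_pQ$. Let $\mathrm{Aut}(\mathbb{P}^2,Q)$ be the group of $k$-automorphisms of $\mathbb{P}^2_k$ preserving $Q$, and let $\mathrm{Aut}(S,\rho_p)$ be the group of those $\Psi\in\mathrm{Aut}_k(S)$ for which there is $\psi\in\mathrm{Aut}_k(\mathbb{A}^1_k)$ with $\rho_p\circ\Psi=\psi\circ\rho_p$. Then the following hold. 1) For every smooth conic $Q\subset\mathbb{P}^2_k$ and every $k$-rational point $p$ of $Q$, the group $\mathrm{Aut}_k(S)$ is the free product of its subgroups $\mathrm{Aut}(\mathbb{P}^2,Q)|_S$ and $\mathrm{Aut}(S,\rho_p)$ amalgamated along their intersection. Let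 now $q_0=xz+y^2$, $Q_0=\{q_0=0\}$, $S_0=\mathbb{P}^2_k\setminus Q_0$, $p_0=[0:0:1]$ and $\rho_0=\rho_{p_0}:[x:y:z]\mapsto x^2/q_0$. 2) The group $\mathrm{Aut}(\mathbb{P}^2,Q_0)$ is isomorphic to $\mathrm{PGL}_2(k)$ and is generated by the automorphisms a) $[x:y:z]\mapsto[x:y+bx:z-2by-b^2x]$, $b\in k$; b) $[x:y:z]\mapsto[ax:y:a^{-1}z]$, $a\in k^*$; c) $[x:y:z]\mapsto[z:-y:x]$. 3) For every $s\in k[t]$ the formula $$[x:y:z]\mapsto\Bigl[x:\ y+s\bigl(\tfrac{x^2}{q_0}\bigr)x:\ z-2y\,s\bigl(\tfrac{x^2}{q_0}\bigr)-x\,s\bigl(\tfrac{x^2}{q_0}\bigr)^2\Bigr]$$ defines an automorphism of $S_0$, and the group $\mathrm{Aut}(S_0,\rho_0)$ is generated by these automorphisms together with the restrictions to $S_0$ of the elements of $\mathrm{Aut}(\mathbb{P}^2,Q_0)$ fixing the point $p_0$. -/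

import Mathlib

open AlgebraicGeometry CategoryTheory HomogeneousLocalization
open scoped MatrixGroups

universe u

noncomputable section

namespace ConicComplement

/-! ### Amalgamated products of two subgroups -/

section Amalgam

variable {G : Type*} [Group G]

/-- The canonical homomorphism to `G` from the free product of two subgroups `H` and `K`
amalgamated along their intersection `H ⊓ K`. -/
def amalgamToGroup (H K : Subgroup G) :
    Monoid.PushoutI (fun b : Bool => Subgroup.inclusion
      (show H ⊓ K ≤ cond b H K by cases b; exacts [inf_le_right, inf_le_left])) →* G :=
  Monoid.PushoutI.lift (fun b => (cond b H K).subtype) (H ⊓ K).subtype (fun _ => rfl)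

/-- `G` is the free product of its subgroups `H` and `K` amalgamated along `H ⊓ K`. -/
def IsAmalgamOf (H K : Subgroup G) : Prop :=
  Function.Bijective (amalgamToGroup H K)

end Amalgam

/-! ### The projective plane -/

variable (k : Type u) [Field k]

/-- The grading of `k[x, y, z]` by the degree; `x = X 0`, `y = X 1`, `z = X 2`. -/
abbrev grading : ℕ → Submodule k (MvPolynomial (Fin 3) k) :=
  MvPolynomial.homogeneousSubmodule (Fin 3) k

instance : GradedAlgebra (grading k) := MvPolynomial.gradedAlgebra

/-- The projective plane `ℙ²` over `k`. -/
def Plane : Scheme.{u} := Proj (grading k)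

/-- The structure morphism of the projective plane. -/
def Plane.toSpec : Plane k ⟶ Spec (.of k) :=
  Proj.toSpecZero (grading k) ≫ Spec.map (CommRingCat.ofHom (algebraMap k (grading k 0)))

/-- The group of `k`-automorphisms of the projective plane. -/
abbrev AutPlane : Type u := Aut (Over.mk (Plane.toSpec k))

variable {k}

theorem hom_left_inv_left_apply (φ : AutPlane k) (x : Plane k) :
    φ.hom.left (φ.inv.left x) = x := by
  have h : φ.inv.left ≫ φ.hom.left = 𝟙 (Plane k) := by
    rw [← Over.comp_left, φ.inv_hom_id]; rfl
  exact congrArg (fun f : Plane k ⟶ Plane k => f x) h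

theorem inv_left_hom_left_apply (φ : AutPlane k) (x : Plane k) :
    φ.inv.left (φ.hom.left x) = x :=
  hom_left_inv_left_apply φ.symm x

/-- The ring homomorphism `k[x, y, z] → k[t]`, `f ↦ f(p₀t, p₁t, p₂t)`, whose kernel is the
homogeneous ideal of the point `[p₀ : p₁ : p₂]`. -/
def restrictToCone (p : Fin 3 → k) : MvPolynomial (Fin 3) k →ₐ[k] Polynomial k :=
  MvPolynomial.aeval fun i => Polynomial.C (p i) * Polynomial.X

theorem restrictToCone_of_mem (p : Fin 3 → k) {n : ℕ} {f : MvPolynomial (Fin 3) k}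
    (hf : f ∈ grading k n) :
    restrictToCone p f = Polynomial.C (MvPolynomial.eval p f) * Polynomial.X ^ n := by
  rw [MvPolynomial.mem_homogeneousSubmodule] at hf
  conv_lhs => rw [restrictToCone, MvPolynomial.aeval_def, MvPolynomial.eval₂_eq']
  rw [MvPolynomial.eval_eq', map_sum, Finset.sum_mul]
  refine Finset.sum_congr rfl fun d hd => ?_
  have hdeg : ∑ i, d i = n := by
    have := hf (MvPolynomial.mem_support_iff.mp hd)
    rw [← this, Finsupp.weight_apply, Finsupp.sum_fintype _ _ (by simp)]
    simp
  simp only [mul_pow, Finset.prod_mul_distrib, Finset.prod_pow_eq_pow_sum, hdeg, map_mul, map_prod,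
    map_pow, Polynomial.algebraMap_eq]
  ring

theorem isHomogeneous_ker_restrictToCone (p : Fin 3 → k) :
    (RingHom.ker (restrictToCone p)).IsHomogeneous (grading k) := by
  intro n f hf
  rw [RingHom.mem_ker] at hf ⊢
  have key : ∀ m, restrictToCone p (DirectSum.decompose (grading k) f m : MvPolynomial (Fin 3) k) =
      Polynomial.C (MvPolynomial.eval p (DirectSum.decompose (grading k) f m)) *
        Polynomial.X ^ m :=
    fun m => restrictToCone_of_mem p (SetLike.coe_mem _)
  classical
  have hsum : ∑ m ∈ (DirectSum.decompose (grading k) f).support,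
      Polynomial.C (MvPolynomial.eval p (DirectSum.decompose (grading k) f m)) *
        Polynomial.X ^ m = 0 := by
    rw [← hf]
    conv_rhs => rw [← DirectSum.sum_support_decompose (grading k) f]
    rw [map_sum]
    exact Finset.sum_congr rfl fun m _ => (key m).symm
  have hn := congrArg (fun g => Polynomial.coeff g n) hsum
  simp only [Polynomial.finsetSum_coeff, Polynomial.coeff_C_mul, Polynomial.coeff_X_pow,
    mul_ite, mul_one, mul_zero, Polynomial.coeff_zero, Finset.sum_ite_eq] at hn
  rw [key]
  by_cases h : n ∈ (DirectSum.decompose (grading k) f).support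
  · rw [if_pos h] at hn
    rw [hn]; simp
  · rw [DFinsupp.notMem_support_iff] at h
    rw [h]; simp

/-- The `k`-rational point `[p₀ : p₁ : p₂]` of the projective plane. -/
def Plane.point (p : Fin 3 → k) (hp : p ≠ 0) : Plane k :=
  show ProjectiveSpectrum (grading k) from
  { asHomogeneousIdeal := ⟨RingHom.ker (restrictToCone p), isHomogeneous_ker_restrictToCone p⟩
    isPrime := RingHom.ker_isPrime _
    not_irrelevant_le := by
      intro h
      refine hp (funext fun i => ?_)
      have hi : (MvPolynomial.X i : MvPolynomial (Fin 3) k) ∈ grading k 1 :=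
        MvPolynomial.isHomogeneous_X k i
      have hX : (MvPolynomial.X i : MvPolynomial (Fin 3) k) ∈
          HomogeneousIdeal.irrelevant (grading k) := by
        rw [HomogeneousIdeal.mem_irrelevant_iff, GradedRing.proj_apply,
          DirectSum.decompose_of_mem_ne (grading k) hi one_ne_zero]
      have h0 : restrictToCone p (MvPolynomial.X i) = 0 := h hX
      simpa [restrictToCone] using h0 }

/-- `φ` is the automorphism `[x : y : z] ↦ [L₀ : L₁ : L₂]` of the projective plane, that is, it is
induced by the graded `k`-algebra endomorphism `X i ↦ L i` of `k[x, y, z]`. -/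
def AutPlane.IsGivenBy (φ : AutPlane k) (L : Fin 3 → MvPolynomial (Fin 3) k) : Prop :=
  ∃ (f : GradedRingHom (grading k) (grading k))
    (hf : HomogeneousIdeal.irrelevant (grading k) ≤
      (HomogeneousIdeal.irrelevant (grading k)).map f),
    (∀ c : k, f (MvPolynomial.C c) = MvPolynomial.C c) ∧
    (∀ i : Fin 3, f (MvPolynomial.X i) = L i) ∧
    φ.hom.left = Proj.map f hf

/-! ### Smooth conics and their complements -/

variable (k) in
/-- A smooth conic in the projective plane over `k`, given by an equation: a quadratic form without
singular zeros over an algebraic closure of `k`. -/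
structure SmoothConic where
  /-- The equation of the conic. -/
  q : MvPolynomial (Fin 3) k
  mem : q ∈ grading k 2
  smooth : ∀ v : Fin 3 → AlgebraicClosure k, v ≠ 0 → MvPolynomial.aeval v q = 0 →
    ∃ i, MvPolynomial.aeval v (MvPolynomial.pderiv i q) ≠ 0

namespace SmoothConic

variable (Q : SmoothConic k)

/-- The complement `S` of the conic `Q`, an open subscheme of the projective plane. -/
def compl : (Plane k).Opens := Proj.basicOpen (grading k) Q.q

/-- The group of `k`-automorphisms of the complement `S` of `Q`. -/
abbrev AutCompl : Type u := Aut (Over.mk (Q.compl.ι ≫ Plane.toSpec k))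

/-- The group `Aut(ℙ², Q)` of the `k`-automorphisms of the projective plane that preserve `Q`.
As `Q` is reduced, preserving it means preserving its set of points, or the complement of it. -/
def autPair : Subgroup (AutPlane k) where
  carrier := {φ | ∀ x : Plane k, φ.hom.left x ∈ Q.compl ↔ x ∈ Q.compl}
  mul_mem' := fun {φ χ} hφ hχ x => (hφ (χ.hom.left x)).trans (hχ x)
  one_mem' := fun _ => Iff.rfl
  inv_mem' := fun {φ} hφ x => by
    have h := hφ (φ.inv.left x)
    rw [hom_left_inv_left_apply] at h
    exact h.symm

/-- The group `Aut(ℙ², Q, p)` of the elements of `Aut(ℙ², Q)` that fix the rational point `p`. -/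
def autPairPoint (p : Fin 3 → k) (hp : p ≠ 0) : Subgroup (AutPlane k) where
  carrier := {φ | φ ∈ Q.autPair ∧ φ.hom.left (Plane.point p hp) = Plane.point p hp}
  mul_mem' := fun {φ χ} hφ hχ => ⟨Q.autPair.mul_mem hφ.1 hχ.1,
    (congrArg (fun x => φ.hom.left x) hχ.2).trans hφ.2⟩
  one_mem' := ⟨Q.autPair.one_mem, rfl⟩
  inv_mem' := fun {φ} hφ => ⟨Q.autPair.inv_mem hφ.1, by
    have h := inv_left_hom_left_apply φ (Plane.point p hp)
    rw [hφ.2] at h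
    exact h⟩

/-- The group of the `k`-automorphisms of `S` that are restrictions of elements of a subgroup `H`
of the group of automorphisms of the projective plane. -/
def restrictToCompl (H : Subgroup (AutPlane k)) : Subgroup Q.AutCompl where
  carrier := {ψ | ∃ φ ∈ H, ψ.hom.left ≫ Q.compl.ι = Q.compl.ι ≫ φ.hom.left}
  mul_mem' := by
    rintro ψ χ ⟨φ, hφ, h⟩ ⟨φ', hφ', h'⟩
    refine ⟨φ * φ', H.mul_mem hφ hφ', ?_⟩
    change (χ.hom.left ≫ ψ.hom.left) ≫ Q.compl.ι = Q.compl.ι ≫ φ'.hom.left ≫ φ.hom.left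
    rw [Category.assoc, h, reassoc_of% h']
  one_mem' := ⟨1, H.one_mem, by
    change 𝟙 _ ≫ Q.compl.ι = Q.compl.ι ≫ 𝟙 _
    simp⟩
  inv_mem' := by
    rintro ψ ⟨φ, hφ, h⟩
    refine ⟨φ⁻¹, H.inv_mem hφ, ?_⟩
    change ψ.inv.left ≫ Q.compl.ι = Q.compl.ι ≫ φ.inv.left
    have h1 : ψ.inv.left ≫ ψ.hom.left = 𝟙 _ := by
      rw [← Over.comp_left, ψ.inv_hom_id]; rfl
    have h2 : φ.hom.left ≫ φ.inv.left = 𝟙 _ := by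
      rw [← Over.comp_left, φ.hom_inv_id]; rfl
    calc ψ.inv.left ≫ Q.compl.ι
        = ψ.inv.left ≫ Q.compl.ι ≫ φ.hom.left ≫ φ.inv.left := by
          rw [h2]; exact congrArg _ (Category.comp_id _).symm
      _ = (ψ.inv.left ≫ ψ.hom.left) ≫ Q.compl.ι ≫ φ.inv.left := by
          rw [← reassoc_of% h, Category.assoc]
      _ = Q.compl.ι ≫ φ.inv.left := by rw [h1]; exact Category.id_comp _

/-! ### The fibration defined by the pencil of a conic and its double tangent -/

/-- The linear form `∑ (∂q/∂Xᵢ)(p) Xᵢ` that defines the tangent line to `Q` at `p`. -/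
def tangentForm (p : Fin 3 → k) : MvPolynomial (Fin 3) k :=
  ∑ i, MvPolynomial.C (MvPolynomial.eval p (MvPolynomial.pderiv i Q.q)) * MvPolynomial.X i

theorem tangentForm_sq_mem (p : Fin 3 → k) : Q.tangentForm p ^ 2 ∈ grading k (1 • 2) := by
  have h : Q.tangentForm p ∈ grading k 1 :=
    Submodule.sum_mem _ fun i _ => by
      simpa using (MvPolynomial.isHomogeneous_C (Fin 3) _).mul (MvPolynomial.isHomogeneous_X k i)
  exact MvPolynomial.IsHomogeneous.pow h 2

/-- The regular function `ℓ² / q` on `S`, where `ℓ` is the equation of the tangent line at `p`. -/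
def pencilFun (p : Fin 3 → k) : Away (grading k) Q.q :=
  Away.mk (grading k) Q.mem 1 (Q.tangentForm p ^ 2) (Q.tangentForm_sq_mem p)

variable (k) in
/-- The affine line over `k`, as a scheme over `k`. -/
def line : Over (Spec (.of k)) :=
  Over.mk (Spec.map (CommRingCat.ofHom (algebraMap k (Polynomial k))))

/-- The `𝔸¹`-fibration `ρ_p : S → 𝔸¹ = Spec k[t]`, with `t ↦ ℓ² / q`, which is the restriction to
`S` of the rational map to `ℙ¹` defined by the pencil generated by `Q` and twice its tangent line
at `p`. -/
def fibration (p : Fin 3 → k) : Q.compl.toScheme ⟶ (line k).left :=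
  Proj.basicOpenToSpec (grading k) Q.q ≫ Spec.map (CommRingCat.ofHom
    (Polynomial.eval₂RingHom
      ((algebraMap (grading k 0) (Away (grading k) Q.q)).comp (algebraMap k (grading k 0)))
      (Q.pencilFun p)))

/-- The group `Aut(S, ρ_p)` of the `k`-automorphisms of `S` that preserve `ρ_p` globally. -/
def autFibration (p : Fin 3 → k) : Subgroup Q.AutCompl where
  carrier := {ψ | ∃ α : Aut (line k),
    ψ.hom.left ≫ Q.fibration p = Q.fibration p ≫ α.hom.left}
  mul_mem' := by
    rintro ψ χ ⟨α, h⟩ ⟨β, h'⟩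
    refine ⟨α * β, ?_⟩
    change (χ.hom.left ≫ ψ.hom.left) ≫ Q.fibration p =
      Q.fibration p ≫ β.hom.left ≫ α.hom.left
    rw [Category.assoc, h, reassoc_of% h']
  one_mem' := ⟨1, by
    change 𝟙 _ ≫ Q.fibration p = Q.fibration p ≫ 𝟙 _
    simp⟩
  inv_mem' := by
    rintro ψ ⟨α, h⟩
    refine ⟨α⁻¹, ?_⟩
    change ψ.inv.left ≫ Q.fibration p = Q.fibration p ≫ α.inv.left
    have h1 : ψ.inv.left ≫ ψ.hom.left = 𝟙 _ := by
      rw [← Over.comp_left, ψ.inv_hom_id]; rfl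
    have h2 : α.hom.left ≫ α.inv.left = 𝟙 _ := by
      rw [← Over.comp_left, α.hom_inv_id]; rfl
    calc ψ.inv.left ≫ Q.fibration p
        = ψ.inv.left ≫ Q.fibration p ≫ α.hom.left ≫ α.inv.left := by
          rw [h2]; exact congrArg _ (Category.comp_id _).symm
      _ = (ψ.inv.left ≫ ψ.hom.left) ≫ Q.fibration p ≫ α.inv.left := by
          rw [← reassoc_of% h, Category.assoc]
      _ = Q.fibration p ≫ α.inv.left := by rw [h1]; exact Category.id_comp _

/-- `ψ` is the automorphism `[x : y : z] ↦ [F₀ : F₁ : F₂]` of `S`, where the `Fᵢ` are elements of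
`k[x, y, z][1/q]` for which `q(F₀, F₁, F₂)` is invertible: the pullback by `ψ` of a regular function
`f / qⁿ` on `S`, with `f` homogeneous of degree `2n`, is `f(F₀, F₁, F₂) / q(F₀, F₁, F₂)ⁿ`. -/
def IsGivenBy (ψ : Q.AutCompl) (F : Fin 3 → Localization.Away Q.q) : Prop :=
  IsUnit (MvPolynomial.aeval F Q.q) ∧
  ∃ g : Away (grading k) Q.q →+* Away (grading k) Q.q,
    (∀ (n : ℕ) (f : MvPolynomial (Fin 3) k) (hf : f ∈ grading k (n • 2)),
      (g (Away.mk (grading k) Q.mem n f hf)).val * MvPolynomial.aeval F Q.q ^ n =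
        MvPolynomial.aeval F f) ∧
    ψ.hom.left ≫ Proj.basicOpenToSpec (grading k) Q.q =
      Proj.basicOpenToSpec (grading k) Q.q ≫ Spec.map (CommRingCat.ofHom g)

/-! ### The model conic -/

variable (k) in
/-- The conic `Q₀` with the equation `xz + y² = 0`. -/
def model : SmoothConic k where
  q := MvPolynomial.X 0 * MvPolynomial.X 2 + MvPolynomial.X 1 ^ 2
  mem := ((MvPolynomial.isHomogeneous_X k 0).mul (MvPolynomial.isHomogeneous_X k 2)).add
    ((MvPolynomial.isHomogeneous_X k 1).pow 2)
  smooth := by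
    intro v hv h
    by_contra! hd
    have h0 := hd 0
    have h2 := hd 2
    simp [MvPolynomial.pderiv_X] at h h0 h2
    refine hv (funext fun i => ?_)
    fin_cases i
    · exact h2
    · simpa [h0, h2] using h
    · exact h0

variable (k) in
/-- Homogeneous coordinates of the point `p₀ = [0 : 0 : 1]` of `Q₀`. The tangent line to `Q₀` at
`p₀` is `{x = 0}`, so that the fibration defined by `Q₀` and `p₀` is `[x : y : z] ↦ x² / q₀`. -/
def modelPoint : Fin 3 → k := ![0, 0, 1]

variable (k) in
theorem modelPoint_ne_zero : modelPoint k ≠ 0 :=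
  fun h => one_ne_zero (congrFun h 2 : (1 : k) = 0)

open MvPolynomial in
/-- The coordinates of the map `[x : y : z] ↦ [x : y + bx : z - 2by - b²x]`. -/
def shear (b : k) : Fin 3 → MvPolynomial (Fin 3) k :=
  ![X 0, X 1 + C b * X 0, X 2 - 2 * C b * X 1 - C b ^ 2 * X 0]

open MvPolynomial in
/-- The coordinates of the map `[x : y : z] ↦ [ax : y : a⁻¹z]`. -/
def torus (a : kˣ) : Fin 3 → MvPolynomial (Fin 3) k :=
  ![C (a : k) * X 0, X 1, C ((a⁻¹ : kˣ) : k) * X 2]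

open MvPolynomial in
variable (k) in
/-- The coordinates of the map `[x : y : z] ↦ [z : -y : x]`. -/
def swap : Fin 3 → MvPolynomial (Fin 3) k :=
  ![X 2, -X 1, X 0]

variable (k) in
/-- The rational function `x² / q₀`, as an element of `k[x, y, z][1/q₀]`. -/
def modelParam : Localization.Away (model k).q :=
  Localization.mk (MvPolynomial.X 0 ^ 2) ⟨(model k).q, Submonoid.mem_powers _⟩

/-- The coordinates of the map
`[x : y : z] ↦ [x : y + s(x²/q₀)x : z - 2y s(x²/q₀) - x s(x²/q₀)²]`. -/
def fiberedMap (s : Polynomial k) : Fin 3 → Localization.Away (model k).q :=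
  let x (i : Fin 3) : Localization.Away (model k).q :=
    algebraMap (MvPolynomial (Fin 3) k) _ (MvPolynomial.X i)
  let σ : Localization.Away (model k).q := Polynomial.aeval (modelParam k) s
  ![x 0, x 1 + σ * x 0, x 2 - 2 * x 1 * σ - x 0 * σ ^ 2]

end SmoothConic
end ConicComplement

end

/-! Suitable homogeneous coordinates turn the conic and its tangent at `p` into `xz + y² = 0` and `x
= 0`, up to constants (`nonempty_frame`). Every complement is therefore the spectrum of one ring
`Coord k`, the even part of the coordinate ring of the quadric `xz + y² = 1`. Put `w = -z`. Through
`y = 1 + xv` this ring lies in `k[v][x]`, with a basis `mono j m`, `m ≤ 4j`, whose leading terms are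
the monomials `x^(2j) v^m`; the degree in `x` is twice the order of the pole along the conic. Write
`t = x²`. In the automorphism group of this ring, `degSub` (degree preserved) corresponds to the
restrictions of plane automorphisms, and `fibSub` (`t` multiplied by a constant) to the
automorphisms that preserve the fibration.

For `fibSub`: an automorphism of the line is affine, and its translation part vanishes because every
automorphism sends `t` to a constant times the square of a form of odd degree (`exists_eq_smul_sq`,
`eq_zero_of_autRing_t_eq`). For `degSub`: a plane automorphism that preserves the conic preserves
regularity at its generic point, so that it respects the order by degree (`deg_symm_le`,
`mem_degSub_of_deg_mono`). Conversely, if the degree is preserved, the leading coefficient of the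
image of `t` is a constant times the fourth power of a polynomial of degree at most one in `v`
(`exists_degSub_t`), which reduces the automorphism to the explicit linear ones
(`closure_linear_eq_degSub`).

The two subgroups generate (`degSub_sup_fibSub`) by descent on the highest degree of the images of
`x², xy, xw, yw, w²`. Let `A = deg φ(t)` and `deg φ(xy) = A + B`. If `B ≤ 0`, either `φ` preserves
the degree, or a shear followed by the swap lowers `deg φ(t)`. If `B > 0`, write `A = da`, `B = db`
with `a`, `b` coprime. The part of highest weight of `φ⁻¹(t)` is a monomial times `Q(v^a / x^(2b))`.
When the leading terms do not cancel in `φ(φ⁻¹(t)) = t`, comparing degrees gives `φ ∈ fibSub`. When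
they do cancel, `Q` has a root `e ≠ 0` in `k`, because `k` is algebraically closed in `k(v)`; if
moreover `a = 1`, an element of `fibSub` removes the leading term of `φ(xy)`
(`mem_fibSub_or_exists_deg_lt`).

The heart is the proof of `a = 1` (`eq_one_of_lead_symm_t`). The translations of `v`, conjugated by
`φ`, form a nontrivial action of the additive group that fixes `φ⁻¹(t)`. The leading part of this
action defines a degree function `D` that is zero on `φ⁻¹(t)`. This determines `D` on the monomials
and on the elements with leading polynomial `(X - e)^r`. The smallest positive value of `D` divides
all of its values (`dvd_D`), which gives `a ∣ 4b`; and `a` is odd, since `deg φ(t) ≡ 2` modulo 4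
(`natDegree_autRing_t_mod`). Iterative higher derivations replace derivations, so that the
characteristic plays no role.

The amalgamated structure follows from ping-pong (`isAmalgamOf_of_pingPong`) with the inequality
`deg φ(t) < deg φ(xy)`, called `Skew`. The isomorphism with `PGL₂` is the action by conjugation on
trace zero matrices, whose determinant is minus the equation of the conic. The generators of
`fibSub` come from `exists_eq_torusAut_mul_fib`; the stabilizer of `p₀` is identified inside
`degSub` by means of `degSub_cases`. -/

noncomputable section

/-! ### Leading terms and the monomial basis of the coordinate ring -/

namespace ConicComplement

open Polynomial

/-! ### Leading coefficients with respect to a degree bound -/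

section Top

variable {S : Type*} [CommRing S]

/-- `P` has degree at most `n` and its coefficient of degree `n` is `c`. -/
def Top (P : S[X]) (n : ℕ) (c : S) : Prop := P.natDegree ≤ n ∧ P.coeff n = c

variable {P Q : S[X]} {n m : ℕ} {c d : S}

theorem Top.mul (hP : Top P n c) (hQ : Top Q m d) : Top (P * Q) (n + m) (c * d) :=
  ⟨natDegree_mul_le_of_le hP.1 hQ.1, by
    rw [coeff_mul_add_eq_of_natDegree_le hP.1 hQ.1, hP.2, hQ.2]⟩

theorem Top.one : Top (1 : S[X]) 0 1 := ⟨by simp, by simp⟩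

theorem Top.C (a : S) : Top (Polynomial.C a) 0 a := ⟨by simp, by simp⟩

theorem Top.X : Top (Polynomial.X : S[X]) 1 1 := ⟨natDegree_X_le, by simp⟩

theorem Top.pow (hP : Top P n c) (r : ℕ) : Top (P ^ r) (r * n) (c ^ r) := by
  induction r with
  | zero => simpa using Top.one
  | succ r ih => simpa only [pow_succ, add_mul, one_mul] using ih.mul hP

theorem Top.of_lt (h : P.natDegree < n) : Top P n 0 := ⟨h.le, coeff_eq_zero_of_natDegree_lt h⟩

theorem Top.of_top_lt (h : Top P m c) (hn : m < n) : Top P n 0 := Top.of_lt (h.1.trans_lt hn)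

theorem Top.add (hP : Top P n c) (hQ : Top Q n d) : Top (P + Q) n (c + d) :=
  ⟨natDegree_add_le_of_degree_le hP.1 hQ.1, by rw [coeff_add, hP.2, hQ.2]⟩

theorem Top.neg (hP : Top P n c) : Top (-P) n (-c) :=
  ⟨by rw [natDegree_neg]; exact hP.1, by rw [coeff_neg, hP.2]⟩

theorem Top.sub (hP : Top P n c) (hQ : Top Q n d) : Top (P - Q) n (c - d) := by
  simpa only [sub_eq_add_neg] using hP.add hQ.neg

theorem Top.sum {ι : Type*} {s : Finset ι} {f : ι → S[X]} {c : ι → S}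
    (h : ∀ i ∈ s, Top (f i) n (c i)) : Top (∑ i ∈ s, f i) n (∑ i ∈ s, c i) :=
  ⟨natDegree_sum_le_of_forall_le s f fun i hi => (h i hi).1, by
    rw [finsetSum_coeff]; exact Finset.sum_congr rfl fun i hi => (h i hi).2⟩

theorem Top.natDegree (hP : Top P n c) (hc : c ≠ 0) : P.natDegree = n :=
  le_antisymm hP.1 (le_natDegree_of_ne_zero (by rw [hP.2]; exact hc))

theorem Top.leadingCoeff (hP : Top P n c) (hc : c ≠ 0) : P.leadingCoeff = c := by
  rw [Polynomial.leadingCoeff, hP.natDegree hc, hP.2]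

theorem Top.ne_zero (hP : Top P n c) (hc : c ≠ 0) : P ≠ 0 := by
  rintro rfl; exact hc (by simpa using hP.2.symm)

theorem Top.self (P : S[X]) : Top P P.natDegree P.leadingCoeff := ⟨le_rfl, rfl⟩

theorem Top.unique (h : Top P n c) (h' : Top P n d) : c = d := h.2.symm.trans h'.2

theorem Top.smul {k : Type*} [CommSemiring k] [Algebra k S] (a : k) (hP : Top P n c) :
    Top (a • P) n (a • c) :=
  ⟨(natDegree_smul_le a P).trans hP.1, by rw [coeff_smul, hP.2]⟩

end Top

/-! ### The coordinate ring of the complement of the conic -/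

variable (k : Type u) [Field k]

/-- The polynomial ring `k[v][x]`, in which the quadric `xz + y² = 1` is parametrized by
`y = 1 + xv` and `z = -2v - xv²`. -/
abbrev Chart : Type u := Polynomial (Polynomial k)

namespace Chart

/-- The function `x`. -/
def x : Chart k := X
/-- The function `v`. -/
def v : Chart k := C X
/-- The function `y = 1 + xv`. -/
def y : Chart k := 1 + x k * v k
/-- The function `w = -z = 2v + xv²`. -/
def w : Chart k := 2 * v k + x k * v k ^ 2

theorem y_sq : y k ^ 2 = 1 + x k * w k := by rw [y, w]; ring

/-- The monomials `x^(2j - ⌈m/2⌉) y^(m mod 2) w^⌊m/2⌋`. -/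
def mono (j m : ℕ) : Chart k := x k ^ (2 * j - (m + 1) / 2) * y k ^ (m % 2) * w k ^ (m / 2)

variable {k}

theorem mono_zero (j : ℕ) : mono k j 0 = (x k ^ 2) ^ j := by simp [mono, pow_mul]

theorem mono_mul_even {j m j' m' : ℕ} (h : m ≤ 4 * j) (h' : m' ≤ 4 * j')
    (hm : m % 2 = 0 ∨ m' % 2 = 0) :
    mono k j m * mono k j' m' = mono k (j + j') (m + m') := by
  have h1 : 2 * (j + j') - (m + m' + 1) / 2 =
    (2 * j - (m + 1) / 2) + (2 * j' - (m' + 1) / 2) := by omega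
  have h2 : (m + m') % 2 = m % 2 + m' % 2 := by omega
  have h3 : (m + m') / 2 = m / 2 + m' / 2 := by omega
  simp only [mono, h1, h2, h3, pow_add]
  ring

/-- Two odd exponents produce `y²`, and `y² = 1 + xw` splits the product into the monomial with the
sum of the indices and a lower one, with the index smaller by `(1, 2)`. -/
theorem mono_mul_odd {j m j' m' : ℕ} (h : m ≤ 4 * j) (h' : m' ≤ 4 * j')
    (hm : m % 2 = 1) (hm' : m' % 2 = 1) :
    mono k j m * mono k j' m' =
      mono k (j + j') (m + m') + mono k (j + j' - 1) (m + m' - 2) := by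
  have h1 : 2 * (j + j') - (m + m' + 1) / 2 =
    (2 * j - (m + 1) / 2) + (2 * j' - (m' + 1) / 2) + 1 := by omega
  have h2 : (m + m') % 2 = 0 := by omega
  have h3 : (m + m') / 2 = m / 2 + m' / 2 + 1 := by omega
  have h4 : 2 * (j + j' - 1) - (m + m' - 2 + 1) / 2 =
    (2 * j - (m + 1) / 2) + (2 * j' - (m' + 1) / 2) := by omega
  have h5 : (m + m' - 2) % 2 = 0 := by omega
  have h6 : (m + m' - 2) / 2 = m / 2 + m' / 2 := by omega
  simp only [mono, h1, h2, h3, h4, h5, h6, hm, hm', pow_add, pow_zero, pow_one]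
  linear_combination x k ^ (2 * j - (m + 1) / 2) * x k ^ (2 * j' - (m' + 1) / 2) *
    w k ^ (m / 2) * w k ^ (m' / 2) * y_sq k

/-- This is `mono j (2l) = t^j (xw/t)^l` with the denominator cleared. Together with the odd case it
lets the images of `t` and `xy` control those of all monomials. -/
theorem pow_mul_mono {j l : ℕ} (h : 2 * l ≤ 4 * j) :
    mono k 1 0 ^ l * mono k j (2 * l) = mono k 1 0 ^ j * mono k 1 2 ^ l := by
  have h1 : 2 * j - (2 * l + 1) / 2 + l = 2 * j := by omega
  have h2 : 2 * l % 2 = 0 := by omega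
  have h3 : 2 * l / 2 = l := by omega
  simp only [mono, h2, h3]
  norm_num
  rw [mul_pow, ← pow_mul, ← pow_mul]
  have h4 : x k ^ (2 * j - (2 * l + 1) / 2) * x k ^ l = x k ^ (2 * j) := by rw [← pow_add, h1]
  linear_combination x k ^ l * w k ^ l * h4

theorem pow_mul_mono_odd {j l : ℕ} (h : 2 * l + 1 ≤ 4 * j) :
    mono k 1 0 ^ l * mono k j (2 * l + 1) = mono k 1 0 ^ (j - 1) * mono k 1 1 * mono k 1 2 ^ l := by
  have h1 : 2 * j - (2 * l + 1 + 1) / 2 + l = 2 * (j - 1) + 1 := by omega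
  have h2 : (2 * l + 1) % 2 = 1 := by omega
  have h3 : (2 * l + 1) / 2 = l := by omega
  simp only [mono, h2, h3]
  norm_num
  have h4 : x k ^ (2 * l) * x k ^ (2 * j - (2 * l + 1 + 1) / 2) =
      x k ^ (2 * (j - 1)) * x k * x k ^ l := by
    rw [← pow_succ, ← h1]; ring
  rw [mul_pow, ← pow_mul, ← pow_mul]
  linear_combination y k * w k ^ l * h4

theorem mono_one_mul_mono_two : mono k 1 0 * mono k 1 2 = mono k 1 1 ^ 2 - mono k 1 0 := by
  simp [mono]
  linear_combination - x k ^ 2 * y_sq k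

/-- A monomial with `j ≥ 2` splits off `w²` when `m ≥ 4` and `x²` otherwise, so the five monomials
with `j = 1` generate the ring. -/
theorem mono_eq_mul_of_four_le {j m : ℕ} (h : m ≤ 4 * j) (hm : 4 ≤ m) :
    mono k j m = mono k (j - 1) (m - 4) * mono k 1 4 := by
  rw [mono_mul_even (by omega) (by omega) (Or.inr rfl)]
  congr 1 <;> omega

theorem mono_eq_mul_of_lt {j m : ℕ} (hm : m < 4) (hj : 2 ≤ j) :
    mono k j m = mono k (j - 1) m * mono k 1 0 := by
  rw [mono_mul_even (by omega) (by omega) (Or.inr rfl)]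
  congr 1; omega

variable (k)

/-- The exponents of the monomials of the coordinate ring. -/
abbrev Idx : Type := {p : ℕ × ℕ // p.2 ≤ 4 * p.1}

/-- The monomial with a given exponent. -/
def monoIdx (i : Idx) : Chart k := mono k i.1.1 i.1.2

/-- The coordinate ring of the complement of the conic `xz + y² = 0`, as a subalgebra of
`k[v][x]`. -/
def coordRing : Subalgebra k (Chart k) :=
  Submodule.toSubalgebra (Submodule.span k (Set.range (monoIdx k)))
    (Submodule.subset_span ⟨⟨(0, 0), le_rfl⟩, by simp [monoIdx, mono]⟩) (by
      intro f g hf hg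
      have : Submodule.span k (Set.range (monoIdx k)) * Submodule.span k (Set.range (monoIdx k)) ≤
          Submodule.span k (Set.range (monoIdx k)) := by
        rw [Submodule.span_mul_span, Submodule.span_le]
        rintro _ ⟨_, ⟨⟨⟨j, m⟩, h⟩, rfl⟩, _, ⟨⟨⟨j', m'⟩, h'⟩, rfl⟩, rfl⟩
        simp only at h h'
        change mono k j m * mono k j' m' ∈ Submodule.span k (Set.range (monoIdx k))
        by_cases hm : m % 2 = 0 ∨ m' % 2 = 0
        · rw [mono_mul_even h h' hm]
          exact Submodule.subset_span ⟨⟨(j + j', m + m'), by simp only; omega⟩, rfl⟩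
        · rw [mono_mul_odd h h' (by omega) (by omega)]
          exact Submodule.add_mem _
            (Submodule.subset_span ⟨⟨(j + j', m + m'), by simp only; omega⟩, rfl⟩)
            (Submodule.subset_span ⟨⟨(j + j' - 1, m + m' - 2), by simp only; omega⟩, rfl⟩)
      exact this (Submodule.mul_mem_mul hf hg))

variable {k}

theorem mono_mem {j m : ℕ} (h : m ≤ 4 * j) : mono k j m ∈ coordRing k :=
  Submodule.subset_span ⟨⟨(j, m), h⟩, rfl⟩

variable (k) in
/-- The element of the coordinate ring with given coefficients. -/
def ofCoeff : (Idx →₀ k) →ₗ[k] Chart k := Finsupp.linearCombination k (monoIdx k)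

theorem ofCoeff_apply (c : Idx →₀ k) : ofCoeff k c = ∑ i ∈ c.support, c i • monoIdx k i := rfl

theorem mem_coordRing_iff {f : Chart k} : f ∈ coordRing k ↔ ∃ c, ofCoeff k c = f := by
  change f ∈ Submodule.span k (Set.range (monoIdx k)) ↔ _
  rw [Finsupp.mem_span_range_iff_exists_finsupp]
  rfl

/-- The weight of an exponent, when `x` has the weight `a` and `v` has the weight `b`. -/
def wt (a b : ℕ) (i : Idx) : ℕ := 2 * i.1.1 * a + i.1.2 * b

section Weights

variable {S : Type*} [CommRing S] [Algebra k S] (F : Chart k →ₐ[k] S[X]) {a b : ℕ} {ξ η : S}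

/-- The part of highest weight of an element of the coordinate ring. -/
def topForm (ξ η : S) (a b M : ℕ) (c : Idx →₀ k) : S :=
  ∑ i ∈ c.support with wt a b i = M, c i • (ξ ^ (2 * i.1.1) * η ^ i.1.2)

variable (hx : Top (F (x k)) a ξ) (hy : Top (F (y k)) (a + b) (ξ * η))
  (hw : Top (F (w k)) (a + 2 * b) (ξ * η ^ 2))

include hx hy hw

/-- The hypotheses say that `x`, `y`, `w` have the leading terms of `x`, `xv`, `xv²`; the number of
factors `x` in a monomial is then always `2j`, and that of factors `v` is `m`. -/
theorem top_mono {j m : ℕ} (h : m ≤ 4 * j) :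
    Top (F (mono k j m)) (2 * j * a + m * b) (ξ ^ (2 * j) * η ^ m) := by
  have := ((hx.pow (2 * j - (m + 1) / 2)).mul (hy.pow (m % 2))).mul (hw.pow (m / 2))
  simp only [mono, map_mul, map_pow]
  convert this using 1
  · have h1 : 2 * j = (2 * j - (m + 1) / 2) + m % 2 + m / 2 := by omega
    have h2 : m = m % 2 + 2 * (m / 2) := by omega
    calc 2 * j * a + m * b = ((2 * j - (m + 1) / 2) + m % 2 + m / 2) * a +
          (m % 2 + 2 * (m / 2)) * b := by rw [← h1, ← h2]
      _ = _ := by ring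
  · have h1 : 2 * j = (2 * j - (m + 1) / 2) + m % 2 + m / 2 := by omega
    have h2 : m = m % 2 + 2 * (m / 2) := by omega
    calc ξ ^ (2 * j) * η ^ m = ξ ^ ((2 * j - (m + 1) / 2) + m % 2 + m / 2) *
          η ^ (m % 2 + 2 * (m / 2)) := by rw [← h1, ← h2]
      _ = _ := by rw [pow_add, pow_add, pow_add, pow_mul]; ring

theorem top_ofCoeff (c : Idx →₀ k) {M : ℕ} (hM : ∀ i ∈ c.support, wt a b i ≤ M) :
    Top (F (ofCoeff k c)) M (topForm ξ η a b M c) := by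
  rw [ofCoeff_apply, map_sum, topForm, Finset.sum_filter]
  refine Top.sum fun i hi => ?_
  rw [map_smul]
  split_ifs with h
  · rw [← h]; exact (top_mono F hx hy hw i.2).smul _
  · simpa [monoIdx] using ((top_mono F hx hy hw i.2).of_top_lt (lt_of_le_of_ne (hM i hi) h)).smul (c i)

end Weights

end Chart

end ConicComplement

/-! ### Degrees, weights and ternary forms -/

namespace ConicComplement

open Polynomial

variable {k : Type u} [Field k]

namespace Chart

/-! ### The degree and the weights on the coordinate ring -/

theorem exists_max_wt (a b : ℕ) {c : Idx →₀ k} (hc : c ≠ 0) :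
    ∃ i ∈ c.support, ∀ i' ∈ c.support, wt a b i' ≤ wt a b i :=
  Finset.exists_max_image _ _ (Finsupp.support_nonempty_iff.mpr hc)

/-- Among the monomials of a fixed degree in `x`, different `m` contribute different powers of `v`,
so leading coefficients never cancel. -/
theorem coeff_topForm_one (c : Idx →₀ k) (i : Idx) :
    (topForm (1 : k[X]) X 1 0 (2 * i.1.1) c).coeff i.1.2 = c i := by
  classical
  rw [topForm, finsetSum_coeff]
  have : ∀ i' : Idx, (c i' • ((1 : k[X]) ^ (2 * i'.1.1) * X ^ i'.1.2)).coeff i.1.2 =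
      if i'.1.2 = i.1.2 then c i' else 0 := by
    intro i'
    rw [one_pow, one_mul, coeff_smul, coeff_X_pow]
    by_cases h : i'.1.2 = i.1.2
    · simp [h]
    · rw [if_neg h, if_neg (Ne.symm h), smul_zero]
  simp only [this]
  rw [← Finset.sum_filter, Finset.filter_filter]
  have h2 : ∀ i' : Idx, (wt 1 0 i' = 2 * i.1.1 ∧ i'.1.2 = i.1.2) ↔ i' = i := by
    intro i'
    constructor
    · rintro ⟨h, h'⟩
      refine Subtype.ext (Prod.ext ?_ h')
      simp only [wt] at h; omega
    · rintro rfl; simp [wt]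
  simp only [h2]
  rw [Finset.sum_filter, Finset.sum_ite_eq']
  split_ifs with h
  · rfl
  · exact (Finsupp.notMem_support_iff.mp h).symm

theorem top_x : Top (x k) 1 1 := Top.X

theorem top_y : Top (y k) 1 X := by
  have : Top (1 + x k * v k) 1 (0 + 1 * X) :=
    (Top.one.of_top_lt one_pos).add (Top.X.mul (Top.C X))
  rw [y]
  simpa only [zero_add, one_mul] using this

theorem top_w : Top (w k) 1 (X ^ 2) := by
  have h : w k = C (2 * X) + x k * C (X ^ 2) := by
    rw [C_mul, C_pow, w, v]; rfl
  have : Top (C (2 * X) + x k * C (X ^ 2) : Chart k) 1 (0 + 1 * X ^ 2) :=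
    ((Top.C _).of_top_lt one_pos).add (Top.X.mul (Top.C _))
  rw [h]; simpa using this

theorem top_mono_one {j m : ℕ} (h : m ≤ 4 * j) : Top (mono k j m) (2 * j) (X ^ m) := by
  have := top_mono (AlgHom.id k (Chart k)) (a := 1) (b := 0) (ξ := 1) (η := (X : k[X]))
    top_x (by simpa using top_y) (by simpa using top_w) h
  simpa using this

theorem top_ofCoeff_one (c : Idx →₀ k) {M : ℕ} (hM : ∀ i ∈ c.support, wt 1 0 i ≤ M) :
    Top (ofCoeff k c) M (topForm 1 X 1 0 M c) :=
  top_ofCoeff (AlgHom.id k (Chart k)) (a := 1) (b := 0) (ξ := 1) (η := (X : k[X]))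
    top_x (by simpa using top_y) (by simpa using top_w) c hM

theorem topForm_one_ne_zero {c : Idx →₀ k} {i : Idx} (hi : i ∈ c.support) :
    topForm (1 : k[X]) X 1 0 (2 * i.1.1) c ≠ 0 := by
  intro h
  have := coeff_topForm_one c i
  rw [h, coeff_zero] at this
  exact Finsupp.mem_support_iff.mp hi this.symm

/-- The degree of an element of the coordinate ring is the highest degree of its monomials. -/
theorem exists_natDegree_ofCoeff {c : Idx →₀ k} (hc : c ≠ 0) :
    ∃ i ∈ c.support, (∀ i' ∈ c.support, i'.1.1 ≤ i.1.1) ∧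
      (ofCoeff k c).natDegree = 2 * i.1.1 ∧
      (ofCoeff k c).leadingCoeff = topForm 1 X 1 0 (2 * i.1.1) c ∧ ofCoeff k c ≠ 0 := by
  obtain ⟨i, hi, hmax⟩ := exists_max_wt 1 0 hc
  have hM : ∀ i' ∈ c.support, wt 1 0 i' ≤ 2 * i.1.1 := fun i' hi' => by
    simpa [wt] using hmax i' hi'
  have ht := top_ofCoeff_one c hM
  have hne := topForm_one_ne_zero hi
  exact ⟨i, hi, fun i' hi' => by have := hM i' hi'; simp only [wt] at this; omega,
    ht.natDegree hne, ht.leadingCoeff hne, ht.ne_zero hne⟩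

theorem ofCoeff_injective : Function.Injective (ofCoeff k) := by
  rw [← LinearMap.ker_eq_bot, LinearMap.ker_eq_bot']
  intro c hc
  by_contra h
  obtain ⟨i, -, -, -, -, h'⟩ := exists_natDegree_ofCoeff h
  exact h' hc

theorem ofCoeff_single (i : Idx) (a : k) : ofCoeff k (Finsupp.single i a) = a • monoIdx k i := by
  simp [ofCoeff]

theorem even_natDegree {f : Chart k} (hf : f ∈ coordRing k) : Even f.natDegree := by
  obtain ⟨c, rfl⟩ := mem_coordRing_iff.mp hf
  by_cases hc : c = 0
  · simp [hc]
  · obtain ⟨i, -, -, h, -⟩ := exists_natDegree_ofCoeff hc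
    exact ⟨i.1.1, by omega⟩

theorem natDegree_ofCoeff_le_iff {c : Idx →₀ k} {n : ℕ} :
    (ofCoeff k c).natDegree ≤ 2 * n ↔ ∀ i ∈ c.support, i.1.1 ≤ n := by
  by_cases hc : c = 0
  · simp [hc]
  · obtain ⟨i, hi, h1, h2, -⟩ := exists_natDegree_ofCoeff hc
    rw [h2]
    constructor
    · intro h i' hi'
      have := h1 i' hi'
      omega
    · intro h
      have := h i hi
      omega

theorem eq_algebraMap_of_natDegree_eq_zero {f : Chart k} (hf : f ∈ coordRing k)
    (h : f.natDegree = 0) : ∃ a : k, f = algebraMap k _ a := by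
  obtain ⟨c, rfl⟩ := mem_coordRing_iff.mp hf
  have h0 := (natDegree_ofCoeff_le_iff (n := 0)).mp h.le
  refine ⟨c ⟨(0, 0), le_rfl⟩, ?_⟩
  have : c = Finsupp.single ⟨(0, 0), le_rfl⟩ (c ⟨(0, 0), le_rfl⟩) := by
    rw [Finsupp.eq_single_iff]
    refine ⟨fun i hi => ?_, rfl⟩
    have h1 := h0 i hi
    have h2 := i.2
    rw [Finset.mem_singleton]
    exact Subtype.ext (Prod.ext (by simp only; omega) (by simp only; omega))
  conv_lhs => rw [this, ofCoeff_single]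
  simp [monoIdx, mono, Algebra.algebraMap_eq_smul_one]

/-- The field of rational functions. -/
abbrev Frac (k : Type u) [Field k] : Type u := FractionRing (Chart k)

/-- The embedding into the field of rational functions. -/
def toFrac (k : Type u) [Field k] : Chart k →ₐ[k] Frac k := Algebra.algHom k (Chart k) (Frac k)

theorem toFrac_injective : Function.Injective (toFrac k) :=
  IsFractionRing.injective (Chart k) (Frac k)

/-- The homomorphism `x ↦ xθ^a`, `v ↦ vθ^b`. -/
def wtHom (k : Type u) [Field k] (a b : ℕ) : Chart k →ₐ[k] (Frac k)[X] :=
  eval₂AlgHom (aeval (C (toFrac k (v k)) * X ^ b)) (C (toFrac k (x k)) * X ^ a)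
    fun _ => Commute.all _ _

theorem wtHom_x (a b : ℕ) : wtHom k a b (x k) = C (toFrac k (x k)) * X ^ a := by
  simp [wtHom, x]

theorem wtHom_v (a b : ℕ) : wtHom k a b (v k) = C (toFrac k (v k)) * X ^ b := by
  simp [wtHom, v]

/-- Homomorphisms from `k[v][x]` are determined by the images of `x` and `v`. -/
theorem algHom_ext {S : Type*} [CommRing S] [Algebra k S] {f g : Chart k →ₐ[k] S}
    (h1 : f (x k) = g (x k)) (h2 : f (v k) = g (v k)) : f = g := by
  have hC : ∀ p : k[X], f (C p) = g (C p) := by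
    intro p
    have : (f.comp (IsScalarTower.toAlgHom k k[X] (Chart k))) =
        (g.comp (IsScalarTower.toAlgHom k k[X] (Chart k))) := Polynomial.algHom_ext h2
    exact DFunLike.congr_fun this p
  apply AlgHom.coe_ringHom_injective
  apply Polynomial.ringHom_ext
  · exact hC
  · exact h1

/-- Setting `θ = 1` recovers the embedding into the field of fractions. -/
theorem wtHom_injective (a b : ℕ) : Function.Injective (wtHom k a b) := by
  have : ((aeval (1 : Frac k)).restrictScalars k).comp (wtHom k a b) = toFrac k := by
    refine algHom_ext ?_ ?_
    · simp [wtHom_x]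
    · simp [wtHom_v]
  have h : Function.Injective (((aeval (1 : Frac k)).restrictScalars k) ∘ (wtHom k a b)) := by
    rw [← AlgHom.coe_comp, this]; exact toFrac_injective
  exact h.of_comp

variable {a b : ℕ}

theorem top_wtHom_x : Top (wtHom k a b (x k)) a (toFrac k (x k)) := by
  rw [wtHom_x]
  simpa using (Top.C (toFrac k (x k))).mul (Top.X.pow a)

theorem top_wtHom_v : Top (wtHom k a b (v k)) b (toFrac k (v k)) := by
  rw [wtHom_v]
  simpa using (Top.C (toFrac k (v k))).mul (Top.X.pow b)

theorem top_wtHom_y (hab : 0 < a + b) :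
    Top (wtHom k a b (y k)) (a + b) (toFrac k (x k) * toFrac k (v k)) := by
  rw [y, map_add, map_one, map_mul]
  simpa using (Top.one.of_top_lt hab).add (top_wtHom_x.mul top_wtHom_v)

theorem top_wtHom_w (hab : 0 < a + b) :
    Top (wtHom k a b (w k)) (a + 2 * b) (toFrac k (x k) * toFrac k (v k) ^ 2) := by
  rw [w, map_add, map_mul, map_mul, map_pow]
  have h1 : Top (wtHom k a b 2 * wtHom k a b (v k)) (a + 2 * b) 0 := by
    have : Top (wtHom k a b 2) 0 2 := by
      rw [map_ofNat]; exact Top.C (2 : Frac k)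
    exact (this.mul top_wtHom_v).of_top_lt (by omega)
  simpa using h1.add (top_wtHom_x.mul (top_wtHom_v.pow 2))

theorem top_wtHom_mono (hab : 0 < a + b) {j m : ℕ} (h : m ≤ 4 * j) :
    Top (wtHom k a b (mono k j m)) (2 * j * a + m * b)
      (toFrac k (x k) ^ (2 * j) * toFrac k (v k) ^ m) :=
  top_mono _ top_wtHom_x (top_wtHom_y hab) (top_wtHom_w hab) h

theorem top_wtHom_ofCoeff (hab : 0 < a + b) (c : Idx →₀ k) {M : ℕ}
    (hM : ∀ i ∈ c.support, wt a b i ≤ M) :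
    Top (wtHom k a b (ofCoeff k c)) M (topForm (toFrac k (x k)) (toFrac k (v k)) a b M c) :=
  top_ofCoeff _ top_wtHom_x (top_wtHom_y hab) (top_wtHom_w hab) c hM

/-- The leading parts are distinct monomials `x^(2j) v^m`, hence linearly independent, so nothing
cancels in the highest weight, whatever the weights are. -/
theorem topForm_frac_ne_zero {c : Idx →₀ k} {i : Idx} (hi : i ∈ c.support) :
    topForm (toFrac k (x k)) (toFrac k (v k)) a b (wt a b i) c ≠ 0 := by
  classical
  intro h
  have h1 : topForm (toFrac k (x k)) (toFrac k (v k)) a b (wt a b i) c =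
      toFrac k (topForm (x k) (v k) a b (wt a b i) c) := by
    simp [topForm, map_sum, map_smul]
  rw [h1] at h
  have h2 := toFrac_injective (h.trans (map_zero _).symm)
  have h3 := congrArg (fun f : Chart k => (f.coeff (2 * i.1.1)).coeff i.1.2) h2
  simp only [topForm, finsetSum_coeff, coeff_zero] at h3
  have : ∀ i' : Idx, ((c i' • (x k ^ (2 * i'.1.1) * v k ^ i'.1.2)).coeff (2 * i.1.1)).coeff i.1.2 =
      if i' = i then c i' else 0 := by
    intro i'
    rw [v, ← C_pow, mul_comm, coeff_smul, x, coeff_C_mul_X_pow]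
    by_cases h4 : i' = i
    · subst h4; simp
    · rw [if_neg h4]
      by_cases h5 : 2 * i.1.1 = 2 * i'.1.1
      · rw [if_pos h5, coeff_smul, coeff_X_pow, if_neg, smul_zero]
        intro h6
        exact h4 (Subtype.ext (Prod.ext (by omega) h6.symm))
      · rw [if_neg h5]; simp
  simp only [this] at h3
  rw [Finset.sum_ite_eq', if_pos (by simp [Finset.mem_filter, Finsupp.mem_support_iff.mp hi])] at h3
  exact Finsupp.mem_support_iff.mp hi h3

/-- The weight of an element of the coordinate ring is the highest weight of its monomials. -/
theorem exists_natDegree_wtHom (hab : 0 < a + b) {c : Idx →₀ k} (hc : c ≠ 0) :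
    ∃ i ∈ c.support, (∀ i' ∈ c.support, wt a b i' ≤ wt a b i) ∧
      (wtHom k a b (ofCoeff k c)).natDegree = wt a b i ∧
      (wtHom k a b (ofCoeff k c)).leadingCoeff =
        topForm (toFrac k (x k)) (toFrac k (v k)) a b (wt a b i) c := by
  obtain ⟨i, hi, hmax⟩ := exists_max_wt a b hc
  have ht := top_wtHom_ofCoeff hab c hmax
  have hne := topForm_frac_ne_zero (a := a) (b := b) hi
  exact ⟨i, hi, hmax, ht.natDegree hne, ht.leadingCoeff hne⟩

/-! ### Generators of the coordinate ring -/

/-- The coordinate ring of the complement of the conic `xz + y² = 0`. -/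
def Coord (k : Type u) [Field k] : Type u := coordRing k

instance : CommRing (Coord k) := inferInstanceAs (CommRing (coordRing k))

instance : IsDomain (Coord k) := inferInstanceAs (IsDomain (coordRing k))

instance : Algebra k (Coord k) := inferInstanceAs (Algebra k (coordRing k))

/-- The embedding of the coordinate ring into `k[v][x]`. -/
def toChart : Coord k →ₐ[k] Chart k := (coordRing k).val

theorem toChart_injective : Function.Injective (toChart (k := k)) := Subtype.val_injective

theorem toChart_mem (f : Coord k) : toChart f ∈ coordRing k := f.2

/-- An element of `k[v][x]` that belongs to the coordinate ring, as an element of it. -/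
def ofChart (f : Chart k) (hf : f ∈ coordRing k) : Coord k := (⟨f, hf⟩ : coordRing k)

@[simp]
theorem toChart_ofChart (f : Chart k) (hf : f ∈ coordRing k) : toChart (ofChart f hf) = f := rfl

/-- The monomials as elements of the coordinate ring. -/
def el (k : Type u) [Field k] (j m : ℕ) (h : m ≤ 4 * j) : Coord k := ofChart (mono k j m) (mono_mem h)

@[simp]
theorem toChart_el (j m : ℕ) (h : m ≤ 4 * j) : toChart (el k j m h) = mono k j m := rfl

/-- The function `t = x²`. -/
def t (k : Type u) [Field k] : Coord k := el k 1 0 (by omega)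

/-- The function `xy`. -/
def xy (k : Type u) [Field k] : Coord k := el k 1 1 (by omega)

theorem toChart_t : toChart (t k) = x k ^ 2 := by simp [t, el, mono]

theorem toChart_xy : toChart (xy k) = x k * y k := by simp [xy, el, mono]

theorem t_ne_zero : t k ≠ 0 := by
  intro h
  have := congrArg toChart h
  rw [toChart_t, map_zero] at this
  exact (pow_ne_zero 2 X_ne_zero : (x k) ^ 2 ≠ 0) this

theorem t_mul_el_two : t k * el k 1 2 (by omega) = xy k ^ 2 - t k :=
  toChart_injective mono_one_mul_mono_two

theorem el_zero_zero : el k 0 0 le_rfl = 1 := toChart_injective (by simp [mono])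

theorem el_eq_mul_of_four_le {j m : ℕ} (h : m ≤ 4 * j) (hm : 4 ≤ m) :
    el k j m h = el k (j - 1) (m - 4) (by omega) * el k 1 4 (by omega) :=
  toChart_injective (mono_eq_mul_of_four_le h hm)

theorem el_eq_mul_of_lt {j m : ℕ} (h : m ≤ 4 * j) (hm : m < 4) (hj : 2 ≤ j) :
    el k j m h = el k (j - 1) m (by omega) * t k :=
  toChart_injective (mono_eq_mul_of_lt hm hj)

theorem t_pow_mul_el {j l : ℕ} (h : 2 * l ≤ 4 * j) :
    t k ^ l * el k j (2 * l) h = t k ^ j * el k 1 2 (by omega) ^ l :=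
  toChart_injective (pow_mul_mono h)

theorem t_pow_mul_el_odd {j l : ℕ} (h : 2 * l + 1 ≤ 4 * j) :
    t k ^ l * el k j (2 * l + 1) h = t k ^ (j - 1) * xy k * el k 1 2 (by omega) ^ l :=
  toChart_injective (pow_mul_mono_odd h)

theorem el_induction {P : ∀ j m, m ≤ 4 * j → Prop} (h0 : P 0 0 le_rfl)
    (h1 : ∀ m (h : m ≤ 4 * 1), P 1 m h)
    (h2 : ∀ j m (h : m ≤ 4 * j) (hm : 4 ≤ m), 2 ≤ j → P (j - 1) (m - 4) (by omega) → P j m h)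
    (h3 : ∀ j m (h : m ≤ 4 * j) (hm : m < 4) (hj : 2 ≤ j), P (j - 1) m (by omega) → P j m h) :
    ∀ j m h, P j m h := by
  intro j
  induction j with
  | zero => intro m h; obtain rfl : m = 0 := by omega
            exact h0
  | succ j ih =>
    intro m h
    by_cases hj : j = 0
    · subst hj; exact h1 m h
    · by_cases hm : 4 ≤ m
      · exact h2 _ _ _ hm (by omega) (ih _ _)
      · exact h3 _ _ _ (by omega) (by omega) (ih _ _)

theorem exists_eq_sum_el (f : Coord k) :
    ∃ c : Idx →₀ k, toChart f = ofCoeff k c ∧ f = ∑ i ∈ c.support, c i • el k i.1.1 i.1.2 i.2 := by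
  obtain ⟨c, hc⟩ := mem_coordRing_iff.mp (toChart_mem f)
  refine ⟨c, hc.symm, toChart_injective ?_⟩
  rw [← hc, ofCoeff_apply, map_sum]
  simp [monoIdx]

theorem algHom_ext_el {S : Type*} [CommRing S] [Algebra k S]
    {f g : Coord k →ₐ[k] S} (h : ∀ j m hm, f (el k j m hm) = g (el k j m hm)) : f = g := by
  ext p
  obtain ⟨c, -, rfl⟩ := exists_eq_sum_el p
  simp [map_sum, h]

/-- The image of `xw` is forced by `t · xw = (xy)² - t`, and the remaining monomials follow after
multiplication by a power of `t`. Cancelling this power needs a domain and a nonzero image of `t`.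
-/
theorem algHom_ext_t {S : Type*} [CommRing S] [IsDomain S] [Algebra k S]
    {f g : Coord k →ₐ[k] S} (h0 : f (t k) ≠ 0) (ht : f (t k) = g (t k))
    (hxy : f (xy k) = g (xy k)) : f = g := by
  have hf2 := congrArg f (t_mul_el_two (k := k))
  have hg2 := congrArg g (t_mul_el_two (k := k))
  simp only [map_mul, map_sub, map_pow] at hf2 hg2
  have h2 : f (el k 1 2 (by omega)) = g (el k 1 2 (by omega)) := by
    apply mul_left_cancel₀ h0
    rw [hf2, ht, hg2, hxy]
  apply algHom_ext_el
  intro j m hm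
  obtain ⟨l, rfl | rfl⟩ := m.even_or_odd'
  · apply mul_left_cancel₀ (pow_ne_zero l h0)
    have hf := congrArg f (t_pow_mul_el hm)
    have hg := congrArg g (t_pow_mul_el hm)
    simp only [map_mul, map_pow] at hf hg
    rw [hf, ht, hg, h2]
  · apply mul_left_cancel₀ (pow_ne_zero l h0)
    have hf := congrArg f (t_pow_mul_el_odd hm)
    have hg := congrArg g (t_pow_mul_el_odd hm)
    simp only [map_mul, map_pow] at hf hg
    rw [hf, ht, hg, h2, hxy]

/-- The group of automorphisms of the coordinate ring. -/
abbrev AutRing (k : Type u) [Field k] : Type u := Coord k ≃ₐ[k] Coord k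

theorem autRing_t_ne_zero (σ : AutRing k) : σ (t k) ≠ 0 :=
  (map_ne_zero_iff σ σ.injective).mpr t_ne_zero

theorem autRing_ext {σ τ : AutRing k} (ht : σ (t k) = τ (t k)) (hxy : σ (xy k) = τ (xy k)) :
    σ = τ := by
  have : (σ : Coord k →ₐ[k] Coord k) = (τ : Coord k →ₐ[k] Coord k) :=
    algHom_ext_t (autRing_t_ne_zero σ) ht hxy
  exact AlgEquiv.ext fun f => DFunLike.congr_fun this f

/-! ### Homomorphisms defined by points of the quadric -/

section Triple

variable (X' Y' Z' : Frac k)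

/-- The homomorphism `x ↦ X'`, `y ↦ Y'`, `z ↦ Z'`, for `X'Z' + Y'² = 1`. -/
def tripleHom : Chart k →ₐ[k] Frac k :=
  eval₂AlgHom (aeval ((Y' - 1) / X')) X' fun _ => Commute.all _ _

theorem tripleHom_x : tripleHom X' Y' (x k) = X' := by simp [tripleHom, x]

theorem tripleHom_v : tripleHom X' Y' (v k) = (Y' - 1) / X' := by simp [tripleHom, v]

variable {X' Y' Z'} (h0 : X' ≠ 0) (hq : X' * Z' + Y' ^ 2 = 1)

include h0 in
theorem tripleHom_y : tripleHom X' Y' (y k) = Y' := by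
  rw [y, map_add, map_mul, tripleHom_x, tripleHom_v, map_one]
  field_simp
  ring

include h0 hq in
theorem tripleHom_w : tripleHom X' Y' (w k) = -Z' := by
  rw [w, map_add, map_mul, map_mul, map_pow, tripleHom_x, tripleHom_v, map_ofNat]
  field_simp
  linear_combination hq

/-- The coordinate ring as a subalgebra of the field of rational functions. -/
def fracRing (k : Type u) [Field k] : Subalgebra k (Frac k) := (coordRing k).map (toFrac k)

include h0 hq in
-- The five hypotheses are, up to sign, the images of the five generators of degree two; `Y'²` is
-- missing from the list because it equals `1 - X'Z'`.
theorem tripleHom_mem (h1 : X' ^ 2 ∈ fracRing k) (h2 : X' * Y' ∈ fracRing k)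
    (h3 : X' * Z' ∈ fracRing k) (h4 : Y' * Z' ∈ fracRing k) (h5 : Z' ^ 2 ∈ fracRing k)
    (f : Coord k) : tripleHom X' Y' (toChart f) ∈ fracRing k := by
  obtain ⟨c, -, rfl⟩ := exists_eq_sum_el f
  rw [map_sum, map_sum]
  refine Subalgebra.sum_mem _ fun i _ => ?_
  rw [map_smul, map_smul]
  refine Subalgebra.smul_mem _ ?_ _
  have hm : ∀ m (h : m ≤ 4 * 1), tripleHom X' Y' (toChart (el k 1 m h)) ∈ fracRing k := by
    intro m h
    simp only [toChart_el, mono, map_mul, map_pow, tripleHom_x, tripleHom_y h0, tripleHom_w h0 hq]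
    interval_cases m <;> norm_num
    · exact h1
    · exact h2
    · exact h3
    · exact h4
    · exact h5
  refine el_induction (P := fun j m h => tripleHom X' Y' (toChart (el k j m h)) ∈ fracRing k)
    ?_ hm ?_ ?_ i.1.1 i.1.2 i.2
  · rw [el_zero_zero]; simp
  · intro j m h hm' _ ih
    rw [el_eq_mul_of_four_le h hm', map_mul, map_mul]
    exact mul_mem ih (hm 4 _)
  · intro j m h hm' hj ih
    rw [el_eq_mul_of_lt h hm' hj, map_mul, map_mul]
    exact mul_mem ih (hm 0 _)

/-- The identification of the coordinate ring with a subalgebra of the field of rational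
functions. -/
def fracEquiv (k : Type u) [Field k] : Coord k ≃ₐ[k] fracRing k :=
  (coordRing k).equivMapOfInjective (toFrac k) toFrac_injective

theorem coe_fracEquiv (f : Coord k) : (fracEquiv k f : Frac k) = toFrac k (toChart f) := rfl

/-- The endomorphism of the coordinate ring given by `x ↦ X'`, `y ↦ Y'`, `z ↦ Z'`. -/
def tripleEnd (h : ∀ f : Coord k, tripleHom X' Y' (toChart f) ∈ fracRing k) :
    Coord k →ₐ[k] Coord k :=
  ((fracEquiv k).symm : fracRing k →ₐ[k] Coord k).comp
    (((tripleHom X' Y').comp toChart).codRestrict (fracRing k) h)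

theorem toFrac_tripleEnd (h : ∀ f : Coord k, tripleHom X' Y' (toChart f) ∈ fracRing k)
    (f : Coord k) : toFrac k (toChart (tripleEnd h f)) = tripleHom X' Y' (toChart f) := by
  rw [← coe_fracEquiv]
  simp only [tripleEnd, AlgHom.comp_apply]
  exact congrArg Subtype.val ((fracEquiv k).apply_symm_apply _)

end Triple

end Chart

/-! ### Factors of homogeneous polynomials -/

section Homogeneous

variable {σ : Type*}

/-- The homomorphism `X i ↦ X i * T`. -/
def scaleHom (k : Type u) [Field k] (σ : Type*) : MvPolynomial σ k →ₐ[k] (MvPolynomial σ k)[X] :=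
  MvPolynomial.aeval fun i => C (MvPolynomial.X i) * X

theorem eval_scaleHom (F : MvPolynomial σ k) : (scaleHom k σ F).eval 1 = F := by
  have : ((aeval (1 : MvPolynomial σ k)).restrictScalars k).comp (scaleHom k σ) =
      AlgHom.id k _ := by
    ext i; simp [scaleHom]
  simpa [coe_aeval_eq_eval] using DFunLike.congr_fun this F

theorem scaleHom_of_isHomogeneous {F : MvPolynomial σ k} {n : ℕ} (hF : F.IsHomogeneous n) :
    scaleHom k σ F = C F * X ^ n := by
  conv_rhs => rw [F.as_sum, map_sum, Finset.sum_mul]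
  conv_lhs => rw [F.as_sum, map_sum]
  refine Finset.sum_congr rfl fun d hd => ?_
  have hdeg : d.degree = n := by
    rw [Finsupp.degree_eq_weight_one]
    exact hF (MvPolynomial.mem_support_iff.mp hd)
  rw [scaleHom, MvPolynomial.aeval_monomial, MvPolynomial.monomial_eq]
  rw [Finsupp.degree_apply] at hdeg
  simp only [Finsupp.prod, mul_pow, Finset.prod_mul_distrib, Finset.prod_pow_eq_pow_sum, hdeg,
    map_mul, map_prod, map_pow, mul_assoc]
  rfl

/-- The coefficients of the scaled polynomial are the homogeneous components. -/
theorem isHomogeneous_of_scaleHom {F : MvPolynomial σ k} {n : ℕ}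
    (h : scaleHom k σ F = C F * X ^ n) : F.IsHomogeneous n := by
  have h1 : ∀ m, (scaleHom k σ F).coeff m = MvPolynomial.homogeneousComponent m F := by
    intro m
    conv_lhs => rw [← MvPolynomial.sum_homogeneousComponent F, map_sum, finsetSum_coeff]
    simp only [scaleHom_of_isHomogeneous (MvPolynomial.homogeneousComponent_isHomogeneous _ F),
      coeff_C_mul, coeff_X_pow, mul_ite, mul_one, mul_zero]
    rw [Finset.sum_ite_eq]
    split_ifs with h
    · rfl
    · rw [MvPolynomial.homogeneousComponent_eq_zero]
      simpa using h
  have h2 := h1 n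
  rw [h] at h2
  simp only [coeff_C_mul, coeff_X_pow, if_true, mul_one] at h2
  rw [h2]
  exact MvPolynomial.homogeneousComponent_isHomogeneous n F

/-- A factor of a nonzero homogeneous polynomial is homogeneous. -/
theorem isHomogeneous_of_dvd {F G : MvPolynomial σ k} {n : ℕ} (hF : F.IsHomogeneous n)
    (h0 : F ≠ 0) (h : G ∣ F) : ∃ m, G.IsHomogeneous m := by
  obtain ⟨H, rfl⟩ := h
  have hG0 : scaleHom k σ G ≠ 0 := by
    intro h
    have := eval_scaleHom G
    rw [h, eval_zero] at this
    exact h0 (by rw [← this, zero_mul])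
  have hH0 : scaleHom k σ H ≠ 0 := by
    intro h
    have := eval_scaleHom H
    rw [h, eval_zero] at this
    exact h0 (by rw [← this, mul_zero])
  have h1 := scaleHom_of_isHomogeneous hF
  have h2 := congrArg natDegree h1
  have h3 := congrArg natTrailingDegree h1
  rw [map_mul, natDegree_mul hG0 hH0, natDegree_C_mul_X_pow _ _ h0] at h2
  rw [map_mul, natTrailingDegree_mul hG0 hH0, C_mul_X_pow_eq_monomial,
    natTrailingDegree_monomial h0] at h3
  -- Degree and order in the scaling variable are both additive and agree on the product, so they
  -- agree on each factor.
  have h4 := natTrailingDegree_le_natDegree (scaleHom k σ G)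
  have h5 := natTrailingDegree_le_natDegree (scaleHom k σ H)
  have h6 : (scaleHom k σ G).natTrailingDegree = (scaleHom k σ G).natDegree := by omega
  refine ⟨(scaleHom k σ G).natDegree, isHomogeneous_of_scaleHom ?_⟩
  have h7 : scaleHom k σ G = C ((scaleHom k σ G).leadingCoeff) *
      X ^ (scaleHom k σ G).natDegree := by
    ext1 m
    rw [coeff_C_mul, coeff_X_pow]
    split_ifs with hm
    · rw [hm, mul_one]; rfl
    · rw [mul_zero]
      rcases lt_or_gt_of_ne hm with hm | hm
      · exact coeff_eq_zero_of_lt_natTrailingDegree (h6 ▸ hm)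
      · exact coeff_eq_zero_of_natDegree_lt hm
  have h8 := eval_scaleHom G
  rw [h7] at h8
  simp only [eval_mul, eval_C, eval_pow, eval_X, one_pow, mul_one] at h8
  rw [h8] at h7
  exact h7

theorem Top.aeval {S : Type*} [CommRing S] [Algebra k S] {P : σ → S[X]} {c : σ → S}
    (h : ∀ i, Top (P i) 1 (c i)) {F : MvPolynomial σ k} {n : ℕ} (hF : F.IsHomogeneous n) :
    Top (MvPolynomial.aeval P F) n (MvPolynomial.aeval c F) := by
  conv => rw [F.as_sum, map_sum, map_sum]
  refine Top.sum fun d hd => ?_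
  have hdeg : d.degree = n := by
    rw [Finsupp.degree_eq_weight_one]
    exact hF (MvPolynomial.mem_support_iff.mp hd)
  rw [MvPolynomial.aeval_monomial, MvPolynomial.aeval_monomial, ← Algebra.smul_def,
    ← Algebra.smul_def]
  refine Top.smul _ ?_
  rw [← hdeg]
  clear hdeg hd
  classical
  induction d using Finsupp.induction with
  | zero => simpa using Top.one
  | single_add i m d hi hm ih =>
    rw [Finsupp.prod_add_index' (by simp) (fun _ _ _ => pow_add _ _ _),
      Finsupp.prod_add_index' (by simp) (fun _ _ _ => pow_add _ _ _), map_add]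
    refine Top.mul ?_ ih
    simpa using (h i).pow m

end Homogeneous

namespace Chart

/-! ### Forms of even degree as functions on the complement of the conic -/

/-- The equation of the conic. -/
abbrev conic (k : Type u) [Field k] : MvPolynomial (Fin 3) k := (SmoothConic.model k).q

theorem conic_def : conic k =
    MvPolynomial.X 0 * MvPolynomial.X 2 + MvPolynomial.X 1 ^ 2 := rfl

theorem conic_isHomogeneous : (conic k).IsHomogeneous 2 := (SmoothConic.model k).mem

theorem conic_ne_zero : conic k ≠ 0 := by
  intro h
  have := congrArg (MvPolynomial.eval ![0, 1, 0]) h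
  simp [conic_def] at this

/-- The evaluation of polynomials in `x`, `y`, `z` on the quadric. -/
def ev (k : Type u) [Field k] : MvPolynomial (Fin 3) k →ₐ[k] Chart k :=
  MvPolynomial.aeval ![x k, y k, -w k]

@[simp]
theorem ev_X0 : ev k (MvPolynomial.X 0) = x k := by simp [ev]

@[simp]
theorem ev_X1 : ev k (MvPolynomial.X 1) = y k := by simp [ev]

@[simp]
theorem ev_X2 : ev k (MvPolynomial.X 2) = -w k := by simp [ev]

@[simp]
theorem ev_conic : ev k (conic k) = 1 := by
  simp only [conic_def, map_add, map_mul, map_pow, ev_X0, ev_X1, ev_X2, y_sq]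
  ring

theorem top_ev {F : MvPolynomial (Fin 3) k} {n : ℕ} (hF : F.IsHomogeneous n) :
    Top (ev k F) n (MvPolynomial.aeval ![1, (X : k[X]), -X ^ 2] F) := by
  refine Top.aeval (fun i => ?_) hF
  fin_cases i
  · exact top_x
  · exact top_y
  · exact top_w.neg

/-- The form of degree `2j` that gives the monomial `mono j m`. -/
def form (k : Type u) [Field k] (j m : ℕ) : MvPolynomial (Fin 3) k :=
  MvPolynomial.X 0 ^ (2 * j - (m + 1) / 2) * MvPolynomial.X 1 ^ (m % 2) *
    (-MvPolynomial.X 2) ^ (m / 2)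

theorem ev_form (j m : ℕ) : ev k (form k j m) = mono k j m := by
  simp [form, mono]

theorem form_isHomogeneous {j m : ℕ} (h : m ≤ 4 * j) : (form k j m).IsHomogeneous (2 * j) := by
  have h1 := ((MvPolynomial.isHomogeneous_X k (0 : Fin 3)).pow (2 * j - (m + 1) / 2)).mul
    ((MvPolynomial.isHomogeneous_X k (1 : Fin 3)).pow (m % 2))
  have h2 := h1.mul ((MvPolynomial.isHomogeneous_X k (2 : Fin 3)).neg.pow (m / 2))
  have h3 : 1 * (2 * j - (m + 1) / 2) + 1 * (m % 2) + 1 * (m / 2) = 2 * j := by omega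
  rw [h3] at h2
  exact h2

/-- The forms of degree `2n` that correspond to the monomials. -/
def formSpan (k : Type u) [Field k] (n : ℕ) : Submodule k (MvPolynomial (Fin 3) k) :=
  Submodule.span k {F | ∃ j m, m ≤ 4 * j ∧ j ≤ n ∧ F = conic k ^ (n - j) * form k j m}

theorem conic_mul_mem_formSpan {n : ℕ} {F : MvPolynomial (Fin 3) k} (hF : F ∈ formSpan k n) :
    conic k * F ∈ formSpan k (n + 1) := by
  induction hF using Submodule.span_induction with
  | mem F h =>
    obtain ⟨j, m, h1, h2, rfl⟩ := h
    refine Submodule.subset_span ⟨j, m, h1, by omega, ?_⟩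
    rw [← mul_assoc, ← pow_succ']
    congr 2; omega
  | zero => simp
  | add F G _ _ hF hG => rw [mul_add]; exact Submodule.add_mem _ hF hG
  | smul a F _ hF => rw [mul_smul_comm]; exact Submodule.smul_mem _ _ hF

/-- Replacing `y²` by `q - xz` lowers the exponent of `y` by two in both resulting terms, until it
is 0 or 1. -/
theorem monomial_mem_formSpan (b : ℕ) : ∀ (a c n : ℕ), a + b + c = 2 * n →
    (MvPolynomial.X 0 ^ a * MvPolynomial.X 1 ^ b * MvPolynomial.X 2 ^ c :
      MvPolynomial (Fin 3) k) ∈ formSpan k n := by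
  induction b using Nat.strong_induction_on with
  | _ b ih =>
    intro a c n h
    by_cases hb : b < 2
    · have : (MvPolynomial.X 0 ^ a * MvPolynomial.X 1 ^ b * MvPolynomial.X 2 ^ c :
          MvPolynomial (Fin 3) k) = (-1 : k) ^ c • (conic k ^ (n - n) * form k n (2 * c + b)) := by
        have h1 : 2 * n - (2 * c + b + 1) / 2 = a := by omega
        have h2 : (2 * c + b) % 2 = b := by omega
        have h3 : (2 * c + b) / 2 = c := by omega
        simp only [form, h1, h2, h3, Nat.sub_self, pow_zero, one_mul]
        rw [neg_pow (MvPolynomial.X 2 : MvPolynomial (Fin 3) k), MvPolynomial.smul_eq_C_mul, map_pow, map_neg, map_one]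
        have h4 : ((-1 : MvPolynomial (Fin 3) k) ^ c) * (-1) ^ c = 1 := by
          rw [← mul_pow]; simp
        linear_combination (-MvPolynomial.X 0 ^ a * MvPolynomial.X 1 ^ b *
          MvPolynomial.X 2 ^ c) * h4
      rw [this]
      exact Submodule.smul_mem _ _ (Submodule.subset_span ⟨n, _, by omega, le_rfl, rfl⟩)
    · obtain ⟨b, rfl⟩ : ∃ b', b = b' + 2 := ⟨b - 2, by omega⟩
      obtain ⟨n, rfl⟩ : ∃ n', n = n' + 1 := ⟨n - 1, by omega⟩
      have h1 := conic_mul_mem_formSpan (ih b (by omega) a c n (by omega))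
      have h2 := ih b (by omega) (a + 1) (c + 1) (n + 1) (by omega)
      convert Submodule.sub_mem _ h1 h2 using 1
      rw [conic_def]; ring

theorem mem_formSpan {F : MvPolynomial (Fin 3) k} {n : ℕ} (hF : F.IsHomogeneous (2 * n)) :
    F ∈ formSpan k n := by
  rw [F.as_sum]
  refine Submodule.sum_mem _ fun d hd => ?_
  have hdeg : d.degree = 2 * n := by
    rw [Finsupp.degree_eq_weight_one]
    exact hF (MvPolynomial.mem_support_iff.mp hd)
  have h1 : d 0 + d 1 + d 2 = 2 * n := by
    rw [← hdeg, Finsupp.degree_eq_sum, Fin.sum_univ_three]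
  have := Submodule.smul_mem _ (F.coeff d) (monomial_mem_formSpan (k := k) (d 1) (d 0) (d 2) n h1)
  convert this using 1
  rw [MvPolynomial.monomial_eq, MvPolynomial.smul_eq_C_mul, Finsupp.prod_fintype _ _ (by simp),
    Fin.prod_univ_three]

theorem exists_coeff_of_isHomogeneous {F : MvPolynomial (Fin 3) k} {n : ℕ}
    (hF : F.IsHomogeneous (2 * n)) : ∃ c : Idx →₀ k, (∀ i ∈ c.support, i.1.1 ≤ n) ∧
      F = c.sum fun i a => a • (conic k ^ (n - i.1.1) * form k i.1.1 i.1.2) := by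
  classical
  have h : F ∈ Submodule.span k ((fun i : Idx => conic k ^ (n - i.1.1) * form k i.1.1 i.1.2) ''
      {i | i.1.1 ≤ n}) := by
    refine Submodule.span_mono ?_ (mem_formSpan hF)
    rintro _ ⟨j, m, h1, h2, rfl⟩
    exact ⟨⟨(j, m), h1⟩, h2, rfl⟩
  rw [Finsupp.mem_span_image_iff_linearCombination] at h
  obtain ⟨c, hc, rfl⟩ := h
  exact ⟨c, fun i hi => hc hi, rfl⟩

theorem ev_sum (c : Idx →₀ k) (n : ℕ) :
    ev k (c.sum fun i a => a • (conic k ^ (n - i.1.1) * form k i.1.1 i.1.2)) = ofCoeff k c := by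
  rw [ofCoeff_apply, Finsupp.sum, map_sum]
  refine Finset.sum_congr rfl fun i _ => ?_
  rw [map_smul, map_mul, map_pow, ev_conic, one_pow, one_mul, ev_form]
  rfl

theorem ev_mem {F : MvPolynomial (Fin 3) k} {n : ℕ} (hF : F.IsHomogeneous (2 * n)) :
    ev k F ∈ coordRing k := by
  obtain ⟨c, -, rfl⟩ := exists_coeff_of_isHomogeneous hF
  rw [ev_sum]
  exact mem_coordRing_iff.mpr ⟨c, rfl⟩

/-- Setting `q = 1` loses nothing within one even degree: such a form is a combination of `q^(n-j) ·
form j m`, whose values `mono j m` are linearly independent. -/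
theorem eq_zero_of_ev_eq_zero {F : MvPolynomial (Fin 3) k} {n : ℕ} (hF : F.IsHomogeneous (2 * n))
    (h : ev k F = 0) : F = 0 := by
  obtain ⟨c, -, rfl⟩ := exists_coeff_of_isHomogeneous hF
  rw [ev_sum] at h
  obtain rfl := ofCoeff_injective (h.trans (map_zero _).symm)
  simp

theorem eq_of_ev_eq {F G : MvPolynomial (Fin 3) k} {n : ℕ} (hF : F.IsHomogeneous (2 * n))
    (hG : G.IsHomogeneous (2 * n)) (h : ev k F = ev k G) : F = G :=
  sub_eq_zero.mp (eq_zero_of_ev_eq_zero (hF.sub hG) (by rw [map_sub, h, sub_self]))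

theorem exists_form {f : Chart k} (hf : f ∈ coordRing k) {n : ℕ} (hn : f.natDegree ≤ 2 * n) :
    ∃ F : MvPolynomial (Fin 3) k, F.IsHomogeneous (2 * n) ∧ ev k F = f := by
  obtain ⟨c, rfl⟩ := mem_coordRing_iff.mp hf
  rw [natDegree_ofCoeff_le_iff] at hn
  refine ⟨_, ?_, ev_sum c n⟩
  refine MvPolynomial.IsHomogeneous.sum _ _ _ fun i hi => ?_
  refine Submodule.smul_mem (MvPolynomial.homogeneousSubmodule (Fin 3) k (2 * n)) _ ?_
  have := (conic_isHomogeneous.pow (n - i.1.1)).mul (form_isHomogeneous (k := k) i.2)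
  have h : 2 * (n - i.1.1) + 2 * i.1.1 = 2 * n := by have := hn i hi; omega
  rwa [h] at this

/-- A form whose value has smaller degree is divisible by the equation of the conic. -/
theorem conic_dvd_of_natDegree_lt {F : MvPolynomial (Fin 3) k} {n : ℕ}
    (hF : F.IsHomogeneous (2 * n)) (h : (ev k F).natDegree < 2 * n) : conic k ∣ F := by
  obtain ⟨m, hm⟩ := even_natDegree (ev_mem hF)
  obtain ⟨n, rfl⟩ : ∃ n', n = n' + 1 := ⟨n - 1, by omega⟩
  obtain ⟨G, hG, hGF⟩ := exists_form (ev_mem hF) (n := n) (by omega)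
  refine ⟨G, eq_of_ev_eq hF ?_ (by rw [map_mul, ev_conic, one_mul, hGF])⟩
  have := conic_isHomogeneous.mul hG
  rwa [show 2 + 2 * n = 2 * (n + 1) by ring] at this

theorem x_mul_ev_mem {F : MvPolynomial (Fin 3) k} {n : ℕ} (hF : F.IsHomogeneous (2 * n + 1)) : x k * ev k F ∈ coordRing k := by
  have := ev_mem (n := n + 1) ((MvPolynomial.isHomogeneous_X k 0).mul
    (show F.IsHomogeneous (2 * n + 1) from hF) |> fun h => by
      rwa [show 1 + (2 * n + 1) = 2 * (n + 1) by ring] at h)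
  simpa using this

end Chart

namespace Chart

/-! ### The image of `t` under an automorphism -/

theorem exists_eq_algebraMap_of_isUnit {f : Chart k} (hf : IsUnit f) :
    ∃ d : k, d ≠ 0 ∧ f = algebraMap k _ d := by
  obtain ⟨g, hg, rfl⟩ := Polynomial.isUnit_iff.mp hf
  obtain ⟨d, hd, rfl⟩ := Polynomial.isUnit_iff.mp hg
  exact ⟨d, hd.ne_zero, rfl⟩

theorem natDegree_t : (toChart (t k)).natDegree = 2 := by
  rw [toChart_t, x, natDegree_X_pow]

theorem t_mul_one_add : t k * (1 + el k 1 2 (by omega)) = xy k ^ 2 := by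
  rw [mul_add, t_mul_el_two]; ring

theorem t_mul_el_four : t k * el k 1 4 (by omega) = el k 1 2 (by omega) ^ 2 :=
  toChart_injective (by simp [t, mono]; ring)

theorem t_mul_el_three : t k * el k 1 3 (by omega) = xy k * el k 1 2 (by omega) :=
  toChart_injective (by simp [t, xy, mono]; ring)

theorem exists_form_of_le (f : Coord k) {n : ℕ} (hn : (toChart f).natDegree ≤ 2 * n) :
    ∃ F : MvPolynomial (Fin 3) k, F.IsHomogeneous (2 * n) ∧ ev k F = toChart f :=
  exists_form (toChart_mem f) hn

/-- The image of `t` under an automorphism is a constant times the square of a form of odd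
degree. -/
theorem exists_eq_smul_sq (φ : AutRing k) : ∃ (d : k) (f : Chart k), d ≠ 0 ∧
    toChart (φ (t k)) = d • f ^ 2 ∧ x k * f ∈ coordRing k := by
  obtain ⟨n, hn⟩ : ∃ n, ∀ m (h : m ≤ 4 * 1), (toChart (φ (el k 1 m h))).natDegree ≤ 2 * n := by
    refine ⟨∑ m ∈ (Finset.range 5).attach, (toChart (φ (el k 1 m.1
      (by have := Finset.mem_range.mp m.2; omega)))).natDegree, fun m h => ?_⟩
    have := Finset.single_le_sum (f := fun m : {m // m ∈ Finset.range 5} =>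
      (toChart (φ (el k 1 m.1 (by have := Finset.mem_range.mp m.2; omega)))).natDegree)
      (fun _ _ => Nat.zero_le _) (Finset.mem_attach _ ⟨m, Finset.mem_range.mpr (by omega)⟩)
    simp only at this
    omega
  -- Forms of one common degree `2n` represent the five images; the relations between the generators
  -- become identities of ternary forms, with `1` replaced by `q^n`, in a unique factorization
  -- domain.
  choose G hG hGe using fun m h => exists_form_of_le (φ (el k 1 m h)) (hn m h)
  have hrel : ∀ {A B : MvPolynomial (Fin 3) k}, A.IsHomogeneous (2 * n + 2 * n) →
      B.IsHomogeneous (2 * n + 2 * n) → ev k A = ev k B → A = B := fun hA hB h =>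
    eq_of_ev_eq (n := 2 * n) (by convert hA using 1; ring) (by convert hB using 1; ring) h
  have hconic : (conic k ^ n).IsHomogeneous (2 * n) := conic_isHomogeneous.pow n
  have e1 : G 0 (by omega) * (conic k ^ n + G 2 (by omega)) = G 1 (by omega) * G 1 (by omega) := by
    refine hrel ((hG _ _).mul (hconic.add (hG _ _))) ((hG _ _).mul (hG _ _)) ?_
    simp only [map_mul, map_add, map_pow, ev_conic, one_pow, hGe]
    have := congrArg (fun f => toChart (φ f)) (t_mul_one_add (k := k))
    simp only [map_mul, map_add, map_one, map_pow, t, xy] at this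
    rw [this, sq]
  have e2 : G 0 (by omega) * G 4 (by omega) = G 2 (by omega) * G 2 (by omega) := by
    refine hrel ((hG _ _).mul (hG _ _)) ((hG _ _).mul (hG _ _)) ?_
    simp only [map_mul, hGe]
    have := congrArg (fun f => toChart (φ f)) (t_mul_el_four (k := k))
    simp only [map_mul, map_pow, t] at this
    rw [this, sq]
  have e3 : G 0 (by omega) * G 3 (by omega) = G 1 (by omega) * G 2 (by omega) := by
    refine hrel ((hG _ _).mul (hG _ _)) ((hG _ _).mul (hG _ _)) ?_
    simp only [map_mul, hGe]
    have := congrArg (fun f => toChart (φ f)) (t_mul_el_three (k := k))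
    simp only [map_mul, t, xy] at this
    exact this
  have h0 : G 0 (by omega) ≠ 0 := by
    intro h
    have := hGe 0 (by omega)
    rw [h, map_zero] at this
    exact autRing_t_ne_zero φ (toChart_injective (this.symm.trans (map_zero _).symm))
  -- With `G₀ = DP`, `G₁ = DR` and `P`, `R` coprime, the relations give `P ∣ D` and `P ∣ G₂`; hence
  -- `G₀ = P² D'`.
  obtain ⟨P, R, D, hPR, hDP, hDR⟩ :=
    UniqueFactorizationMonoid.exists_reduced_factors _ h0 (G 1 (by omega))
  have hD0 : D ≠ 0 := by rintro rfl; exact h0 (by rw [← hDP, zero_mul])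
  have hP0 : P ≠ 0 := by rintro rfl; exact h0 (by rw [← hDP, mul_zero])
  rw [← hDP, ← hDR] at e1 e3
  rw [← hDP] at e2
  have f1 : P * (conic k ^ n + G 2 (by omega)) = D * (R * R) :=
    mul_left_cancel₀ hD0 (by linear_combination e1)
  have f3 : P * G 3 (by omega) = R * G 2 (by omega) :=
    mul_left_cancel₀ hD0 (by linear_combination e3)
  obtain ⟨D', rfl⟩ : P ∣ D :=
    (hPR.mul_right hPR).dvd_of_dvd_mul_right ⟨_, f1.symm⟩
  obtain ⟨M, hM⟩ : P ∣ G 2 (by omega) := hPR.dvd_of_dvd_mul_left ⟨_, f3.symm⟩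
  rw [hM] at f1 e2
  have f1' : conic k ^ n + P * M = D' * (R * R) :=
    mul_left_cancel₀ hP0 (by linear_combination f1)
  have f2' : D' * G 4 (by omega) = M * M :=
    mul_left_cancel₀ (mul_ne_zero hP0 hP0) (by linear_combination e2)
  -- The cofactor `D'` divides a power of `q`, which takes the value 1 on the quadric.
  have hunit : IsUnit (ev k D') := by
    have : D' * (D' * (R * R) ^ 2 - 2 * (R * R) * P * M + P * P * G 4 (by omega)) =
        (conic k ^ n) ^ 2 := by
      linear_combination (P * P) * f2' - (conic k ^ n + D' * (R * R) - P * M) * f1'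
    have h1 := congrArg (ev k) this
    rw [map_mul, map_pow, map_pow, ev_conic, one_pow, one_pow] at h1
    exact IsUnit.of_mul_eq_one _ h1
  obtain ⟨d, hd, hd'⟩ := exists_eq_algebraMap_of_isUnit hunit
  have ht : toChart (φ (t k)) = d • ev k P ^ 2 := by
    have := hGe 0 (by omega)
    rw [← hDP, map_mul, map_mul, hd'] at this
    rw [t, ← this, Algebra.smul_def]; ring
  refine ⟨d, ev k P, hd, ht, ?_⟩
  obtain ⟨r, hr⟩ := isHomogeneous_of_dvd (hG 0 (by omega)) h0 ⟨P * D', by rw [← hDP]; ring⟩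
  obtain ⟨r', rfl | rfl⟩ := r.even_or_odd'
  -- If `P` had even degree, its value would be a function `g` on the complement, and `t` would be a
  -- constant times the square of `φ⁻¹(g)`. The degree of such a square is a multiple of 4, but `t`
  -- has degree 2.
  · exfalso
    set g : Coord k := ofChart (ev k P) (ev_mem hr) with hg
    have h1 : φ (t k) = d • g ^ 2 := toChart_injective (by rw [ht, map_smul, map_pow, hg]; rfl)
    have h2 : t k = d • (φ.symm g) ^ 2 := by
      rw [← map_pow, ← map_smul, ← h1, AlgEquiv.symm_apply_apply]
    have h3 := congrArg (fun f => (toChart f).natDegree) h2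
    simp only [map_smul, map_pow, natDegree_t] at h3
    rw [natDegree_smul_of_smul_regular _ (IsSMulRegular.of_ne_zero hd), natDegree_pow] at h3
    obtain ⟨r, hr⟩ := even_natDegree (toChart_mem (φ.symm g))
    omega
  · exact x_mul_ev_mem hr

/-- Half the degree of the image of `t` under an automorphism is odd. -/
theorem natDegree_autRing_t_mod (φ : AutRing k) : (toChart (φ (t k))).natDegree % 4 = 2 := by
  obtain ⟨d, f, hd, h, hf⟩ := exists_eq_smul_sq φ
  have hf0 : f ≠ 0 := by
    rintro rfl
    refine autRing_t_ne_zero φ (toChart_injective ?_)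
    rw [h]; simp
  rw [h, natDegree_smul_of_smul_regular _ (IsSMulRegular.of_ne_zero hd), natDegree_pow]
  obtain ⟨r, hr⟩ := even_natDegree hf
  rw [natDegree_mul (show x k ≠ 0 from X_ne_zero) hf0, x, natDegree_X] at hr
  omega

/-- The element `l x² + μ` must be `d f²` with `f` of degree at most one in `x`. In characteristic
two this alone does not exclude `μ ≠ 0`; what does is that `f` is odd, that is, that `xf` belongs to
the coordinate ring. -/
theorem eq_zero_of_autRing_t_eq {φ : AutRing k} {l μ : k}
    (h : φ (t k) = l • t k + algebraMap k _ μ) : μ = 0 := by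
  obtain ⟨d, f, hd, hdf, hf⟩ := exists_eq_smul_sq φ
  have hl : l ≠ 0 := by
    rintro rfl
    have h1 := natDegree_autRing_t_mod φ
    rw [h, zero_smul, zero_add, AlgHom.commutes] at h1
    have : (algebraMap k (Chart k) μ).natDegree = 0 := natDegree_C _
    omega
  have hf2 : d • f ^ 2 = l • x k ^ 2 + algebraMap k _ μ := by
    rw [← hdf, h, map_add, map_smul, toChart_t, AlgHom.commutes]
  have hdeg : f.natDegree ≤ 1 := by
    have h1 := congrArg natDegree hf2
    rw [natDegree_smul_of_smul_regular _ (IsSMulRegular.of_ne_zero hd), natDegree_pow] at h1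
    have h2 : (l • x k ^ 2 + algebraMap k (Chart k) μ).natDegree ≤ 2 :=
      natDegree_add_le_of_degree_le ((natDegree_smul_le _ _).trans (natDegree_X_pow_le 2))
        ((natDegree_C _).le.trans (by omega))
    omega
  obtain ⟨f1, f0, rfl⟩ : ∃ f1 f0 : k[X], f = C f1 * X + C f0 :=
    ⟨_, _, eq_X_add_C_of_natDegree_le_one hdeg⟩
  have hd' : ∀ p : k[X], d • p = C d * p := fun p => smul_eq_C_mul d
  have hl' : l • x k ^ 2 = C (C l) * X ^ 2 := Algebra.smul_def _ _
  have hμ : algebraMap k (Chart k) μ = C (C μ) := rfl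
  have hdd : d • (C f1 * X + C f0 : Chart k) ^ 2 =
      C (C d * f1 ^ 2) * X ^ 2 + C (C d * (2 * f1 * f0)) * X + C (C d * f0 ^ 2) := by
    rw [Algebra.smul_def, show algebraMap k (Chart k) d = C (C d) from rfl]
    simp only [C_mul, C_pow, C_ofNat]
    ring
  rw [hdd, hl', hμ] at hf2
  have c2 : C d * f1 ^ 2 = C l := by
    have := congrArg (fun p => coeff p 2) hf2
    simp only [coeff_add, coeff_C_mul, coeff_X_pow, coeff_X, coeff_C] at this
    simpa using this
  have c0 : C d * f0 ^ 2 = C μ := by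
    have := congrArg (fun p => coeff p 0) hf2
    simp only [coeff_add, coeff_C_mul, coeff_X_pow, coeff_X, coeff_C] at this
    simpa using this
  have hf1 : f1.natDegree = 0 := by
    have := congrArg natDegree c2
    rw [natDegree_C_mul hd, natDegree_pow, natDegree_C] at this
    omega
  obtain ⟨e, rfl⟩ : ∃ e, f1 = C e := ⟨_, eq_C_of_natDegree_eq_zero hf1⟩
  obtain ⟨c, hc⟩ := mem_coordRing_iff.mp hf
  have hdeg2 : (ofCoeff k c).natDegree ≤ 2 * 1 := by
    rw [hc]
    refine natDegree_mul_le_of_le (m := 1) (n := 1) natDegree_X_le ?_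
    exact hdeg
  rw [natDegree_ofCoeff_le_iff] at hdeg2
  have htop := top_ofCoeff_one c (M := 2) (fun i hi => by
    have := hdeg2 i hi; simp only [wt]; omega)
  rw [hc] at htop
  have htop2 : topForm (1 : k[X]) X 1 0 2 c = C e := by
    rw [← htop.2, x]; simp [coeff_X_mul, coeff_C]
  -- The coefficient of `x²` in `xf` is the constant `e`, so `xf` involves only the monomials `1`
  -- and `x²`, and the coefficient of `x` in it, which is `f0`, vanishes.
  have hce : ∀ m (hm : m ≤ 4 * 1), m ≠ 0 → c ⟨(1, m), hm⟩ = 0 := by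
    intro m hm hm0
    have := coeff_topForm_one c ⟨(1, m), hm⟩
    rw [← this]
    simp only [mul_one]
    rw [htop2, coeff_C, if_neg hm0]
  have hsum : ofCoeff k c = c ⟨(0, 0), le_rfl⟩ • 1 + c ⟨(1, 0), by omega⟩ • x k ^ 2 := by
    classical
    have hc' : c = Finsupp.single ⟨(0, 0), le_rfl⟩ (c ⟨(0, 0), le_rfl⟩) +
        Finsupp.single ⟨(1, 0), by omega⟩ (c ⟨(1, 0), by omega⟩) := by
      ext ⟨⟨j, m⟩, h⟩
      simp only [Finsupp.add_apply, Finsupp.single_apply, Subtype.mk.injEq, Prod.mk.injEq]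
      simp only at h
      by_cases hj : j = 0
      · subst hj; obtain rfl : m = 0 := by omega
        simp
      · by_cases hj1 : j = 1
        · subst hj1
          by_cases hm : m = 0
          · subst hm; simp
          · rw [hce m h hm, if_neg (by omega), if_neg (by omega), add_zero]
        · rw [if_neg (by omega), if_neg (by omega), add_zero]
          by_contra hne
          have := hdeg2 _ (Finsupp.mem_support_iff.mpr hne)
          simp only at this; omega
    conv_lhs => rw [hc', map_add, ofCoeff_single, ofCoeff_single]
    simp [monoIdx, mono]
  rw [hc] at hsum
  have hf0 : f0 = 0 := by
    have := congrArg (fun p => coeff p 1) hsum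
    simp only [x, coeff_X_mul] at this
    simpa [coeff_X, coeff_one, coeff_smul, coeff_X_pow] using this
  rw [hf0] at c0
  have : (C μ : k[X]) = 0 := by rw [← c0]; simp
  exact C_eq_zero.mp this

end Chart

/-! ### Explicit automorphisms and the growth of degrees -/

namespace Chart

/-! ### Explicit automorphisms of the coordinate ring -/

theorem toFrac_toChart_mem (f : Coord k) : toFrac k (toChart f) ∈ fracRing k :=
  ⟨_, toChart_mem f, rfl⟩

theorem toFrac_toChart_injective :
    Function.Injective fun f : Coord k => toFrac k (toChart f) :=
  toFrac_injective.comp toChart_injective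

/-- A point of the quadric with coordinates in `k[v][x]` whose products of pairs of coordinates
belong to the coordinate ring. -/
structure QuadricPoint (k : Type u) [Field k] where
  /-- The image of `x`. -/
  x' : Chart k
  /-- The image of `y`. -/
  y' : Chart k
  /-- The image of `z`. -/
  z' : Chart k
  ne_zero : x' ≠ 0
  eq_one : x' * z' + y' ^ 2 = 1
  /-- The image of `x²`. -/
  xx : Coord k
  /-- The image of `xy`. -/
  xy : Coord k
  /-- The image of `xz`. -/
  xz : Coord k
  /-- The image of `yz`. -/
  yz : Coord k
  /-- The image of `z²`. -/
  zz : Coord k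
  hxx : toChart xx = x' ^ 2
  hxy : toChart xy = x' * y'
  hxz : toChart xz = x' * z'
  hyz : toChart yz = y' * z'
  hzz : toChart zz = z' ^ 2

namespace QuadricPoint

variable (P : QuadricPoint k)

theorem toFrac_ne_zero : toFrac k P.x' ≠ 0 := (map_ne_zero_iff _ toFrac_injective).mpr P.ne_zero

theorem toFrac_eq_one : toFrac k P.x' * toFrac k P.z' + toFrac k P.y' ^ 2 = 1 := by
  rw [← map_mul, ← map_pow, ← map_add, P.eq_one, map_one]

theorem tripleHom_mem (f : Coord k) :
    tripleHom (toFrac k P.x') (toFrac k P.y') (toChart f) ∈ fracRing k := by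
  refine Chart.tripleHom_mem P.toFrac_ne_zero P.toFrac_eq_one ?_ ?_ ?_ ?_ ?_ f
  · rw [← map_pow, ← P.hxx]; exact toFrac_toChart_mem _
  · rw [← map_mul, ← P.hxy]; exact toFrac_toChart_mem _
  · rw [← map_mul, ← P.hxz]; exact toFrac_toChart_mem _
  · rw [← map_mul, ← P.hyz]; exact toFrac_toChart_mem _
  · rw [← map_pow, ← P.hzz]; exact toFrac_toChart_mem _

/-- The endomorphism of the coordinate ring defined by a point of the quadric. -/
def toEnd : Coord k →ₐ[k] Coord k := tripleEnd P.tripleHom_mem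

theorem toEnd_eq {f g : Coord k}
    (h : tripleHom (toFrac k P.x') (toFrac k P.y') (toChart f) = toFrac k (toChart g)) :
    P.toEnd f = g :=
  toFrac_toChart_injective ((toFrac_tripleEnd _ f).trans h)

theorem tripleHom_y : tripleHom (toFrac k P.x') (toFrac k P.y') (y k) = toFrac k P.y' :=
  Chart.tripleHom_y P.toFrac_ne_zero

theorem tripleHom_w : tripleHom (toFrac k P.x') (toFrac k P.y') (w k) = -toFrac k P.z' :=
  Chart.tripleHom_w P.toFrac_ne_zero P.toFrac_eq_one

theorem toEnd_t : P.toEnd (t k) = P.xx :=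
  P.toEnd_eq (by rw [P.hxx, toChart_t, map_pow, tripleHom_x, map_pow])

theorem toEnd_xy : P.toEnd (Chart.xy k) = P.xy :=
  P.toEnd_eq (by rw [P.hxy, toChart_xy, map_mul, tripleHom_x, P.tripleHom_y, map_mul])

theorem toEnd_el_two : P.toEnd (el k 1 2 (by omega)) = -P.xz :=
  P.toEnd_eq (by simp [mono, tripleHom_x, P.tripleHom_w, P.hxz])

theorem toEnd_el_three : P.toEnd (el k 1 3 (by omega)) = -P.yz :=
  P.toEnd_eq (by simp [mono, P.tripleHom_y, P.tripleHom_w, P.hyz])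

theorem toEnd_el_four : P.toEnd (el k 1 4 (by omega)) = P.zz :=
  P.toEnd_eq (by simp [mono, P.tripleHom_w, P.hzz])

end QuadricPoint

theorem toChart_el_two : toChart (el k 1 2 (by omega)) = x k * w k := by simp [mono]
theorem toChart_el_three : toChart (el k 1 3 (by omega)) = y k * w k := by simp [mono]
theorem toChart_el_four : toChart (el k 1 4 (by omega)) = w k ^ 2 := by simp [mono]

/-- The point `(x, y + sx, z - 2sy - s²x)` for `s` in the coordinate ring. -/
def fibPoint (s : Coord k) : QuadricPoint k where
  x' := x k
  y' := y k + toChart s * x k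
  z' := -w k - 2 * toChart s * y k - toChart s ^ 2 * x k
  ne_zero := X_ne_zero
  eq_one := by linear_combination y_sq k
  xx := t k
  xy := xy k + s * t k
  xz := -el k 1 2 (by omega) - 2 * s * xy k - s ^ 2 * t k
  -- The square `y²` is not one of the generators; it enters as `1 + xw`.
  yz := -el k 1 3 (by omega) - 2 * s * (1 + el k 1 2 (by omega)) - 3 * s ^ 2 * xy k -
    s * el k 1 2 (by omega) - s ^ 3 * t k
  zz := el k 1 4 (by omega) + 4 * s ^ 2 * (1 + el k 1 2 (by omega)) + s ^ 4 * t k +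
    4 * s * el k 1 3 (by omega) + 2 * s ^ 2 * el k 1 2 (by omega) + 4 * s ^ 3 * xy k
  hxx := toChart_t
  hxy := by simp only [map_add, map_mul, toChart_t, toChart_xy]; ring
  hxz := by
    simp only [map_sub, map_neg, map_mul, map_pow, map_ofNat, toChart_t, toChart_xy,
      toChart_el_two]
    ring
  hyz := by
    simp only [map_sub, map_neg, map_mul, map_pow, map_ofNat, map_add, map_one, toChart_t,
      toChart_xy, toChart_el_two, toChart_el_three]
    linear_combination 2 * toChart s * y_sq k
  hzz := by
    simp only [map_mul, map_pow, map_ofNat, map_add, map_one, toChart_t, toChart_xy,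
      toChart_el_two, toChart_el_three, toChart_el_four]
    linear_combination -4 * toChart s ^ 2 * y_sq k

/-- The automorphism `(x, y, z) ↦ (x, y + sx, z - 2sy - s²x)`, for `s` a polynomial in `t`. -/
def fib (s : k[X]) : AutRing k :=
  have h : ∀ s : k[X], ((fibPoint (aeval (t k) (-s))).toEnd).comp (fibPoint (aeval (t k) s)).toEnd =
      AlgHom.id k (Coord k) := fun s => by
    have h1 : ∀ s : k[X], (fibPoint (aeval (t k) (-s))).toEnd (t k) = t k := fun s =>
      (fibPoint _).toEnd_t
    refine algHom_ext_t ?_ ?_ ?_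
    · rw [AlgHom.comp_apply, (fibPoint _).toEnd_t]
      change (fibPoint (aeval (t k) (-s))).toEnd (t k) ≠ 0
      rw [h1]; exact t_ne_zero
    · rw [AlgHom.comp_apply, (fibPoint _).toEnd_t]
      exact h1 s
    · rw [AlgHom.comp_apply, (fibPoint _).toEnd_xy]
      change (fibPoint (aeval (t k) (-s))).toEnd (xy k + aeval (t k) s * t k) = xy k
      rw [map_add, map_mul, ← aeval_algHom_apply, h1, (fibPoint _).toEnd_xy]
      change xy k + aeval (t k) (-s) * t k + aeval (t k) s * t k = xy k
      rw [map_neg]; ring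
  AlgEquiv.ofAlgHom (fibPoint (aeval (t k) s)).toEnd (fibPoint (aeval (t k) (-s))).toEnd
    (by have := h (-s); rwa [neg_neg] at this) (h s)

theorem fib_t (s : k[X]) : fib s (t k) = t k := (fibPoint _).toEnd_t

theorem fib_xy (s : k[X]) : fib s (xy k) = xy k + aeval (t k) s * t k := (fibPoint _).toEnd_xy

theorem fib_el_two (s : k[X]) : fib s (el k 1 2 (by omega)) =
    -(-el k 1 2 (by omega) - 2 * aeval (t k) s * xy k - aeval (t k) s ^ 2 * t k) :=
  (fibPoint _).toEnd_el_two

theorem fib_el_three (s : k[X]) : fib s (el k 1 3 (by omega)) =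
    -(-el k 1 3 (by omega) - 2 * aeval (t k) s * (1 + el k 1 2 (by omega)) -
      3 * aeval (t k) s ^ 2 * xy k - aeval (t k) s * el k 1 2 (by omega) -
      aeval (t k) s ^ 3 * t k) :=
  (fibPoint _).toEnd_el_three

theorem fib_el_four (s : k[X]) : fib s (el k 1 4 (by omega)) =
    el k 1 4 (by omega) + 4 * aeval (t k) s ^ 2 * (1 + el k 1 2 (by omega)) +
      aeval (t k) s ^ 4 * t k + 4 * aeval (t k) s * el k 1 3 (by omega) +
      2 * aeval (t k) s ^ 2 * el k 1 2 (by omega) + 4 * aeval (t k) s ^ 3 * xy k :=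
  (fibPoint _).toEnd_el_four

theorem fib_add (s s' : k[X]) : fib (s + s') = fib s * fib s' := by
  apply autRing_ext
  · rw [AlgEquiv.mul_apply, fib_t, fib_t, fib_t]
  · rw [AlgEquiv.mul_apply, fib_xy, fib_xy, map_add (aeval (t k)), map_add (fib s), map_mul,
      fib_t, fib_xy, ← aeval_algHom_apply, fib_t]
    ring

theorem fib_zero : fib (0 : k[X]) = 1 := by
  apply autRing_ext
  · rw [fib_t]; rfl
  · rw [fib_xy]; simp

theorem fib_neg (s : k[X]) : fib (-s) = (fib s)⁻¹ := by
  rw [eq_inv_iff_mul_eq_one, ← fib_add, neg_add_cancel, fib_zero]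

/-- The point `(ax, y, a⁻¹z)`. -/
def torusPoint (a : kˣ) : QuadricPoint k where
  x' := (a : k) • x k
  y' := y k
  z' := (a⁻¹ : k) • -w k
  ne_zero := smul_ne_zero a.ne_zero X_ne_zero
  eq_one := by
    rw [smul_mul_smul_comm, mul_inv_cancel₀ a.ne_zero, one_smul, y_sq]; ring
  xx := ((a : k) ^ 2) • t k
  xy := (a : k) • xy k
  xz := -el k 1 2 (by omega)
  yz := (a⁻¹ : k) • -el k 1 3 (by omega)
  zz := ((a⁻¹ : k) ^ 2) • el k 1 4 (by omega)
  hxx := by rw [map_smul, toChart_t, _root_.smul_pow]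
  hxy := by rw [map_smul, toChart_xy, smul_mul_assoc]
  hxz := by
    rw [smul_mul_smul_comm, mul_inv_cancel₀ a.ne_zero, one_smul, map_neg, toChart_el_two]; ring
  hyz := by rw [map_smul, map_neg, toChart_el_three, mul_smul_comm]; exact congrArg _ (by ring)
  hzz := by rw [map_smul, toChart_el_four, _root_.smul_pow]; exact congrArg _ (by ring)

/-- The automorphism `(x, y, z) ↦ (ax, y, a⁻¹z)`. -/
def torusAut (a : kˣ) : AutRing k :=
  have h : ∀ a : kˣ, ((torusPoint a⁻¹).toEnd).comp (torusPoint a).toEnd =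
      AlgHom.id k (Coord k) := fun a => by
    have e1 : (torusPoint a⁻¹).toEnd ((torusPoint a).toEnd (t k)) = t k := by
      rw [(torusPoint a).toEnd_t]
      change (torusPoint a⁻¹).toEnd (((a : k) ^ 2) • t k) = t k
      rw [map_smul, (torusPoint _).toEnd_t]
      change ((a : k) ^ 2) • (((a⁻¹ : kˣ) : k) ^ 2) • t k = t k
      rw [smul_smul, ← mul_pow, Units.mul_inv, one_pow, one_smul]
    refine algHom_ext_t ?_ e1 ?_
    · rw [AlgHom.comp_apply, e1]; exact t_ne_zero
    · rw [AlgHom.comp_apply, (torusPoint a).toEnd_xy]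
      change (torusPoint a⁻¹).toEnd ((a : k) • xy k) = xy k
      rw [map_smul, (torusPoint _).toEnd_xy]
      change (a : k) • ((a⁻¹ : kˣ) : k) • xy k = xy k
      rw [smul_smul, Units.mul_inv, one_smul]
  AlgEquiv.ofAlgHom (torusPoint a).toEnd (torusPoint a⁻¹).toEnd
    (by have := h a⁻¹; rwa [inv_inv] at this) (h a)

theorem torusAut_t (a : kˣ) : torusAut a (t k) = ((a : k) ^ 2) • t k := (torusPoint _).toEnd_t

theorem torusAut_xy (a : kˣ) : torusAut a (xy k) = (a : k) • xy k := (torusPoint _).toEnd_xy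

theorem torusAut_el_two (a : kˣ) :
    torusAut a (el k 1 2 (by omega)) = - -el k 1 2 (by omega) := (torusPoint _).toEnd_el_two

theorem torusAut_el_three (a : kˣ) :
    torusAut a (el k 1 3 (by omega)) = - ((a⁻¹ : k) • -el k 1 3 (by omega)) :=
  (torusPoint _).toEnd_el_three

theorem torusAut_el_four (a : kˣ) :
    torusAut a (el k 1 4 (by omega)) = ((a⁻¹ : k) ^ 2) • el k 1 4 (by omega) :=
  (torusPoint _).toEnd_el_four

theorem w_ne_zero : w k ≠ 0 := top_w.ne_zero (pow_ne_zero 2 X_ne_zero)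

/-- The point `(z, -y, x)`. -/
def swapPoint (k : Type u) [Field k] : QuadricPoint k where
  x' := -w k
  y' := -y k
  z' := x k
  ne_zero := neg_ne_zero.mpr w_ne_zero
  eq_one := by linear_combination y_sq k
  xx := el k 1 4 (by omega)
  xy := el k 1 3 (by omega)
  xz := -el k 1 2 (by omega)
  yz := -xy k
  zz := t k
  hxx := by rw [toChart_el_four]; ring
  hxy := by rw [toChart_el_three]; ring
  hxz := by rw [map_neg, toChart_el_two]; ring
  hyz := by rw [map_neg, toChart_xy]; ring
  hzz := toChart_t

/-- The automorphism `(x, y, z) ↦ (z, -y, x)`. -/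
def swapAut (k : Type u) [Field k] : AutRing k :=
  have h : ((swapPoint k).toEnd).comp (swapPoint k).toEnd = AlgHom.id k (Coord k) := by
    have e1 : (swapPoint k).toEnd ((swapPoint k).toEnd (t k)) = t k := by
      rw [(swapPoint k).toEnd_t]; exact (swapPoint k).toEnd_el_four
    refine algHom_ext_t ?_ e1 ?_
    · rw [AlgHom.comp_apply, e1]; exact t_ne_zero
    · rw [AlgHom.comp_apply, (swapPoint k).toEnd_xy]
      exact ((swapPoint k).toEnd_el_three).trans (neg_neg _)
  AlgEquiv.ofAlgHom (swapPoint k).toEnd (swapPoint k).toEnd h h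

theorem swapAut_t : swapAut k (t k) = el k 1 4 (by omega) := (swapPoint _).toEnd_t

theorem swapAut_xy : swapAut k (xy k) = el k 1 3 (by omega) := (swapPoint _).toEnd_xy

theorem swapAut_el_two : swapAut k (el k 1 2 (by omega)) = - -el k 1 2 (by omega) :=
  (swapPoint _).toEnd_el_two

theorem swapAut_el_three : swapAut k (el k 1 3 (by omega)) = - -xy k :=
  (swapPoint _).toEnd_el_three

theorem swapAut_el_four : swapAut k (el k 1 4 (by omega)) = t k := (swapPoint _).toEnd_el_four

/-! ### Leading coefficients of the images of the monomials -/

section General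

variable {K : Type*} [Field K] [Algebra k K] {A B : ℕ} {θ₀ θ₁ : K}

theorem _root_.ConicComplement.Top.of_mul {P Q : K[X]} {n m : ℕ} {c d : K} (hP : Top P n c)
    (hc : c ≠ 0) (h : Top (P * Q) (n + m) d) : Top Q m (d / c) := by
  have hle : Q.natDegree ≤ m := by
    by_cases hQ : Q = 0
    · simp [hQ]
    · have := h.1
      rw [natDegree_mul (hP.ne_zero hc) hQ, hP.natDegree hc] at this
      omega
  refine ⟨hle, ?_⟩
  rw [eq_div_iff hc, ← h.2, coeff_mul_add_eq_of_natDegree_le hP.1 hle, hP.2, mul_comm]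

variable (G : Coord k →ₐ[k] K[X]) (hA : Top (G (t k)) A θ₀) (h0 : θ₀ ≠ 0)
  (hB : Top (G (xy k)) (A + B) θ₁) (hAB : 0 < A + 2 * B)

include hA h0 hB hAB

/-- In `t · xw = (xy)² - t` the last term has lower degree exactly when `A < 2(A + B)`, which is the
hypothesis `0 < A + 2B`. -/
theorem top_el_two_of_top : Top (G (el k 1 2 (by omega))) (A + 2 * B) (θ₁ ^ 2 / θ₀) := by
  refine hA.of_mul h0 ?_
  rw [← map_mul, t_mul_el_two, map_sub, map_pow]
  have h1 : Top (G (xy k) ^ 2) (A + (A + 2 * B)) (θ₁ ^ 2) := by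
    have := hB.pow 2
    rwa [show 2 * (A + B) = A + (A + 2 * B) by ring] at this
  have h2 : Top (G (t k)) (A + (A + 2 * B)) 0 := hA.of_top_lt (by omega)
  simpa using h1.sub h2

/-- At the level of leading terms `mono j m` behaves like `t^j (xy/t)^m`, where `xy/t` has the
formal degree `B`. The coefficient `θ₁` may be zero; this is used to show that a degree drops. -/
theorem top_el_of_top {j m : ℕ} (h : m ≤ 4 * j) :
    Top (G (el k j m h)) (j * A + m * B) (θ₀ ^ j * (θ₁ / θ₀) ^ m) := by
  have h2 := top_el_two_of_top G hA h0 hB hAB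
  have hr : θ₁ ^ 2 / θ₀ = (θ₁ / θ₀) ^ 2 * θ₀ := by field_simp
  obtain ⟨l, rfl | rfl⟩ := m.even_or_odd'
  · have h3 := (hA.pow j).mul (h2.pow l)
    rw [← map_pow, ← map_pow, ← map_mul, ← t_pow_mul_el h, map_mul, map_pow] at h3
    have h4 : j * A + l * (A + 2 * B) = l * A + (j * A + 2 * l * B) := by ring
    rw [h4] at h3
    have h5 := (hA.pow l).of_mul (pow_ne_zero l h0) h3
    convert h5 using 1
    rw [hr, mul_pow, ← pow_mul, ← mul_assoc, mul_div_assoc, div_self (pow_ne_zero l h0), mul_one]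
  · have h3 := ((hA.pow (j - 1)).mul hB).mul (h2.pow l)
    rw [← map_pow, ← map_mul, ← map_pow, ← map_mul, ← t_pow_mul_el_odd h, map_mul, map_pow] at h3
    obtain ⟨i, rfl⟩ : ∃ i, j = i + 1 := ⟨j - 1, by omega⟩
    simp only [Nat.add_sub_cancel] at h3
    have h4 : i * A + (A + B) + l * (A + 2 * B) = l * A + ((i + 1) * A + (2 * l + 1) * B) := by
      ring
    rw [h4] at h3
    have h5 := (hA.pow l).of_mul (pow_ne_zero l h0) h3
    convert h5 using 1
    rw [hr, mul_pow, ← pow_mul, ← mul_assoc, mul_div_assoc, div_self (pow_ne_zero l h0), mul_one,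
      pow_succ, pow_succ]
    field_simp

theorem top_sum_el_of_top (c : Idx →₀ k) {M : ℕ}
    (hM : ∀ i ∈ c.support, i.1.1 * A + i.1.2 * B ≤ M) :
    Top (G (∑ i ∈ c.support, c i • el k i.1.1 i.1.2 i.2)) M
      (∑ i ∈ c.support with i.1.1 * A + i.1.2 * B = M,
        c i • (θ₀ ^ i.1.1 * (θ₁ / θ₀) ^ i.1.2)) := by
  rw [map_sum, Finset.sum_filter]
  refine Top.sum fun i hi => ?_
  rw [map_smul]
  have h1 := top_el_of_top G hA h0 hB hAB i.2
  split_ifs with h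
  · rw [← h]; exact h1.smul _
  · simpa using (h1.of_top_lt (lt_of_le_of_ne (hM i hi) h)).smul (c i)

end General

end Chart

/-! ### The two subgroups, and the structure of the stabilizer of the fibration -/

namespace Chart

/-- The degree of an element of the coordinate ring, twice the order of its pole along the
conic. -/
def deg (f : Coord k) : ℕ := (toChart f).natDegree

/-- The automorphisms of the coordinate ring that preserve the degree. -/
def degSub (k : Type u) [Field k] : Subgroup (AutRing k) where
  carrier := {σ | ∀ f, deg (σ f) = deg f}
  mul_mem' := fun {σ τ} hσ hτ f => by rw [AlgEquiv.mul_apply, hσ, hτ]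
  one_mem' := fun _ => rfl
  inv_mem' := fun {σ} hσ f => by
    have := hσ (σ⁻¹ f)
    rwa [← AlgEquiv.mul_apply, mul_inv_cancel, AlgEquiv.one_apply, eq_comm] at this

/-- The automorphisms of the coordinate ring that multiply `t` by a constant. -/
def fibSub (k : Type u) [Field k] : Subgroup (AutRing k) where
  carrier := {σ | ∃ l : k, σ (t k) = l • t k}
  mul_mem' := by
    rintro σ τ ⟨l, hl⟩ ⟨l', hl'⟩
    exact ⟨l' * l, by rw [AlgEquiv.mul_apply, hl', map_smul, hl, smul_smul]⟩
  one_mem' := ⟨1, by simp⟩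
  inv_mem' := by
    rintro σ ⟨l, hl⟩
    have hl0 : l ≠ 0 := by
      rintro rfl
      exact autRing_t_ne_zero σ (by rw [hl, zero_smul])
    refine ⟨l⁻¹, σ.injective ?_⟩
    rw [← AlgEquiv.mul_apply, mul_inv_cancel, map_smul, hl, smul_smul, inv_mul_cancel₀ hl0,
      one_smul, AlgEquiv.one_apply]

theorem mem_fibSub_of_eq {σ : AutRing k} {l μ : k} (h : σ (t k) = l • t k + algebraMap k _ μ) :
    σ ∈ fibSub k :=
  ⟨l, by rw [h, eq_zero_of_autRing_t_eq h, map_zero, add_zero]⟩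

theorem fib_mem_fibSub (s : k[X]) : fib s ∈ fibSub k := ⟨1, by rw [fib_t, one_smul]⟩

/-! ### Polynomials in `t` -/

theorem aeval_t_injective : Function.Injective (aeval (t k) : k[X] →ₐ[k] Coord k) := by
  have h : ∀ p : k[X], toChart (aeval (t k) p) = expand k[X] 2 (p.map C) := by
    intro p
    rw [← aeval_algHom_apply, toChart_t]
    induction p using Polynomial.induction_on' with
    | add p q hp hq => rw [map_add, hp, hq, Polynomial.map_add, map_add]
    | monomial n a =>
      rw [aeval_monomial, Polynomial.map_monomial, expand_monomial, ← C_mul_X_pow_eq_monomial,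
        mul_comm n 2, pow_mul]
      rfl
  intro p q hpq
  have h1 := congrArg toChart hpq
  rw [h, h] at h1
  exact map_injective C C_injective (expand_injective (by norm_num) h1)

theorem autRing_aeval_t (σ : AutRing k) (p : k[X]) :
    σ (aeval (t k) p) = aeval (σ (t k)) p :=
  (aeval_algHom_apply (σ : Coord k →ₐ[k] Coord k) (t k) p).symm

theorem aeval_smul_t (l : k) (p : k[X]) :
    aeval (l • t k) p = aeval (t k) (p.comp (C l * X)) := by
  rw [aeval_comp]
  simp [Algebra.smul_def]

/-- The homomorphism that measures the degree of an element of the coordinate ring along the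
fibres of `t`. -/
def fibDegHom (k : Type u) [Field k] : Coord k →ₐ[k] (Frac k)[X] := (wtHom k 0 1).comp toChart

theorem fibDegHom_aeval_t (p : k[X]) :
    fibDegHom k (aeval (t k) p) = C (toFrac k (toChart (aeval (t k) p))) := by
  have : (fibDegHom k).comp (aeval (t k)) =
      ((IsScalarTower.toAlgHom k (Frac k) (Frac k)[X]).comp
        ((toFrac k).comp (toChart.comp (aeval (t k))))) := by
    refine Polynomial.algHom_ext ?_
    simp [fibDegHom, toChart_t, wtHom_x]
  exact DFunLike.congr_fun this p

theorem top_fibDegHom_el {j m : ℕ} (h : m ≤ 4 * j) :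
    Top (fibDegHom k (el k j m h)) m (toFrac k (x k) ^ (2 * j) * toFrac k (v k) ^ m) := by
  have := top_wtHom_mono (k := k) (a := 0) (b := 1) (by omega) h
  simpa [fibDegHom] using this

theorem toFrac_x_ne_zero : toFrac k (x k) ≠ 0 :=
  (map_ne_zero_iff _ toFrac_injective).mpr X_ne_zero

theorem v_ne_zero : v k ≠ 0 := C_ne_zero.mpr X_ne_zero

theorem toFrac_v_ne_zero : toFrac k (v k) ≠ 0 :=
  (map_ne_zero_iff _ toFrac_injective).mpr v_ne_zero

theorem eq_zero_of_aeval_mul_xy_add {p q : k[X]}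
    (h : aeval (t k) p * xy k + aeval (t k) q = 0) : p = 0 ∧ q = 0 := by
  have hp : p = 0 := by
    have h1 := congrArg (fibDegHom k) h
    rw [map_add, map_mul, fibDegHom_aeval_t, fibDegHom_aeval_t, map_zero] at h1
    have h2 := ((Top.C (toFrac k (toChart (aeval (t k) p)))).mul
      (top_fibDegHom_el (k := k) (j := 1) (m := 1) (by omega))).add
      ((Top.C (toFrac k (toChart (aeval (t k) q)))).of_top_lt (n := 0 + 1) (by omega))
    change Top (_ * fibDegHom k (xy k) + _) _ _ at h2
    rw [h1, add_zero] at h2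
    have h3 := h2.2
    rw [coeff_zero, eq_comm, mul_eq_zero, or_iff_left
      (mul_ne_zero (pow_ne_zero _ toFrac_x_ne_zero) (pow_ne_zero _ toFrac_v_ne_zero))] at h3
    have h4 := toFrac_toChart_injective (a₁ := aeval (t k) p) (a₂ := 0) (by simpa using h3)
    exact aeval_t_injective (h4.trans (map_zero _).symm)
  subst hp
  rw [map_zero, zero_mul, zero_add] at h
  exact ⟨rfl, aeval_t_injective (h.trans (map_zero _).symm)⟩

/-- For the weights `(0, 1)` the monomial `mono j m` has weight `m`, so only `mono j 0 = t^j` and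
`mono j 1 = t^(j-1) xy` can occur. -/
theorem exists_eq_of_fibDeg_le_one {f : Coord k} (hf : (fibDegHom k f).natDegree ≤ 1) :
    ∃ p q : k[X], f = aeval (t k) p * xy k + aeval (t k) q := by
  obtain ⟨c, hc, hf'⟩ := exists_eq_sum_el f
  by_cases hc0 : c = 0
  · refine ⟨0, 0, ?_⟩
    rw [hf', hc0]; simp
  obtain ⟨i, hi, hmax, hdeg, -⟩ := exists_natDegree_wtHom (a := 0) (b := 1) (by omega) hc0
  rw [← hc] at hdeg
  have hle : ∀ i' ∈ c.support, i'.1.2 ≤ 1 := fun i' hi' => by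
    have h1 := hmax i' hi'
    rw [← hdeg] at h1
    have h2 : wt 0 1 i' = i'.1.2 := by simp [wt]
    rw [h2] at h1
    exact h1.trans hf
  rw [hf']
  refine Finset.sum_induction _ (fun f => ∃ p q : k[X], f = aeval (t k) p * xy k + aeval (t k) q)
    ?_ ⟨0, 0, by simp⟩ ?_
  · rintro _ _ ⟨p, q, rfl⟩ ⟨p', q', rfl⟩
    exact ⟨p + p', q + q', by rw [map_add, map_add]; ring⟩
  · rintro ⟨⟨j, m⟩, h⟩ hi'
    have h1 := hle _ hi'
    simp only at h h1
    rcases Nat.le_one_iff_eq_zero_or_eq_one.mp h1 with rfl | rfl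
    · refine ⟨0, C (c ⟨(j, 0), h⟩) * X ^ j, toChart_injective ?_⟩
      simp [mono_zero, toChart_t, Algebra.smul_def]
    · obtain ⟨j, rfl⟩ : ∃ j', j = j' + 1 := ⟨j - 1, by omega⟩
      refine ⟨C (c ⟨(j + 1, 1), h⟩) * X ^ j, 0, toChart_injective ?_⟩
      have : 2 * (j + 1) - 1 = 2 * j + 1 := by omega
      simp [mono, toChart_t, toChart_xy, Algebra.smul_def, this]
      ring

theorem exists_eq_of_fibDeg_eq_zero {f : Coord k} (hf : (fibDegHom k f).natDegree = 0) :
    ∃ q : k[X], f = aeval (t k) q := by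
  obtain ⟨p, q, rfl⟩ := exists_eq_of_fibDeg_le_one (hf.le.trans zero_le_one)
  refine ⟨q, ?_⟩
  suffices p = 0 by rw [this]; simp
  by_contra hp
  have h1 : toFrac k (toChart (aeval (t k) p)) ≠ 0 := fun h => hp (aeval_t_injective
    (toFrac_toChart_injective (by simpa using h)))
  have h2 := ((Top.C (toFrac k (toChart (aeval (t k) p)))).mul
      (top_fibDegHom_el (k := k) (j := 1) (m := 1) (by omega))).add
      ((Top.C (toFrac k (toChart (aeval (t k) q)))).of_top_lt (n := 0 + 1) (by omega))
  have h3 := h2.natDegree (by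
    rw [add_zero]
    exact mul_ne_zero h1
      (mul_ne_zero (pow_ne_zero _ toFrac_x_ne_zero) (pow_ne_zero _ toFrac_v_ne_zero)))
  rw [← fibDegHom_aeval_t, ← fibDegHom_aeval_t] at h3
  change natDegree (_ * fibDegHom k (xy k) + _) = _ at h3
  rw [← map_mul, ← map_add, hf] at h3
  omega

theorem natDegree_fibDegHom_xy : (fibDegHom k (xy k)).natDegree = 1 :=
  (top_fibDegHom_el (k := k) (j := 1) (m := 1) (by omega)).natDegree
    (mul_ne_zero (pow_ne_zero _ toFrac_x_ne_zero) (pow_ne_zero _ toFrac_v_ne_zero))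

/-! ### Automorphisms that preserve the fibration -/

/-- Let `d` be the degree of `σ(xy)` along the fibres. It is not 0, since otherwise `xy` would be a
polynomial in `t`. The weight of `σ(f)` is then `d` times that of `f`, as the leading coefficient, a
nonzero polynomial in `σ(t)`, survives. For `f = σ⁻¹(xy)` this says that `d` divides 1. -/
theorem natDegree_fibDegHom_autRing_xy {σ : AutRing k} (hσ : σ ∈ fibSub k) :
    (fibDegHom k (σ (xy k))).natDegree = 1 := by
  obtain ⟨l, hl⟩ := hσ
  have hl0 : l ≠ 0 := by
    rintro rfl
    exact autRing_t_ne_zero σ (by rw [hl, zero_smul])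
  set d := (fibDegHom k (σ (xy k))).natDegree with hd
  have hd0 : d ≠ 0 := by
    intro h0
    obtain ⟨q, hq⟩ := exists_eq_of_fibDeg_eq_zero (hd.symm.trans h0)
    have h1 : xy k = aeval (σ.symm (t k)) q := by
      rw [← autRing_aeval_t, ← hq, AlgEquiv.symm_apply_apply]
    have h2 : σ.symm (t k) = l⁻¹ • t k := by
      apply σ.injective
      rw [AlgEquiv.apply_symm_apply, map_smul, hl, smul_smul, inv_mul_cancel₀ hl0, one_smul]
    rw [h2, aeval_smul_t] at h1
    have h3 := eq_zero_of_aeval_mul_xy_add (p := 1) (q := -q.comp (C l⁻¹ * X))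
      (by rw [map_neg, ← h1]; simp)
    exact one_ne_zero h3.1
  set G : Coord k →ₐ[k] (Frac k)[X] := (fibDegHom k).comp (σ : Coord k →ₐ[k] Coord k) with hG
  set θ₀ : Frac k := toFrac k (toChart (l • t k)) with hθ₀
  have hA : Top (G (t k)) 0 θ₀ := by
    have h1 : G (t k) = C θ₀ := by
      change fibDegHom k (σ (t k)) = _
      rw [hl, hθ₀, map_smul, map_smul, map_smul, ← aeval_X (R := k) (t k), fibDegHom_aeval_t,
        smul_C]
    rw [h1]; exact Top.C _
  have h0 : θ₀ ≠ 0 := by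
    rw [hθ₀, map_smul, map_smul, toChart_t, map_pow]
    exact smul_ne_zero hl0 (pow_ne_zero _ toFrac_x_ne_zero)
  have hB : Top (G (xy k)) (0 + d) (fibDegHom k (σ (xy k))).leadingCoeff := by
    rw [zero_add]; exact Top.self _
  have hne : (fibDegHom k (σ (xy k))).leadingCoeff ≠ 0 := by
    rw [leadingCoeff_ne_zero]
    intro h
    rw [h, natDegree_zero] at hd
    exact hd0 hd
  obtain ⟨c, hc, hf⟩ := exists_eq_sum_el (σ.symm (xy k))
  have hc0 : c ≠ 0 := by
    rintro rfl
    have h1 : σ.symm (xy k) = 0 := by rw [hf]; simp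
    have h2 : xy k = 0 := by rw [← σ.apply_symm_apply (xy k), h1, map_zero]
    have := natDegree_fibDegHom_xy (k := k)
    rw [h2, map_zero, natDegree_zero] at this
    omega
  obtain ⟨i, hi, hmax⟩ := exists_max_wt 0 1 hc0
  have hmax' : ∀ i' ∈ c.support, i'.1.2 ≤ i.1.2 := fun i' hi' => by
    simpa [wt] using hmax i' hi'
  have htop := top_sum_el_of_top G hA h0 hB (by omega) c (M := i.1.2 * d) fun i' hi' => by
    have := hmax' i' hi'
    simp only [mul_zero, zero_add]
    gcongr
  have hfilter : ∀ i' : Idx, i'.1.1 * 0 + i'.1.2 * d = i.1.2 * d ↔ i'.1.2 = i.1.2 := fun i' => by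
    rw [mul_zero, zero_add, Nat.mul_left_inj hd0]
  simp only [hfilter] at htop
  set θ := (fibDegHom k (σ (xy k))).leadingCoeff / θ₀ with hθ
  set p : k[X] := ∑ i' ∈ c.support with i'.1.2 = i.1.2, C (c i') * X ^ i'.1.1 with hp
  have hcoef : p.coeff i.1.1 = c i := by
    classical
    rw [hp, finsetSum_coeff]
    simp only [coeff_C_mul, coeff_X_pow, mul_ite, mul_one, mul_zero]
    rw [← Finset.sum_filter, Finset.filter_filter]
    have h2 : ∀ i' : Idx, (i'.1.2 = i.1.2 ∧ i.1.1 = i'.1.1) ↔ i' = i := by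
      intro i'
      constructor
      · rintro ⟨h, h'⟩
        exact Subtype.ext (Prod.ext h'.symm h)
      · rintro rfl; simp
    simp only [h2]
    rw [Finset.sum_filter, Finset.sum_ite_eq', if_pos hi]
  have hsum : ∑ i' ∈ c.support with i'.1.2 = i.1.2, c i' • (θ₀ ^ i'.1.1 * θ ^ i'.1.2) =
      θ ^ i.1.2 * aeval θ₀ p := by
    rw [hp, map_sum, Finset.mul_sum]
    refine Finset.sum_congr rfl fun i' hi' => ?_
    rw [(Finset.mem_filter.mp hi').2]
    simp [Algebra.smul_def]; ring
  rw [hsum] at htop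
  have hp0 : p ≠ 0 := by
    intro h
    rw [h, coeff_zero] at hcoef
    exact Finsupp.mem_support_iff.mp hi hcoef.symm
  have hne2 : aeval θ₀ p ≠ 0 := by
    have h1 : aeval θ₀ p = toFrac k (toChart (σ (aeval (t k) p))) := by
      rw [autRing_aeval_t, hl, hθ₀, ← aeval_algHom_apply, ← aeval_algHom_apply]
    rw [h1]
    intro h2
    have h3 := toFrac_toChart_injective (a₁ := σ (aeval (t k) p)) (a₂ := 0) (by simpa using h2)
    have h4 := (map_eq_zero_iff σ σ.injective).mp h3
    exact hp0 (aeval_t_injective (h4.trans (map_zero _).symm))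
  have hdeg := htop.natDegree (mul_ne_zero (pow_ne_zero _ (div_ne_zero hne h0)) hne2)
  rw [← hf] at hdeg
  change (fibDegHom k (σ (σ.symm (xy k)))).natDegree = _ at hdeg
  rw [AlgEquiv.apply_symm_apply, natDegree_fibDegHom_xy] at hdeg
  exact Nat.eq_one_of_mul_eq_one_left hdeg.symm

/-- Evaluation at `x = 0`. -/
def evalZero (k : Type u) [Field k] : Chart k →ₐ[k] k[X] :=
  (aeval (0 : k[X])).restrictScalars k

theorem evalZero_x : evalZero k (x k) = 0 := by simp [evalZero, x]

/-- The automorphisms that preserve the fibration are the compositions of a linear one with one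
that fixes `t`. -/
theorem exists_eq_torusAut_mul_fib {σ : AutRing k} (hσ : σ ∈ fibSub k) :
    ∃ (a : kˣ) (s : k[X]), σ = torusAut a * fib s := by
  obtain ⟨P, S, hPS⟩ := exists_eq_of_fibDeg_le_one (natDegree_fibDegHom_autRing_xy hσ).le
  obtain ⟨P', S', hPS'⟩ := exists_eq_of_fibDeg_le_one
    (natDegree_fibDegHom_autRing_xy (inv_mem hσ)).le
  obtain ⟨l, hl⟩ := hσ
  have hl0 : l ≠ 0 := by
    rintro rfl
    exact autRing_t_ne_zero σ (by rw [hl, zero_smul])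
  -- Applying `σ` to the corresponding expression of `σ⁻¹(xy)` exhibits an inverse of `P`, up to the
  -- substitution `t ↦ lt`.
  have hP : IsUnit P := by
    have h1 : σ (σ⁻¹ (xy k)) = xy k := by
      rw [← AlgEquiv.mul_apply, mul_inv_cancel, AlgEquiv.one_apply]
    rw [hPS', map_add, map_mul, autRing_aeval_t, autRing_aeval_t, hPS, hl, aeval_smul_t,
      aeval_smul_t] at h1
    have h2 := (eq_zero_of_aeval_mul_xy_add (k := k) (p := P'.comp (C l * X) * P - 1)
      (q := P'.comp (C l * X) * S + S'.comp (C l * X)) (by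
        rw [map_sub, map_mul, map_add, map_mul, map_one]
        linear_combination h1)).1
    exact IsUnit.of_mul_eq_one (P'.comp (C l * X)) (by rw [mul_comm]; exact sub_eq_zero.mp h2)
  obtain ⟨c, hc, rfl⟩ := Polynomial.isUnit_iff.mp hP
  rw [aeval_C] at hPS
  -- On `x = 0` the image of `t · xw = (xy)² - t` reads `0 = S(0)²`.
  have hS0 : S.coeff 0 = 0 := by
    have h1 := congrArg (fun f => evalZero k (toChart (σ f))) (t_mul_el_two (k := k))
    simp only [map_sub, map_mul, map_pow, hl, hPS, map_add, map_smul, toChart_t, toChart_xy,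
      evalZero_x, ← aeval_algHom_apply] at h1
    simpa [aeval_def, eval₂_at_zero] using h1.symm
  obtain ⟨S₁, rfl⟩ := X_dvd_iff.mpr hS0
  have hl1 : (algebraMap k (Coord k) l) * algebraMap k (Coord k) l⁻¹ = 1 := by
    rw [← map_mul, mul_inv_cancel₀ hl0, map_one]
  -- The choice makes `σ(s(t) t) = -t S₁(t)`, which cancels the second term of `σ(xy)`.
  set s := -(C l⁻¹ * S₁.comp (C l⁻¹ * X)) with hs
  set τ := σ * fib s with hτ
  have hτt : τ (t k) = l • t k := by rw [hτ, AlgEquiv.mul_apply, fib_t, hl]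
  have hτxy : τ (xy k) = algebraMap k _ c * xy k := by
    have h1 : aeval (l • t k) (S₁.comp (C l⁻¹ * X)) = aeval (t k) S₁ := by
      rw [aeval_comp]
      rw [map_mul, aeval_C, aeval_X, Algebra.smul_def, ← mul_assoc,
        mul_comm (algebraMap k (Coord k) l⁻¹), hl1, one_mul]
    rw [hτ, AlgEquiv.mul_apply, fib_xy, map_add, map_mul, autRing_aeval_t, hPS, hl, hs, map_neg,
      map_mul (aeval (l • t k)), h1, aeval_C, map_mul, aeval_X, Algebra.smul_def]
    linear_combination (- (t k) * aeval (t k) S₁) * hl1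
  -- Eliminating the image of `xw` from the images of the relations for `t · xw` and `t · yw`, and
  -- restricting to `x = 0`, leaves `c(c² - l) = 0`.
  have hcl : l = c ^ 2 := by
    have e2 := congrArg (fun f => toChart (τ f)) (t_mul_el_two (k := k))
    have e3 := congrArg (fun f => toChart (τ f)) (t_mul_el_three (k := k))
    simp only [map_sub, map_mul, map_pow, hτt, hτxy, toChart_t, toChart_xy,
      Algebra.smul_def, AlgHom.commutes] at e2 e3
    have e4 : (x k) ^ 3 * (algebraMap k (Chart k) l ^ 2 * x k * toChart (τ (el k 1 3 (by omega)))) =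
        x k ^ 3 * (algebraMap k _ c * y k *
          (algebraMap k _ c ^ 2 * y k ^ 2 - algebraMap k _ l)) := by
      linear_combination algebraMap k (Chart k) l * x k ^ 2 * e3 +
        algebraMap k (Chart k) c * x k * y k * e2
    have e5 := mul_left_cancel₀ (pow_ne_zero 3 (X_ne_zero : x k ≠ 0)) e4
    have e6 := congrArg (evalZero k) e5
    simp only [map_mul, map_sub, map_pow, evalZero_x, AlgHom.commutes, y, map_add, map_one] at e6
    simp only [mul_zero, zero_mul, add_zero, one_pow, mul_one, ← map_pow, ← map_sub,
      ← map_mul] at e6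
    have e7 : c * (c ^ 2 - l) = 0 := C_injective (e6.symm.trans (map_zero _).symm)
    have e8 := (mul_eq_zero.mp e7).resolve_left hc.ne_zero
    linear_combination -e8
  refine ⟨hc.unit, -s, ?_⟩
  have hτ' : τ = torusAut hc.unit := by
    apply autRing_ext
    · rw [hτt, torusAut_t, hcl]; rfl
    · rw [hτxy, torusAut_xy, Algebra.smul_def]; rfl
  rw [fib_neg, ← hτ', hτ, mul_inv_cancel_right]

end Chart

/-! ### The structure of the group of automorphisms that preserve the degree -/

namespace Chart

/-! ### Elements of degree two -/

theorem deg_el {j m : ℕ} (h : m ≤ 4 * j) : deg (el k j m h) = 2 * j :=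
  (top_mono_one h).natDegree (pow_ne_zero _ X_ne_zero)

theorem deg_t : deg (t k) = 2 := deg_el _

theorem deg_xy : deg (xy k) = 2 := deg_el _

theorem deg_algebraMap (a : k) : deg (algebraMap k (Coord k) a) = 0 := by
  rw [deg, AlgHom.commutes]; exact natDegree_C _

theorem deg_add_le {f g : Coord k} {n : ℕ} (hf : deg f ≤ n) (hg : deg g ≤ n) :
    deg (f + g) ≤ n := by
  rw [deg, map_add]; exact natDegree_add_le_of_degree_le hf hg

theorem deg_smul_le (a : k) (f : Coord k) : deg (a • f) ≤ deg f := by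
  rw [deg, map_smul]; exact natDegree_smul_le _ _

theorem deg_smul {a : k} (ha : a ≠ 0) (f : Coord k) : deg (a • f) = deg f := by
  rw [deg, map_smul, natDegree_smul_of_smul_regular _ (IsSMulRegular.of_ne_zero ha)]; rfl

theorem deg_neg (f : Coord k) : deg (-f) = deg f := by
  rw [deg, map_neg, natDegree_neg]; rfl

theorem toChart_ne_zero {f : Coord k} (hf : f ≠ 0) : toChart f ≠ 0 :=
  (map_ne_zero_iff _ toChart_injective).mpr hf

theorem deg_mul {f g : Coord k} (hf : f ≠ 0) (hg : g ≠ 0) : deg (f * g) = deg f + deg g := by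
  rw [deg, map_mul, natDegree_mul (toChart_ne_zero hf) (toChart_ne_zero hg)]; rfl

theorem deg_mul_le (f g : Coord k) : deg (f * g) ≤ deg f + deg g := by
  rw [deg, map_mul]; exact natDegree_mul_le

theorem deg_pow (f : Coord k) (n : ℕ) : deg (f ^ n) = n * deg f := by
  rw [deg, map_pow, natDegree_pow]; rfl

theorem deg_sum_le {ι : Type*} (s : Finset ι) (f : ι → Coord k) {n : ℕ}
    (h : ∀ i ∈ s, deg (f i) ≤ n) : deg (∑ i ∈ s, f i) ≤ n := by
  rw [deg, map_sum]; exact natDegree_sum_le_of_forall_le _ _ h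

theorem deg_aeval_t (p : k[X]) : deg (aeval (t k) p) = 2 * p.natDegree := by
  by_cases hp : p = 0
  · simp [hp, deg]
  have h1 : Top (toChart (aeval (t k) p)) (2 * p.natDegree) (C p.leadingCoeff) := by
    rw [← aeval_algHom_apply, toChart_t, aeval_eq_sum_range]
    have h2 := Top.sum (s := Finset.range (p.natDegree + 1)) (n := 2 * p.natDegree)
      (f := fun i => p.coeff i • (x k ^ 2) ^ i)
      (c := fun i => if i = p.natDegree then C p.leadingCoeff else 0) fun i hi => by
        rw [← pow_mul]
        have h3 : Top (p.coeff i • (X : k[X][X]) ^ (2 * i)) (2 * i) (p.coeff i • (1 : k[X])) := by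
          have h4 := ((Top.X (S := k[X])).pow (2 * i)).smul (p.coeff i)
          simpa only [one_pow, mul_one] using h4
        change Top (p.coeff i • (X : k[X][X]) ^ (2 * i)) _ _
        split_ifs with h
        · subst h
          rwa [smul_eq_C_mul, mul_one] at h3
        · exact h3.of_top_lt (by have := Finset.mem_range.mp hi; omega)
    simpa using h2
  exact h1.natDegree (C_ne_zero.mpr (leadingCoeff_ne_zero.mpr hp))

theorem exists_of_deg_le_two {f : Coord k} (hf : deg f ≤ 2) : ∃ a b₀ b₁ b₂ b₃ b₄ : k,
    f = a • 1 + b₀ • t k + b₁ • xy k + b₂ • el k 1 2 (by decide) + b₃ • el k 1 3 (by decide) +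
      b₄ • el k 1 4 (by decide) := by
  have h : f ∈ Submodule.span k (Set.range ![1, t k, xy k, el k 1 2 (by decide),
      el k 1 3 (by decide), el k 1 4 (by decide)]) := by
    obtain ⟨c, hc, hf'⟩ := exists_eq_sum_el f
    rw [hf']
    refine Submodule.sum_mem _ fun i hi => Submodule.smul_mem _ _ (Submodule.subset_span ?_)
    have h1 := (natDegree_ofCoeff_le_iff (n := 1)).mp (by rw [← hc]; exact hf) i hi
    obtain ⟨⟨j, m⟩, h2⟩ := i
    simp only at h1 h2
    rcases Nat.le_one_iff_eq_zero_or_eq_one.mp h1 with rfl | rfl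
    · obtain rfl : m = 0 := by omega
      exact ⟨0, el_zero_zero.symm⟩
    · have h3 : m ≤ 4 := by omega
      interval_cases m
      exacts [⟨1, rfl⟩, ⟨2, rfl⟩, ⟨3, rfl⟩, ⟨4, rfl⟩, ⟨5, rfl⟩]
  rw [Submodule.mem_span_range_iff_exists_fun] at h
  obtain ⟨c, hc⟩ := h
  refine ⟨c 0, c 1, c 2, c 3, c 4, c 5, ?_⟩
  rw [← hc, Fin.sum_univ_six]
  rfl

/-- The coefficient of `x²`, a polynomial in `v`. -/
def coeffTwo (k : Type u) [Field k] : Coord k →ₗ[k] k[X] :=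
  ((lcoeff k[X] 2).restrictScalars k).comp toChart.toLinearMap

theorem coeffTwo_el {m : ℕ} (h : m ≤ 4 * 1) : coeffTwo k (el k 1 m h) = X ^ m :=
  (top_mono_one h).2

theorem coeffTwo_one : coeffTwo k 1 = 0 := by
  change (toChart (1 : Coord k)).coeff 2 = 0
  rw [map_one, coeff_one]; simp

theorem coeffTwo_eq (a b₀ b₁ b₂ b₃ b₄ : k) : coeffTwo k (a • 1 + b₀ • t k + b₁ • xy k +
    b₂ • el k 1 2 (by omega) + b₃ • el k 1 3 (by omega) + b₄ • el k 1 4 (by omega)) =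
    C b₀ + C b₁ * X + C b₂ * X ^ 2 + C b₃ * X ^ 3 + C b₄ * X ^ 4 := by
  simp only [map_add, map_smul, coeffTwo_one, t, xy, coeffTwo_el, smul_eq_C_mul]
  simp

theorem natDegree_coeffTwo_le {f : Coord k} (hf : deg f ≤ 2) : (coeffTwo k f).natDegree ≤ 4 := by
  obtain ⟨a, b₀, b₁, b₂, b₃, b₄, rfl⟩ := exists_of_deg_le_two hf
  rw [coeffTwo_eq]
  compute_degree

theorem top_coeffTwo {f : Coord k} (hf : deg f ≤ 2) : Top (toChart f) 2 (coeffTwo k f) := ⟨hf, rfl⟩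

/-! ### Automorphisms that preserve the degree -/

/-- The filtration by the degree is generated in degree two, so a bound on the five generators
suffices. -/
theorem deg_map_le {σ : AutRing k} (h : ∀ m (hm : m ≤ 4 * 1), deg (σ (el k 1 m hm)) ≤ 2)
    (f : Coord k) : deg (σ f) ≤ deg f := by
  have h1 : ∀ j m hm, deg (σ (el k j m hm)) ≤ 2 * j := by
    refine el_induction ?_ h ?_ ?_
    · rw [el_zero_zero, map_one, ← map_one (algebraMap k (Coord k)), deg_algebraMap]
    · intro j m hm h4 hj ih
      rw [el_eq_mul_of_four_le hm h4, map_mul]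
      have h5 := deg_mul_le (σ (el k (j - 1) (m - 4) (by omega))) (σ (el k 1 4 (by omega)))
      have h6 := h 4 (by omega)
      omega
    · intro j m hm h4 hj ih
      rw [el_eq_mul_of_lt hm h4 hj, map_mul]
      have h5 := deg_mul_le (σ (el k (j - 1) m (by omega))) (σ (t k))
      have h6 := h 0 (by omega)
      change deg (σ (t k)) ≤ 2 at h6
      omega
  obtain ⟨c, hc, hf⟩ := exists_eq_sum_el f
  obtain ⟨n, hn⟩ := even_natDegree (toChart_mem f)
  have h2 := (natDegree_ofCoeff_le_iff (n := n)).mp (by rw [← hc]; omega)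
  change deg f = _ at hn
  rw [hn]
  conv_lhs => rw [hf]
  rw [map_sum]
  refine deg_sum_le _ _ fun i hi => ?_
  rw [map_smul]
  refine (deg_smul_le _ _).trans ((h1 _ _ _).trans ?_)
  have := h2 i hi
  omega

theorem mem_degSub_of_le {σ : AutRing k} (h : ∀ f, deg (σ f) ≤ deg f)
    (h' : ∀ f, deg (σ⁻¹ f) ≤ deg f) : σ ∈ degSub k := fun f => by
  refine le_antisymm (h f) ?_
  have := h' (σ f)
  rwa [← AlgEquiv.mul_apply, inv_mul_cancel, AlgEquiv.one_apply] at this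

/-- Since `y + bx = 1 + x(v + b)`, a constant `s` acts as the translation `v ↦ v + b`, which does
not affect the degree in `x`. -/
theorem toChart_fib_C (b : k) (f : Coord k) :
    toChart (fib (C b) f) = (toChart f).map (compRingHom (X + C b)) := by
  have : toChart.comp (fib (C b) : Coord k →ₐ[k] Coord k) =
      ((mapAlgHom (aeval (X + C b) : k[X] →ₐ[k] k[X])).comp toChart) := by
    refine algHom_ext_t ?_ ?_ ?_
    · change toChart (fib (C b) (t k)) ≠ 0
      rw [fib_t]; exact toChart_ne_zero t_ne_zero
    · change toChart (fib (C b) (t k)) = mapAlgHom _ (toChart (t k))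
      rw [fib_t, toChart_t, map_pow]
      congr 1
      simp [x]
    · change toChart (fib (C b) (xy k)) = mapAlgHom _ (toChart (xy k))
      rw [fib_xy, map_add, map_mul, toChart_xy, toChart_t, aeval_C, AlgHom.commutes,
        IsScalarTower.algebraMap_apply k k[X] (Chart k)]
      simp [x, y, v]
      ring
  exact DFunLike.congr_fun this f

theorem fib_C_mem_degSub (b : k) : fib (C b) ∈ degSub k := fun f => by
  rw [deg, toChart_fib_C]
  refine natDegree_map_eq_of_injective ?_ _
  intro p q h
  have h1 := congrArg (fun r => r.comp (X - C b)) h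
  simpa [comp_assoc] using h1

theorem torusAut_inv (a : kˣ) : (torusAut a)⁻¹ = torusAut a⁻¹ := by
  rw [inv_eq_iff_mul_eq_one]
  apply autRing_ext
  · rw [AlgEquiv.mul_apply, torusAut_t, map_smul, torusAut_t, smul_smul, ← mul_pow,
      Units.inv_mul, one_pow, one_smul]; rfl
  · rw [AlgEquiv.mul_apply, torusAut_xy, map_smul, torusAut_xy, smul_smul,
      Units.inv_mul, one_smul]; rfl

theorem torusAut_mem_degSub (a : kˣ) : torusAut a ∈ degSub k := by
  have h : ∀ (a : kˣ) (f : Coord k), deg (torusAut a f) ≤ deg f := fun a => by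
    refine deg_map_le fun m hm => ?_
    have hm' : m ≤ 4 := hm
    interval_cases m
    · change deg (torusAut a (t k)) ≤ 2
      rw [torusAut_t]; exact (deg_smul_le _ _).trans (deg_el _).le
    · change deg (torusAut a (xy k)) ≤ 2
      rw [torusAut_xy]; exact (deg_smul_le _ _).trans (deg_el _).le
    · rw [torusAut_el_two, neg_neg]; exact (deg_el _).le
    · rw [torusAut_el_three, deg_neg]
      exact (deg_smul_le _ _).trans (by rw [deg_neg]; exact (deg_el _).le)
    · rw [torusAut_el_four]; exact (deg_smul_le _ _).trans (deg_el _).le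
  exact mem_degSub_of_le (h a) (by rw [torusAut_inv]; exact h _)

theorem swapAut_inv : (swapAut k)⁻¹ = swapAut k := by
  rw [inv_eq_iff_mul_eq_one]
  apply autRing_ext
  · rw [AlgEquiv.mul_apply, swapAut_t, swapAut_el_four]; rfl
  · rw [AlgEquiv.mul_apply, swapAut_xy, swapAut_el_three, neg_neg]; rfl

theorem swapAut_mem_degSub : swapAut k ∈ degSub k := by
  have h : ∀ (f : Coord k), deg (swapAut k f) ≤ deg f := by
    refine deg_map_le fun m hm => ?_
    have hm' : m ≤ 4 := hm
    interval_cases m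
    · exact (congrArg deg swapAut_t).le.trans (deg_el _).le
    · exact (congrArg deg swapAut_xy).le.trans (deg_el _).le
    · rw [swapAut_el_two, neg_neg]; exact (deg_el _).le
    · rw [swapAut_el_three, neg_neg]; exact (deg_el _).le
    · rw [swapAut_el_four]; exact (deg_el _).le
  exact mem_degSub_of_le h (by rw [swapAut_inv]; exact h)

/-- The image of `t` under an automorphism that preserves the degree. -/
theorem exists_degSub_t {σ : AutRing k} (hσ : σ ∈ degSub k) : ∃ a h r s : k, h ≠ 0 ∧
    σ (t k) = a • 1 + (h * r ^ 4) • t k + (4 * h * r ^ 3 * s) • xy k +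
      (6 * h * r ^ 2 * s ^ 2) • el k 1 2 (by omega) + (4 * h * r * s ^ 3) • el k 1 3 (by omega) +
      (h * s ^ 4) • el k 1 4 (by omega) := by
  have hle : ∀ m (hm : m ≤ 4 * 1), deg (σ (el k 1 m hm)) ≤ 2 := fun m hm => by
    rw [hσ, deg_el]
  set g : ∀ m, m ≤ 4 * 1 → k[X] := fun m hm => coeffTwo k (σ (el k 1 m hm)) with hg
  have htop : ∀ m hm, Top (toChart (σ (el k 1 m hm))) 2 (g m hm) := fun m hm =>
    top_coeffTwo (hle m hm)
  -- The relation `t(1 + xw) = (xy)²` loses its constant 1, which has smaller degree than `xw`.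
  have e1 : g 0 (by omega) * g 2 (by omega) = g 1 (by omega) ^ 2 := by
    have h1 := (htop 0 (by omega)).mul
      (((Top.one (S := k[X])).of_top_lt (n := 2) (by omega)).add (htop 2 (by omega)))
    rw [zero_add, ← map_one toChart, ← map_one σ, ← map_add, ← map_mul, ← map_add,
      ← map_mul] at h1
    change Top (toChart (σ (t k * _))) _ _ at h1
    rw [t_mul_one_add, map_pow, map_pow] at h1
    exact h1.unique ((htop 1 (by omega)).pow 2)
  have e2 : g 0 (by omega) * g 4 (by omega) = g 2 (by omega) ^ 2 := by
    have h1 := (htop 0 (by omega)).mul (htop 4 (by omega))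
    rw [← map_mul, ← map_mul] at h1
    change Top (toChart (σ (t k * _))) _ _ at h1
    rw [t_mul_el_four, map_pow, map_pow] at h1
    exact h1.unique ((htop 2 (by omega)).pow 2)
  have e3 : g 0 (by omega) * g 3 (by omega) = g 1 (by omega) * g 2 (by omega) := by
    have h1 := (htop 0 (by omega)).mul (htop 3 (by omega))
    rw [← map_mul, ← map_mul] at h1
    change Top (toChart (σ (t k * _))) _ _ at h1
    rw [t_mul_el_three, map_mul, map_mul] at h1
    exact h1.unique ((htop 1 (by omega)).mul (htop 2 (by omega)))
  have h0 : g 0 (by omega) ≠ 0 := by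
    intro h
    have h1 := (htop 0 (by omega)).2
    rw [h] at h1
    have h2 : deg (σ (t k)) = 2 := by rw [hσ, deg_t]
    have h3 : (toChart (σ (t k))).leadingCoeff = 0 := by
      rw [leadingCoeff]; change (toChart (σ (t k))).coeff (deg (σ (t k))) = 0
      rw [h2]; exact h1
    exact toChart_ne_zero (autRing_t_ne_zero σ) (leadingCoeff_eq_zero.mp h3)
  -- Since `σ⁻¹(t)` has degree two, expanding it and applying `σ` writes the leading coefficient 1
  -- of `t` as a combination of the five `g m`.
  have hspan : ∃ b₀ b₁ b₂ b₃ b₄ : k, C b₀ * g 0 (by omega) + C b₁ * g 1 (by omega) +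
      C b₂ * g 2 (by omega) + C b₃ * g 3 (by omega) + C b₄ * g 4 (by omega) = 1 := by
    obtain ⟨a, b₀, b₁, b₂, b₃, b₄, h⟩ := exists_of_deg_le_two (f := σ⁻¹ (t k))
      (by rw [inv_mem hσ, deg_t])
    refine ⟨b₀, b₁, b₂, b₃, b₄, ?_⟩
    have h1 := congrArg (fun f => coeffTwo k (σ f)) h
    rw [← AlgEquiv.mul_apply, mul_inv_cancel, AlgEquiv.one_apply] at h1
    simp only [map_add, map_smul, map_one, coeffTwo_one, smul_zero, zero_add] at h1
    rw [show coeffTwo k (t k) = 1 from (coeffTwo_el (by omega)).trans (pow_zero _)] at h1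
    rw [h1]
    simp only [hg, smul_eq_C_mul]
    rfl
  have hdeg0 : (g 0 (by omega)).natDegree ≤ 4 := natDegree_coeffTwo_le (hle 0 _)
  have hg0 : coeffTwo k (σ (t k)) = g 0 (by omega) := rfl
  generalize g 0 (by omega) = g₀ at *
  generalize g 1 (by omega) = g₁ at *
  generalize g 2 (by omega) = g₂ at *
  generalize g 3 (by omega) = g₃ at *
  generalize g 4 (by omega) = g₄ at *
  -- Repeated use of coprimality yields `g m = D Q^(4-m) P^m`. By `hspan` the factor `D` is a unit,
  -- and `deg (g 0) ≤ 4` makes `Q` of degree at most one.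
  obtain ⟨Q, P, D, hQP, rfl, rfl⟩ := UniqueFactorizationMonoid.exists_reduced_factors _ h0 g₁
  have hD0 : D ≠ 0 := left_ne_zero_of_mul h0
  have hQ0 : Q ≠ 0 := right_ne_zero_of_mul h0
  have hQP2 := hQP.mul_right hQP
  have f1 : Q * g₂ = D * (P * P) := mul_left_cancel₀ hD0 (by linear_combination e1)
  obtain ⟨D, rfl⟩ : Q ∣ D := hQP2.dvd_of_dvd_mul_right ⟨_, f1.symm⟩
  obtain rfl : g₂ = D * (P * P) := mul_left_cancel₀ hQ0 (by linear_combination f1)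
  have hD0 : D ≠ 0 := right_ne_zero_of_mul hD0
  have f2 : Q * g₃ = D * (P * (P * P)) :=
    mul_left_cancel₀ (mul_ne_zero hQ0 hD0) (by linear_combination e3)
  obtain ⟨D, rfl⟩ : Q ∣ D := (hQP.mul_right hQP2).dvd_of_dvd_mul_right ⟨_, f2.symm⟩
  obtain rfl : g₃ = D * (P * (P * P)) := mul_left_cancel₀ hQ0 (by linear_combination f2)
  have hD0 : D ≠ 0 := right_ne_zero_of_mul hD0
  have f3 : Q * g₄ = D * (P * P * (P * P)) :=
    mul_left_cancel₀ (mul_ne_zero (mul_ne_zero hQ0 hQ0) hD0) (by linear_combination e2)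
  obtain ⟨D, rfl⟩ : Q ∣ D := (hQP2.mul_right hQP2).dvd_of_dvd_mul_right ⟨_, f3.symm⟩
  obtain rfl : g₄ = D * (P * P * (P * P)) := mul_left_cancel₀ hQ0 (by linear_combination f3)
  have hD : IsUnit D := by
    obtain ⟨b₀, b₁, b₂, b₃, b₄, h⟩ := hspan
    refine IsUnit.of_mul_eq_one (C b₀ * Q ^ 4 + C b₁ * Q ^ 3 * P + C b₂ * Q ^ 2 * P ^ 2 +
      C b₃ * Q * P ^ 3 + C b₄ * P ^ 4) ?_
    rw [← h]; ring
  obtain ⟨h, hh, rfl⟩ := Polynomial.isUnit_iff.mp hD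
  have hQ1 : Q.natDegree ≤ 1 := by
    have h1 : Q * (Q * (Q * C h)) * Q = C h * Q ^ 4 := by ring
    rw [h1, natDegree_C_mul hh.ne_zero, natDegree_pow] at hdeg0
    omega
  obtain ⟨s, r, rfl⟩ : ∃ s r : k, Q = C s * X + C r := ⟨_, _, eq_X_add_C_of_natDegree_le_one hQ1⟩
  obtain ⟨a, b₀, b₁, b₂, b₃, b₄, hσt⟩ := exists_of_deg_le_two (f := σ (t k))
    (by rw [hσ, deg_t])
  refine ⟨a, h, r, s, hh.ne_zero, ?_⟩
  have hcoef : C b₀ + C b₁ * X + C b₂ * X ^ 2 + C b₃ * X ^ 3 + C b₄ * X ^ 4 =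
      C (h * r ^ 4) + C (4 * h * r ^ 3 * s) * X + C (6 * h * r ^ 2 * s ^ 2) * X ^ 2 +
        C (4 * h * r * s ^ 3) * X ^ 3 + C (h * s ^ 4) * X ^ 4 := by
    rw [← coeffTwo_eq a, ← hσt, hg0]
    simp only [C_mul, C_pow, C_ofNat]
    ring
  have hc : ∀ n, (C b₀ + C b₁ * X + C b₂ * X ^ 2 + C b₃ * X ^ 3 + C b₄ * X ^ 4).coeff n = _ :=
    fun n => congrArg (fun p => coeff p n) hcoef
  simp only [coeff_add, coeff_C_mul, coeff_X_pow, coeff_X, coeff_C] at hc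
  have hc0 := hc 0
  have hc1 := hc 1
  have hc2 := hc 2
  have hc3 := hc 3
  have hc4 := hc 4
  norm_num at hc0 hc1 hc2 hc3 hc4
  rw [hσt, hc0, hc1, hc2, hc3, hc4]

/-- An automorphism that preserves the degree also preserves the fibration, up to composition
with linear automorphisms. -/
theorem degSub_cases {σ : AutRing k} (hσ : σ ∈ degSub k) :
    σ ∈ fibSub k ∨ ∃ b : k, swapAut k * fib (C b) * σ ∈ fibSub k := by
  obtain ⟨a, h, r, s, hh, ht⟩ := exists_degSub_t hσ
  by_cases hs : s = 0
  · left
    refine mem_fibSub_of_eq (l := h * r ^ 4) (μ := a) ?_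
    rw [ht, hs, Algebra.algebraMap_eq_smul_one]
    simp [add_comm]
  · right
    -- The polynomial `r + sv` vanishes at `v = b`; the translation `v ↦ v + b` turns it into `sv`,
    -- so that only `w²` and a constant are left, and the swap takes `w²` to `t`. The summand `4b²`
    -- of the constant comes from `y² = 1 + xw`.
    obtain ⟨b, rfl⟩ : ∃ b, r = -b * s := ⟨-r / s, by field_simp⟩
    refine ⟨b, mem_fibSub_of_eq (l := h * s ^ 4) (μ := a - h * s ^ 4 * (4 * b ^ 2)) ?_⟩
    rw [AlgEquiv.mul_apply, AlgEquiv.mul_apply, ht]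
    have h1 : fib (C b) (a • 1 + (h * (-b * s) ^ 4) • t k + (4 * h * (-b * s) ^ 3 * s) • xy k +
      (6 * h * (-b * s) ^ 2 * s ^ 2) • el k 1 2 (by omega) +
      (4 * h * (-b * s) * s ^ 3) • el k 1 3 (by omega) +
      (h * s ^ 4) • el k 1 4 (by omega)) =
        (h * s ^ 4) • el k 1 4 (by omega) + algebraMap k _ (a - h * s ^ 4 * (4 * b ^ 2)) := by
      simp only [map_add, map_one, fib_t, fib_xy, fib_el_two, fib_el_three, fib_el_four,
        Algebra.smul_def, aeval_C, map_mul, map_pow, map_neg, map_sub, map_ofNat, AlgEquiv.commutes]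
      ring
    rw [h1, map_add, map_smul, swapAut_el_four, AlgEquiv.commutes]

theorem deg_fib_xy {s : k[X]} (hs : s.natDegree ≠ 0) :
    deg (fib s (xy k)) = 2 * s.natDegree + 2 := by
  have hs0 : s ≠ 0 := by rintro rfl; simp at hs
  have h1 : deg (aeval (t k) s * t k) = 2 * s.natDegree + 2 := by
    rw [deg_mul ?_ t_ne_zero, deg_aeval_t, deg_t]
    exact (map_ne_zero_iff _ aeval_t_injective).mpr hs0
  rw [fib_xy, ← h1, deg, map_add, natDegree_add_eq_right_of_natDegree_lt]
  · rfl
  · change deg (xy k) < deg _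
    rw [h1, deg_xy]; omega

theorem fib_mem_degSub_iff {s : k[X]} : fib s ∈ degSub k ↔ s.natDegree = 0 := by
  constructor
  · intro h
    by_contra hs
    have := h (xy k)
    rw [deg_fib_xy hs, deg_xy] at this
    omega
  · intro h
    rw [eq_C_of_natDegree_eq_zero h]
    exact fib_C_mem_degSub _

/-- The linear automorphisms generate the group of the automorphisms that preserve the degree. -/
theorem closure_linear_eq_degSub : Subgroup.closure {σ : AutRing k | (∃ b : k, σ = fib (C b)) ∨
    (∃ a : kˣ, σ = torusAut a) ∨ σ = swapAut k} = degSub k := by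
  apply le_antisymm
  · rw [Subgroup.closure_le]
    rintro _ (⟨b, rfl⟩ | ⟨a, rfl⟩ | rfl)
    exacts [fib_C_mem_degSub b, torusAut_mem_degSub a, swapAut_mem_degSub]
  · set H := Subgroup.closure {σ : AutRing k | (∃ b : k, σ = fib (C b)) ∨
      (∃ a : kˣ, σ = torusAut a) ∨ σ = swapAut k} with hH
    have hfib : ∀ b : k, fib (C b) ∈ H := fun b => Subgroup.subset_closure (Or.inl ⟨b, rfl⟩)
    have htorus : ∀ a : kˣ, torusAut a ∈ H := fun a =>
      Subgroup.subset_closure (Or.inr (Or.inl ⟨a, rfl⟩))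
    have hswap : swapAut k ∈ H := Subgroup.subset_closure (Or.inr (Or.inr rfl))
    -- In `σ = torusAut a * fib s` preservation of the degree makes `s` constant.
    have h1 : ∀ σ ∈ degSub k, σ ∈ fibSub k → σ ∈ H := by
      intro σ hσ hσ'
      obtain ⟨a, s, rfl⟩ := exists_eq_torusAut_mul_fib hσ'
      have h2 := ((degSub k).mul_mem_cancel_left (torusAut_mem_degSub a)).mp hσ
      rw [eq_C_of_natDegree_eq_zero (fib_mem_degSub_iff.mp h2)]
      exact mul_mem (htorus a) (hfib _)
    intro σ hσ
    rcases degSub_cases hσ with h | ⟨b, h⟩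
    · exact h1 σ hσ h
    · have h2 := h1 _ (mul_mem (mul_mem swapAut_mem_degSub (fib_C_mem_degSub b)) hσ) h
      exact (H.mul_mem_cancel_left (mul_mem hswap (hfib b))).mp h2

end Chart

end ConicComplement

/-! ### Additive group actions and their degree functions in any characteristic -/

namespace ConicComplement

open Polynomial

/-! ### Degree functions defined by exponential maps -/

section Sums

variable {K : Type*} [CommRing K] {ι : Type*} {s : Finset ι} {F : ι → K[X]}

theorem exists_natDegree_le_of_sum_ne_zero (h : ∑ i ∈ s, F i ≠ 0) :
    ∃ i ∈ s, F i ≠ 0 ∧ (∑ i ∈ s, F i).natDegree ≤ (F i).natDegree := by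
  by_contra! hc
  have h1 : (∑ i ∈ s, F i).leadingCoeff = 0 := by
    rw [leadingCoeff, finsetSum_coeff]
    refine Finset.sum_eq_zero fun i hi => ?_
    by_cases h0 : F i = 0
    · rw [h0, coeff_zero]
    · exact coeff_eq_zero_of_natDegree_lt (hc i hi h0)
  exact h (leadingCoeff_eq_zero.mp h1)

theorem sum_ne_zero_and_natDegree_eq {i₀ : ι} (hi₀ : i₀ ∈ s) (h0 : F i₀ ≠ 0)
    (h : ∀ i ∈ s, i ≠ i₀ → F i ≠ 0 → (F i).natDegree < (F i₀).natDegree) :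
    ∑ i ∈ s, F i ≠ 0 ∧ (∑ i ∈ s, F i).natDegree = (F i₀).natDegree := by
  classical
  have h1 : Top (∑ i ∈ s, F i) (F i₀).natDegree
      (∑ i ∈ s, if i = i₀ then (F i₀).leadingCoeff else 0) := by
    refine Top.sum fun i hi => ?_
    split_ifs with hii
    · subst hii; exact Top.self _
    · by_cases hF : F i = 0
      · rw [hF]; exact ⟨by simp, by simp⟩
      · exact Top.of_lt (h i hi hii hF)
  rw [Finset.sum_ite_eq', if_pos hi₀] at h1
  have h2 := leadingCoeff_ne_zero.mpr h0
  exact ⟨h1.ne_zero h2, h1.natDegree h2⟩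

end Sums

variable (k : Type*) [Field k] (R : Type*) [CommRing R] [Algebra k R]

/-- A locally finite iterative higher derivation, that is, an action of the additive group. -/
structure ExpMap where
  /-- The components of the higher derivation. -/
  E : ℕ → R →ₗ[k] R
  E_zero : ∀ f, E 0 f = f
  E_mul : ∀ n f g, E n (f * g) = ∑ p ∈ Finset.HasAntidiagonal.antidiagonal n, E p.1 f * E p.2 g
  E_one : ∀ n, 0 < n → E n 1 = 0
  E_comp : ∀ i j f, E i (E j f) = ((i + j).choose i : k) • E (i + j) f
  finite : ∀ f, ∃ N, ∀ i, N < i → E i f = 0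

namespace ExpMap

variable {k R} {K : Type*} [Field K] [Algebra k K]

/-- A weight function on `R` for which the exponential map has slope at most `P / s`. -/
structure Weighted (X : ExpMap k R) (K : Type*) [Field K] [Algebra k K] where
  /-- The homomorphism that defines the weight. -/
  G : R →ₐ[k] K[X]
  injective : Function.Injective G
  /-- The denominator of the slope. -/
  s : ℕ
  /-- The numerator of the slope. -/
  P : ℤ
  s_pos : 0 < s
  bound : ∀ f i, X.E i f ≠ 0 →
    (s : ℤ) * (G (X.E i f)).natDegree ≤ s * (G f).natDegree + i * P

variable {X : ExpMap k R} (W : X.Weighted K)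

namespace Weighted

/-- The weight of an element. -/
def wd (f : R) : ℕ := (W.G f).natDegree

/-- The component of the exponential map of order `i` attains the bound at `f`. -/
def Attains (f : R) (i : ℕ) : Prop :=
  X.E i f ≠ 0 ∧ (W.s : ℤ) * W.wd (X.E i f) = W.s * W.wd f + i * W.P

/-- The degree of an element with respect to the leading part of the exponential map. -/
def D (f : R) : ℕ := sSup {i | W.Attains f i}

variable {W}

theorem map_ne_zero {f : R} (hf : f ≠ 0) : W.G f ≠ 0 := (map_ne_zero_iff _ W.injective).mpr hf

theorem bound' (f : R) (i : ℕ) (h : X.E i f ≠ 0) :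
    (W.s : ℤ) * W.wd (X.E i f) ≤ W.s * W.wd f + i * W.P := W.bound f i h

theorem lt_of_not_attains {f : R} {i : ℕ} (h : ¬ W.Attains f i) (h0 : X.E i f ≠ 0) :
    (W.s : ℤ) * W.wd (X.E i f) < W.s * W.wd f + i * W.P :=
  lt_of_le_of_ne (bound' f i h0) fun h' => h ⟨h0, h'⟩

theorem attains_zero {f : R} (hf : f ≠ 0) : W.Attains f 0 := by
  refine ⟨by rwa [X.E_zero], ?_⟩
  rw [X.E_zero]; simp

theorem bddAbove (f : R) : BddAbove {i | W.Attains f i} := by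
  obtain ⟨N, hN⟩ := X.finite f
  refine ⟨N, fun i hi => ?_⟩
  by_contra h
  exact hi.1 (hN i (by omega))

theorem attains_D {f : R} (hf : f ≠ 0) : W.Attains f (W.D f) :=
  Nat.sSup_mem (s := {i | W.Attains f i}) ⟨0, attains_zero hf⟩ (bddAbove f)

theorem le_D {f : R} {i : ℕ} (h : W.Attains f i) : i ≤ W.D f := le_csSup (bddAbove f) h

theorem not_attains {f : R} {i : ℕ} (h : W.D f < i) : ¬ W.Attains f i := fun h' => by
  have := le_D h'; omega

theorem D_eq {f : R} {n : ℕ} (hn : W.Attains f n) (h : ∀ i, n < i → ¬ W.Attains f i) :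
    W.D f = n := by
  refine le_antisymm ?_ (le_D hn)
  by_contra hlt
  exact h _ (not_le.mp hlt) (Nat.sSup_mem (s := {i | W.Attains f i}) ⟨n, hn⟩ (bddAbove f))

theorem s_pos' : (0 : ℤ) < W.s := by exact_mod_cast W.s_pos

section

variable [IsDomain R]

theorem wd_mul {f g : R} (hf : f ≠ 0) (hg : g ≠ 0) : W.wd (f * g) = W.wd f + W.wd g := by
  rw [wd, map_mul, natDegree_mul (map_ne_zero hf) (map_ne_zero hg)]; rfl

/-- The terms of the Leibniz formula, away from the leading one, have smaller weight. -/
theorem lt_of_mul {f g : R} (hf : f ≠ 0) (hg : g ≠ 0) {i j : ℕ}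
    (hij : W.D f < i ∨ W.D g < j) (hi : X.E i f ≠ 0) (hj : X.E j g ≠ 0) :
    (W.s : ℤ) * W.wd (X.E i f * X.E j g) < W.s * W.wd (f * g) + (i + j : ℕ) * W.P := by
  rw [wd_mul hi hj, wd_mul hf hg]
  push_cast
  have h1 := bound' (W := W) f i hi
  have h2 := bound' (W := W) g j hj
  rcases hij with h | h
  · have h3 := lt_of_not_attains (not_attains h) hi
    linarith
  · have h3 := lt_of_not_attains (not_attains h) hj
    linarith

/-- In order `D f + D g` the pair `(D f, D g)` is the only one in the Leibniz formula whose two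
factors both attain the bound, so its term survives; in any higher order every term stays strictly
below. In effect `D` is the degree, in the parameter of the group, of the image under the leading
part of the action. -/
theorem D_mul {f g : R} (hf : f ≠ 0) (hg : g ≠ 0) : W.D (f * g) = W.D f + W.D g := by
  have hf' := attains_D (W := W) hf
  have hg' := attains_D (W := W) hg
  refine D_eq ?_ fun n hn h => ?_
  · have h1 := sum_ne_zero_and_natDegree_eq (s := Finset.HasAntidiagonal.antidiagonal (W.D f + W.D g))
      (F := fun p => W.G (X.E p.1 f * X.E p.2 g)) (i₀ := (W.D f, W.D g)) (by simp)
      (map_ne_zero (mul_ne_zero hf'.1 hg'.1)) (by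
        rintro ⟨i, j⟩ hij hne h0
        simp only [Finset.HasAntidiagonal.mem_antidiagonal] at hij
        simp only [ne_eq, Prod.mk.injEq, not_and_or] at hne
        have h0' : X.E i f * X.E j g ≠ 0 := fun h => h0 (by rw [h, map_zero])
        have h2 := lt_of_mul (W := W) hf hg (i := i) (j := j) (by omega)
          (left_ne_zero_of_mul h0') (right_ne_zero_of_mul h0')
        change W.wd _ < W.wd _
        rw [hij] at h2
        have h3 : (W.s : ℤ) * W.wd (X.E (W.D f) f * X.E (W.D g) g) =
            W.s * W.wd (f * g) + (W.D f + W.D g : ℕ) * W.P := by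
          rw [wd_mul hf'.1 hg'.1, wd_mul hf hg]
          push_cast
          linarith [hf'.2, hg'.2]
        rw [← h3] at h2
        exact_mod_cast lt_of_mul_lt_mul_left h2 s_pos'.le)
    rw [← map_sum, ← X.E_mul] at h1
    refine ⟨fun h => h1.1 (by rw [h, map_zero]), ?_⟩
    have h4 : W.wd (X.E (W.D f + W.D g) (f * g)) = W.wd (X.E (W.D f) f * X.E (W.D g) g) := h1.2
    rw [h4, wd_mul hf'.1 hg'.1, wd_mul hf hg]
    push_cast
    linarith [hf'.2, hg'.2]
  · have h0 := h.1
    have h1 := X.E_mul n f g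
    have h2 : ∑ p ∈ Finset.HasAntidiagonal.antidiagonal n, W.G (X.E p.1 f * X.E p.2 g) ≠ 0 := by
      rw [← map_sum, ← h1]; exact map_ne_zero h0
    obtain ⟨⟨i, j⟩, hij, h3, h4⟩ := exists_natDegree_le_of_sum_ne_zero h2
    rw [← map_sum, ← h1] at h4
    have h3' : X.E i f * X.E j g ≠ 0 := fun h => h3 (by simp only [h, map_zero])
    simp only [Finset.HasAntidiagonal.mem_antidiagonal] at hij
    have h5 := lt_of_mul (W := W) hf hg (i := i) (j := j) (by omega)
          (left_ne_zero_of_mul h3') (right_ne_zero_of_mul h3')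
    rw [hij, ← h.2] at h5
    have h6 : W.wd (X.E n (f * g)) ≤ W.wd (X.E i f * X.E j g) := h4
    have h7 := lt_of_mul_lt_mul_left h5 s_pos'.le
    have h8 : W.wd (X.E i f * X.E j g) < W.wd (X.E n (f * g)) := by exact_mod_cast h7
    omega

theorem D_one : W.D (1 : R) = 0 := by
  have := D_mul (W := W) (one_ne_zero (α := R)) one_ne_zero
  rw [mul_one] at this
  omega

theorem D_pow {f : R} (hf : f ≠ 0) (n : ℕ) : W.D (f ^ n) = n * W.D f := by
  induction n with
  | zero => rw [pow_zero, D_one, zero_mul]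
  | succ n ih => rw [pow_succ, D_mul (pow_ne_zero n hf) hf, ih]; ring

theorem D_algebraMap {a : k} (ha : a ≠ 0) : W.D (algebraMap k R a) = 0 := by
  have h1 : algebraMap k R a * algebraMap k R a⁻¹ = 1 := by
    rw [← map_mul, mul_inv_cancel₀ ha, map_one]
  have h2 : algebraMap k R a * algebraMap k R a⁻¹ ≠ 0 := by rw [h1]; exact one_ne_zero
  have := D_mul (W := W) (left_ne_zero_of_mul h2) (right_ne_zero_of_mul h2)
  rw [h1, D_one] at this
  omega

theorem D_smul {a : k} (ha : a ≠ 0) {f : R} (hf : f ≠ 0) : W.D (a • f) = W.D f := by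
  rw [Algebra.smul_def, D_mul ?_ hf, D_algebraMap ha, zero_add]
  exact (map_ne_zero_iff _ (algebraMap k R).injective).mpr ha

end

/-- A summand of smaller weight stays strictly below the bound in every order, so it has no
influence on which orders attain it. -/
theorem D_add_of_lt {f g : R} (h : W.wd g < W.wd f) :
    W.D (f + g) = W.D f := by
  have hwd : W.wd (f + g) = W.wd f := by
    rw [wd, map_add, natDegree_add_eq_left_of_natDegree_lt h]; rfl
  have h' : (W.s : ℤ) * W.wd g < W.s * W.wd f :=
    mul_lt_mul_of_pos_left (by exact_mod_cast h) s_pos'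
  have key : ∀ i, W.Attains (f + g) i ↔ W.Attains f i := by
    intro i
    have hgi : X.E i g ≠ 0 → (W.s : ℤ) * W.wd (X.E i g) < W.s * W.wd f + i * W.P := fun h0 => by
      have := bound' (W := W) g i h0
      linarith
    rw [Attains, Attains, hwd, map_add]
    by_cases h0 : X.E i g = 0
    · rw [h0, add_zero]
    specialize hgi h0
    have hcmp : ∀ u : R, u ≠ 0 → (W.s : ℤ) * W.wd u = W.s * W.wd f + i * W.P →
        W.wd (X.E i g) < W.wd u := fun u _ hu => by
      rw [← hu] at hgi
      exact_mod_cast lt_of_mul_lt_mul_left hgi s_pos'.le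
    constructor
    · rintro ⟨h1, h2⟩
      have h3 := hcmp _ h1 h2
      have h4 : X.E i f = (X.E i f + X.E i g) - X.E i g := by ring
      have h5 : W.wd (X.E i f) = W.wd (X.E i f + X.E i g) := by
        conv_lhs => rw [h4, wd, map_sub, natDegree_sub_eq_left_of_natDegree_lt h3]
        rfl
      refine ⟨fun h6 => ?_, by rw [h5, h2]⟩
      rw [h6, zero_add] at h3
      omega
    · rintro ⟨h1, h2⟩
      have h3 := hcmp _ h1 h2
      have h5 : W.wd (X.E i f + X.E i g) = W.wd (X.E i f) := by
        rw [wd, map_add, natDegree_add_eq_left_of_natDegree_lt h3]; rfl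
      refine ⟨fun h6 => ?_, by rw [h5, h2]⟩
      have h7 : W.wd (X.E i f + X.E i g) = 0 := by rw [h6, wd, map_zero, natDegree_zero]
      omega
  rw [D, D]
  simp only [key]

/-- Thus `D` depends only on the leading part, and an element may be replaced by an explicit one
with the same leading part. -/
theorem D_eq_of_top {f g : R} {n : ℕ} {c : K} (hc : c ≠ 0) (hf : Top (W.G f) n c)
    (hg : Top (W.G g) n c) : W.D f = W.D g := by
  by_cases h : g = f
  · rw [h]
  have h1 : g = f + (g - f) := by ring
  rw [h1, D_add_of_lt]
  have h2 := hg.sub hf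
  rw [sub_self, ← map_sub] at h2
  rw [wd, wd, hf.natDegree hc]
  refine lt_of_le_of_ne h2.1 fun h3 => ?_
  have h4 : (W.G (g - f)).leadingCoeff = 0 := by rw [leadingCoeff, h3, h2.2]
  exact sub_ne_zero.mpr h (W.injective ((leadingCoeff_eq_zero.mp h4).trans (map_zero _).symm))

theorem exists_D_le {ι : Type*} {s : Finset ι} {f : ι → R} (h0 : ∑ i ∈ s, f i ≠ 0)
    (h : ∀ i ∈ s, f i ≠ 0 → W.wd (f i) ≤ W.wd (∑ i ∈ s, f i)) :
    ∃ i ∈ s, f i ≠ 0 ∧ W.D (∑ i ∈ s, f i) ≤ W.D (f i) := by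
  have h1 := attains_D (W := W) h0
  set n := W.D (∑ i ∈ s, f i) with hn
  have h2 : ∑ i ∈ s, W.G (X.E n (f i)) ≠ 0 := by
    rw [← map_sum, ← map_sum]; exact map_ne_zero h1.1
  obtain ⟨i, hi, h3, h4⟩ := exists_natDegree_le_of_sum_ne_zero h2
  rw [← map_sum, ← map_sum] at h4
  have h5 : X.E n (f i) ≠ 0 := fun h => h3 (by rw [h, map_zero])
  have h6 : f i ≠ 0 := fun h => h5 (by rw [h, map_zero])
  refine ⟨i, hi, h6, le_D ⟨h5, le_antisymm (bound' _ _ h5) ?_⟩⟩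
  have h7 : (W.s : ℤ) * W.wd (f i) ≤ W.s * W.wd (∑ i ∈ s, f i) :=
    mul_le_mul_of_nonneg_left (by exact_mod_cast h i hi h6) s_pos'.le
  have h8 : (W.s : ℤ) * W.wd (X.E n (∑ i ∈ s, f i)) ≤ W.s * W.wd (X.E n (f i)) :=
    mul_le_mul_of_nonneg_left (by exact_mod_cast h4) s_pos'.le
  linarith [h1.2]

theorem le_D_sum {ι : Type*} {s : Finset ι} {f : ι → R} {i₀ : ι} (hi₀ : i₀ ∈ s) (h0 : f i₀ ≠ 0)
    (hwd : W.wd (f i₀) = W.wd (∑ i ∈ s, f i))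
    (h : ∀ i ∈ s, i ≠ i₀ → f i ≠ 0 → W.wd (f i) ≤ W.wd (f i₀) ∧ W.D (f i) < W.D (f i₀)) :
    W.D (f i₀) ≤ W.D (∑ i ∈ s, f i) := by
  have h1 := attains_D (W := W) h0
  set n := W.D (f i₀) with hn
  have h2 := sum_ne_zero_and_natDegree_eq (F := fun i => W.G (X.E n (f i))) hi₀
    (map_ne_zero h1.1) fun i hi hne h3 => by
      have h4 : X.E n (f i) ≠ 0 := fun h => h3 (by rw [h, map_zero])
      have h5 : f i ≠ 0 := fun h => h4 (by rw [h, map_zero])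
      obtain ⟨h6, h7⟩ := h i hi hne h5
      have h8 := lt_of_not_attains (not_attains h7) h4
      have h9 : (W.s : ℤ) * W.wd (f i) ≤ W.s * W.wd (f i₀) :=
        mul_le_mul_of_nonneg_left (by exact_mod_cast h6) s_pos'.le
      have h10 : (W.s : ℤ) * W.wd (X.E n (f i)) < W.s * W.wd (X.E n (f i₀)) := by
        rw [h1.2]; linarith
      exact_mod_cast lt_of_mul_lt_mul_left h10 s_pos'.le
  rw [← map_sum, ← map_sum] at h2
  refine le_D ⟨fun h => h2.1 (by rw [h, map_zero]), ?_⟩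
  rw [← hwd, ← h1.2]
  congr 2
  exact h2.2

/-- With `i + j = D f`, the composition `E j ∘ E i` is a nonzero multiple of `E (i + j)`, which
attains the bound at `f`; the bounds for the two steps add up to this one, so both steps attain
theirs. -/
theorem D_E {f : R} (hf : f ≠ 0) {i : ℕ} (hi : i ≤ W.D f) (hc : ((W.D f).choose i : k) ≠ 0) :
    X.E i f ≠ 0 ∧ W.D (X.E i f) = W.D f - i := by
  have h1 := attains_D (W := W) hf
  obtain ⟨j, hj⟩ : ∃ j, W.D f = i + j := ⟨W.D f - i, by omega⟩
  rw [hj] at h1 hc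
  have h2 : X.E j (X.E i f) = ((i + j).choose i : k) • X.E (i + j) f := by
    rw [X.E_comp, add_comm j i, Nat.choose_symm_add]
  have h3 : X.E j (X.E i f) ≠ 0 := by rw [h2]; exact smul_ne_zero hc h1.1
  have h4 : X.E i f ≠ 0 := fun h => h3 (by rw [h, map_zero])
  have h5 := bound' (W := W) f i h4
  have h6 := bound' (W := W) (X.E i f) j h3
  have hwd : ∀ (a : k) (u : R), a ≠ 0 → W.wd (a • u) = W.wd u := fun a u ha => by
    rw [wd, map_smul, natDegree_smul_of_smul_regular _ (IsSMulRegular.of_ne_zero ha)]; rfl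
  have h7 : W.wd (X.E j (X.E i f)) = W.wd (X.E (i + j) f) := by rw [h2, hwd _ _ hc]
  have h8 := h1.2
  push_cast at h8
  rw [h7] at h6
  have h9 : (W.s : ℤ) * W.wd (X.E i f) = W.s * W.wd f + i * W.P := by linarith
  refine ⟨h4, ?_⟩
  rw [hj, Nat.add_sub_cancel_left]
  refine D_eq ⟨h3, by rw [h7]; linarith⟩ fun l hl ⟨h10, h11⟩ => ?_
  rw [X.E_comp] at h10 h11
  have h12 : (((l + i).choose l : ℕ) : k) ≠ 0 := left_ne_zero_of_smul h10
  rw [hwd _ _ h12, h9] at h11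
  refine not_attains (W := W) (f := f) (i := l + i) (by omega)
    ⟨right_ne_zero_of_smul h10, ?_⟩
  push_cast
  linarith

/-- If `m` is the smallest positive degree, then all the degrees are multiples of `m`. -/
theorem dvd_D {g : R} (hg : g ≠ 0) (hpos : 0 < W.D g)
    (hmin : ∀ f, f ≠ 0 → 0 < W.D f → W.D g ≤ W.D f) {f : R} (hf : f ≠ 0) : W.D g ∣ W.D f := by
  set m := W.D g with hm
  -- Otherwise `E i g` would have the degree `m - i`, strictly between 0 and the minimum `m`.
  have hchoose : ∀ i, 0 < i → i < m → ((m.choose i : ℕ) : k) = 0 := by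
    intro i h0 h1
    by_contra hc
    obtain ⟨h2, h3⟩ := D_E (W := W) hg (i := i) (by omega) (by rwa [← hm])
    have := hmin _ h2 (by omega)
    omega
  have hpow : (1 + Polynomial.X : k[X]) ^ m = 1 + Polynomial.X ^ m := by
    ext i
    rw [coeff_one_add_X_pow, coeff_add, coeff_one, coeff_X_pow]
    rcases lt_trichotomy i m with h | h | h
    · by_cases hi : i = 0
      · subst hi; simp [h.ne]
      · rw [hchoose i (by omega) h]; simp [hi, h.ne]
    · rw [h, Nat.choose_self]; simp [hpos.ne']
    · rw [Nat.choose_eq_zero_of_lt h]; simp [h.ne', (show i ≠ 0 by omega)]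
  by_contra hdvd
  set M := W.D f with hM
  have hr : 0 < M % m := Nat.pos_of_ne_zero fun h => hdvd (Nat.dvd_of_mod_eq_zero h)
  have hr' : M % m < m := Nat.mod_lt _ hpos
  have hMeq : M = M % m + m * (M / m) := (Nat.mod_add_div M m).symm
  -- For `r = M % m` this is the coefficient of `X^r` in `(1 + X)^r (1 + X^m)^(M / m)`. As it is
  -- nonzero, `E (M - r) f` has the degree `r`, positive and smaller than `m`.
  have hc : ((M.choose (M % m) : ℕ) : k) = 1 := by
    rw [← coeff_one_add_X_pow]
    conv_lhs => rw [hMeq, pow_add, pow_mul, hpow]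
    obtain ⟨A, hA⟩ : ∃ A : k[X], (1 + Polynomial.X ^ m) ^ (M / m) = 1 + Polynomial.X ^ m * A := by
      obtain ⟨A, hA⟩ := sub_dvd_pow_sub_pow (1 + Polynomial.X ^ m : k[X]) 1 (M / m)
      refine ⟨A, ?_⟩
      rw [one_pow, add_sub_cancel_left] at hA
      rw [← hA]; ring
    rw [hA, mul_add, mul_one, coeff_add, mul_left_comm, coeff_X_pow_mul', ← hMeq, if_neg (by omega),
      add_zero, coeff_one_add_X_pow, Nat.choose_self, Nat.cast_one]
  have hle : M % m ≤ M := Nat.mod_le _ _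
  obtain ⟨h2, h3⟩ := D_E (W := W) hf (i := M - M % m) (by omega)
    (by rw [← hM, Nat.choose_symm hle, hc]; exact one_ne_zero)
  have := hmin _ h2 (by omega)
  omega

end Weighted

end ExpMap

end ConicComplement

/-! ### Additive group actions on the coordinate ring and leading parts of invariants -/

namespace ConicComplement

open Polynomial

variable {k : Type u} [Field k]

namespace Chart

/-! ### Exponential maps on the coordinate ring -/

section Slope

variable (X : ExpMap k (Coord k))

theorem exists_el_one_ne_zero (h : ∃ f, ∃ i, 0 < i ∧ X.E i f ≠ 0) :
    ∃ m : ℕ, ∃ hm : m ≤ 4 * 1, ∃ i, 0 < i ∧ X.E i (el k 1 m hm) ≠ 0 := by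
  by_contra! hc
  obtain ⟨f, i, hi, hf⟩ := h
  have hmul : ∀ f g : Coord k, (∀ i, 0 < i → X.E i f = 0) → (∀ i, 0 < i → X.E i g = 0) →
      ∀ i, 0 < i → X.E i (f * g) = 0 := by
    intro f g hf hg i hi
    rw [X.E_mul]
    refine Finset.sum_eq_zero fun p hp => ?_
    rw [Finset.HasAntidiagonal.mem_antidiagonal] at hp
    by_cases h1 : 0 < p.1
    · rw [hf _ h1, zero_mul]
    · rw [hg p.2 (by omega), mul_zero]
  have hel := el_induction (P := fun j m h => ∀ i, 0 < i → X.E i (el k j m h) = 0)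
    (by rw [el_zero_zero]; exact X.E_one) hc
    (fun j m h hm _ ih => by
      rw [el_eq_mul_of_four_le h hm]; exact hmul _ _ ih (hc 4 _))
    (fun j m h hm hj ih => by
      rw [el_eq_mul_of_lt h hm hj]; exact hmul _ _ ih (hc 0 _))
  obtain ⟨c, -, rfl⟩ := exists_eq_sum_el f
  refine hf ?_
  rw [map_sum]
  exact Finset.sum_eq_zero fun j _ => by rw [map_smul, hel _ _ _ i hi, smul_zero]

theorem natDegree_el_le {a b : ℕ} (hab : 0 < a + b) {f : Coord k} {c : Idx →₀ k}
    (hc : toChart f = ofCoeff k c) {i : Idx} (hi : i ∈ c.support) :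
    (wtHom k a b (toChart (el k i.1.1 i.1.2 i.2))).natDegree ≤
      (wtHom k a b (toChart f)).natDegree := by
  have h0 : c ≠ 0 := by rintro rfl; simp at hi
  obtain ⟨i', -, h1, h2, -⟩ := exists_natDegree_wtHom hab h0
  rw [hc, h2]
  exact (top_wtHom_mono hab i.2).1.trans (h1 i hi)

/-- The slope is the maximum of `(weight of E i f - weight of f) / i` over the five generators `f`
and the finitely many `i > 0` with `E i f ≠ 0`. The Leibniz formula extends the bound to all
monomials, and the absence of cancellation in the highest weight to all elements. The generator with
the maximal slope attains the bound in a positive order. -/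
theorem exists_weighted {a b : ℕ} (hab : 0 < a + b) (h : ∃ f, ∃ i, 0 < i ∧ X.E i f ≠ 0) :
    ∃ W : X.Weighted (Frac k), W.G = (wtHom k a b).comp toChart ∧ ∃ g, g ≠ 0 ∧ 0 < W.D g := by
  classical
  set G := (wtHom k a b).comp toChart with hG
  have hinj : Function.Injective G := (wtHom_injective a b).comp toChart_injective
  let gen : Fin 5 → Coord k := fun m => el k 1 m (by omega)
  obtain ⟨N, hN⟩ : ∃ N, ∀ m i, N < i → X.E i (gen m) = 0 := by
    choose N hN using fun m => X.finite (gen m)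
    exact ⟨∑ m, N m, fun m i hi => hN m i
      ((Finset.single_le_sum (fun _ _ => Nat.zero_le _) (Finset.mem_univ m)).trans_lt hi)⟩
  let S : Finset (Fin 5 × ℕ) := {p ∈ Finset.univ ×ˢ Finset.Icc 1 N | X.E p.2 (gen p.1) ≠ 0}
  have hS : ∀ m i, 0 < i → X.E i (gen m) ≠ 0 → (m, i) ∈ S := fun m i h0 h1 => by
    have : i ≤ N := by by_contra hc; exact h1 (hN m i (by omega))
    simp only [S, Finset.mem_filter, Finset.mem_product, Finset.mem_univ, Finset.mem_Icc]
    exact ⟨⟨trivial, h0, this⟩, h1⟩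
  have hSne : S.Nonempty := by
    obtain ⟨m, hm, i, hi, h1⟩ := exists_el_one_ne_zero X h
    exact ⟨(⟨m, by omega⟩, i), hS _ _ hi h1⟩
  obtain ⟨⟨m', s⟩, hms, hmax⟩ := Finset.exists_max_image S (fun p =>
    (((G (X.E p.2 (gen p.1))).natDegree : ℚ) - (G (gen p.1)).natDegree) / p.2) hSne
  simp only [S, Finset.mem_filter, Finset.mem_product, Finset.mem_univ, Finset.mem_Icc] at hms
  have hs : 0 < s := hms.1.2.1
  set P : ℤ := (G (X.E s (gen m'))).natDegree - (G (gen m')).natDegree with hP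
  have hgen : ∀ m i, X.E i (gen m) ≠ 0 →
      (s : ℤ) * (G (X.E i (gen m))).natDegree ≤ s * (G (gen m)).natDegree + i * P := by
    intro m i h1
    by_cases h0 : i = 0
    · subst h0; rw [X.E_zero]; simp
    · have h2 := hmax (m, i) (hS m i (by omega) h1)
      simp only at h2
      rw [div_le_div_iff₀ (by exact_mod_cast Nat.pos_of_ne_zero h0) (by exact_mod_cast hs)] at h2
      have h3 : (((G (X.E i (gen m))).natDegree : ℤ) - (G (gen m)).natDegree) * s ≤ P * i := by
        rw [hP]; exact_mod_cast h2
      linarith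
  have hmul : ∀ f g : Coord k,
      (∀ i, X.E i f ≠ 0 → (s : ℤ) * (G (X.E i f)).natDegree ≤ s * (G f).natDegree + i * P) →
      (∀ i, X.E i g ≠ 0 → (s : ℤ) * (G (X.E i g)).natDegree ≤ s * (G g).natDegree + i * P) →
      ∀ i, X.E i (f * g) ≠ 0 →
        (s : ℤ) * (G (X.E i (f * g))).natDegree ≤ s * (G (f * g)).natDegree + i * P := by
    intro f g hf hg n hn
    have hf0 : f ≠ 0 := by rintro rfl; simp at hn
    have hg0 : g ≠ 0 := by rintro rfl; simp at hn
    have h1 : ∑ p ∈ Finset.HasAntidiagonal.antidiagonal n, G (X.E p.1 f * X.E p.2 g) ≠ 0 := by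
      rw [← map_sum, ← X.E_mul]; exact (map_ne_zero_iff G hinj).mpr hn
    obtain ⟨⟨i, j⟩, hij, h3, h4⟩ := exists_natDegree_le_of_sum_ne_zero h1
    rw [← map_sum, ← X.E_mul] at h4
    simp only [Finset.HasAntidiagonal.mem_antidiagonal] at hij
    have hi : X.E i f ≠ 0 := fun h => h3 (by simp only [h, zero_mul, map_zero])
    have hj : X.E j g ≠ 0 := fun h => h3 (by simp only [h, mul_zero, map_zero])
    rw [map_mul G (X.E i f), natDegree_mul ((map_ne_zero_iff G hinj).mpr hi)
      ((map_ne_zero_iff G hinj).mpr hj)] at h4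
    rw [map_mul G f g, natDegree_mul ((map_ne_zero_iff G hinj).mpr hf0)
      ((map_ne_zero_iff G hinj).mpr hg0)]
    have h5 := hf i hi
    have h6 := hg j hj
    have h7 : (s : ℤ) * (G (X.E n (f * g))).natDegree ≤
        s * ((G (X.E i f)).natDegree + (G (X.E j g)).natDegree) :=
      mul_le_mul_of_nonneg_left (by exact_mod_cast h4) (by positivity)
    rw [← hij]
    rw [← hij] at h7
    push_cast
    linarith
  have hel := el_induction (P := fun j m h => ∀ i, X.E i (el k j m h) ≠ 0 →
      (s : ℤ) * (G (X.E i (el k j m h))).natDegree ≤ s * (G (el k j m h)).natDegree + i * P)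
    (by
      rw [el_zero_zero]
      intro i hi
      obtain rfl : i = 0 := by
        by_contra h0
        exact hi (X.E_one i (Nat.pos_of_ne_zero h0))
      rw [X.E_zero]; simp)
    (fun m h => hgen ⟨m, by omega⟩)
    (fun j m h hm _ ih => by
      rw [el_eq_mul_of_four_le h hm]; exact hmul _ _ ih (hgen 4))
    (fun j m h hm hj ih => by
      rw [el_eq_mul_of_lt h hm hj]; exact hmul _ _ ih (hgen 0))
  refine ⟨⟨G, hinj, s, P, hs, fun f n hn => ?_⟩, rfl, gen m', fun h => hms.2 (by rw [h, map_zero]),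
    lt_of_lt_of_le hs (ExpMap.Weighted.le_D ⟨hms.2, ?_⟩)⟩
  · obtain ⟨c, hc, hf⟩ := exists_eq_sum_el f
    have h1 : ∑ i ∈ c.support, G (X.E n (c i • el k i.1.1 i.1.2 i.2)) ≠ 0 := by
      rw [← map_sum, ← map_sum, ← hf]; exact (map_ne_zero_iff G hinj).mpr hn
    obtain ⟨i, hi, h3, h4⟩ := exists_natDegree_le_of_sum_ne_zero h1
    rw [← map_sum, ← map_sum, ← hf] at h4
    have h5 : X.E n (el k i.1.1 i.1.2 i.2) ≠ 0 := fun h => h3 (by rw [map_smul, h]; simp)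
    have h6 := hel _ _ i.2 n h5
    have h7 : (G (el k i.1.1 i.1.2 i.2)).natDegree ≤ (G f).natDegree := natDegree_el_le hab hc hi
    rw [map_smul, map_smul] at h4
    have h8 := h4.trans (natDegree_smul_le _ _)
    have h9 : (s : ℤ) * (G (X.E n f)).natDegree ≤
        s * (G (X.E n (el k i.1.1 i.1.2 i.2))).natDegree :=
      mul_le_mul_of_nonneg_left (by exact_mod_cast h8) (by positivity)
    have h10 : (s : ℤ) * (G (el k i.1.1 i.1.2 i.2)).natDegree ≤ s * (G f).natDegree :=
      mul_le_mul_of_nonneg_left (by exact_mod_cast h7) (by positivity)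
    linarith
  · change (s : ℤ) * (G (X.E s (gen m'))).natDegree = s * (G (gen m')).natDegree + s * P
    rw [hP]; ring

end Slope

/-! ### Polynomials attached to the parts of highest weight -/

/-- As `a` and `b` are coprime, the exponents on the line `a j + b m = M` differ by multiples of
`(-b, a)`. Starting from the smallest `m`, their sum is a monomial times a polynomial in `y^a /
θ^b`; the inequality says that the last exponent still satisfies `m ≤ 4j`. -/
theorem exists_topPoly {a b : ℕ} (ha : 0 < a) (hab : a.Coprime b) (c : Idx →₀ k) {M : ℕ}
    (hM : ∃ i ∈ c.support, a * i.1.1 + b * i.1.2 = M) :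
    ∃ (i₀ m₀ : ℕ) (Q : k[X]), Q ≠ 0 ∧ m₀ + (a + 4 * b) * Q.natDegree ≤ 4 * i₀ ∧
      a * i₀ + b * m₀ = M ∧ ∀ (L : Type u) [Field L] [Algebra k L] (θ y : L), θ ≠ 0 →
        ∑ i ∈ c.support with a * i.1.1 + b * i.1.2 = M, c i • (θ ^ i.1.1 * y ^ i.1.2) =
          θ ^ i₀ * y ^ m₀ * aeval (y ^ a / θ ^ b) Q := by
  classical
  set S : Finset Idx := {i ∈ c.support | a * i.1.1 + b * i.1.2 = M} with hS
  have hSne : S.Nonempty := by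
    obtain ⟨i, hi, h⟩ := hM
    exact ⟨i, by simp only [hS, Finset.mem_filter]; exact ⟨hi, h⟩⟩
  obtain ⟨i, hi, hmin⟩ := Finset.exists_min_image S (fun i => i.1.2) hSne
  have hmem : ∀ i ∈ S, c i ≠ 0 ∧ a * i.1.1 + b * i.1.2 = M := fun i hi => by
    simp only [hS, Finset.mem_filter, Finsupp.mem_support_iff] at hi; exact hi
  have hr : ∀ i' ∈ S, i'.1.2 = i.1.2 + a * ((i'.1.2 - i.1.2) / a) ∧
      i.1.1 = i'.1.1 + b * ((i'.1.2 - i.1.2) / a) := by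
    intro i' hi'
    have h1 := (hmem _ hi).2
    have h2 := (hmem _ hi').2
    have h3 := hmin _ hi'
    obtain ⟨e, he⟩ : ∃ e, i'.1.2 = i.1.2 + e := ⟨i'.1.2 - i.1.2, by omega⟩
    have h4 : a * i.1.1 = a * i'.1.1 + b * e := by
      rw [he] at h2; rw [← h2] at h1; linarith
    obtain ⟨r, rfl⟩ : a ∣ e := by
      refine hab.dvd_of_dvd_mul_left ?_
      rw [← Nat.dvd_add_right (dvd_mul_right a i'.1.1), ← h4]
      exact dvd_mul_right _ _
    rw [he, Nat.add_sub_cancel_left, Nat.mul_div_cancel_left _ ha]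
    refine ⟨rfl, Nat.eq_of_mul_eq_mul_left ha ?_⟩
    rw [h4]; ring
  set Q : k[X] := ∑ i' ∈ S, Polynomial.monomial ((i'.1.2 - i.1.2) / a) (c i') with hQ
  have hcoeff : ∀ i' ∈ S, Q.coeff ((i'.1.2 - i.1.2) / a) = c i' := by
    intro i' hi'
    rw [hQ, finsetSum_coeff]
    simp only [coeff_monomial]
    rw [Finset.sum_eq_single_of_mem i' hi', if_pos rfl]
    intro i'' hi'' hne
    rw [if_neg]
    intro h
    have h1 := hr _ hi'
    have h2 := hr _ hi''
    rw [h] at h2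
    exact hne (Subtype.ext (Prod.ext (by omega) (by omega)))
  have hQ0 : Q ≠ 0 := fun h => (hmem i hi).1 (by rw [← hcoeff i hi, h, coeff_zero])
  refine ⟨i.1.1, i.1.2, Q, hQ0, ?_, (hmem _ hi).2, ?_⟩
  · have h1 : Q.coeff Q.natDegree ≠ 0 := leadingCoeff_ne_zero.mpr hQ0
    rw [hQ, finsetSum_coeff] at h1
    obtain ⟨i', hi', h2⟩ := Finset.exists_ne_zero_of_sum_ne_zero h1
    rw [← hQ, coeff_monomial] at h2
    split_ifs at h2 with h3
    · have h4 := hr _ hi'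
      rw [h3] at h4
      have h5 := i'.2
      nlinarith [h4.1, h4.2]
    · exact absurd rfl h2
  · intro L _ _ θ y hθ
    rw [hQ, map_sum, Finset.mul_sum]
    refine Finset.sum_congr rfl fun i' hi' => ?_
    rw [aeval_monomial, Algebra.smul_def]
    obtain ⟨h1, h2⟩ := hr _ hi'
    set r := (i'.1.2 - i.1.2) / a
    rw [h1, h2, div_pow, ← pow_mul, ← pow_mul, pow_add, pow_add]
    field_simp

end Chart

namespace Chart

/-! ### Leading parts with respect to a weight -/

/-- The rational function `v^a / x^(2b)`. -/
def ratio (k : Type u) [Field k] (a b : ℕ) : Frac k := toFrac k (v k) ^ a / (toFrac k (x k) ^ 2) ^ b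

/-- After clearing denominators, the term with the leading coefficient of `Q` is the only one
without a factor `x`, because `b > 0`. -/
theorem aeval_ratio_ne_zero {a b : ℕ} (hb : 0 < b) {Q : k[X]} (hQ : Q ≠ 0) :
    aeval (ratio k a b) Q ≠ 0 := by
  intro h
  have hξ := toFrac_x_ne_zero (k := k)
  have h1 : toFrac k (∑ r ∈ Finset.range (Q.natDegree + 1),
      Q.coeff r • (x k ^ (2 * b * (Q.natDegree - r)) * v k ^ (a * r))) =
      toFrac k (x k) ^ (2 * b * Q.natDegree) * aeval (ratio k a b) Q := by
    rw [aeval_eq_sum_range, Finset.mul_sum, map_sum]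
    refine Finset.sum_congr rfl fun r hr => ?_
    have hr' : Q.natDegree = (Q.natDegree - r) + r := by
      have := Finset.mem_range.mp hr; omega
    rw [map_smul, map_mul, map_pow, map_pow, mul_smul_comm, ratio]
    congr 1
    conv_rhs => rw [hr', mul_add, pow_add, div_pow, ← pow_mul, ← pow_mul, ← pow_mul, ← mul_assoc]
    rw [mul_div_assoc', eq_div_iff (pow_ne_zero _ hξ)]
    ring
  rw [h, mul_zero] at h1
  have h2 := toFrac_injective (h1.trans (map_zero _).symm)
  have h3 := congrArg (fun f : Chart k => (f.coeff 0).coeff (a * Q.natDegree)) h2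
  simp only [finsetSum_coeff, coeff_zero] at h3
  rw [Finset.sum_eq_single_of_mem Q.natDegree (by simp)] at h3
  · rw [Nat.sub_self, mul_zero, pow_zero, one_mul, v, ← C_pow, coeff_smul, coeff_C_zero,
      coeff_smul, coeff_X_pow, if_pos rfl, smul_eq_mul, mul_one] at h3
    exact hQ (leadingCoeff_eq_zero.mp h3)
  · intro r hr hne
    have hr' : r < Q.natDegree := by
      have := Finset.mem_range.mp hr; omega
    have h4 : 2 * b * (Q.natDegree - r) ≠ 0 := by
      have : 0 < b * (Q.natDegree - r) := Nat.mul_pos hb (by omega)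
      rw [mul_assoc]; omega
    rw [coeff_smul, x, mul_comm, v, ← C_pow, coeff_C_mul_X_pow, if_neg h4.symm]
    simp

/-- The leading coefficient `x^(2i) v^m Q(v^a / x^(2b))`. -/
def leadForm (a b i m : ℕ) (Q : k[X]) : Frac k :=
  toFrac k (x k) ^ (2 * i) * toFrac k (v k) ^ m * aeval (ratio k a b) Q

theorem leadForm_ne_zero {a b : ℕ} (hb : 0 < b) (i m : ℕ) {Q : k[X]} (hQ : Q ≠ 0) :
    leadForm a b i m Q ≠ 0 :=
  mul_ne_zero (mul_ne_zero (pow_ne_zero _ toFrac_x_ne_zero) (pow_ne_zero _ toFrac_v_ne_zero))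
    (aeval_ratio_ne_zero hb hQ)

/-- The leading part of `f` for the weights `a` of `x` and `2b` of `v` is given by `i`, `m` and
`Q`. -/
def Lead (a b : ℕ) (f : Coord k) (i m : ℕ) (Q : k[X]) : Prop :=
  Top (wtHom k a (2 * b) (toChart f)) (2 * (a * i + b * m)) (leadForm a b i m Q)

section Lead

variable {a b : ℕ} {f g : Coord k} {i m i' m' : ℕ} {Q Q' : k[X]}

theorem Lead.mul (hf : Lead a b f i m Q) (hg : Lead a b g i' m' Q') :
    Lead a b (f * g) (i + i') (m + m') (Q * Q') := by
  have := Top.mul hf hg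
  rw [Lead, map_mul, map_mul]
  convert this using 1
  · ring
  · simp only [leadForm, map_mul]; ring

theorem Lead.add (hf : Lead a b f i m Q) (hg : Lead a b g i m Q') :
    Lead a b (f + g) i m (Q + Q') := by
  have := Top.add hf hg
  rw [Lead, map_add, map_add]
  convert this using 1
  simp only [leadForm, map_add]; ring

theorem lead_one : Lead a b (1 : Coord k) 0 0 1 := by
  rw [Lead, map_one, map_one, leadForm]
  simpa using Top.one

theorem Lead.pow (hf : Lead a b f i m Q) (n : ℕ) : Lead a b (f ^ n) (n * i) (n * m) (Q ^ n) := by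
  induction n with
  | zero => simpa using lead_one
  | succ n ih => simpa only [pow_succ, add_mul, one_mul] using ih.mul hf

theorem lead_el (ha : 0 < a) {j m : ℕ} (h : m ≤ 4 * j) : Lead a b (el k j m h) j m 1 := by
  have := top_wtHom_mono (k := k) (a := a) (b := 2 * b) (by omega) h
  rw [Lead, toChart_el, leadForm]
  convert this using 1
  · ring
  · simp

theorem lead_algebraMap (e : k) : Lead a b (algebraMap k (Coord k) e) 0 0 (C e) := by
  rw [Lead, AlgHom.commutes, AlgHom.commutes, leadForm]
  simpa using Top.C (algebraMap k (Frac k) e)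

theorem Lead.ne_zero (hb : 0 < b) (hf : Lead a b f i m Q) (hQ : Q ≠ 0) : f ≠ 0 := by
  rintro rfl
  have := Top.ne_zero hf (leadForm_ne_zero hb _ _ hQ)
  simp at this

/-- The summands of the element `coneEl`. -/
def coneTerm (a b i m : ℕ) (Q : k[X]) (r : ℕ) : Coord k :=
  -- Under the inequality `m + (a + 4b) deg Q ≤ 4i` the condition holds for every `r ≤ deg Q`
  -- (`le_of_cone`), so the value 0 is then never taken.
  if h : b * r ≤ i ∧ m + a * r ≤ 4 * (i - b * r) then
    Q.coeff r • el k (i - b * r) (m + a * r) h.2 else 0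

/-- An element with the leading part given by `i`, `m` and `Q`. -/
def coneEl (a b i m : ℕ) (Q : k[X]) : Coord k :=
  ∑ r ∈ Finset.range (Q.natDegree + 1), coneTerm a b i m Q r

theorem le_of_cone {p d r : ℕ} (hp : p = a + 4 * b) (h : m + p * d ≤ 4 * i) (hr : r ≤ d) :
    b * r ≤ i ∧ m + a * r ≤ 4 * (i - b * r) := by
  have h1 : (a + 4 * b) * r ≤ (a + 4 * b) * d := Nat.mul_le_mul_left _ hr
  rw [hp] at h
  have h2 : (a + 4 * b) * r = a * r + 4 * (b * r) := by ring
  omega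

theorem lead_coneTerm (ha : 0 < a) (h : m + (a + 4 * b) * Q.natDegree ≤ 4 * i) {r : ℕ}
    (hr : r ≤ Q.natDegree) : Lead a b (coneTerm a b i m Q r) i m (Q.coeff r • X ^ r) := by
  have h1 := le_of_cone rfl h hr
  rw [coneTerm, dif_pos h1, Algebra.smul_def]
  have h2 := (lead_algebraMap (a := a) (b := b) (Q.coeff r)).mul (lead_el ha (b := b) h1.2)
  rw [Lead] at h2 ⊢
  have h3 : a * (0 + (i - b * r)) + b * (0 + (m + a * r)) = a * i + b * m := by
    obtain ⟨e, rfl⟩ : ∃ e, i = b * r + e := ⟨i - b * r, by omega⟩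
    rw [Nat.add_sub_cancel_left]; ring
  rw [h3] at h2
  convert h2 using 1
  obtain ⟨e, rfl⟩ : ∃ e, i = b * r + e := ⟨i - b * r, by omega⟩
  rw [Nat.add_sub_cancel_left, zero_add, zero_add]
  have h4 : aeval (ratio k a b) (Q.coeff r • (X : k[X]) ^ r) =
      algebraMap k (Frac k) (Q.coeff r) * ratio k a b ^ r := by
    rw [map_smul, map_pow, aeval_X, Algebra.smul_def]
  simp only [leadForm, mul_one, aeval_C, h4]
  rw [ratio]
  have hξ : ((toFrac k (x k) ^ 2) ^ b) ^ r ≠ 0 := pow_ne_zero _ (pow_ne_zero _ (pow_ne_zero _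
    toFrac_x_ne_zero))
  have h5 : toFrac k (x k) ^ (2 * (b * r + e)) =
      ((toFrac k (x k) ^ 2) ^ b) ^ r * toFrac k (x k) ^ (2 * e) := by ring
  rw [h5, div_pow]
  field_simp
  ring

theorem lead_coneEl (ha : 0 < a) (h : m + (a + 4 * b) * Q.natDegree ≤ 4 * i) :
    Lead a b (coneEl a b i m Q) i m Q := by
  have h1 : Top (∑ r ∈ Finset.range (Q.natDegree + 1),
      wtHom k a (2 * b) (toChart (coneTerm a b i m Q r))) (2 * (a * i + b * m))
      (∑ r ∈ Finset.range (Q.natDegree + 1), leadForm a b i m (Q.coeff r • X ^ r)) :=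
    Top.sum fun r hr => lead_coneTerm ha h (by have := Finset.mem_range.mp hr; omega)
  rw [Lead, coneEl, map_sum, map_sum]
  convert h1 using 1
  simp only [leadForm]
  rw [← Finset.mul_sum, ← map_sum]
  congr 2
  conv_lhs => rw [Q.as_sum_range_C_mul_X_pow]
  simp only [smul_eq_C_mul]

/-- The last clause evaluates the same `Q` in an arbitrary field. It will be applied to the leading
coefficients of the images of `t` and `xy` under an automorphism. -/
theorem exists_lead (ha : 0 < a) (hab : a.Coprime b) (hf : f ≠ 0) :
    ∃ (c : Idx →₀ k) (M i m : ℕ) (Q : k[X]), toChart f = ofCoeff k c ∧ Q ≠ 0 ∧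
      m + (a + 4 * b) * Q.natDegree ≤ 4 * i ∧ Lead a b f i m Q ∧
      (∃ i ∈ c.support, a * i.1.1 + b * i.1.2 = M) ∧
      (∀ i ∈ c.support, a * i.1.1 + b * i.1.2 ≤ M) ∧
      ∀ (L : Type u) [Field L] [Algebra k L] (θ y : L), θ ≠ 0 →
        ∑ i ∈ c.support with a * i.1.1 + b * i.1.2 = M, c i • (θ ^ i.1.1 * y ^ i.1.2) =
          θ ^ i * y ^ m * aeval (y ^ a / θ ^ b) Q := by
  classical
  obtain ⟨c, hc, -⟩ := exists_eq_sum_el f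
  have hc0 : c ≠ 0 := by
    rintro rfl
    exact hf (toChart_injective (by rw [hc, map_zero, map_zero]))
  have hwt : ∀ i : Idx, wt a (2 * b) i = 2 * (a * i.1.1 + b * i.1.2) := fun i => by rw [wt]; ring
  obtain ⟨i₁, hi₁, hmax⟩ := exists_max_wt a (2 * b) hc0
  obtain ⟨i, m, Q, hQ, hcone, hM, hsum⟩ := exists_topPoly ha hab c ⟨i₁, hi₁, rfl⟩
  refine ⟨c, _, i, m, Q, hc, hQ, hcone, ?_, ⟨i₁, hi₁, rfl⟩, fun i' hi' => ?_, hsum⟩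
  · have h1 := top_wtHom_ofCoeff (a := a) (b := 2 * b) (by omega) c hmax
    rw [Lead, hc, hM]
    rw [hwt] at h1
    convert h1 using 1
    have h2 := hsum (Frac k) (toFrac k (x k) ^ 2) (toFrac k (v k)) (pow_ne_zero _ toFrac_x_ne_zero)
    rw [leadForm, ratio, pow_mul, ← h2, topForm]
    simp only [hwt, mul_eq_mul_left_iff, pow_mul, OfNat.ofNat_ne_zero, or_false]
  · have := hmax i' hi'
    rw [hwt, hwt] at this
    omega

end Lead

end Chart

namespace Chart

open ExpMap.Weighted

/-! ### The weights of the leading parts and exponential maps -/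

section Cone

variable {a b : ℕ} {X : ExpMap k (Coord k)} {W : X.Weighted (Frac k)}
  (hW : W.G = (wtHom k a (2 * b)).comp toChart)

include hW

theorem Lead.top {f : Coord k} {i m : ℕ} {Q : k[X]} (h : Lead a b f i m Q) :
    Top (W.G f) (2 * (a * i + b * m)) (leadForm a b i m Q) := by
  rw [hW]; exact h

variable (ha : 0 < a) (hb : 0 < b)

include hb in
theorem Lead.wd_eq {f : Coord k} {i m : ℕ} {Q : k[X]} (h : Lead a b f i m Q) (hQ : Q ≠ 0) :
    W.wd f = 2 * (a * i + b * m) :=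
  (h.top hW).natDegree (leadForm_ne_zero hb _ _ hQ)

include hb in
theorem Lead.D_eq {f g : Coord k} {i m : ℕ} {Q : k[X]} (hf : Lead a b f i m Q)
    (hg : Lead a b g i m Q) (hQ : Q ≠ 0) : W.D f = W.D g :=
  D_eq_of_top (leadForm_ne_zero hb i m hQ) (hf.top hW) (hg.top hW)

include ha hb in
-- The elements `(mono j m)^4` and `t^(4j-m) (w²)^m` have the same leading part.
theorem four_mul_D_el {j m : ℕ} (h : m ≤ 4 * j) :
    4 * W.D (el k j m h) = (4 * j - m) * W.D (t k) + m * W.D (el k 1 4 (by decide)) := by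
  have h1 : Lead a b (el k j m h ^ 4) (4 * j) (4 * m) 1 := by
    simpa using (lead_el ha (b := b) h).pow 4
  have h4 : Lead a b (el k 1 4 (by decide)) 1 4 1 := lead_el ha (b := b) (by decide)
  have h0 : Lead a b (t k) 1 0 1 := lead_el ha (b := b) (by decide)
  have h2 : Lead a b (t k ^ (4 * j - m) * el k 1 4 (by decide) ^ m) (4 * j) (4 * m) 1 := by
    have := (h0.pow (4 * j - m)).mul (h4.pow m)
    simp only [mul_one, mul_zero, zero_add, one_pow, Nat.sub_add_cancel h] at this
    rwa [mul_comm m 4] at this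
  have h3 := h1.D_eq hW hb h2 one_ne_zero
  rwa [D_pow ((lead_el ha (b := b) h).ne_zero hb one_ne_zero), D_mul
    (pow_ne_zero _ t_ne_zero) (pow_ne_zero _ (h4.ne_zero hb one_ne_zero)), D_pow t_ne_zero,
    D_pow (h4.ne_zero hb one_ne_zero)] at h3

omit hW in
theorem coneTerm_eq {i m r : ℕ} {Q : k[X]}
    (h0 : coneTerm a b i m Q r ≠ 0) : ∃ h : m + a * r ≤ 4 * (i - b * r), b * r ≤ i ∧
      W.D (coneTerm a b i m Q r) = W.D (el k (i - b * r) (m + a * r) h) ∧ Q.coeff r ≠ 0 := by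
  rw [coneTerm] at h0
  split_ifs at h0 with h1
  · refine ⟨h1.2, h1.1, ?_, left_ne_zero_of_smul h0⟩
    rw [coneTerm, dif_pos h1, D_smul (left_ne_zero_of_smul h0) (right_ne_zero_of_smul h0)]
  · exact absurd rfl h0

include ha hb in
-- Replace `T` by `coneEl`. A nonzero root means that `Q` has at least two terms. If the equality
-- failed, the values of `D` on these terms would be pairwise distinct, being affine in `r` with
-- nonzero slope, so the largest of them would be at most `D T = 0`; but two distinct natural
-- numbers are not both 0.
theorem mul_D_eq_of_D_eq_zero {T : Coord k} {i m : ℕ} {Q : k[X]} {c : k} (hT : Lead a b T i m Q)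
    (hQ : Q ≠ 0) (h : m + (a + 4 * b) * Q.natDegree ≤ 4 * i) (hD : W.D T = 0) (hc : c ≠ 0)
    (hQc : Q.eval c = 0) :
    a * W.D (el k 1 4 (by decide)) = (a + 4 * b) * W.D (t k) := by
  classical
  by_contra hne
  set X₀ := W.D (t k)
  set X₁ := W.D (el k 1 4 (by decide))
  have hcone := lead_coneEl (b := b) (Q := Q) ha h
  rw [hT.D_eq hW hb hcone hQ] at hD
  -- the degrees of the terms of `coneEl`
  have hterm : ∀ r, Q.coeff r ≠ 0 → coneTerm a b i m Q r ≠ 0 ∧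
      W.wd (coneTerm a b i m Q r) = W.wd (coneEl a b i m Q) ∧
      (4 * W.D (coneTerm a b i m Q r) : ℤ) =
        (4 * i - m) * X₀ + m * X₁ + r * (a * X₁ - (a + 4 * b) * X₀) := by
    intro r hr
    have hrd : r ≤ Q.natDegree := le_natDegree_of_ne_zero hr
    have h1 := lead_coneTerm ha h hrd
    have h1' : Q.coeff r • (Polynomial.X : k[X]) ^ r ≠ 0 := smul_ne_zero hr (pow_ne_zero _ X_ne_zero)
    have h2 := h1.ne_zero hb h1'
    refine ⟨h2, by rw [h1.wd_eq hW hb h1', hcone.wd_eq hW hb hQ], ?_⟩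
    obtain ⟨h3, h4, h5, -⟩ := coneTerm_eq (W := W) h2
    have h6 := four_mul_D_el hW ha hb h3
    rw [← h5] at h6
    zify [h3, h4] at h6
    rw [h6]
    ring
  have hdist : ∀ r r', Q.coeff r ≠ 0 → Q.coeff r' ≠ 0 → r ≠ r' →
      W.D (coneTerm a b i m Q r) ≠ W.D (coneTerm a b i m Q r') := by
    intro r r' hr hr' hrr h1
    have h2 := (hterm r hr).2.2
    have h3 := (hterm r' hr').2.2
    rw [h1, h3] at h2
    have h4 : ((r : ℤ) - r') * (a * X₁ - (a + 4 * b) * X₀) = 0 := by linarith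
    rcases mul_eq_zero.mp h4 with h5 | h5
    · exact hrr (by omega)
    · exact hne (by zify; linarith)
  obtain ⟨r₀, hr₀, hmax⟩ := Finset.exists_max_image Q.support
    (fun r => W.D (coneTerm a b i m Q r)) (nonempty_support_iff.mpr hQ)
  rw [mem_support_iff] at hr₀
  obtain ⟨r₁, hr₁, hr₁₀⟩ : ∃ r, Q.coeff r ≠ 0 ∧ r ≠ r₀ := by
    by_contra! hall
    have h1 : Q = Polynomial.monomial r₀ (Q.coeff r₀) := by
      ext r
      rw [coeff_monomial]
      split_ifs with h2
      · rw [h2]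
      · by_contra h3; exact h2 (hall r h3).symm
    rw [h1, eval_monomial] at hQc
    exact mul_ne_zero hr₀ (pow_ne_zero _ hc) hQc
  have h1 : W.D (coneTerm a b i m Q r₀) ≤ W.D (coneEl a b i m Q) := by
    refine le_D_sum (f := coneTerm a b i m Q)
      (Finset.mem_range.mpr (Nat.lt_succ_of_le (le_natDegree_of_ne_zero hr₀)))
      (hterm r₀ hr₀).1 (hterm r₀ hr₀).2.1 fun r _ hr hr0 => ?_
    obtain ⟨-, -, -, h2⟩ := coneTerm_eq (W := W) hr0
    exact ⟨((hterm r h2).2.1.trans (hterm r₀ hr₀).2.1.symm).le,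
      lt_of_le_of_ne (hmax r (mem_support_iff.mpr h2)) (hdist r r₀ h2 hr₀ hr)⟩
  have h2 := hmax r₁ (mem_support_iff.mpr hr₁)
  have h3 := hdist r₁ r₀ hr₁ hr₀ hr₁₀
  omega

/-! In the rest of the section, the degrees of the monomials are proportional to their weights. -/

variable {κ : ℕ} (hκ : ∀ j m (h : m ≤ 4 * j), W.D (el k j m h) = κ * (a * j + b * m))

include ha hb hκ in
-- All terms of `coneEl` have the same value of `D`, which the sum cannot exceed.
theorem D_coneEl_le {i m : ℕ} {Q : k[X]} (hQ : Q ≠ 0)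
    (h : m + (a + 4 * b) * Q.natDegree ≤ 4 * i) :
    W.D (coneEl a b i m Q) ≤ κ * (a * i + b * m) := by
  have hcone := lead_coneEl (b := b) (Q := Q) ha h
  obtain ⟨r, -, hr0, hr⟩ := exists_D_le (W := W) (s := Finset.range (Q.natDegree + 1))
    (f := coneTerm a b i m Q) (hcone.ne_zero hb hQ) (by
      intro r _ hr
      obtain ⟨h1, h2, h3, h4⟩ := coneTerm_eq (W := W) hr
      change _ ≤ W.wd (coneEl a b i m Q)
      rw [hcone.wd_eq hW hb hQ, (lead_coneTerm ha h (le_natDegree_of_ne_zero h4)).wd_eq hW hb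
        (smul_ne_zero h4 (pow_ne_zero _ X_ne_zero))])
  refine hr.trans ?_
  obtain ⟨h1, h2, h3, h4⟩ := coneTerm_eq (W := W) hr0
  rw [h3, hκ]
  refine Nat.mul_le_mul_left _ (le_of_eq ?_)
  obtain ⟨e, rfl⟩ : ∃ e, i = b * r + e := ⟨i - b * r, by omega⟩
  rw [Nat.add_sub_cancel_left]; ring

omit hW in
/-- The difference between the degree of a monomial and the degree of an element with the leading
polynomial `Q`, of the same weight. -/
def defect (W : X.Weighted (Frac k)) (a b κ : ℕ) (Q : k[X]) : ℕ :=
  κ * (a * ((a + 4 * b) * Q.natDegree)) - W.D (coneEl a b ((a + 4 * b) * Q.natDegree) 0 Q)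

include ha hb hκ in
-- The defect depends on `Q` alone: `f` times a power of `t` and `coneEl` times a monomial have the
-- same leading part.
theorem Lead.D_add_defect {f : Coord k} {i m : ℕ} {Q : k[X]} (hf : Lead a b f i m Q) (hQ : Q ≠ 0)
    (h : m ≤ 4 * i) : W.D f + defect W a b κ Q = κ * (a * i + b * m) := by
  set n := (a + 4 * b) * Q.natDegree with hn
  have hle : 0 + (a + 4 * b) * Q.natDegree ≤ 4 * n := by omega
  have h1 := D_coneEl_le hW ha hb hκ hQ hle
  have h2 := lead_coneEl (b := b) (Q := Q) ha hle
  have h3 : Lead a b (f * el k n 0 (by omega)) (i + n) m Q := by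
    simpa using hf.mul (lead_el ha (b := b) (by omega : 0 ≤ 4 * n))
  have h4 : Lead a b (coneEl a b n 0 Q * el k i m h) (i + n) m Q := by
    have := h2.mul (lead_el ha (b := b) h)
    rwa [zero_add, mul_one, add_comm] at this
  have h5 := h3.D_eq hW hb h4 hQ
  rw [D_mul (hf.ne_zero hb hQ) ((lead_el ha (b := b) (by omega)).ne_zero hb one_ne_zero),
    D_mul (h2.ne_zero hb hQ) ((lead_el ha (b := b) h).ne_zero hb one_ne_zero), hκ, hκ] at h5
  rw [defect, ← hn]
  rw [mul_zero, add_zero] at h1 h5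
  omega

include ha hb hκ in
-- The defect behaves as a valuation on `k[X]`; the aim is to show that it measures the order of
-- vanishing at `c`.
theorem defect_mul {Q R : k[X]} (hQ : Q ≠ 0) (hR : R ≠ 0) :
    defect W a b κ (Q * R) = defect W a b κ Q + defect W a b κ R := by
  have hQ1 := lead_coneEl (b := b) (Q := Q) (i := (a + 4 * b) * Q.natDegree) (m := 0) ha (by omega)
  have hR1 := lead_coneEl (b := b) (Q := R) (i := (a + 4 * b) * R.natDegree) (m := 0) ha (by omega)
  have h1 := hQ1.D_add_defect hW ha hb hκ hQ (by omega)
  have h2 := hR1.D_add_defect hW ha hb hκ hR (by omega)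
  have h3 := (hQ1.mul hR1).D_add_defect hW ha hb hκ (mul_ne_zero hQ hR) (by omega)
  rw [D_mul (hQ1.ne_zero hb hQ) (hR1.ne_zero hb hR)] at h3
  have h4 : κ * (a * ((a + 4 * b) * Q.natDegree + (a + 4 * b) * R.natDegree) + b * (0 + 0)) =
    κ * (a * ((a + 4 * b) * Q.natDegree) + b * 0) +
      κ * (a * ((a + 4 * b) * R.natDegree) + b * 0) := by ring
  omega

include ha hb hκ in
theorem defect_one : defect W a b κ (1 : k[X]) = 0 := by
  have := defect_mul hW ha hb hκ (one_ne_zero (α := k[X])) one_ne_zero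
  rw [mul_one] at this
  omega

include ha hb hκ in
theorem defect_pow {Q : k[X]} (hQ : Q ≠ 0) (n : ℕ) :
    defect W a b κ (Q ^ n) = n * defect W a b κ Q := by
  induction n with
  | zero => rw [pow_zero, defect_one hW ha hb hκ, zero_mul]
  | succ n ih => rw [pow_succ, defect_mul hW ha hb hκ (pow_ne_zero n hQ) hQ, ih]; ring

include ha hb hκ in
theorem defect_C {e : k} (he : e ≠ 0) : defect W a b κ (C e) = 0 := by
  have h1 := (lead_algebraMap (a := a) (b := b) e).D_add_defect hW ha hb hκ (C_ne_zero.mpr he)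
    le_rfl
  rw [mul_zero, mul_zero, add_zero, mul_zero] at h1
  omega

include ha hb hκ in
-- The polynomial `Q⁴` is already the leading polynomial of an element with `i = (a + 4b) deg Q` and
-- `m = 0`, and `D` is nonnegative there.
theorem four_mul_defect_le {Q : k[X]} (hQ : Q ≠ 0) :
    4 * defect W a b κ Q ≤ κ * (a * ((a + 4 * b) * Q.natDegree)) := by
  have h1 := lead_coneEl (b := b) (Q := Q ^ 4) (i := (a + 4 * b) * Q.natDegree) (m := 0) ha (by
    rw [natDegree_pow]; linarith [mul_left_comm (a + 4 * b) 4 Q.natDegree])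
  have h2 := h1.D_add_defect hW ha hb hκ (pow_ne_zero 4 hQ) (by omega)
  rw [defect_pow hW ha hb hκ hQ, mul_zero, add_zero] at h2
  omega

include ha hb hκ in
-- As `D T = 0`, the defect of `Q` is all of `κ(ai + bm)`, hence at least `κ a (a + 4b) deg Q / 4`.
-- The general upper bound for the factors `X - c` and `R` of `Q` then has to be an equality for
-- both.
theorem four_mul_defect_eq {T : Coord k} {i m : ℕ} {Q : k[X]} {c : k} (hT : Lead a b T i m Q)
    (hQ : Q ≠ 0) (h : m + (a + 4 * b) * Q.natDegree ≤ 4 * i) (hD : W.D T = 0)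
    (hQc : Q.eval c = 0) :
    4 * defect W a b κ (Polynomial.X - C c) = κ * (a * (a + 4 * b)) := by
  have h1 := hT.D_add_defect hW ha hb hκ hQ (by omega)
  obtain ⟨R, rfl⟩ := dvd_iff_isRoot.mpr hQc
  have hR : R ≠ 0 := right_ne_zero_of_mul hQ
  have hX : (Polynomial.X - C c : k[X]) ≠ 0 := X_sub_C_ne_zero c
  rw [natDegree_mul hX hR, natDegree_X_sub_C] at h
  rw [hD, defect_mul hW ha hb hκ hX hR, zero_add] at h1
  have h2 := four_mul_defect_le hW ha hb hκ hX
  have h3 := four_mul_defect_le hW ha hb hκ hR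
  rw [natDegree_X_sub_C, mul_one] at h2
  refine le_antisymm h2 ?_
  obtain ⟨e, he⟩ : ∃ e, 4 * i = m + (a + 4 * b) * (1 + R.natDegree) + e :=
    ⟨4 * i - (m + (a + 4 * b) * (1 + R.natDegree)), by omega⟩
  have h5 : 4 * (κ * (a * i + b * m)) = κ * (a * (4 * i) + 4 * b * m) := by ring
  rw [← h1, he] at h5
  have h6 : κ * (a * (m + (a + 4 * b) * (1 + R.natDegree) + e) + 4 * b * m) =
    κ * (a * (a + 4 * b)) + κ * (a * ((a + 4 * b) * R.natDegree)) +
      κ * (a * (m + e) + 4 * b * m) := by ring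
  have h7 : 0 ≤ κ * (a * (m + e) + 4 * b * m) := Nat.zero_le _
  omega

include ha hb hκ in
-- Write `Q` as a multiple of `X - c` plus a nonzero constant. The multiple has positive defect and
-- the constant has none, so in an element with this leading part the constant has the larger `D`
-- and decides.
theorem defect_eq_zero {Q : k[X]} {c : k} (hc : 0 < defect W a b κ (Polynomial.X - C c))
    (hQ : Q.eval c ≠ 0) : defect W a b κ Q = 0 := by
  have hX : (Polynomial.X - C c : k[X]) ≠ 0 := X_sub_C_ne_zero c
  obtain ⟨R, hR⟩ := X_sub_C_dvd_sub_C_eval (a := c) (p := Q)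
  have hQR : Q = (Polynomial.X - C c) * R + C (Q.eval c) := by rw [← hR]; ring
  have hQ0 : Q ≠ 0 := by rintro rfl; simp at hQ
  have hC0 : C (Q.eval c) ≠ 0 := C_ne_zero.mpr hQ
  by_cases hR0 : R = 0
  · rw [hQR, hR0, mul_zero, zero_add]; exact defect_C hW ha hb hκ hQ
  have hXR : (Polynomial.X - C c) * R ≠ 0 := mul_ne_zero hX hR0
  set n := (a + 4 * b) * ((Polynomial.X - C c) * R).natDegree with hn
  have h1 := lead_coneEl (b := b) (Q := (Polynomial.X - C c) * R) (i := n) (m := 0) ha (by omega)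
  have h2 : Lead a b (coneEl a b n 0 (C (Q.eval c))) n 0 (C (Q.eval c)) :=
    lead_coneEl ha (by rw [natDegree_C]; omega)
  have h3 := h1.add h2
  rw [← hQR] at h3
  have h4 := h1.D_add_defect hW ha hb hκ hXR (by omega)
  have h5 := h2.D_add_defect hW ha hb hκ hC0 (by omega)
  have h6 := h3.D_add_defect hW ha hb hκ hQ0 (by omega)
  rw [defect_C hW ha hb hκ hQ] at h5
  rw [defect_mul hW ha hb hκ hX hR0] at h4
  let F : Bool → Coord k := fun i => cond i (coneEl a b n 0 (C (Q.eval c)))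
    (coneEl a b n 0 ((Polynomial.X - C c) * R))
  have hF : ∑ i ∈ Finset.univ, F i = coneEl a b n 0 ((Polynomial.X - C c) * R) +
      coneEl a b n 0 (C (Q.eval c)) := by
    rw [Fintype.sum_bool, add_comm]; rfl
  have h7 : W.D (F true) ≤ W.D (∑ i ∈ Finset.univ, F i) := by
    refine le_D_sum (f := F) (Finset.mem_univ true) (h2.ne_zero hb hC0) ?_ ?_
    · rw [hF, h3.wd_eq hW hb hQ0]; exact h2.wd_eq hW hb hC0
    · rintro (_ | _) _ h8 _
      · refine ⟨((h1.wd_eq hW hb hXR).trans (h2.wd_eq hW hb hC0).symm).le, ?_⟩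
        change W.D (coneEl a b n 0 ((Polynomial.X - C c) * R)) < W.D (coneEl a b n 0 (C (Q.eval c)))
        omega
      · exact absurd rfl h8
  rw [hF] at h7
  change W.D (coneEl a b n 0 (C (Q.eval c))) ≤ _ at h7
  omega

include ha hb hκ in
-- If `r` is the order of `Q` at `c` and `e` is the slack in `m + (a + 4b) r ≤ 4i`, the defect gives
-- `4 D f = κ(a(e + m) + 4bm)`. When positive, this is at least `κ a`.
theorem le_four_mul_D (hab : a.Coprime b) {f : Coord k} {c : k} (hκ0 : 0 < κ)
    (hc : 4 * defect W a b κ (Polynomial.X - C c) = κ * (a * (a + 4 * b))) (hf : f ≠ 0) (hD : 0 < W.D f) :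
    κ * a ≤ 4 * W.D f := by
  obtain ⟨-, -, i, m, Q, -, hQ, hcone, hlead, -⟩ := exists_lead (b := b) ha hab hf
  have hX : (Polynomial.X - C c : k[X]) ≠ 0 := X_sub_C_ne_zero c
  obtain ⟨R, hR, hRc⟩ := Polynomial.exists_eq_pow_rootMultiplicity_mul_and_not_dvd Q hQ c
  set r := Q.rootMultiplicity c
  have hR0 : R ≠ 0 := by rintro rfl; simp at hRc
  have h1 := hlead.D_add_defect hW ha hb hκ hQ (by omega)
  have hpos : 0 < κ * (a * (a + 4 * b)) := by positivity
  rw [hR, defect_mul hW ha hb hκ (pow_ne_zero _ hX) hR0, defect_pow hW ha hb hκ hX,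
    defect_eq_zero hW ha hb hκ (c := c) (by omega) (fun h => hRc (dvd_iff_isRoot.mpr h)),
    add_zero] at h1
  have h2 : r ≤ Q.natDegree := by
    rw [hR, natDegree_mul (pow_ne_zero _ hX) hR0, natDegree_pow, natDegree_X_sub_C]; omega
  have h3 : m + (a + 4 * b) * r ≤ 4 * i :=
    (Nat.add_le_add_left (Nat.mul_le_mul_left _ h2) m).trans hcone
  obtain ⟨e, he⟩ : ∃ e, 4 * i = m + (a + 4 * b) * r + e := ⟨4 * i - (m + (a + 4 * b) * r), by omega⟩
  have h4 : 4 * (κ * (a * i + b * m)) = κ * (a * (4 * i) + 4 * b * m) := by ring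
  rw [← h1, he] at h4
  have h5 : 4 * (W.D f + r * defect W a b κ (Polynomial.X - C c)) =
    4 * W.D f + r * (κ * (a * (a + 4 * b))) := by rw [← hc]; ring
  have h6 : κ * (a * (m + (a + 4 * b) * r + e) + 4 * b * m) =
    r * (κ * (a * (a + 4 * b))) + κ * (a * (e + m) + 4 * b * m) := by ring
  have h7 : 4 * W.D f = κ * (a * (e + m) + 4 * b * m) := by omega
  rw [h7]
  refine Nat.mul_le_mul_left _ ?_
  rcases Nat.eq_zero_or_pos (e + m) with h8 | h8
  · have hm : m = 0 := by omega
    rw [h8, hm] at h7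
    simp only [mul_zero, add_zero] at h7
    omega
  · have := Nat.mul_le_mul_left a h8
    omega

include ha hb hκ in
-- Take `4i = 1 + (a + 4b) r`, solvable as `a` is odd. The elements with leading polynomial `(X -
-- c)^r` and `m = 0`, respectively `m = 1`, have `4D` equal to the minimum `κa` and to `κa + 4κb`.
-- Divisibility gives `a ∣ 4b`, hence `a ∣ 4`.
theorem eq_one_of_four_mul_defect_eq (hodd : a % 2 = 1) (hab : a.Coprime b) {c : k} (hκ0 : 0 < κ)
    (hc : 4 * defect W a b κ (Polynomial.X - C c) = κ * (a * (a + 4 * b))) : a = 1 := by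
  have hX : (Polynomial.X - C c : k[X]) ≠ 0 := X_sub_C_ne_zero c
  -- Three or one, according to whether `a` is 1 or 3 modulo 4.
  obtain ⟨r, i, hi⟩ : ∃ r i, 4 * i = 1 + (a + 4 * b) * r := by
    rcases (show a % 4 = 1 ∨ a % 4 = 3 by omega) with h | h
    · exact ⟨3, (1 + (a + 4 * b) * 3) / 4, by omega⟩
    · exact ⟨1, (1 + (a + 4 * b) * 1) / 4, by omega⟩
  have hQ := pow_ne_zero r hX
  have hdeg : ((Polynomial.X - C c) ^ r).natDegree = r := by
    rw [natDegree_pow, natDegree_X_sub_C, mul_one]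
  have h0 := lead_coneEl (b := b) (Q := (Polynomial.X - C c) ^ r) (i := i) (m := 0) ha
    (by rw [hdeg]; omega)
  have h1 := lead_coneEl (b := b) (Q := (Polynomial.X - C c) ^ r) (i := i) (m := 1) ha
    (by rw [hdeg]; omega)
  have hD0 := h0.D_add_defect hW ha hb hκ hQ (by omega)
  have hD1 := h1.D_add_defect hW ha hb hκ hQ (by omega)
  rw [defect_pow hW ha hb hκ hX] at hD0 hD1
  have e0 : 4 * (κ * (a * i + b * 0)) = κ * (a * (4 * i)) := by ring
  have e1 : 4 * (κ * (a * i + b * 1)) = κ * (a * (4 * i)) + κ * (4 * b) := by ring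
  have e2 : κ * (a * (1 + (a + 4 * b) * r)) = κ * a + r * (κ * (a * (a + 4 * b))) := by ring
  have e3 : r * (4 * defect W a b κ (Polynomial.X - C c)) =
    4 * (r * defect W a b κ (Polynomial.X - C c)) := by ring
  rw [hi, e2] at e0 e1
  rw [hc] at e3
  have h2 : 4 * W.D (coneEl a b i 0 ((Polynomial.X - C c) ^ r)) = κ * a := by omega
  have h3 : 4 * W.D (coneEl a b i 1 ((Polynomial.X - C c) ^ r)) = κ * a + κ * (4 * b) := by omega
  have hpos : 0 < κ * a := Nat.mul_pos hκ0 ha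
  have h4 := dvd_D (W := W) (h0.ne_zero hb hQ) (by omega) (fun f hf hD => by
    have := le_four_mul_D hW ha hb hκ hab hκ0 hc hf hD
    omega) (h1.ne_zero hb hQ)
  have h5 := Nat.mul_dvd_mul_left 4 h4
  rw [h2, h3, Nat.dvd_add_right (dvd_refl _)] at h5
  have h6 := Nat.dvd_of_mul_dvd_mul_left hκ0 h5
  have h7 : a ∣ 4 := hab.dvd_of_dvd_mul_right h6
  have h8 : a ≤ 4 := Nat.le_of_dvd (by norm_num) h7
  interval_cases a <;> omega

end Cone

/-- If an exponential map of the coordinate ring kills an element whose leading part vanishes for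
`v^a = c x^(2b)`, with `a` odd and prime to `b`, then `a = 1`. -/
theorem eq_one_of_expMap (X : ExpMap k (Coord k)) (hX : ∃ f, ∃ i, 0 < i ∧ X.E i f ≠ 0) {a b : ℕ}
    (hb : 0 < b) (hodd : a % 2 = 1) (hab : a.Coprime b) {T : Coord k} {i m : ℕ} {Q : k[X]} {c : k}
    (hT : Lead a b T i m Q) (hQ : Q ≠ 0) (h : m + (a + 4 * b) * Q.natDegree ≤ 4 * i) (hc : c ≠ 0)
    (hQc : Q.eval c = 0) (hXT : ∀ i, 0 < i → X.E i T = 0) : a = 1 := by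
  have ha : 0 < a := by omega
  obtain ⟨W, hW, g, hg, hgD⟩ := exists_weighted X (a := a) (b := 2 * b) (by omega) hX
  have hD : W.D T = 0 := by
    by_contra h0
    exact (attains_D (W := W) (hT.ne_zero hb hQ)).1 (hXT _ (Nat.pos_of_ne_zero h0))
  have h1 := mul_D_eq_of_D_eq_zero hW ha hb hT hQ h hD hc hQc
  have hcop : a.Coprime (a + 4 * b) := by
    have h2 : a.Coprime 4 := by
      have : a.Coprime 2 := (Nat.coprime_two_right).mpr (Nat.odd_iff.mpr hodd)
      exact Nat.Coprime.pow_right 2 this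
    rw [Nat.coprime_self_add_right]
    exact h2.mul_right hab
  obtain ⟨κ, h2⟩ : a ∣ W.D (t k) := hcop.dvd_of_dvd_mul_left (by rw [← h1]; exact dvd_mul_right _ _)
  have h3 : W.D (el k 1 4 (by decide)) = (a + 4 * b) * κ := by
    rw [h2] at h1
    exact Nat.eq_of_mul_eq_mul_left ha (by rw [h1]; ring)
  have hκ : ∀ j m (h : m ≤ 4 * j), W.D (el k j m h) = κ * (a * j + b * m) := by
    intro j m h
    have h4 := four_mul_D_el hW ha hb h
    rw [h2, h3] at h4
    obtain ⟨e, he⟩ : ∃ e, 4 * j = m + e := ⟨4 * j - m, by omega⟩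
    have h5 : 4 * (κ * (a * j + b * m)) = κ * (a * (4 * j) + 4 * b * m) := by ring
    rw [he, Nat.add_sub_cancel_left] at h4
    rw [he] at h5
    have h6 : κ * (a * (m + e) + 4 * b * m) = e * (a * κ) + m * ((a + 4 * b) * κ) := by ring
    omega
  -- With `κ = 0` the function `D` would vanish on all monomials and hence on every element, but it
  -- is positive at `g`.
  have hκ0 : 0 < κ := by
    rw [Nat.pos_iff_ne_zero]
    rintro rfl
    obtain ⟨c', hc', hg'⟩ := exists_eq_sum_el g
    have h4 : ∀ i ∈ c'.support, c' i ≠ 0 := fun i hi => Finsupp.mem_support_iff.mp hi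
    have hel0 : ∀ i : Idx, el k i.1.1 i.1.2 i.2 ≠ 0 := fun i =>
      (lead_el ha (b := b) i.2).ne_zero hb one_ne_zero
    obtain ⟨i, hi, h5, h6⟩ := exists_D_le (W := W) (s := c'.support)
      (f := fun i => c' i • el k i.1.1 i.1.2 i.2) (by rw [← hg']; exact hg) (by
        intro i hi _
        rw [← hg']
        have h7 := natDegree_el_le (a := a) (b := 2 * b) (by omega) hc' hi
        change (W.G _).natDegree ≤ (W.G _).natDegree
        rw [map_smul]
        refine (natDegree_smul_le _ _).trans ?_
        rw [hW]; exact h7)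
    rw [← hg', D_smul (h4 i hi) (hel0 i), hκ] at h6
    omega
  exact eq_one_of_four_mul_defect_eq hW ha hb hκ hodd hab hκ0 (four_mul_defect_eq hW ha hb hκ hT hQ h hD hQc)

end Chart

namespace Chart

/-! ### The exponential map defined by the translations of `v` -/

theorem coeff_sum_hasseDeriv (n : ℕ) (f : Chart k) (i : ℕ) :
    (∑ i ∈ f.support, monomial i (hasseDeriv n (f.coeff i))).coeff i =
      hasseDeriv n (f.coeff i) := by
  rw [finsetSum_coeff]
  simp only [coeff_monomial]
  rw [Finset.sum_ite_eq']
  split_ifs with h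
  · rfl
  · rw [notMem_support_iff.mp h, map_zero]

/-- The Hasse derivative with respect to `v`. -/
def hasse (n : ℕ) : Chart k →ₗ[k] Chart k where
  toFun f := ∑ i ∈ f.support, monomial i (hasseDeriv n (f.coeff i))
  map_add' f g := Polynomial.ext fun i => by
    rw [coeff_sum_hasseDeriv, coeff_add, coeff_add, coeff_sum_hasseDeriv, coeff_sum_hasseDeriv,
      map_add]
  map_smul' a f := Polynomial.ext fun i => by
    rw [coeff_sum_hasseDeriv, coeff_smul, RingHom.id_apply, coeff_smul, coeff_sum_hasseDeriv,
      map_smul]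

theorem coeff_hasse (n : ℕ) (f : Chart k) (i : ℕ) :
    (hasse n f).coeff i = hasseDeriv n (f.coeff i) :=
  coeff_sum_hasseDeriv n f i

theorem hasse_zero (f : Chart k) : hasse 0 f = f := by
  refine Polynomial.ext fun i => ?_
  rw [coeff_hasse, hasseDeriv_zero']

theorem hasse_C (n : ℕ) (p : k[X]) : hasse n (C p) = C (hasseDeriv n p) := by
  refine Polynomial.ext fun i => ?_
  rw [coeff_hasse, coeff_C, coeff_C]
  split_ifs
  · rfl
  · rw [map_zero]

theorem hasse_one {n : ℕ} (hn : 0 < n) : hasse n (1 : Chart k) = 0 := by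
  rw [← C_1, hasse_C, hasseDeriv_apply_one _ hn, C_0]

theorem hasse_x_mul (n : ℕ) (f : Chart k) : hasse n (x k * f) = x k * hasse n f := by
  refine Polynomial.ext fun i => ?_
  rw [coeff_hasse, x]
  cases i with
  | zero => rw [coeff_X_mul_zero, coeff_X_mul_zero, map_zero]
  | succ i => rw [coeff_X_mul, coeff_X_mul, coeff_hasse]

theorem hasse_mul (n : ℕ) (f g : Chart k) :
    hasse n (f * g) = ∑ p ∈ Finset.HasAntidiagonal.antidiagonal n, hasse p.1 f * hasse p.2 g := by
  refine Polynomial.ext fun i => ?_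
  rw [coeff_hasse, coeff_mul, map_sum, finsetSum_coeff]
  simp only [hasseDeriv_mul, coeff_mul, coeff_hasse]
  exact Finset.sum_comm

theorem hasse_hasse (i j : ℕ) (f : Chart k) :
    hasse i (hasse j f) = ((i + j).choose i : k) • hasse (i + j) f := by
  refine Polynomial.ext fun l => ?_
  rw [coeff_hasse, coeff_hasse, coeff_smul, coeff_hasse, ← LinearMap.comp_apply, hasseDeriv_comp,
    LinearMap.smul_apply, Nat.cast_smul_eq_nsmul]

theorem exists_hasse_eq_zero (f : Chart k) : ∃ N, ∀ n, N < n → hasse n f = 0 := by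
  refine ⟨∑ i ∈ f.support, (f.coeff i).natDegree, fun n hn => Polynomial.ext fun i => ?_⟩
  rw [coeff_hasse, coeff_zero]
  by_cases h : i ∈ f.support
  · exact hasseDeriv_eq_zero_of_lt_natDegree _ _ ((Finset.single_le_sum
      (f := fun i => (f.coeff i).natDegree) (fun _ _ => Nat.zero_le _) h).trans_lt hn)
  · rw [notMem_support_iff.mp h, map_zero]

/-- The values of the forms of degree `d`. -/
def evSub (k : Type u) [Field k] (d : ℕ) : Submodule k (Chart k) :=
  (MvPolynomial.homogeneousSubmodule (Fin 3) k d).map (ev k).toLinearMap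

theorem mul_mem_evSub {d e : ℕ} {f g : Chart k} (hf : f ∈ evSub k d) (hg : g ∈ evSub k e) :
    f * g ∈ evSub k (d + e) := by
  obtain ⟨F, hF, rfl⟩ := hf
  obtain ⟨G, hG, rfl⟩ := hg
  exact ⟨F * G, MvPolynomial.IsHomogeneous.mul hF hG, map_mul (ev k) F G⟩

theorem x_mem_evSub : x k ∈ evSub k 1 :=
  ⟨MvPolynomial.X 0, MvPolynomial.isHomogeneous_X k 0, ev_X0⟩

theorem y_mem_evSub : y k ∈ evSub k 1 :=
  ⟨MvPolynomial.X 1, MvPolynomial.isHomogeneous_X k 1, ev_X1⟩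

theorem w_mem_evSub : w k ∈ evSub k 1 := by
  rw [← neg_neg (w k)]
  exact Submodule.neg_mem _ ⟨MvPolynomial.X 2, MvPolynomial.isHomogeneous_X k 2, ev_X2⟩

theorem one_mem_evSub : (1 : Chart k) ∈ evSub k 0 :=
  ⟨1, MvPolynomial.isHomogeneous_one _ _, map_one (ev k)⟩

/-- The functions whose Hasse derivatives are values of forms of degree `d`. -/
def evStable (d : ℕ) (f : Chart k) : Prop := ∀ n, hasse n f ∈ evSub k d

theorem evStable.mul {d e : ℕ} {f g : Chart k} (hf : evStable d f) (hg : evStable e g) :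
    evStable (d + e) (f * g) := fun n => by
  rw [hasse_mul]
  exact Submodule.sum_mem _ fun p _ => mul_mem_evSub (hf _) (hg _)

theorem evStable_one : evStable 0 (1 : Chart k) := fun n => by
  rcases Nat.eq_zero_or_pos n with rfl | hn
  · rw [hasse_zero]; exact one_mem_evSub
  · rw [hasse_one hn]; exact Submodule.zero_mem _

theorem evStable.pow {d : ℕ} {f : Chart k} (hf : evStable d f) (r : ℕ) :
    evStable (r * d) (f ^ r) := by
  induction r with
  | zero => simpa using evStable_one
  | succ r ih => simpa only [pow_succ, add_mul, one_mul] using ih.mul hf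

theorem hasse_x (n : ℕ) : hasse n (x k) = if n = 0 then x k else 0 := by
  have := hasse_x_mul n (1 : Chart k)
  rw [mul_one] at this
  rw [this]
  split_ifs with h
  · rw [h, hasse_zero, mul_one]
  · rw [hasse_one (Nat.pos_of_ne_zero h), mul_zero]

theorem evStable_x : evStable 1 (x k) := fun n => by
  rw [hasse_x]
  split_ifs
  · exact x_mem_evSub
  · exact Submodule.zero_mem _

theorem evStable_y : evStable 1 (y k) := fun n => by
  rcases Nat.lt_trichotomy n 1 with h | rfl | h
  · obtain rfl : n = 0 := by omega
    rw [hasse_zero]; exact y_mem_evSub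
  · rw [y, map_add, hasse_one one_pos, hasse_x_mul, v, hasse_C, hasseDeriv_one', derivative_X, C_1,
      mul_one, zero_add]
    exact x_mem_evSub
  · rw [y, map_add, hasse_one (by omega), hasse_x_mul, v, hasse_C, hasseDeriv_X _ h, C_0, mul_zero,
      zero_add]
    exact Submodule.zero_mem _

theorem evStable_w : evStable 1 (w k) := fun n => by
  have hw : w k = C (2 * X) + x k * C (X ^ 2) := by
    rw [C_mul, C_pow, w, v]; rfl
  have h2 : (2 * X : k[X]) = (2 : k) • X := by rw [smul_eq_C_mul]; rfl
  rcases Nat.lt_trichotomy n 2 with h | rfl | h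
  · rcases (show n = 0 ∨ n = 1 by omega) with rfl | rfl
    · rw [hasse_zero]; exact w_mem_evSub
    · have : hasse 1 (w k) = (2 : k) • y k := by
        rw [hw, map_add, hasse_x_mul, hasse_C, hasse_C, hasseDeriv_one', hasseDeriv_one', h2,
          derivative_smul, derivative_X, derivative_X_pow, y, v, smul_eq_C_mul]
        simp [Algebra.smul_def]
        ring
      rw [this]
      exact Submodule.smul_mem _ _ y_mem_evSub
  · have : hasse 2 (w k) = x k := by
      rw [hw, map_add, hasse_x_mul, hasse_C, hasse_C, h2, map_smul, hasseDeriv_X _ (by norm_num),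
        ← monomial_one_right_eq_X_pow, hasseDeriv_monomial]
      simp
    rw [this]
    exact x_mem_evSub
  · have : hasse n (w k) = 0 := by
      rw [hw, map_add, hasse_x_mul, hasse_C, hasse_C,
        hasseDeriv_eq_zero_of_lt_natDegree (X ^ 2) n (by rw [natDegree_X_pow]; exact h), h2,
        map_smul, hasseDeriv_X _ (by omega)]
      simp
    rw [this]
    exact Submodule.zero_mem _

/-- The Hasse derivatives of `x`, `y`, `w` are linear forms in `x`, `y`, `w`, so by the Leibniz
formula those of a form of degree `2j` are again forms of degree `2j`. -/
theorem hasse_mem {f : Chart k} (hf : f ∈ coordRing k) (n : ℕ) : hasse n f ∈ coordRing k := by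
  obtain ⟨c, rfl⟩ := mem_coordRing_iff.mp hf
  rw [ofCoeff_apply, map_sum]
  refine Subalgebra.sum_mem _ fun i _ => ?_
  rw [map_smul]
  refine Subalgebra.smul_mem _ ?_ _
  obtain ⟨⟨j, m⟩, h⟩ := i
  simp only at h
  obtain ⟨F, hF, hF'⟩ := ((evStable_x (k := k).pow (2 * j - (m + 1) / 2)).mul
    (evStable_y.pow (m % 2))).mul (evStable_w.pow (m / 2)) n
  have hd : (2 * j - (m + 1) / 2) * 1 + m % 2 * 1 + m / 2 * 1 = 2 * j := by omega
  rw [hd] at hF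
  have := ev_mem (n := j) hF
  rwa [show ev k F = _ from hF'] at this

/-- The exponential map of the coordinate ring defined by the translations of `v`. -/
def translations (k : Type u) [Field k] : ExpMap k (Coord k) where
  E n :=
    { toFun := fun f => ofChart (hasse n (toChart f)) (hasse_mem (toChart_mem f) n)
      map_add' := fun f g => toChart_injective (by simp)
      map_smul' := fun a f => toChart_injective (by simp) }
  E_zero f := toChart_injective (hasse_zero _)
  E_mul n f g := toChart_injective (by
    rw [map_sum]
    simp only [LinearMap.coe_mk, AddHom.coe_mk, toChart_ofChart, map_mul, hasse_mul])
  E_one n hn := toChart_injective (by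
    simp only [LinearMap.coe_mk, AddHom.coe_mk, toChart_ofChart, map_one, map_zero, hasse_one hn])
  E_comp i j f := toChart_injective (by
    simp only [LinearMap.coe_mk, AddHom.coe_mk, toChart_ofChart, map_smul, hasse_hasse])
  finite f := by
    obtain ⟨N, hN⟩ := exists_hasse_eq_zero (toChart f)
    exact ⟨N, fun i hi => toChart_injective (by
      simp only [LinearMap.coe_mk, AddHom.coe_mk, toChart_ofChart, map_zero, hN i hi])⟩

theorem toChart_translations (n : ℕ) (f : Coord k) :
    toChart ((translations k).E n f) = hasse n (toChart f) := rfl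

theorem translations_t {n : ℕ} (hn : 0 < n) : (translations k).E n (t k) = 0 :=
  toChart_injective (by
    rw [toChart_translations, toChart_t, pow_two, hasse_x_mul, hasse_x, if_neg hn.ne', mul_zero,
      map_zero])

theorem translations_xy : (translations k).E 1 (xy k) = t k :=
  toChart_injective (by
    rw [toChart_translations, toChart_t, toChart_xy, pow_two, hasse_x_mul, y, map_add,
      hasse_one one_pos, hasse_x_mul, v, hasse_C, hasseDeriv_one', derivative_X, C_1, mul_one,
      zero_add])

/-- The conjugate of an exponential map by an automorphism. -/
def _root_.ConicComplement.ExpMap.conj {R : Type*} [CommRing R] [Algebra k R] (X : ExpMap k R)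
    (φ : R ≃ₐ[k] R) : ExpMap k R where
  E n := φ.symm.toLinearMap ∘ₗ X.E n ∘ₗ φ.toLinearMap
  E_zero f := by simp [X.E_zero]
  E_mul n f g := by simp [X.E_mul, map_sum]
  E_one n hn := by simp [X.E_one n hn]
  E_comp i j f := by simp [X.E_comp]
  finite f := by
    obtain ⟨N, hN⟩ := X.finite (φ f)
    exact ⟨N, fun i hi => by simp [hN i hi]⟩

/-- If the leading part of `φ⁻¹(t)` vanishes for `v^a = c x^(2b)`, with `a` odd and prime to `b`,
then `a = 1`. -/
theorem eq_one_of_lead_symm_t (φ : AutRing k) {a b : ℕ} (hb : 0 < b) (hodd : a % 2 = 1)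
    (hab : a.Coprime b) {i m : ℕ} {Q : k[X]} {c : k} (hT : Lead a b (φ.symm (t k)) i m Q)
    (hQ : Q ≠ 0) (h : m + (a + 4 * b) * Q.natDegree ≤ 4 * i) (hc : c ≠ 0)
    (hQc : Q.eval c = 0) : a = 1 := by
  have hE : ∀ n f, ((translations k).conj φ).E n (φ.symm f) =
      φ.symm ((translations k).E n f) := fun n f => by
    change φ.symm ((translations k).E n (φ (φ.symm f))) = _
    rw [φ.apply_symm_apply]
  refine eq_one_of_expMap ((translations k).conj φ) ⟨φ.symm (xy k), 1, one_pos, ?_⟩ hb hodd hab hT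
    hQ h hc hQc fun i hi => ?_
  · rw [hE, translations_xy]
    exact autRing_t_ne_zero φ.symm
  · rw [hE, translations_t hi, map_zero]

end Chart

/-! ### Descent on the degree -/

namespace Chart

/-! ### Generation of the group of automorphisms -/

/-- The algebraic elements of `k(v)` are constant. -/
theorem exists_algebraMap_eq_of_aeval_eq_zero {y : FractionRing k[X]} {Q : k[X]} (hQ : Q ≠ 0)
    (h : aeval y Q = 0) : ∃ c : k, y = algebraMap k _ c := by
  have h1 : IsIntegral k y := isAlgebraic_iff_isIntegral.mp ⟨Q, hQ, h⟩
  obtain ⟨p, rfl⟩ := IsIntegrallyClosed.isIntegral_iff.mp (h1.tower_top (A := k[X]))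
  rw [aeval_algebraMap_apply, map_eq_zero_iff _ (IsFractionRing.injective k[X] _)] at h
  have h2 : Q.comp p = 0 := h
  rw [comp_eq_zero_iff] at h2
  obtain ⟨-, h3⟩ := h2.resolve_left hQ
  exact ⟨p.coeff 0, by conv_lhs => rw [h3]
                       rw [IsScalarTower.algebraMap_apply k k[X]]; rfl⟩

/-- The automorphism `φ`, followed by the embedding into `k(v)[x]`. -/
def fracHom (φ : AutRing k) : Coord k →ₐ[k] (FractionRing k[X])[X] :=
  ((mapAlgHom (IsScalarTower.toAlgHom k k[X] (FractionRing k[X]))).comp toChart).comp φ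

theorem natDegree_fracHom (φ : AutRing k) (f : Coord k) : (fracHom φ f).natDegree = deg (φ f) :=
  natDegree_map_eq_of_injective (IsFractionRing.injective k[X] _) _

theorem fracHom_ne_zero (φ : AutRing k) {f : Coord k} (hf : f ≠ 0) : fracHom φ f ≠ 0 :=
  (Polynomial.map_ne_zero_iff (IsFractionRing.injective k[X] (FractionRing k[X]))).mpr
    (toChart_ne_zero ((map_ne_zero_iff φ φ.injective).mpr hf))

theorem top_fracHom (φ : AutRing k) {f : Coord k} {n : ℕ} (h : deg (φ f) ≤ n) :
    Top (fracHom φ f) n ((fracHom φ f).coeff n) :=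
  ⟨(natDegree_fracHom φ f).trans_le h, rfl⟩

theorem top_fracHom_self (φ : AutRing k) (f : Coord k) :
    Top (fracHom φ f) (deg (φ f)) (fracHom φ f).leadingCoeff := by
  rw [← natDegree_fracHom]; exact Top.self _

theorem deg_le_of_top {φ : AutRing k} {f : Coord k} {n : ℕ} {c : FractionRing k[X]}
    (h : Top (fracHom φ f) n c) : deg (φ f) ≤ n := (natDegree_fracHom φ f).symm.trans_le h.1

theorem deg_lt_of_top {φ : AutRing k} {f : Coord k} {n : ℕ} (hn : 0 < n)
    (h : Top (fracHom φ f) n 0) : deg (φ f) < n := by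
  rw [← natDegree_fracHom]
  refine lt_of_le_of_ne h.1 fun h1 => ?_
  have h2 : (fracHom φ f).leadingCoeff = 0 := by rw [leadingCoeff, h1, h.2]
  rw [leadingCoeff_eq_zero] at h2
  rw [h2, natDegree_zero] at h1
  omega

theorem top_of_topPoly (G : Coord k →ₐ[k] (FractionRing k[X])[X]) {a b d : ℕ}
    {θ₀ θ₁ : FractionRing k[X]} (hA : Top (G (t k)) (d * a) θ₀) (h0 : θ₀ ≠ 0)
    (hB : Top (G (xy k)) (d * a + d * b) θ₁) (ha : 0 < a) (hd : 0 < d) {f : Coord k}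
    {c : Idx →₀ k} (hc : toChart f = ofCoeff k c) {M : ℕ}
    (hM : ∀ i ∈ c.support, a * i.1.1 + b * i.1.2 ≤ M) :
    Top (G f) (d * M) (∑ i ∈ c.support with a * i.1.1 + b * i.1.2 = M,
      c i • (θ₀ ^ i.1.1 * (θ₁ / θ₀) ^ i.1.2)) := by
  have hmul : ∀ i : Idx, i.1.1 * (d * a) + i.1.2 * (d * b) = d * (a * i.1.1 + b * i.1.2) :=
    fun i => by ring
  have h1 := top_sum_el_of_top G hA h0 hB (Nat.add_pos_left (Nat.mul_pos hd ha) _) c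
    (M := d * M) (fun i hi => by rw [hmul]; exact Nat.mul_le_mul_left d (hM i hi))
  have hf : f = ∑ i ∈ c.support, c i • el k i.1.1 i.1.2 i.2 := by
    refine toChart_injective ?_
    rw [hc, ofCoeff_apply, map_sum]
    simp [monoIdx]
  rw [← hf] at h1
  simp only [hmul, Nat.mul_right_inj hd.ne'] at h1
  exact h1

theorem deg_autRing_t_pos (φ : AutRing k) : 0 < deg (φ (t k)) := by
  have := natDegree_autRing_t_mod φ
  change deg (φ (t k)) % 4 = 2 at this
  omega

/-- The automorphisms for which `xy/t` is not constant at infinity preserve the degree up to a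
factor, so that they preserve it. -/
theorem mem_degSub_of_top {φ : AutRing k} (h : deg (φ (xy k)) ≤ deg (φ (t k)))
    (h' : ∀ c : k, (fracHom φ (xy k)).coeff (deg (φ (t k))) ≠
      algebraMap k _ c * (fracHom φ (t k)).leadingCoeff) : φ ∈ degSub k := by
  set n := deg (φ (t k)) with hn
  have hn0 : 0 < n := deg_autRing_t_pos φ
  have hA := top_fracHom_self φ (t k)
  have h0 : (fracHom φ (t k)).leadingCoeff ≠ 0 :=
    leadingCoeff_ne_zero.mpr (fracHom_ne_zero φ t_ne_zero)
  have hB := top_fracHom φ h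
  set θ₀ := (fracHom φ (t k)).leadingCoeff
  set θ₁ := (fracHom φ (xy k)).coeff n
  have key : ∀ f, f ≠ 0 → 2 * deg (φ f) = n * deg f := by
    intro f hf
    obtain ⟨c, hc, -⟩ := exists_eq_sum_el f
    have hc0 : c ≠ 0 := by
      rintro rfl
      exact hf (toChart_injective (by rw [hc, map_zero, map_zero]))
    obtain ⟨i₁, hi₁, hmax, hdeg, -, -⟩ := exists_natDegree_ofCoeff hc0
    have h1 := top_of_topPoly (fracHom φ) (a := 1) (b := 0) (d := n) (by simpa using hA) h0
      (by simpa using hB) one_pos hn0 hc (M := i₁.1.1) (fun i hi => by simpa using hmax i hi)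
    obtain ⟨i, m, Q, hQ, -, -, hsum⟩ := exists_topPoly (a := 1) (b := 0) one_pos
      (Nat.coprime_zero_right 1 |>.mpr rfl) c (M := i₁.1.1) ⟨i₁, hi₁, by simp⟩
    rw [hsum _ θ₀ (θ₁ / θ₀) h0, pow_one, pow_zero, div_one] at h1
    -- A nonconstant element of `k(v)` is transcendental, so `Q` does not vanish at it, leading
    -- terms do not cancel, and `φ` multiplies all degrees by `n / 2`.
    have h2 : ∀ c : k, θ₁ / θ₀ ≠ algebraMap k _ c := fun c h => h' c ((div_eq_iff h0).mp h)
    have h3 : θ₁ / θ₀ ≠ 0 := fun h => h2 0 (by rw [h, map_zero])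
    have h4 : aeval (θ₁ / θ₀) Q ≠ 0 := fun h => by
      obtain ⟨c, hc⟩ := exists_algebraMap_eq_of_aeval_eq_zero hQ h
      exact h2 c hc
    have h5 := h1.natDegree (mul_ne_zero (mul_ne_zero (pow_ne_zero _ h0) (pow_ne_zero _ h3)) h4)
    rw [natDegree_fracHom] at h5
    rw [← hc] at hdeg
    change deg f = 2 * i₁.1.1 at hdeg
    rw [h5, hdeg]; ring
  -- For `f = φ⁻¹(t)` the product of `n` and an even degree is 4, while `n` is 2 modulo 4.
  have h2 : n = 2 := by
    have h3 := key (φ.symm (t k)) ((map_ne_zero_iff φ.symm φ.symm.injective).mpr t_ne_zero)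
    rw [φ.apply_symm_apply, deg_t] at h3
    obtain ⟨l, hl⟩ := even_natDegree (toChart_mem (φ.symm (t k)))
    change deg (φ.symm (t k)) = l + l at hl
    have h4 := natDegree_autRing_t_mod φ
    change n % 4 = 2 at h4
    rw [hl] at h3
    have h5 : n * l = 2 := by
      have : n * (l + l) = 2 * (n * l) := by ring
      omega
    have h6 := Nat.le_of_dvd (by norm_num) (Dvd.intro _ h5)
    interval_cases n <;> omega
  intro f
  by_cases hf : f = 0
  · rw [hf, map_zero]
  · have := key f hf
    rw [h2] at this
    omega

/-- The inequality leaves only the exponents `(0, 0)` and `(1, 0)`, so `φ⁻¹(t)` is affine in `t`. -/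
theorem mem_fibSub_of_deg {φ : AutRing k} {A B : ℕ} (hA : 2 ≤ A) (hB : 0 < B)
    (h : ∃ c : Idx →₀ k, toChart (φ.symm (t k)) = ofCoeff k c ∧
      ∀ i ∈ c.support, A * i.1.1 + B * i.1.2 ≤ 2) : φ ∈ fibSub k := by
  obtain ⟨c, hc, hM⟩ := h
  have h1 : φ.symm (t k) = c ⟨(1, 0), by decide⟩ • t k +
      algebraMap k _ (c ⟨(0, 0), by decide⟩) := by
    have hz : ∀ i : Idx, i ≠ ⟨(1, 0), by decide⟩ → i ≠ ⟨(0, 0), by decide⟩ → c i = 0 := by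
      intro i hi hi'
      by_contra h0
      have h2 := hM i (Finsupp.mem_support_iff.mpr h0)
      obtain ⟨⟨j, m⟩, hjm⟩ := i
      simp only at h2 hjm
      have hj : j ≤ 1 := by
        by_contra hj
        have : A * 2 ≤ A * j := Nat.mul_le_mul_left A (by omega)
        omega
      rcases (show j = 0 ∨ j = 1 by omega) with rfl | rfl
      · obtain rfl : m = 0 := by omega
        exact hi' rfl
      · have : m = 0 := by
          by_contra hm
          have := Nat.mul_le_mul hB (Nat.pos_of_ne_zero hm)
          omega
        subst this
        exact hi rfl
    refine toChart_injective ?_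
    have h3 : c = Finsupp.single ⟨(1, 0), by decide⟩ (c ⟨(1, 0), by decide⟩) +
        Finsupp.single ⟨(0, 0), by decide⟩ (c ⟨(0, 0), by decide⟩) := by
      classical
      ext i
      rw [Finsupp.add_apply, Finsupp.single_apply, Finsupp.single_apply]
      by_cases hi : i = ⟨(1, 0), by decide⟩
      · subst hi; rw [if_pos rfl, if_neg (by simp), add_zero]
      · by_cases hi' : i = ⟨(0, 0), by decide⟩
        · subst hi'; rw [if_neg (by simp), if_pos rfl, zero_add]
        · rw [if_neg (Ne.symm hi), if_neg (Ne.symm hi'), hz i hi hi', add_zero]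
    rw [hc]
    conv_lhs => rw [h3]
    rw [map_add, ofCoeff_single, ofCoeff_single, map_add, map_smul, AlgHom.commutes]
    congr 1
    simp [monoIdx, mono, Algebra.algebraMap_eq_smul_one]
  have h2 : φ.symm ∈ fibSub k := mem_fibSub_of_eq h1
  have h3 := (fibSub k).inv_mem h2
  rwa [show (φ.symm : AutRing k)⁻¹ = φ from inv_inv φ] at h3

/-- An automorphism for which `deg φ(xy) > deg φ(t)` belongs to `fibSub`, or it can be simplified
by an element of `fibSub`. -/
theorem mem_fibSub_or_exists_deg_lt {φ : AutRing k} {B : ℕ} (hB : 0 < B)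
    (hφ : deg (φ (xy k)) = deg (φ (t k)) + B) : φ ∈ fibSub k ∨
      ∃ s : k[X], ∀ m (hm : m ≤ 4 * 1),
        deg ((φ * fib s) (el k 1 m hm)) < deg (φ (t k)) + 4 * B := by
  set A := deg (φ (t k)) with hAdef
  have hA4 : A % 4 = 2 := natDegree_autRing_t_mod φ
  have hB2 : B % 2 = 0 := by
    obtain ⟨l, hl⟩ := even_natDegree (toChart_mem (φ (xy k)))
    change deg (φ (xy k)) = l + l at hl
    omega
  have htop0 := top_fracHom_self φ (t k)
  have h0 : (fracHom φ (t k)).leadingCoeff ≠ 0 :=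
    leadingCoeff_ne_zero.mpr (fracHom_ne_zero φ t_ne_zero)
  have htop1 := top_fracHom_self φ (xy k)
  have hxy0 : xy k ≠ 0 := fun h => by
    have := deg_xy (k := k)
    rw [h, deg, map_zero, natDegree_zero] at this
    omega
  have h1 : (fracHom φ (xy k)).leadingCoeff ≠ 0 :=
    leadingCoeff_ne_zero.mpr (fracHom_ne_zero φ hxy0)
  rw [hφ] at htop1
  set θ₀ := (fracHom φ (t k)).leadingCoeff
  set θ₁ := (fracHom φ (xy k)).leadingCoeff
  obtain ⟨d, a, b, hd, hab, hda, hdb⟩ : ∃ d a b, 0 < d ∧ a.Coprime b ∧ A = d * a ∧ B = d * b := by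
    obtain ⟨d, a, b, h1, h2, h3, h4⟩ := Nat.exists_coprime' (m := A) (n := B) (Nat.gcd_pos_of_pos_right _ hB)
    exact ⟨d, a, b, h1, h2, by rw [h3]; ring, by rw [h4]; ring⟩
  have ha : 0 < a := Nat.pos_of_ne_zero fun h => by rw [h] at hda; omega
  have hb : 0 < b := Nat.pos_of_ne_zero fun h => by rw [h] at hdb; omega
  obtain ⟨c, M, i, m, Q, hc, hQ, hcone, hlead, hM1, hM2, hsum⟩ := exists_lead (b := b) ha hab
    ((map_ne_zero_iff φ.symm φ.symm.injective).mpr (t_ne_zero (k := k)))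
  have htop := top_of_topPoly (fracHom φ) (a := a) (b := b) (d := d) (by rwa [← hda]) h0
    (by rwa [← hda, ← hdb]) ha hd hc hM2
  rw [hsum _ θ₀ (θ₁ / θ₀) h0] at htop
  -- The alternative is whether the leading terms cancel when `φ` is applied to the expansion of
  -- `φ⁻¹(t)`.
  by_cases hQΘ : aeval ((θ₁ / θ₀) ^ a / θ₀ ^ b) Q = 0
  · right
    -- A root of `Q` in `k(v)` is algebraic over `k`, hence constant.
    obtain ⟨e, he⟩ := exists_algebraMap_eq_of_aeval_eq_zero hQ hQΘ
    have he0 : e ≠ 0 := by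
      rintro rfl
      rw [map_zero, div_eq_zero_iff, pow_eq_zero_iff ha.ne', div_eq_zero_iff] at he
      exact he.elim (fun h => h.elim h1 h0) (pow_ne_zero _ h0)
    rw [he, aeval_algebraMap_apply, map_eq_zero_iff _ (algebraMap k _).injective] at hQΘ
    -- If `a` were even, `b` would be odd, so `d` would be even because `B` is, and 4 would divide
    -- `A`, which is 2 modulo 4.
    have hodd : a % 2 = 1 := by
      by_contra hev
      obtain ⟨a', ha'⟩ : ∃ a', a = 2 * a' := ⟨a / 2, by omega⟩
      have hbodd : b % 2 = 1 := by
        by_contra hbev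
        have := Nat.dvd_gcd (show 2 ∣ a by omega) (show 2 ∣ b by omega)
        rw [hab] at this
        omega
      have hdev : d % 2 = 0 := by
        have := hB2
        rw [hdb, Nat.mul_mod, hbodd] at this
        omega
      obtain ⟨d', hd'⟩ : ∃ d', d = 2 * d' := ⟨d / 2, by omega⟩
      have : A = 4 * (d' * a') := by rw [hda, ha', hd']; ring
      omega
    obtain rfl := eq_one_of_lead_symm_t φ hb hodd hab hlead hQ hcone he0 hQΘ
    rw [mul_one] at hda
    subst hda
    -- With `a = 1` the relation is `θ₁ = e θ₀^(b+1)`, so `e t^(b+1)` and `xy` have images with the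
    -- same leading term, and the difference has smaller degree.
    refine ⟨-(C e * X ^ b), fun m hm => ?_⟩
    have e0 : (φ * fib (-(C e * X ^ b)) : AutRing k) (t k) = φ (t k) := by rw [AlgEquiv.mul_apply, fib_t]
    have e1 : (φ * fib (-(C e * X ^ b)) : AutRing k) (xy k) = φ (xy k) - e • φ (t k) ^ (b + 1) := by
      rw [AlgEquiv.mul_apply, fib_xy, map_add, map_neg, map_mul, map_mul, aeval_C, map_pow, aeval_X,
        map_neg, map_mul, AlgEquiv.commutes, map_pow, Algebra.smul_def]
      ring
    set ψ := φ * fib (-(C e * X ^ b))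
    have hψ0 : Top (fracHom ψ (t k)) A θ₀ := by
      have : fracHom ψ (t k) = fracHom φ (t k) := by
        change (mapAlgHom _ (toChart (ψ (t k)))) = _
        rw [e0]; rfl
      rw [this]; exact htop0
    have hψ1 : deg (ψ (xy k)) < A + B := by
      have h2 : fracHom ψ (xy k) = fracHom φ (xy k) - e • fracHom φ (t k) ^ (b + 1) := by
        change (mapAlgHom _ (toChart (ψ (xy k)))) = _
        rw [e1, map_sub, map_sub, map_smul, map_smul, map_pow, map_pow]; rfl
      have h3 := (htop0.pow (b + 1)).smul e
      have h4 : (b + 1) * A = A + B := by rw [hdb]; ring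
      rw [h4] at h3
      have h5 := htop1.sub h3
      rw [← h2] at h5
      refine deg_lt_of_top (by omega) ?_
      convert h5
      rw [Algebra.smul_def, ← he, pow_one]
      field_simp
      ring
    -- The strict inequality for `ψ(xy)` is used as the bound with `B - 1`; it makes all five
    -- degrees at most `A + 4(B - 1)`.
    have h2 := top_el_of_top (fracHom ψ) hψ0 h0 (B := B - 1)
      (top_fracHom ψ (n := A + (B - 1)) (by omega)) (by omega) hm
    have h3 := deg_le_of_top h2
    have hm4 : m * (B - 1) ≤ 4 * (B - 1) := Nat.mul_le_mul_right _ hm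
    omega
  · left
    -- Without cancellation `2 = deg t = dM`, which bounds every exponent that occurs in `φ⁻¹(t)`.
    have h2 := htop.natDegree (mul_ne_zero (mul_ne_zero (pow_ne_zero _ h0)
      (pow_ne_zero _ (div_ne_zero h1 h0))) hQΘ)
    rw [natDegree_fracHom, φ.apply_symm_apply, deg_t] at h2
    refine mem_fibSub_of_deg (A := A) (B := B) (by omega) hB ⟨c, hc, fun i hi => ?_⟩
    have h3 : A * i.1.1 + B * i.1.2 = d * (a * i.1.1 + b * i.1.2) := by rw [hda, hdb]; ring
    rw [h3, h2]
    exact Nat.mul_le_mul_left d (hM2 i hi)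

/-- Descent on the highest degree of the images of the generators. When `φ(t)` has smaller degree
than some other generator, an element of `fibSub` lowers this maximum; when `φ(t)` has the highest
degree and `φ` is not in `degSub`, a linear automorphism leads back to the first case. -/
theorem mem_sup_of_deg_le (n : ℕ) : ∀ φ : AutRing k,
    (∀ m (hm : m ≤ 4 * 1), deg (φ (el k 1 m hm)) ≤ n) → φ ∈ degSub k ⊔ fibSub k := by
  induction n with
  | zero =>
    intro φ h
    have h1 := deg_autRing_t_pos φ
    have h2 := h 0 (by omega)
    change deg (φ (t k)) ≤ 0 at h2
    omega
  | succ n ih =>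
    -- the case of `deg φ(t) ≤ n`
    have hlow : ∀ φ : AutRing k, (∀ m (hm : m ≤ 4 * 1), deg (φ (el k 1 m hm)) ≤ n + 1) →
        deg (φ (t k)) ≤ n → φ ∈ degSub k ⊔ fibSub k := by
      intro φ h ht
      by_cases hlt : ∀ m (hm : m ≤ 4 * 1), deg (φ (el k 1 m hm)) ≤ n
      · exact ih φ hlt
      push Not at hlt
      obtain ⟨m, hm, hlt⟩ := hlt
      have h0 : (fracHom φ (t k)).leadingCoeff ≠ 0 :=
        leadingCoeff_ne_zero.mpr (fracHom_ne_zero φ t_ne_zero)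
      have hpos := deg_autRing_t_pos φ
      obtain ⟨B, hB, hφ⟩ : ∃ B, 0 < B ∧ deg (φ (xy k)) = deg (φ (t k)) + B := by
        by_contra! hc
        have h1 : deg (φ (xy k)) ≤ deg (φ (t k)) := by
          by_contra h2
          exact hc (deg (φ (xy k)) - deg (φ (t k))) (by omega) (by omega)
        have h2 := top_el_of_top (fracHom φ) (top_fracHom_self φ (t k)) h0 (B := 0)
          (top_fracHom φ h1) (by omega) hm
        have h3 := deg_le_of_top h2
        omega
      have hxy0 : (fracHom φ (xy k)).leadingCoeff ≠ 0 := by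
        rw [leadingCoeff_ne_zero]
        intro h1
        have h2 := natDegree_fracHom φ (xy k)
        rw [h1, natDegree_zero] at h2
        omega
      -- The left side is the exact degree of the image of `w²`.
      have h4 : deg (φ (t k)) + 4 * B ≤ n + 1 := by
        have h1 := top_fracHom_self φ (xy k)
        rw [hφ] at h1
        have h2 := top_el_of_top (fracHom φ) (top_fracHom_self φ (t k)) h0 h1 (by omega)
          (j := 1) (m := 4) (by omega)
        have h3 := h2.natDegree (mul_ne_zero (pow_ne_zero _ h0)
          (pow_ne_zero _ (div_ne_zero hxy0 h0)))
        rw [natDegree_fracHom] at h3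
        have h5 := h 4 (by omega)
        omega
      rcases mem_fibSub_or_exists_deg_lt hB hφ with h1 | ⟨s, hs⟩
      · exact Subgroup.mem_sup_right h1
      · have h2 := ih (φ * fib s) fun m hm => by have := hs m hm; omega
        have h3 := mul_mem h2 (Subgroup.mem_sup_right (inv_mem (fib_mem_fibSub s)) :
          (fib s)⁻¹ ∈ degSub k ⊔ fibSub k)
        rwa [mul_inv_cancel_right] at h3
    intro φ h
    by_cases ht : deg (φ (t k)) ≤ n
    · exact hlow φ h ht
    have htn : deg (φ (t k)) = n + 1 := le_antisymm (h 0 (by omega)) (by omega)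
    have hxy : deg (φ (xy k)) ≤ deg (φ (t k)) := by rw [htn]; exact h 1 (by omega)
    by_cases hc : ∃ c : k, (fracHom φ (xy k)).coeff (deg (φ (t k))) =
      algebraMap k _ c * (fracHom φ (t k)).leadingCoeff
    swap
    · push Not at hc
      exact Subgroup.mem_sup_left (mem_degSub_of_top hxy hc)
    obtain ⟨c, hc⟩ := hc
    have h0 : (fracHom φ (t k)).leadingCoeff ≠ 0 :=
      leadingCoeff_ne_zero.mpr (fracHom_ne_zero φ t_ne_zero)
    -- The shear makes the ratio of `xy` to `t` vanish at infinity; then the image of `w²` has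
    -- degree below `n + 1`, and the swap puts it in the place of `t`.
    set ψ := φ * fib (C (-c)) with hψ
    have e0 : ψ (t k) = φ (t k) := by rw [hψ, AlgEquiv.mul_apply, fib_t]
    have e1 : ψ (xy k) = φ (xy k) - c • φ (t k) := by
      rw [hψ, AlgEquiv.mul_apply, fib_xy, map_add, aeval_C, map_mul, AlgEquiv.commutes, map_neg,
        Algebra.smul_def]
      ring
    have hψ0 : Top (fracHom ψ (t k)) (n + 1) (fracHom φ (t k)).leadingCoeff := by
      have : fracHom ψ (t k) = fracHom φ (t k) := by
        change (mapAlgHom _ (toChart (ψ (t k)))) = _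
        rw [e0]; rfl
      rw [this, ← htn]; exact top_fracHom_self φ _
    have hψ1 : Top (fracHom ψ (xy k)) (n + 1 + 0) 0 := by
      have h2 : fracHom ψ (xy k) = fracHom φ (xy k) - c • fracHom φ (t k) := by
        change (mapAlgHom _ (toChart (ψ (xy k)))) = _
        rw [e1, map_sub, map_sub, map_smul, map_smul]; rfl
      have h3 := (top_fracHom φ hxy).sub ((top_fracHom_self φ (t k)).smul c)
      rw [h2, add_zero, ← htn]
      convert h3
      rw [hc, Algebra.smul_def, sub_self]
    have hel : ∀ m (hm : m ≤ 4 * 1), Top (fracHom ψ (el k 1 m hm)) (n + 1)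
        ((fracHom φ (t k)).leadingCoeff ^ 1 * (0 / (fracHom φ (t k)).leadingCoeff) ^ m) := by
      intro m hm
      simpa using top_el_of_top (fracHom ψ) hψ0 h0 hψ1 (by omega) hm
    have hel' : ∀ m (hm : m ≤ 4 * 1), deg (ψ (el k 1 m hm)) ≤ n + 1 := fun m hm =>
      deg_le_of_top (hel m hm)
    have hswap : ∀ m (hm : m ≤ 4 * 1), deg ((ψ * swapAut k) (el k 1 m hm)) ≤ n + 1 := by
      intro m hm
      have hm' : m ≤ 4 := hm
      rw [AlgEquiv.mul_apply]
      interval_cases m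
      · change deg (ψ (swapAut k (t k))) ≤ _
        rw [swapAut_t]; exact hel' _ _
      · change deg (ψ (swapAut k (xy k))) ≤ _
        rw [swapAut_xy]; exact hel' _ _
      · rw [swapAut_el_two, neg_neg]; exact hel' _ _
      · rw [swapAut_el_three, neg_neg]; exact hel' 1 _
      · rw [swapAut_el_four]; exact hel' 0 (by omega)
    have h5 := hlow (ψ * swapAut k) hswap (by
      rw [AlgEquiv.mul_apply, swapAut_t]
      have h6 := hel 4 (by omega)
      rw [zero_div, zero_pow (by norm_num), mul_zero] at h6
      have := deg_lt_of_top (by omega) h6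
      omega)
    have h6 : (fib (C (-c)) * swapAut k) ∈ degSub k ⊔ fibSub k :=
      Subgroup.mem_sup_left (mul_mem (fib_C_mem_degSub _) swapAut_mem_degSub)
    rw [hψ, mul_assoc] at h5
    have h7 := mul_mem h5 (inv_mem h6)
    rwa [mul_inv_cancel_right] at h7

/-- The group of automorphisms of the coordinate ring is generated by the automorphisms that
preserve the degree and those that preserve the fibration. -/
theorem degSub_sup_fibSub : degSub k ⊔ fibSub k = ⊤ := by
  rw [eq_top_iff]
  intro φ _
  obtain ⟨N, hN⟩ : ∃ N, ∀ m : Fin 5, deg (φ (el k 1 m (Nat.le_of_lt_succ m.2))) ≤ N := by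
    have h : ∀ g : Fin 5 → ℕ, ∃ N, ∀ m, g m ≤ N := fun g =>
      ⟨∑ m, g m, fun m => Finset.single_le_sum (fun _ _ => Nat.zero_le _) (Finset.mem_univ m)⟩
    exact h _
  exact mem_sup_of_deg_le N φ fun m hm => hN ⟨m, Nat.lt_succ_of_le hm⟩

end Chart

end ConicComplement

/-! ### Ping-pong for amalgamated products -/

namespace ConicComplement

/-! ### A criterion for amalgamated products -/

section Amalgam

open Monoid Monoid.PushoutI Monoid.PushoutI.NormalWord

variable {Γ : Type*} [Group Γ] {N : Γ → Prop}

/-- A ping-pong criterion for the injectivity of a homomorphism from an amalgamated product. -/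
theorem pushout_injective {B : Type*} {A : Bool → Type*} [Group B] [∀ b, Group (A b)]
    {φ : ∀ b, B →* A b} (hφ : ∀ b, Function.Injective (φ b)) (F : PushoutI φ →* Γ)
    (hF : Function.Injective fun g : A true => F (of true g))
    (hH : ∀ g : A true, ¬ N (F (of true g)))
    (hK : ∀ g : A false, g ∉ (φ false).range → ∀ x, ¬ N x → N (F (of false g) * x))
    (hN : ∀ g : A true, g ∉ (φ true).range → ∀ x, N x → ¬ N (F (of true g) * x)) :
    Function.Injective F := by
  classical
  obtain ⟨d⟩ := transversal_nonempty φ hφ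
  have h1 : F (of true (1 : A true)) = 1 := by rw [map_one, map_one]
  -- For a reduced word with trivial head the image is located by the first letter: a letter of the
  -- factor `false` puts it into `N`; a letter `h` of the factor `true` leaves it of the form `h x`
  -- with `x` trivial or in `N`.
  have key : ∀ w : NormalWord d, w.head = 1 →
      (w.fstIdx = none → w.prod = 1) ∧
      (w.fstIdx = some false → N (F w.prod)) ∧
      (w.fstIdx = some true → ∃ h : A true, h ∉ (φ true).range ∧ ∃ x,
        F w.prod = F (of true h) * x ∧ (x = 1 ∨ N x)) := by
    intro w
    induction w using consRecOn with
    | empty => exact fun _ => ⟨fun _ => prod_empty, nofun, nofun⟩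
    | cons b g w hmw _ hgr hw1 ih =>
      intro _
      obtain ⟨ih0, ih1, ih2⟩ := ih hw1
      have hfst : (cons g w hmw hgr).fstIdx = some b := rfl
      rw [hfst, prod_cons, map_mul]
      refine ⟨nofun, fun h => ?_, fun h => ?_⟩
      · obtain rfl : b = false := Option.some_injective _ h
        refine hK g hgr _ ?_
        rcases hw : w.fstIdx with _ | b
        · rw [ih0 hw, map_one, ← h1]; exact hH 1
        · cases b
          · exact absurd hw hmw
          · obtain ⟨h, hh, x, hx, hx'⟩ := ih2 hw
            rw [hx]
            rcases hx' with rfl | hx'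
            · rw [mul_one]; exact hH h
            · exact hN h hh x hx'
      · obtain rfl : b = true := Option.some_injective _ h
        refine ⟨g, hgr, _, rfl, ?_⟩
        rcases hw : w.fstIdx with _ | b
        · left; rw [ih0 hw, map_one]
        · cases b
          · exact Or.inr (ih1 hw)
          · exact absurd hw hmw
    | base h w hw ih =>
      intro h1
      have h2 : h = 1 := by
        rw [base_smul_def, hw, mul_one] at h1
        exact h1
      rw [h2, map_one, one_smul]
      exact ih hw
  rw [injective_iff_map_eq_one]
  intro g hg
  obtain ⟨w, rfl⟩ : ∃ w : NormalWord d, g = w.prod :=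
    ⟨g • empty, by rw [prod_smul, prod_empty, mul_one]⟩
  -- The head, an element of the amalgamated subgroup, is moved to the other side; the image of the
  -- remaining word then lies in that of the factor `true`, which no nonempty reduced word allows.
  let w₁ : NormalWord d := ⟨w.toWord, 1, w.normalized⟩
  have hw : w.prod = base φ w.head * w₁.prod := by
    simp [NormalWord.prod, w₁]
  rw [hw, ← of_apply_eq_base φ true, map_mul, mul_eq_one_iff_eq_inv', ← map_inv, ← map_inv,
    ← map_inv] at hg
  obtain ⟨h0, h1, h2⟩ := key w₁ rfl
  rcases hfst : w₁.fstIdx with _ | b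
  · rw [h0 hfst, map_one] at hg
    have h3 : φ true w.head⁻¹ = 1 := hF (by
      change F (of true (φ true w.head⁻¹)) = F (of true 1)
      rw [← hg, map_one, map_one])
    have h4 : w.head = 1 := by
      rw [← inv_eq_one]
      exact hφ true (h3.trans (map_one _).symm)
    rw [hw, h0 hfst, h4, map_one, mul_one]
  · cases b
    · have h3 := h1 hfst
      rw [hg] at h3
      exact absurd h3 (hH _)
    · obtain ⟨h, hh, x, hx, hx'⟩ := h2 hfst
      rw [hx] at hg
      rcases hx' with rfl | hx'
      · rw [mul_one] at hg
        have := hF (a₁ := h) (a₂ := φ true w.head⁻¹) hg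
        exact absurd ⟨_, this.symm⟩ hh
      · rw [← eq_inv_mul_iff_mul_eq, ← map_inv, ← map_inv, ← map_mul, ← map_mul] at hg
        rw [hg] at hx'
        exact absurd hx' (hH _)

variable {H K : Subgroup Γ}

/-- The inclusions of the intersection of two subgroups. -/
abbrev amalgamIncl (H K : Subgroup Γ) (b : Bool) :
    (H ⊓ K : Subgroup Γ) →* (cond b H K : Subgroup Γ) :=
  Subgroup.inclusion (show H ⊓ K ≤ cond b H K by cases b; exacts [inf_le_right, inf_le_left])

theorem amalgamToGroup_of (b : Bool) (g : (cond b H K : Subgroup Γ)) :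
    amalgamToGroup H K (of (G := fun b => (cond b H K : Subgroup Γ)) (φ := amalgamIncl H K) b g) =
      g :=
  lift_of (φ := amalgamIncl H K) (fun b => (cond b H K).subtype) (H ⊓ K).subtype (fun _ => rfl) g

theorem isAmalgamOf_of_pingPong (hsup : H ⊔ K = ⊤) (hH : ∀ h ∈ H, ¬ N h)
    (hK : ∀ g ∈ K, g ∉ H → ∀ x, ¬ N x → N (g * x))
    (hN : ∀ h ∈ H, h ∉ K → ∀ x, N x → ¬ N (h * x)) : IsAmalgamOf H K := by
  constructor
  · refine pushout_injective (A := fun b => (cond b H K : Subgroup Γ)) (φ := amalgamIncl H K)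
      (N := N) (fun b => Subgroup.inclusion_injective _) _ ?_ ?_ ?_ ?_
    · intro g g' h
      exact Subtype.ext (((amalgamToGroup_of true g).symm.trans h).trans (amalgamToGroup_of true g'))
    · intro g
      rw [amalgamToGroup_of]
      exact hH _ g.2
    · intro g hg x hx
      rw [amalgamToGroup_of]
      exact hK _ g.2 (fun h => hg ⟨⟨g, h, g.2⟩, rfl⟩) x hx
    · intro g hg x hx
      rw [amalgamToGroup_of]
      exact hN _ g.2 (fun h => hg ⟨⟨g, g.2, h⟩, rfl⟩) x hx
  · rw [← MonoidHom.range_eq_top, eq_top_iff, ← hsup]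
    exact sup_le (fun g hg => ⟨_, amalgamToGroup_of true ⟨g, hg⟩⟩)
      (fun g hg => ⟨_, amalgamToGroup_of false ⟨g, hg⟩⟩)

end Amalgam

end ConicComplement

/-! ### The amalgamated product, and the passage from rings to schemes -/

namespace ConicComplement

open Polynomial

variable {k : Type u} [Field k]

namespace Chart

/-! ### The group of automorphisms as an amalgamated product -/

theorem deg_aeval (f : Coord k) (p : k[X]) : deg (aeval f p) = p.natDegree * deg f := by
  have h : toChart (aeval f p) = (p.map (C : k →+* k[X])).comp (toChart f) := by
    rw [← aeval_algHom_apply, comp, eval₂_map]; rfl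
  rw [deg, h, natDegree_comp, natDegree_map_eq_of_injective (C_injective)]; rfl

/-- The automorphisms that make the degree of `t` smaller than the degree of `xy`. -/
def Skew (φ : AutRing k) : Prop := deg (φ (t k)) < deg (φ (xy k))

theorem not_skew_of_mem_degSub {φ : AutRing k} (h : φ ∈ degSub k) : ¬ Skew φ := by
  rw [Skew, h, h, deg_t, deg_xy]; exact lt_irrefl 2

/-- Up to a torus element, `κ` is `fib (-s)` with `s` not constant; the degree of `φ(s(t) t)` is
`deg s + 1` times that of `φ(t)`, and it exceeds that of `φ(xy)`. -/
theorem skew_mul {φ κ : AutRing k} (hφ : ¬ Skew φ) (hκ : κ ∈ fibSub k) (hκ' : κ ∉ degSub k) :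
    Skew (φ * κ) := by
  obtain ⟨a, s, hs⟩ := exists_eq_torusAut_mul_fib (inv_mem hκ)
  have hκ1 : κ = fib (-s) * torusAut a⁻¹ := by
    rw [← inv_inv κ, hs, mul_inv_rev, fib_neg, torusAut_inv]
  have hs0 : 0 < s.natDegree := by
    rw [Nat.pos_iff_ne_zero, ← natDegree_neg]
    intro h
    exact hκ' (by
      rw [hκ1]; exact mul_mem (fib_mem_degSub_iff.mpr h) (torusAut_mem_degSub _))
  have hA := deg_autRing_t_pos φ
  rw [Skew, not_lt] at hφ
  have h1 : φ (aeval (t k) (-s) * t k) ≠ 0 := by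
    rw [map_ne_zero_iff φ φ.injective, neg_eq_neg_one_mul, map_mul]
    refine mul_ne_zero (mul_ne_zero ?_ fun h => ?_) t_ne_zero
    · simp
    · have := aeval_t_injective (h.trans (map_zero _).symm)
      rw [this, natDegree_zero] at hs0
      omega
  have h2 : deg (φ (aeval (t k) (-s) * t k)) = (s.natDegree + 1) * deg (φ (t k)) := by
    have h3 : φ (aeval (t k) (-s)) = aeval (φ (t k)) (-s) :=
      (aeval_algHom_apply (φ : Coord k →ₐ[k] Coord k) (t k) (-s)).symm
    rw [map_mul] at h1 ⊢
    rw [deg_mul (left_ne_zero_of_mul h1) (right_ne_zero_of_mul h1), h3, deg_aeval, natDegree_neg]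
    ring
  have h4 : deg (φ (xy k)) < deg (φ (aeval (t k) (-s) * t k)) := by
    rw [h2]
    nlinarith
  have ha : ((a⁻¹ : kˣ) : k) ≠ 0 := Units.ne_zero _
  rw [Skew, hκ1, AlgEquiv.mul_apply, AlgEquiv.mul_apply, AlgEquiv.mul_apply, AlgEquiv.mul_apply,
    torusAut_t, torusAut_xy, map_smul, map_smul, map_smul, map_smul, fib_t, fib_xy,
    deg_smul (pow_ne_zero 2 ha), deg_smul ha, map_add, deg, deg, map_add,
    natDegree_add_eq_right_of_natDegree_lt h4]
  change deg (φ (t k)) < deg _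
  rw [h2]
  nlinarith

/-- For a skew `φ` the images of the five generators have the increasing degrees `A + mB`. Since `η`
is not in `fibSub`, the expansion of `η(t)` contains `w²`, so its image reaches the highest degree
`A + 4B` possible for elements of degree two. -/
theorem not_skew_mul {φ η : AutRing k} (hφ : Skew φ) (hη : η ∈ degSub k) (hη' : η ∉ fibSub k) :
    ¬ Skew (φ * η) := by
  rw [Skew] at hφ
  obtain ⟨B, hB, hφB⟩ : ∃ B, 0 < B ∧ deg (φ (xy k)) = deg (φ (t k)) + B :=
    ⟨deg (φ (xy k)) - deg (φ (t k)), by omega, by omega⟩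
  have hA := deg_autRing_t_pos φ
  set A := deg (φ (t k)) with hAdef
  have hxy0 : xy k ≠ 0 := fun h => by rw [h, map_zero] at hφ; simp [deg] at hφ
  have h0 : (fracHom φ (t k)).leadingCoeff ≠ 0 :=
    leadingCoeff_ne_zero.mpr (fracHom_ne_zero φ t_ne_zero)
  have h1 : (fracHom φ (xy k)).leadingCoeff ≠ 0 :=
    leadingCoeff_ne_zero.mpr (fracHom_ne_zero φ hxy0)
  have hB' := top_fracHom_self φ (xy k)
  rw [hφB] at hB'
  have hdeg : ∀ m (hm : m ≤ 4 * 1), deg (φ (el k 1 m hm)) = A + m * B := by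
    intro m hm
    have h2 := top_el_of_top (fracHom φ) (top_fracHom_self φ (t k)) h0 hB' (by omega) hm
    have h3 := h2.natDegree (mul_ne_zero (pow_ne_zero _ h0) (pow_ne_zero _ (div_ne_zero h1 h0)))
    rw [natDegree_fracHom, one_mul] at h3
    exact h3
  have hd1 : deg (φ (1 : Coord k)) ≤ A := by
    rw [map_one, deg, map_one, natDegree_one]; omega
  have hd2 : ∀ (b : k) m (hm : m ≤ 4 * 1), m ≤ 3 → deg (φ (b • el k 1 m hm)) ≤ A + 3 * B := by
    intro b m hm hm3
    rw [map_smul]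
    refine (deg_smul_le _ _).trans ?_
    rw [hdeg]
    have := Nat.mul_le_mul_right B hm3
    omega
  have hd3 : ∀ b : k, deg (φ (b • (1 : Coord k))) ≤ A + 3 * B := fun b => by
    rw [map_smul]
    exact (deg_smul_le _ _).trans (by omega)
  have hd : ∀ a b₀ b₁ b₂ b₃ : k, deg (φ (a • 1 + b₀ • t k + b₁ • xy k + b₂ • el k 1 2 (by decide) +
      b₃ • el k 1 3 (by decide))) ≤ A + 3 * B := by
    intro a b₀ b₁ b₂ b₃
    simp only [map_add φ]
    exact deg_add_le (deg_add_le (deg_add_le (deg_add_le (hd3 a) (hd2 b₀ 0 _ (by omega)))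
      (hd2 b₁ 1 _ (by omega))) (hd2 b₂ 2 _ (by omega))) (hd2 b₃ 3 _ (by omega))
  obtain ⟨a, h, r, s, hh, ht⟩ := exists_degSub_t hη
  have hs : s ≠ 0 := by
    rintro rfl
    refine hη' (mem_fibSub_of_eq (l := h * r ^ 4) (μ := a) ?_)
    rw [ht, Algebra.algebraMap_eq_smul_one]
    simp [add_comm]
  have hηt : deg ((φ * η) (t k)) = A + 4 * B := by
    have h4 : deg (φ ((h * s ^ 4) • el k 1 4 (by decide))) = A + 4 * B := by
      rw [map_smul, deg_smul (mul_ne_zero hh (pow_ne_zero 4 hs)), hdeg]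
    have h5 := hd a (h * r ^ 4) (4 * h * r ^ 3 * s) (6 * h * r ^ 2 * s ^ 2) (4 * h * r * s ^ 3)
    rw [AlgEquiv.mul_apply, ht, map_add, deg, map_add, natDegree_add_eq_right_of_natDegree_lt]
    · exact h4
    · change deg _ < deg _
      rw [h4]
      exact lt_of_le_of_lt h5 (by omega)
  obtain ⟨a, b₀, b₁, b₂, b₃, b₄, hxy⟩ := exists_of_deg_le_two
    (show deg (η (xy k)) ≤ 2 by rw [hη, deg_xy])
  rw [Skew, hηt, AlgEquiv.mul_apply, hxy, not_lt, map_add]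
  refine deg_add_le ((hd a b₀ b₁ b₂ b₃).trans (by omega)) ?_
  rw [map_smul]
  exact (deg_smul_le _ _).trans (hdeg 4 _).le

/-- The group of automorphisms of the coordinate ring is the amalgamated product of the group of
automorphisms that preserve the degree and of the group of automorphisms that preserve the
fibration. -/
theorem isAmalgamOf_comap {Γ : Type*} [Group Γ] (e : Γ ≃* AutRing k) :
    IsAmalgamOf ((degSub k).comap e.toMonoidHom) ((fibSub k).comap e.toMonoidHom) := by
  have hmem : ∀ (S : Subgroup (AutRing k)) (g : Γ), g ∈ S.comap e.toMonoidHom ↔ e g ∈ S :=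
    fun _ _ => Iff.rfl
  -- The estimates for `Skew` concern multiplication on the right and the criterion multiplication
  -- on the left, hence the inverse.
  refine isAmalgamOf_of_pingPong (N := fun g => Skew (e g)⁻¹) ?_ ?_ ?_ ?_
  · have h3 : ∀ S : Subgroup (AutRing k), S.comap e.toMonoidHom = S.map e.symm.toMonoidHom :=
      fun S => Subgroup.comap_equiv_eq_map_symm e S
    rw [h3, h3, ← Subgroup.map_sup, degSub_sup_fibSub]
    exact Subgroup.map_top_of_surjective _ e.symm.surjective
  · intro g hg
    rw [hmem] at hg
    exact not_skew_of_mem_degSub ((degSub k).inv_mem hg)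
  · intro g hg hg' x hx
    rw [hmem] at hg hg'
    rw [map_mul, mul_inv_rev]
    exact skew_mul hx ((fibSub k).inv_mem hg) fun h => hg' ((degSub k).inv_mem_iff.mp h)
  · intro g hg hg' x hx
    rw [hmem] at hg hg'
    rw [map_mul, mul_inv_rev]
    exact not_skew_mul hx ((degSub k).inv_mem hg) fun h => hg' ((fibSub k).inv_mem_iff.mp h)

end Chart

/-! ### Automorphisms of affine schemes over a field -/

section AffineAut

variable {A : Type u} [CommRing A] [Algebra k A] {X Y Z : Over (Spec (.of k))}

/-- A scheme over `k` with a coordinate ring `A`. -/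
structure AffineModel (A : Type u) [CommRing A] [Algebra k A] (X : Over (Spec (.of k))) where
  /-- The isomorphism with the spectrum. -/
  iso : X.left ≅ Spec (.of A)
  comm : iso.hom ≫ Spec.map (CommRingCat.ofHom (algebraMap k A)) = X.hom

namespace AffineModel

variable (c : AffineModel A X)

/-- The ring endomorphism that underlies `AffineModel.pull`. -/
def pullRing (f : X ⟶ X) : A →+* A :=
  (Spec.preimage (c.iso.inv ≫ f.left ≫ c.iso.hom)).hom

theorem left_comp_hom (f : X ⟶ X) :
    f.left ≫ c.iso.hom = c.iso.hom ≫ Spec.map (CommRingCat.ofHom (c.pullRing f)) := by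
  rw [pullRing, CommRingCat.ofHom_hom, Spec.map_preimage, Iso.hom_inv_id_assoc]

theorem eq_pullRing (f : X ⟶ X) {g : A →+* A}
    (h : f.left ≫ c.iso.hom = c.iso.hom ≫ Spec.map (CommRingCat.ofHom g)) :
    c.pullRing f = g := by
  rw [c.left_comp_hom, Iso.cancel_iso_hom_left] at h
  have := Spec.map_injective h
  simpa using congrArg CommRingCat.Hom.hom this

/-- The pullback of functions along an endomorphism over `k`. -/
def pull (f : X ⟶ X) : A →ₐ[k] A where
  toRingHom := c.pullRing f
  commutes' r := by
    have h : c.iso.hom ≫ Spec.map (CommRingCat.ofHom ((c.pullRing f).comp (algebraMap k A))) =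
        c.iso.hom ≫ Spec.map (CommRingCat.ofHom (algebraMap k A)) := by
      rw [CommRingCat.ofHom_comp, Spec.map_comp, ← Category.assoc, ← c.left_comp_hom,
        Category.assoc, c.comm]
      exact Over.w f
    rw [Iso.cancel_iso_hom_left] at h
    have := congrArg CommRingCat.Hom.hom (Spec.map_injective h)
    exact RingHom.congr_fun this r

theorem left_comp_hom' (f : X ⟶ X) :
    f.left ≫ c.iso.hom = c.iso.hom ≫ Spec.map (CommRingCat.ofHom (c.pull f : A →+* A)) :=
  c.left_comp_hom f

theorem eq_pull (f : X ⟶ X) {g : A →ₐ[k] A}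
    (h : f.left ≫ c.iso.hom = c.iso.hom ≫ Spec.map (CommRingCat.ofHom (g : A →+* A))) :
    c.pull f = g :=
  AlgHom.coe_ringHom_injective (c.eq_pullRing f h)

theorem pull_id : c.pull (𝟙 X) = AlgHom.id k A :=
  c.eq_pull _ (by
    change 𝟙 _ ≫ _ = _ ≫ Spec.map (𝟙 _)
    rw [Spec.map_id, Category.comp_id, Category.id_comp])

theorem pull_comp (f g : X ⟶ X) : c.pull (f ≫ g) = (c.pull f).comp (c.pull g) :=
  c.eq_pull _ (by
    change (f.left ≫ g.left) ≫ _ = _ ≫ Spec.map (CommRingCat.ofHom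
      ((c.pull f : A →+* A).comp (c.pull g : A →+* A)))
    rw [CommRingCat.ofHom_comp, Spec.map_comp, Category.assoc, left_comp_hom', ← Category.assoc,
      left_comp_hom', Category.assoc])

/-- The endomorphism over `k` defined by an endomorphism of the coordinate ring. -/
def push (g : A →ₐ[k] A) : X ⟶ X :=
  Over.homMk (c.iso.hom ≫ Spec.map (CommRingCat.ofHom (g : A →+* A)) ≫ c.iso.inv) (by
    have h : Spec.map (CommRingCat.ofHom (g : A →+* A)) ≫
        Spec.map (CommRingCat.ofHom (algebraMap k A)) =
        Spec.map (CommRingCat.ofHom (algebraMap k A)) := by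
      rw [← Spec.map_comp, ← CommRingCat.ofHom_comp, g.comp_algebraMap]
    rw [← c.comm]
    simp [h])

theorem pull_push (g : A →ₐ[k] A) : c.pull (c.push g) = g :=
  c.eq_pull _ (by simp [push])

theorem push_pull (f : X ⟶ X) : c.push (c.pull f) = f := by
  ext1
  rw [← Iso.cancel_iso_hom_right _ _ c.iso]
  simp [push, left_comp_hom']

theorem pull_injective : Function.Injective c.pull :=
  Function.LeftInverse.injective c.push_pull

theorem push_comp (g h : A →ₐ[k] A) : c.push (g.comp h) = c.push g ≫ c.push h :=
  c.pull_injective (by rw [pull_comp, pull_push, pull_push, pull_push])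

theorem push_id : c.push (AlgHom.id k A) = 𝟙 X :=
  c.pull_injective (by rw [pull_push, pull_id])

/-- The automorphisms over `k` correspond to those of the coordinate ring; to make this
correspondence multiplicative, a function is transported by the inverse automorphism. -/
def autEquiv : Aut X ≃* (A ≃ₐ[k] A) where
  toFun ψ := AlgEquiv.ofAlgHom (c.pull ψ.inv) (c.pull ψ.hom)
    (by rw [← pull_comp, ψ.inv_hom_id, pull_id]) (by rw [← pull_comp, ψ.hom_inv_id, pull_id])
  invFun σ :=
    { hom := c.push σ.symm
      inv := c.push σ
      hom_inv_id := by rw [← push_comp, ← push_id c]; congr 1; ext; simp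
      inv_hom_id := by rw [← push_comp, ← push_id c]; congr 1; ext; simp }
  left_inv ψ := by
    ext1
    exact c.push_pull ψ.hom
  right_inv σ := by
    ext a
    change c.pull (c.push σ) a = _
    rw [pull_push]; rfl
  map_mul' ψ χ := by
    ext a
    change c.pull (ψ.inv ≫ χ.inv) a = _
    rw [pull_comp]; rfl

theorem hom_left_comp (ψ : Aut X) : ψ.hom.left ≫ c.iso.hom =
    c.iso.hom ≫ Spec.map (CommRingCat.ofHom ((c.autEquiv ψ).symm : A →+* A)) :=
  c.left_comp_hom' ψ.hom

end AffineModel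

/-- The affine line as the spectrum of the polynomial ring. -/
def lineModel (k : Type u) [Field k] : AffineModel k[X] (SmoothConic.line k) where
  iso := Iso.refl _
  comm := Category.id_comp _

end AffineAut

/-! ### Linear changes of the homogeneous coordinates -/

variable (k) in
/-- The algebra automorphisms of `k[x, y, z]` that respect the grading. -/
def gradedAut : Subgroup (MvPolynomial (Fin 3) k ≃ₐ[k] MvPolynomial (Fin 3) k) where
  carrier := {W | ∀ n, ∀ f ∈ grading k n, W f ∈ grading k n ∧ W⁻¹ f ∈ grading k n}
  mul_mem' := fun {V W} hV hW n f hf => ⟨(hV n _ (hW n f hf).1).1, by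
    rw [mul_inv_rev]
    exact (hW n _ (hV n f hf).2).2⟩
  one_mem' := fun n f hf => ⟨hf, by rw [inv_one]; exact hf⟩
  inv_mem' := fun {W} hW n f hf => ⟨(hW n f hf).2, by rw [inv_inv]; exact (hW n f hf).1⟩

/-- The substitution of linear forms with a given coefficient matrix. -/
def linHom (M : Matrix (Fin 3) (Fin 3) k) : MvPolynomial (Fin 3) k →ₐ[k] MvPolynomial (Fin 3) k :=
  MvPolynomial.aeval fun i => ∑ j, MvPolynomial.C (M i j) * MvPolynomial.X j

theorem linHom_X (M : Matrix (Fin 3) (Fin 3) k) (i : Fin 3) :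
    linHom M (MvPolynomial.X i) = ∑ j, MvPolynomial.C (M i j) * MvPolynomial.X j := by
  rw [linHom, MvPolynomial.aeval_X]

theorem linHom_mul (M N : Matrix (Fin 3) (Fin 3) k) :
    linHom (M * N) = (linHom N).comp (linHom M) := by
  refine MvPolynomial.algHom_ext fun i => ?_
  rw [linHom_X, AlgHom.comp_apply, linHom_X, map_sum]
  simp only [map_mul, linHom_X, MvPolynomial.algHom_C, MvPolynomial.algebraMap_eq,
    Matrix.mul_apply, Fin.sum_univ_three, map_add]
  ring

theorem linHom_one : linHom (1 : Matrix (Fin 3) (Fin 3) k) = AlgHom.id k _ := by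
  refine MvPolynomial.algHom_ext fun i => ?_
  rw [linHom_X]
  simp [Matrix.one_apply]

theorem linHom_mem (M : Matrix (Fin 3) (Fin 3) k) {n : ℕ} {f : MvPolynomial (Fin 3) k}
    (hf : f ∈ grading k n) : linHom M f ∈ grading k n := by
  have h := MvPolynomial.IsHomogeneous.aeval (hφ := hf)
    (fun i => ∑ j, MvPolynomial.C (M i j) * MvPolynomial.X j) (n := 1) fun i =>
    MvPolynomial.IsHomogeneous.sum _ _ _ fun j _ => by
      simpa using (MvPolynomial.isHomogeneous_C (Fin 3) (M i j)).mul
        (MvPolynomial.isHomogeneous_X k j)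
  rw [one_mul] at h
  exact h

/-- The substitution defined by a pair of mutually inverse matrices. -/
def linEquiv (M N : Matrix (Fin 3) (Fin 3) k) (h : M * N = 1) :
    MvPolynomial (Fin 3) k ≃ₐ[k] MvPolynomial (Fin 3) k :=
  AlgEquiv.ofAlgHom (linHom M) (linHom N)
    (by rw [← linHom_mul, mul_eq_one_comm.mp h, linHom_one])
    (by rw [← linHom_mul, h, linHom_one])

theorem linEquiv_mem (M N : Matrix (Fin 3) (Fin 3) k) (h : M * N = 1) :
    linEquiv M N h ∈ gradedAut k :=
  fun _ _ hf => ⟨linHom_mem M hf, linHom_mem N hf⟩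

/-! ### Coordinates in which a conic has the standard equation -/

theorem exists_sum_X_mul {n : ℕ} {f : MvPolynomial (Fin 3) k} (hf : f.IsHomogeneous (n + 1)) :
    ∃ g : Fin 3 → MvPolynomial (Fin 3) k, (∀ i, (g i).IsHomogeneous n) ∧
      f = ∑ i, MvPolynomial.X i * g i := by
  rw [f.as_sum]
  refine Finset.sum_induction _ (fun F => ∃ g : Fin 3 → MvPolynomial (Fin 3) k,
    (∀ i, (g i).IsHomogeneous n) ∧ F = ∑ i, MvPolynomial.X i * g i) ?_ ?_ ?_
  · rintro _ _ ⟨g, hg, rfl⟩ ⟨h, hh, rfl⟩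
    exact ⟨g + h, fun i => (hg i).add (hh i), by simp [mul_add, Finset.sum_add_distrib]⟩
  · exact ⟨0, fun i => MvPolynomial.isHomogeneous_zero _ _ _, by simp⟩
  · intro d hd
    have hdeg := hf (MvPolynomial.mem_support_iff.mp hd)
    have hdeg' : d.degree = n + 1 := by
      rw [← hdeg, Finsupp.degree_eq_weight_one]
      rfl
    obtain ⟨i, hi⟩ : ∃ i, d i ≠ 0 := by
      by_contra! h
      have : d = 0 := Finsupp.ext h
      rw [this] at hdeg'
      simp at hdeg'
    have hs : Finsupp.single i 1 + (d - Finsupp.single i 1) = d :=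
      add_tsub_cancel_of_le (Finsupp.single_le_iff.mpr (Nat.one_le_iff_ne_zero.mpr hi))
    refine ⟨Pi.single i (MvPolynomial.monomial (d - Finsupp.single i 1) (f.coeff d)),
      fun j => ?_, ?_⟩
    · by_cases hj : j = i
      · subst hj
        rw [Pi.single_eq_same]
        apply MvPolynomial.isHomogeneous_monomial
        have := congrArg Finsupp.degree hs
        rw [map_add, Finsupp.degree_single, hdeg'] at this
        omega
      · rw [Pi.single_eq_of_ne hj]
        exact MvPolynomial.isHomogeneous_zero _ _ _
    · rw [Finset.sum_eq_single i]
      · rw [Pi.single_eq_same, MvPolynomial.X, MvPolynomial.monomial_mul, hs, one_mul]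
      · intro j _ hj
        rw [Pi.single_eq_of_ne hj, mul_zero]
      · simp

theorem exists_quadratic_coeffs {f : MvPolynomial (Fin 3) k} (hf : f.IsHomogeneous 2) :
    ∃ a : Fin 3 → Fin 3 → k,
      f = ∑ i, ∑ j, MvPolynomial.C (a i j) * (MvPolynomial.X i * MvPolynomial.X j) := by
  obtain ⟨g, hg, rfl⟩ := exists_sum_X_mul hf
  choose h hh heq using fun i => exists_sum_X_mul (hg i)
  refine ⟨fun i j => (h i j).coeff 0, Finset.sum_congr rfl fun i _ => ?_⟩
  rw [heq i, Finset.mul_sum]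
  refine Finset.sum_congr rfl fun j _ => ?_
  have : h i j = MvPolynomial.C ((h i j).coeff 0) :=
    MvPolynomial.totalDegree_eq_zero_iff_eq_C.mp
      ((hh i j).totalDegree_le.antisymm (Nat.zero_le _))
  conv_lhs => rw [this]
  ring

/-- The value of the quadratic form with a given matrix of coefficients. -/
def quad {R : Type*} [CommRing R] (a : Fin 3 → Fin 3 → R) (v : Fin 3 → R) : R :=
  ∑ i, ∑ j, a i j * (v i * v j)

/-- The polar form of a quadratic form. -/
def polar {R : Type*} [CommRing R] (a : Fin 3 → Fin 3 → R) (v w : Fin 3 → R) : R :=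
  ∑ i, (∑ j, (a i j + a j i) * v j) * w i

section Quad

variable {R : Type*} [CommRing R] (a : Fin 3 → Fin 3 → R)

theorem polar_add (v w w' : Fin 3 → R) : polar a v (w + w') = polar a v w + polar a v w' := by
  simp only [polar, Pi.add_apply, mul_add, Finset.sum_add_distrib]

theorem polar_smul (v w : Fin 3 → R) (c : R) : polar a v (c • w) = c * polar a v w := by
  simp only [polar, Pi.smul_apply, smul_eq_mul, Finset.mul_sum]
  exact Finset.sum_congr rfl fun i _ => by ring

theorem polar_comm (v w : Fin 3 → R) : polar a v w = polar a w v := by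
  simp only [polar, Finset.sum_mul]
  rw [Finset.sum_comm]
  exact Finset.sum_congr rfl fun i _ => Finset.sum_congr rfl fun j _ => by ring

theorem polar_self (v : Fin 3 → R) : polar a v v = 2 * quad a v := by
  simp only [polar, quad, Fin.sum_univ_three]
  ring

theorem quad_add (v w : Fin 3 → R) : quad a (v + w) = quad a v + quad a w + polar a v w := by
  simp only [polar, quad, Fin.sum_univ_three, Pi.add_apply]
  ring

theorem quad_smul (v : Fin 3 → R) (c : R) : quad a (c • v) = c ^ 2 * quad a v := by
  simp only [quad, Pi.smul_apply, smul_eq_mul, Finset.mul_sum]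
  exact Finset.sum_congr rfl fun i _ => Finset.sum_congr rfl fun j _ => by ring

theorem map_quad {S : Type*} [CommRing S] (φ : R →+* S) (v : Fin 3 → R) :
    φ (quad a v) = quad (fun i j => φ (a i j)) (fun i => φ (v i)) := by
  simp [quad]

theorem map_polar {S : Type*} [CommRing S] (φ : R →+* S) (v w : Fin 3 → R) :
    φ (polar a v w) = polar (fun i j => φ (a i j)) (fun i => φ (v i)) (fun i => φ (w i)) := by
  simp [polar]

end Quad

theorem aeval_quadratic {R : Type*} [CommRing R] [Algebra k R] (a : Fin 3 → Fin 3 → k)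
    (v : Fin 3 → R) :
    MvPolynomial.aeval v (∑ i, ∑ j, MvPolynomial.C (a i j) *
      (MvPolynomial.X i * MvPolynomial.X j)) = quad (fun i j => algebraMap k R (a i j)) v := by
  simp [quad]

theorem pderiv_quadratic (a : Fin 3 → Fin 3 → k) (l : Fin 3) :
    MvPolynomial.pderiv l (∑ i, ∑ j, MvPolynomial.C (a i j) *
      (MvPolynomial.X i * MvPolynomial.X j)) =
    ∑ j, MvPolynomial.C (a l j + a j l) * MvPolynomial.X j := by
  fin_cases l <;>
  · simp [Fin.sum_univ_three, MvPolynomial.pderiv_X]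
    ring

/-- Smoothness at `p` gives a hyperbolic pair `p`, `p'`, and a dimension count gives `p'' ≠ 0`
orthogonal to both. If `p''` were isotropic, it would be orthogonal to everything, also in
characteristic two. The factor `quad a p''` at `p` gives `xz` and `y²` the same coefficient. -/
theorem exists_standard_basis (a : Fin 3 → Fin 3 → k)
    (hsmooth : ∀ v : Fin 3 → k, v ≠ 0 → quad a v = 0 → ∃ w, polar a v w ≠ 0) (p : Fin 3 → k)
    (hp : p ≠ 0) (hq : quad a p = 0) : ∃ (p' p'' : Fin 3 → k) (N : Matrix (Fin 3) (Fin 3) k),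
      quad a p' = 0 ∧ polar a p p' = 1 ∧ polar a p p'' = 0 ∧ polar a p' p'' = 0 ∧
      quad a p'' ≠ 0 ∧ (Matrix.of fun i => ![p' i, p'' i, quad a p'' * p i]) * N = 1 := by
  obtain ⟨w, hw⟩ := hsmooth p hp hq
  obtain ⟨p', hp', hpp'⟩ : ∃ p', quad a p' = 0 ∧ polar a p p' = 1 := by
    have hu : polar a p ((polar a p w)⁻¹ • w) = 1 := by
      rw [polar_smul, inv_mul_cancel₀ hw]
    generalize (polar a p w)⁻¹ • w = u at hu
    -- As `p` is isotropic and pairs to 1 with `u`, this correction changes the value of the form by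
    -- exactly `-quad a u`.
    refine ⟨u + (-quad a u) • p, ?_, ?_⟩
    · rw [quad_add, quad_smul, hq, polar_smul, polar_comm, hu]; ring
    · rw [polar_add, polar_smul, polar_self, hq, hu]; ring
  obtain ⟨p'', hp''0, hpp'', hp'p''⟩ : ∃ p'', p'' ≠ 0 ∧ polar a p p'' = 0 ∧ polar a p' p'' = 0 := by
    let f : (Fin 3 → k) →ₗ[k] (Fin 2 → k) :=
      { toFun := fun v => ![polar a p v, polar a p' v]
        map_add' := fun v w => by simp [polar_add]
        map_smul' := fun c v => by simp [polar_smul] }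
    have hker := LinearMap.ker_ne_bot_of_finrank_lt (f := f) (by simp)
    obtain ⟨v, hv, hv0⟩ := (Submodule.ne_bot_iff _).mp hker
    rw [LinearMap.mem_ker] at hv
    exact ⟨v, hv0, congrFun hv 0, congrFun hv 1⟩
  have hindep : ∀ x y z : k, x • p' + y • p'' + z • p = 0 → x = 0 ∧ y = 0 ∧ z = 0 := by
    intro x y z h
    have h1 := congrArg (polar a p) h
    have h2 := congrArg (polar a p') h
    have h0 : ∀ v, polar a v 0 = 0 := fun v => by simp [polar]
    rw [polar_add, polar_add, polar_smul, polar_smul, polar_smul, polar_self, h0, hpp', hpp'', hq]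
      at h1
    rw [polar_add, polar_add, polar_smul, polar_smul, polar_smul, polar_self, h0, hp', hp'p'',
      polar_comm, hpp'] at h2
    have hx : x = 0 := by linear_combination h1
    have hz : z = 0 := by linear_combination h2
    rw [hx, hz] at h
    simp only [zero_smul, zero_add, add_zero, smul_eq_zero] at h
    exact ⟨hx, h.resolve_right hp''0, hz⟩
  have hinv : ∀ c : k, c ≠ 0 → ∃ N : Matrix (Fin 3) (Fin 3) k,
      (Matrix.of fun i => ![p' i, p'' i, c * p i]) * N = 1 := by
    intro c hc
    set M : Matrix (Fin 3) (Fin 3) k := Matrix.of fun i => ![p' i, p'' i, c * p i]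
    have hM : M.det ≠ 0 := by
      intro h0
      obtain ⟨v, hv0, hv⟩ := Matrix.exists_mulVec_eq_zero_iff.mpr h0
      obtain ⟨h1, h2, h3⟩ := hindep (v 0) (v 1) (v 2 * c) (by
        rw [← hv]
        funext i
        simp [M, Matrix.mulVec, dotProduct, Fin.sum_univ_three]
        ring)
      refine hv0 (funext fun i => ?_)
      fin_cases i
      · exact h1
      · exact h2
      · exact (mul_eq_zero.mp h3).resolve_right hc
    exact ⟨M⁻¹, Matrix.mul_nonsing_inv _ (isUnit_iff_ne_zero.mpr hM)⟩
  have hc : quad a p'' ≠ 0 := by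
    intro h0
    obtain ⟨u, hu⟩ := hsmooth p'' hp''0 h0
    obtain ⟨N, hN⟩ := hinv 1 one_ne_zero
    have hv : u = (N.mulVec u 0) • p' + (N.mulVec u 1) • p'' + (N.mulVec u 2) • p := by
      have : (Matrix.of fun i => ![p' i, p'' i, 1 * p i]).mulVec (N.mulVec u) = u := by
        rw [Matrix.mulVec_mulVec, hN, Matrix.one_mulVec]
      conv_lhs => rw [← this]
      funext i
      simp only [Matrix.mulVec, dotProduct, Fin.sum_univ_three, Matrix.of_apply, Matrix.cons_val,
        Pi.add_apply, Pi.smul_apply, smul_eq_mul]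
      ring
    rw [hv, polar_add, polar_add, polar_smul, polar_smul, polar_smul, polar_self, h0,
      polar_comm a p'' p', polar_comm a p'' p, hpp'', hp'p''] at hu
    simp at hu
  obtain ⟨N, hN⟩ := hinv _ hc
  exact ⟨p', p'', N, hp', hpp', hpp'', hp'p'', hc, hN⟩

namespace SmoothConic

variable (Q : SmoothConic k) (p : Fin 3 → k)

/-- Homogeneous coordinates in which the conic and its tangent line at a point have the standard
equations `xz + y²` and `x`, up to constant factors. -/
structure Frame where
  /-- The change of coordinates. -/
  W : MvPolynomial (Fin 3) k ≃ₐ[k] MvPolynomial (Fin 3) k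
  mem : W ∈ gradedAut k
  /-- The factor of the equation of the conic. -/
  a : kˣ
  map_q : W Q.q = MvPolynomial.C (a : k) * (model k).q
  map_tangentForm : W (Q.tangentForm p) = MvPolynomial.X 0

variable (k) in
/-- The given coordinates are standard for the model conic. -/
def modelFrame : Frame (model k) (modelPoint k) where
  W := 1
  mem := one_mem _
  a := 1
  map_q := by simp
  map_tangentForm := by
    simp [tangentForm, model, modelPoint, Fin.sum_univ_three, MvPolynomial.pderiv_X]

/-- The tangent form is the polar form with first argument `p`; on the vector `x p' + y p'' + z c p`
it takes the value `x`. -/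
theorem nonempty_frame (hp : p ≠ 0) (hq : MvPolynomial.eval p Q.q = 0) :
    Nonempty (Frame Q p) := by
  obtain ⟨a, ha⟩ := exists_quadratic_coeffs (MvPolynomial.mem_homogeneousSubmodule _ _ |>.mp Q.mem)
  have hquad : ∀ v : Fin 3 → k, MvPolynomial.eval v Q.q = quad a v := fun v => by
    have := aeval_quadratic a v
    rw [← ha] at this
    simpa [MvPolynomial.aeval_eq_eval] using this
  have hpder : ∀ (v : Fin 3 → k) (l : Fin 3), MvPolynomial.eval v (MvPolynomial.pderiv l Q.q) =
      polar a v (Pi.single l 1) := fun v l => by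
    rw [ha, pderiv_quadratic]
    simp [polar, Pi.single_apply]
  -- Smoothness over the algebraic closure is needed only at rational points.
  have hsmooth : ∀ v : Fin 3 → k, v ≠ 0 → quad a v = 0 → ∃ w, polar a v w ≠ 0 := by
    intro v hv h
    obtain ⟨i, hi⟩ := Q.smooth (fun i => algebraMap k _ (v i))
      (fun h0 => hv (funext fun i => by simpa using congrFun h0 i))
      ((MvPolynomial.aeval_algebraMap_apply _ v _).trans (by
        rw [MvPolynomial.aeval_eq_eval]
        simp [hquad, h]))
    refine ⟨Pi.single i 1, fun h0 => hi ?_⟩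
    refine (MvPolynomial.aeval_algebraMap_apply _ v _).trans ?_
    rw [MvPolynomial.aeval_eq_eval]
    simp [hpder, h0]
  rw [hquad] at hq
  obtain ⟨p', p'', N, hp', hpp', hpp'', hp'p'', hc, hN⟩ := exists_standard_basis a hsmooth p hp hq
  let em : (Fin 3 → k) → Fin 3 → MvPolynomial (Fin 3) k := fun v i => MvPolynomial.C (v i)
  let L : Fin 3 → MvPolynomial (Fin 3) k := (MvPolynomial.X 0 : MvPolynomial (Fin 3) k) • em p' +
    ((MvPolynomial.X 1 : MvPolynomial (Fin 3) k) • em p'' +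
      (MvPolynomial.X 2 * MvPolynomial.C (quad a p'') : MvPolynomial (Fin 3) k) • em p)
  have hL : linHom (Matrix.of fun i => ![p' i, p'' i, quad a p'' * p i]) =
      MvPolynomial.aeval L := by
    refine MvPolynomial.algHom_ext fun i => ?_
    rw [linHom_X, MvPolynomial.aeval_X]
    simp only [L, em, Fin.sum_univ_three, Matrix.of_apply, Matrix.cons_val, Pi.add_apply,
      Pi.smul_apply, smul_eq_mul, map_mul]
    ring
  have eq : ∀ v, quad (fun i j => MvPolynomial.C (a i j)) (em v) =
      MvPolynomial.C (quad a v) := fun v => (map_quad a MvPolynomial.C v).symm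
  have ep : ∀ v w, polar (fun i j => MvPolynomial.C (a i j)) (em v) (em w) =
      MvPolynomial.C (polar a v w) := fun v w => (map_polar a MvPolynomial.C v w).symm
  refine ⟨⟨linEquiv _ N hN, linEquiv_mem _ _ _, Units.mk0 _ hc, ?_, ?_⟩⟩
  · change linHom _ Q.q = _
    conv_lhs => rw [ha]
    rw [hL, aeval_quadratic]
    simp only [MvPolynomial.algebraMap_eq]
    simp only [L, quad_add, quad_smul, polar_add, polar_smul, eq]
    rw [polar_comm _ (_ • _), polar_comm _ (_ • _), polar_comm _ (_ • _)]
    simp only [polar_smul, ep]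
    simp only [hp', hpp', hpp'', hp'p'', hq, polar_comm a p'' p', map_zero, map_one, model,
      Units.val_mk0]
    ring
  · change linHom _ (∑ i, _) = _
    have hpolar : ∀ v : Fin 3 → MvPolynomial (Fin 3) k,
        ∑ i, MvPolynomial.C (MvPolynomial.eval p (MvPolynomial.pderiv i Q.q)) * v i =
        polar (fun i j => MvPolynomial.C (a i j)) (em p) v := by
      intro v
      rw [polar]
      refine Finset.sum_congr rfl fun i _ => ?_
      rw [hpder]
      simp [polar, em, Pi.single_apply]
    rw [hpolar]
    rw [hL, ← AlgHom.coe_toRingHom, map_polar]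
    simp only [em, AlgHom.coe_toRingHom, MvPolynomial.algHom_C, MvPolynomial.aeval_X,
      MvPolynomial.algebraMap_eq]
    change polar _ (em p) L = _
    simp only [L, polar_add, polar_smul, ep, hpp', hpp'', polar_self, hq]
    simp

end SmoothConic

/-! ### The coordinate ring of the complement of a conic -/

section AwayEval

variable {S : Type*} [CommRing S] [Algebra k S]

/-- The extension of a homomorphism to fractions with a denominator that becomes invertible. -/
def locEval {f : MvPolynomial (Fin 3) k} (φ : MvPolynomial (Fin 3) k →ₐ[k] S)
    (h : IsUnit (φ f)) : Localization.Away f →+* S :=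
  IsLocalization.Away.lift f (g := (φ : MvPolynomial (Fin 3) k →+* S)) (by exact h)

theorem locEval_algebraMap {f : MvPolynomial (Fin 3) k} (φ : MvPolynomial (Fin 3) k →ₐ[k] S)
    (h : IsUnit (φ f)) (F : MvPolynomial (Fin 3) k) :
    locEval φ h (algebraMap _ (Localization.Away f) F) = φ F :=
  IsLocalization.Away.lift_eq f _ F

/-- The homomorphism `F / fⁿ ↦ φ F / (φ f)ⁿ`. -/
def awayEval {f : MvPolynomial (Fin 3) k} (φ : MvPolynomial (Fin 3) k →ₐ[k] S)
    (h : IsUnit (φ f)) : Away (grading k) f →+* S :=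
  (locEval φ h).comp (algebraMap (Away (grading k) f) (Localization.Away f))

theorem awayEval_eq {f : MvPolynomial (Fin 3) k} (φ : MvPolynomial (Fin 3) k →ₐ[k] S)
    (h : IsUnit (φ f)) (y : Away (grading k) f) : awayEval φ h y = locEval φ h y.val := rfl

theorem val_mk_mul {f : MvPolynomial (Fin 3) k} {d : ℕ} (hf : f ∈ grading k d) (n : ℕ)
    (F : MvPolynomial (Fin 3) k) (hF : F ∈ grading k (n • d)) :
    (Away.mk (grading k) hf n F hF).val * algebraMap _ (Localization.Away f) (f ^ n) =
      algebraMap _ _ F := by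
  rw [Away.val_mk, Localization.mk_eq_mk']
  exact IsLocalization.mk'_spec _ F _

variable {f : MvPolynomial (Fin 3) k} (φ : MvPolynomial (Fin 3) k →ₐ[k] S) (h : IsUnit (φ f))

theorem awayEval_mk {d : ℕ} (hf : f ∈ grading k d) (n : ℕ) (F : MvPolynomial (Fin 3) k)
    (hF : F ∈ grading k (n • d)) :
    awayEval φ h (Away.mk (grading k) hf n F hF) * φ f ^ n = φ F := by
  have h2 := congrArg (locEval φ h) (val_mk_mul hf n F hF)
  rwa [map_mul, locEval_algebraMap, locEval_algebraMap, map_pow] at h2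

variable (k) in
/-- The structure homomorphism of the ring of fractions of degree `0`. -/
def awayBase (f : MvPolynomial (Fin 3) k) : k →+* Away (grading k) f :=
  (algebraMap (grading k 0) (Away (grading k) f)).comp (algebraMap k (grading k 0))

theorem awayEval_awayBase (c : k) : awayEval φ h (awayBase k f c) = algebraMap k S c := by
  have h1 : (awayBase k f c).val = algebraMap _ (Localization.Away f) (MvPolynomial.C c) :=
    Localization.mk_one_eq_algebraMap _
  rw [awayEval_eq, h1, locEval_algebraMap]
  exact MvPolynomial.algHom_C _ _

end AwayEval

theorem comp_specMap_comp_specMap {X : Scheme.{u}} {A B C : Type u} [CommRing A] [CommRing B]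
    [CommRing C] (f : X ⟶ Spec (.of C)) (g : B →+* C) (h : A →+* B) :
    (f ≫ Spec.map (CommRingCat.ofHom g)) ≫ Spec.map (CommRingCat.ofHom h) =
      f ≫ Spec.map (CommRingCat.ofHom (g.comp h)) := by
  rw [Category.assoc, ← Spec.map_comp, ← CommRingCat.ofHom_comp]

theorem basicOpen_ι_toSpecZero (f : MvPolynomial (Fin 3) k) {d : ℕ} (hf : f ∈ grading k d)
    (hd : 0 < d) : (Proj.basicOpen (grading k) f).ι ≫ Proj.toSpecZero (grading k) =
      Proj.basicOpenToSpec (grading k) f ≫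
        Spec.map (CommRingCat.ofHom (fromZeroRingHom (grading k) _)) := by
  rw [← Proj.awayι_toSpecZero (grading k) f hf hd, Proj.awayι, Category.assoc,
    ← Proj.basicOpenIsoSpec_hom (grading k) f hf hd, Iso.hom_inv_id_assoc]

theorem compl_toSpec (Q : SmoothConic k) : Q.compl.ι ≫ Plane.toSpec k =
    Proj.basicOpenToSpec (grading k) Q.q ≫ Spec.map (CommRingCat.ofHom (awayBase k Q.q)) := by
  change (Proj.basicOpen (grading k) Q.q).ι ≫ Proj.toSpecZero (grading k) ≫ _ = _
  rw [← Category.assoc, basicOpen_ι_toSpecZero Q.q Q.mem two_pos, Category.assoc,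
    ← Spec.map_comp, ← CommRingCat.ofHom_comp]
  rfl

namespace SmoothConic.Frame

open Chart

variable {Q : SmoothConic k} {p : Fin 3 → k} (fr : Frame Q p)

/-- Evaluation of a form on the double cover of the complement where the equation of the conic
is constant. -/
def evW : MvPolynomial (Fin 3) k →ₐ[k] Chart k := (ev k).comp (fr.W : _ →ₐ[k] _)

theorem evW_apply (F : MvPolynomial (Fin 3) k) : fr.evW F = ev k (fr.W F) := rfl

theorem evW_q : fr.evW Q.q = algebraMap k _ (fr.a : k) := by
  rw [evW_apply, fr.map_q, map_mul, ev_conic, mul_one]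
  exact MvPolynomial.algHom_C _ _

theorem isUnit_evW_q : IsUnit (fr.evW Q.q) := by
  rw [evW_q]
  exact fr.a.isUnit.map _

theorem W_mem {n : ℕ} {F : MvPolynomial (Fin 3) k} (hF : F ∈ grading k n) :
    (fr.W F).IsHomogeneous n :=
  (fr.mem n F hF).1

theorem W_symm_mem {n : ℕ} {F : MvPolynomial (Fin 3) k} (hF : F.IsHomogeneous n) :
    fr.W.symm F ∈ grading k n :=
  (fr.mem n F hF).2

theorem awayEval_mk_q (n : ℕ) (F : MvPolynomial (Fin 3) k) (hF : F ∈ grading k (n • 2)) :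
    awayEval fr.evW fr.isUnit_evW_q (Away.mk (grading k) Q.mem n F hF) =
      ((fr.a : k)⁻¹ ^ n) • fr.evW F := by
  have h := awayEval_mk fr.evW fr.isUnit_evW_q Q.mem n F hF
  rw [evW_q, ← map_pow] at h
  rw [← h, Algebra.smul_def, mul_comm, mul_assoc, ← map_mul, ← mul_pow,
    mul_inv_cancel₀ fr.a.ne_zero, one_pow, map_one, mul_one]

theorem awayEval_mem (f : Away (grading k) Q.q) :
    awayEval fr.evW fr.isUnit_evW_q f ∈ coordRing k := by
  obtain ⟨n, F, hF, rfl⟩ := Away.mk_surjective (grading k) Q.mem f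
  rw [awayEval_mk_q]
  refine Subalgebra.smul_mem _ (ev_mem (n := n) ?_) _
  rw [mul_comm]
  exact fr.W_mem hF

/-- The homomorphism that underlies `coordEquiv`. -/
def coordHom : Away (grading k) Q.q →+* Coord k where
  toFun f := ofChart (awayEval fr.evW fr.isUnit_evW_q f) (fr.awayEval_mem f)
  map_one' := toChart_injective (by simp)
  map_mul' f g := toChart_injective (by simp)
  map_zero' := toChart_injective (by simp)
  map_add' f g := toChart_injective (by simp)

theorem toChart_coordHom (f : Away (grading k) Q.q) :
    toChart (fr.coordHom f) = awayEval fr.evW fr.isUnit_evW_q f := rfl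

/-- A fraction `F / q^n` vanishes if its numerator vanishes on the quadric, and each element of the
coordinate ring is the value of a form of even degree. -/
theorem coordHom_bijective : Function.Bijective fr.coordHom := by
  constructor
  · rw [injective_iff_map_eq_zero]
    intro f hf
    have hf' : awayEval fr.evW fr.isUnit_evW_q f = 0 := by
      rw [← toChart_coordHom, hf, map_zero]
    obtain ⟨n, F, hF, rfl⟩ := Away.mk_surjective (grading k) Q.mem f
    have h := awayEval_mk fr.evW fr.isUnit_evW_q Q.mem n F hF
    rw [hf', zero_mul, evW_apply] at h
    have h0 : fr.W F = 0 := eq_zero_of_ev_eq_zero (n := n)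
      (by rw [mul_comm]; exact fr.W_mem hF) h.symm
    have hF0 : F = 0 := fr.W.injective (h0.trans (map_zero _).symm)
    exact mk_eq_zero_of_num _ (Subtype.ext hF0)
  · intro f
    -- Any exponent `n` with `deg f ≤ 2n` would do; the degree itself is such an exponent.
    obtain ⟨F, hF, hev⟩ := exists_form (toChart_mem f) (n := (toChart f).natDegree) (by omega)
    refine ⟨Away.mk (grading k) Q.mem (toChart f).natDegree
      (((fr.a : k) ^ (toChart f).natDegree) • fr.W.symm F)
      (Submodule.smul_mem _ _ (fr.W_symm_mem (by rw [smul_eq_mul, mul_comm]; exact hF))), ?_⟩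
    refine toChart_injective ?_
    rw [toChart_coordHom, awayEval_mk_q, map_smul, smul_smul, ← mul_pow,
      inv_mul_cancel₀ fr.a.ne_zero, one_pow, one_smul, evW_apply, AlgEquiv.apply_symm_apply, hev]

/-- The isomorphism of the ring of regular functions on the complement with the coordinate ring of
the complement of the model conic. -/
def coordEquiv : Away (grading k) Q.q ≃+* Coord k :=
  RingEquiv.ofBijective fr.coordHom fr.coordHom_bijective

theorem toChart_coordEquiv (f : Away (grading k) Q.q) :
    toChart (fr.coordEquiv f) = awayEval fr.evW fr.isUnit_evW_q f := rfl

theorem coordEquiv_awayBase (c : k) : fr.coordEquiv (awayBase k Q.q c) = algebraMap k _ c :=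
  toChart_injective (by
    rw [toChart_coordEquiv, awayEval_awayBase, AlgHom.commutes])

theorem coordEquiv_symm_algebraMap (c : k) :
    fr.coordEquiv.symm (algebraMap k _ c) = awayBase k Q.q c := by
  rw [← coordEquiv_awayBase, RingEquiv.symm_apply_apply]

theorem coordEquiv_pencilFun : fr.coordEquiv (Q.pencilFun p) = (fr.a : k)⁻¹ • t k :=
  toChart_injective (by
    rw [toChart_coordEquiv, pencilFun, awayEval_mk_q, map_smul, toChart_t, evW_apply, map_pow,
      map_tangentForm, map_pow, ev_X0, pow_one])

/-- The complement of the conic is affine. -/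
def model : AffineModel (Coord k) (Over.mk (Q.compl.ι ≫ Plane.toSpec k)) where
  iso := Proj.basicOpenIsoSpec (grading k) Q.q Q.mem two_pos ≪≫
    Scheme.Spec.mapIso fr.coordEquiv.symm.toCommRingCatIso.op
  comm := by
    refine Eq.trans ?_ (compl_toSpec Q).symm
    change (Proj.basicOpenToSpec (grading k) Q.q ≫ Spec.map (CommRingCat.ofHom
      (fr.coordEquiv.symm : Coord k →+* Away (grading k) Q.q))) ≫ _ = _
    rw [Category.assoc, ← Spec.map_comp, ← CommRingCat.ofHom_comp]
    congr 3
    exact RingHom.ext fun c => fr.coordEquiv_symm_algebraMap c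

theorem model_iso_hom_comp : fr.model.iso.hom ≫
    Spec.map (CommRingCat.ofHom (fr.coordEquiv : Away (grading k) Q.q →+* Coord k)) =
    Proj.basicOpenToSpec (grading k) Q.q := by
  have : (fr.coordEquiv.symm : Coord k →+* Away (grading k) Q.q).comp
      (fr.coordEquiv : Away (grading k) Q.q →+* Coord k) = RingHom.id _ :=
    RingHom.ext fun f => fr.coordEquiv.symm_apply_apply f
  refine (comp_specMap_comp_specMap (Proj.basicOpenToSpec (grading k) Q.q) _ _).trans ?_
  rw [this, CommRingCat.ofHom_id, Spec.map_id]
  exact Category.comp_id _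

/-! ### The automorphisms that preserve the fibration -/

theorem fibration_eq : Q.fibration p = fr.model.iso.hom ≫ Spec.map (CommRingCat.ofHom
    (aeval ((fr.a : k)⁻¹ • t k) : k[X] →ₐ[k] Coord k).toRingHom) := by
  rw [fibration, ← fr.model_iso_hom_comp]
  refine (comp_specMap_comp_specMap fr.model.iso.hom _ _).trans ?_
  congr 3
  refine Polynomial.ringHom_ext (fun c => ?_) ?_
  · simp only [RingHom.comp_apply, Polynomial.coe_eval₂RingHom, Polynomial.eval₂_C]
    refine (fr.coordEquiv_awayBase c).trans ?_
    simp
  · simp [fr.coordEquiv_pencilFun]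

theorem mem_autFibration_iff_exists {ψ : Q.AutCompl} : ψ ∈ Q.autFibration p ↔
    ∃ β : k[X] ≃ₐ[k] k[X], (fr.model.autEquiv ψ).symm ((fr.a : k)⁻¹ • t k) =
      aeval ((fr.a : k)⁻¹ • t k) (β X) := by
  have key : ∀ α : Aut (line k), ψ.hom.left ≫ Q.fibration p = Q.fibration p ≫ α.hom.left ↔
      (fr.model.autEquiv ψ).symm ((fr.a : k)⁻¹ • t k) =
        aeval ((fr.a : k)⁻¹ • t k) (((lineModel k).autEquiv α).symm X) := by
    intro α
    have hα : α.hom.left = Spec.map (CommRingCat.ofHom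
        (((lineModel k).autEquiv α).symm : k[X] →+* k[X])) := by
      exact (Category.comp_id _).symm.trans (((lineModel k).hom_left_comp α).trans
        (Category.id_comp _))
    have hψ := fr.model.hom_left_comp ψ
    rw [hα, fr.fibration_eq]
    have e1 : ψ.hom.left ≫ fr.model.iso.hom ≫ Spec.map (CommRingCat.ofHom
          (aeval ((fr.a : k)⁻¹ • t k) : k[X] →ₐ[k] Coord k).toRingHom) =
        fr.model.iso.hom ≫ Spec.map (CommRingCat.ofHom
          (((fr.model.autEquiv ψ).symm : Coord k →+* Coord k).comp
          (aeval ((fr.a : k)⁻¹ • t k) : k[X] →ₐ[k] Coord k).toRingHom)) := by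
      rw [← Category.assoc, hψ]
      exact comp_specMap_comp_specMap fr.model.iso.hom _ _
    refine (Eq.congr e1 (comp_specMap_comp_specMap fr.model.iso.hom _ _)).trans ?_
    rw [Iso.cancel_iso_hom_left, Spec.map_inj]
    constructor
    · intro h
      have := RingHom.congr_fun (congrArg CommRingCat.Hom.hom h) X
      simpa using this
    · intro h
      congr 1
      refine Polynomial.ringHom_ext (fun c => ?_) ?_
      · change (fr.model.autEquiv ψ).symm (aeval _ (C c)) =
          aeval _ (((lineModel k).autEquiv α).symm (C c))
        rw [← Polynomial.algebraMap_eq, AlgEquiv.commutes, AlgHom.commutes, AlgEquiv.commutes]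
      · simpa using h
  constructor
  · rintro ⟨α, h⟩
    exact ⟨_, (key α).mp h⟩
  · rintro ⟨β, h⟩
    refine ⟨(lineModel k).autEquiv.symm β.symm, (key _).mpr ?_⟩
    rw [MulEquiv.apply_symm_apply]
    exact h

theorem _root_.ConicComplement.natDegree_algEquiv_X (β : k[X] ≃ₐ[k] k[X]) :
    (β X).natDegree = 1 := by
  have h : (β.symm X).comp (β X) = X := by
    have h1 : β (β.symm X) = aeval (β X) (β.symm X) := by
      rw [Polynomial.aeval_algHom_apply, Polynomial.aeval_X_left_apply]
    rw [AlgEquiv.apply_symm_apply] at h1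
    exact h1.symm
  have := congrArg natDegree h
  rw [natDegree_comp, natDegree_X] at this
  exact Nat.eq_one_of_mul_eq_one_left this

/-- An automorphism of the line is affine, so `t` goes to `lt + μ`, and `μ = 0` by
`eq_zero_of_autRing_t_eq`. Conversely, multiplication by `l` is an automorphism of the line. -/
theorem mem_autFibration_iff {ψ : Q.AutCompl} :
    ψ ∈ Q.autFibration p ↔ fr.model.autEquiv ψ ∈ fibSub k := by
  rw [fr.mem_autFibration_iff_exists, ← inv_mem_iff]
  have ha : (fr.a : k)⁻¹ ≠ 0 := inv_ne_zero fr.a.ne_zero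
  constructor
  · rintro ⟨β, h⟩
    have hX := Polynomial.eq_X_add_C_of_natDegree_le_one (natDegree_algEquiv_X β).le
    rw [hX] at h
    refine mem_fibSub_of_eq (l := (β X).coeff 1) (μ := (fr.a : k) * (β X).coeff 0) ?_
    refine smul_right_injective _ ha ?_
    have h' : (fr.a : k)⁻¹ • (fr.model.autEquiv ψ).symm (t k) = _ :=
      (map_smul (fr.model.autEquiv ψ).symm _ _).symm.trans h
    refine h'.trans ?_
    simp only [map_add, map_mul, aeval_C, aeval_X, Algebra.smul_def]
    have hinv : algebraMap k (Coord k) (fr.a : k)⁻¹ * algebraMap k (Coord k) (fr.a : k) = 1 := by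
      rw [← map_mul, inv_mul_cancel₀ fr.a.ne_zero, map_one]
    linear_combination -algebraMap k (Coord k) ((β X).coeff 0) * hinv
  · rintro ⟨l, hl⟩
    have hl0 : l ≠ 0 := by
      rintro rfl
      exact autRing_t_ne_zero _ (by rw [hl, zero_smul])
    let := invertibleOfNonzero hl0
    refine ⟨Polynomial.algEquivCMulXAddC l 0, ?_⟩
    have hl' : (fr.model.autEquiv ψ).symm (t k) = l • t k := hl
    rw [map_smul, hl']
    simp [Algebra.smul_def]
    ring

end SmoothConic.Frame

/-! ### Automorphisms of the plane defined by linear substitutions -/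

section ProjAut

theorem projMap_congr {f g : GradedRingHom (grading k) (grading k)} (h : f = g)
    (hf : HomogeneousIdeal.irrelevant (grading k) ≤
      (HomogeneousIdeal.irrelevant (grading k)).map f) :
    Proj.map f hf = Proj.map g (h ▸ hf) := by
  subst h; rfl

/-- An algebra automorphism that respects the grading, as a graded homomorphism. -/
def gradedHom {W : MvPolynomial (Fin 3) k ≃ₐ[k] MvPolynomial (Fin 3) k} (hW : W ∈ gradedAut k) :
    GradedRingHom (grading k) (grading k) where
  toRingHom := (W : MvPolynomial (Fin 3) k →+* MvPolynomial (Fin 3) k)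
  map_mem := fun {n f} hf => (hW n f hf).1

variable {W V : MvPolynomial (Fin 3) k ≃ₐ[k] MvPolynomial (Fin 3) k} (hW : W ∈ gradedAut k)
  (hV : V ∈ gradedAut k)

theorem gradedHom_mul : gradedHom (mul_mem hW hV) = (gradedHom hW).comp (gradedHom hV) :=
  GradedRingHom.ext fun _ => rfl

theorem irrelevant_le_map_gradedHom : HomogeneousIdeal.irrelevant (grading k) ≤
    (HomogeneousIdeal.irrelevant (grading k)).map (gradedHom hW) := by
  intro f hf
  have hf' : W⁻¹ f ∈ HomogeneousIdeal.irrelevant (grading k) := by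
    rw [HomogeneousIdeal.mem_irrelevant_iff, GradedRing.proj_apply] at hf ⊢
    have h : gradedHom (inv_mem hW) f = W⁻¹ f := rfl
    rw [← h, ← GradedRingHom.map_directSumDecompose, hf, map_zero]
  have h : W (W⁻¹ f) = f := W.apply_symm_apply f
  rw [← h]
  exact Ideal.mem_map_of_mem (gradedHom hW) hf'

/-- The morphism of the plane defined by a graded automorphism. -/
def planeMap : Plane k ⟶ Plane k := Proj.map (gradedHom hW) (irrelevant_le_map_gradedHom hW)

theorem planeMap_mul : planeMap (mul_mem hW hV) = planeMap hW ≫ planeMap hV := by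
  refine (projMap_congr (gradedHom_mul hW hV) _).trans ?_
  exact Proj.map_comp (gradedHom hV) (gradedHom hW) _ _

theorem planeMap_one : planeMap (one_mem (gradedAut k)) = 𝟙 (Plane k) := by
  have h : gradedHom (one_mem (gradedAut k)) = .id (grading k) := GradedRingHom.ext fun _ => rfl
  exact (projMap_congr h _).trans Proj.map_id

theorem planeMap_congr (h : W = V) : planeMap hW = planeMap (h ▸ hW) := by
  subst h; rfl

theorem awayι_comp_projMap {Λ : GradedRingHom (grading k) (grading k)}
    (hΛ : HomogeneousIdeal.irrelevant (grading k) ≤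
      (HomogeneousIdeal.irrelevant (grading k)).map Λ) {d : ℕ} (hd : 0 < d)
    {s s' : MvPolynomial (Fin 3) k} (hs : s ∈ grading k d) (hs' : s' ∈ grading k d)
    (h : Λ s = s') : ∃ g : Away (grading k) s →+* Away (grading k) s',
      (∀ n F hF, g (Away.mk (grading k) hs n F hF) =
        Away.mk (grading k) hs' n (Λ F) (Λ.map_mem hF)) ∧
      Proj.awayι (grading k) s' hs' hd ≫ Proj.map Λ hΛ =
        Spec.map (CommRingCat.ofHom g) ≫ Proj.awayι (grading k) s hs hd := by
  subst h
  exact ⟨Away.map Λ s, fun n F hF => Away.map_mk _ _ _ _ _ _, Proj.awayι_comp_map Λ hΛ hd s hs⟩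

theorem awayBase_eq_mk {s : MvPolynomial (Fin 3) k} {d : ℕ} (hs : s ∈ grading k d) (c : k) :
    awayBase k s c = Away.mk (grading k) hs 0 (MvPolynomial.C c) (by
      rw [zero_smul]; exact MvPolynomial.isHomogeneous_C _ _) := by
  apply val_injective
  rw [Away.val_mk]
  simp only [pow_zero]
  rfl

theorem awayι_toSpec {d : ℕ} (hd : 0 < d) {s : MvPolynomial (Fin 3) k} (hs : s ∈ grading k d) :
    Proj.awayι (grading k) s hs hd ≫ Plane.toSpec k =
      Spec.map (CommRingCat.ofHom (awayBase k s)) := by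
  change Proj.awayι (grading k) s hs hd ≫ Proj.toSpecZero (grading k) ≫ _ = _
  rw [← Category.assoc, Proj.awayι_toSpecZero, ← Spec.map_comp, ← CommRingCat.ofHom_comp]
  rfl

/-- On the charts where some `Λ s` does not vanish, which cover the plane, both sides come from ring
homomorphisms, and these agree on constants. -/
theorem projMap_toSpec (Λ : GradedRingHom (grading k) (grading k))
    (hΛ : HomogeneousIdeal.irrelevant (grading k) ≤
      (HomogeneousIdeal.irrelevant (grading k)).map Λ)
    (hC : ∀ c : k, Λ (MvPolynomial.C c) = MvPolynomial.C c) :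
    (Proj.map Λ hΛ : Plane k ⟶ Plane k) ≫ Plane.toSpec k = Plane.toSpec k := by
  have key : ∀ {d : ℕ} (hd : 0 < d) {s : MvPolynomial (Fin 3) k} (hs : s ∈ grading k d),
      Proj.awayι (grading k) (Λ s) (Λ.map_mem hs) hd ≫
        ((Proj.map Λ hΛ : Plane k ⟶ Plane k) ≫ Plane.toSpec k) =
      Proj.awayι (grading k) (Λ s) (Λ.map_mem hs) hd ≫ Plane.toSpec k := by
    intro d hd s hs
    obtain ⟨g, hg, h⟩ := awayι_comp_projMap hΛ hd hs (Λ.map_mem hs) rfl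
    refine (Category.assoc _ _ _).symm.trans ?_
    refine (congrArg (· ≫ Plane.toSpec k) h).trans ?_
    refine (Category.assoc _ _ _).trans ?_
    refine (congrArg (Spec.map (CommRingCat.ofHom g) ≫ ·) (awayι_toSpec hd hs)).trans ?_
    rw [awayι_toSpec, ← Spec.map_comp, ← CommRingCat.ofHom_comp]
    congr 2
    ext c
    rw [RingHom.comp_apply, awayBase_eq_mk hs, hg]
    refine congrArg val (Eq.trans ?_ (awayBase_eq_mk (Λ.map_mem hs) c).symm)
    simp only [hC]
  exact (Proj.mapAffineOpenCover Λ hΛ).openCover.hom_ext _ _ fun s => key s.1.2 s.2.2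

theorem gradedHom_C (c : k) : gradedHom hW (MvPolynomial.C c) = MvPolynomial.C c :=
  W.commutes c

theorem planeMap_toSpec : planeMap hW ≫ Plane.toSpec k = Plane.toSpec k :=
  projMap_toSpec _ _ (gradedHom_C hW)

/-- The automorphism of the plane defined by a graded automorphism. -/
def planeAut : AutPlane k where
  hom := Over.homMk (planeMap hW) (planeMap_toSpec hW)
  inv := Over.homMk (planeMap (inv_mem hW)) (planeMap_toSpec _)
  hom_inv_id := by
    ext1
    change planeMap hW ≫ planeMap (inv_mem hW) = 𝟙 (Plane k)
    rw [← planeMap_mul, planeMap_congr _ (mul_inv_cancel W), planeMap_one]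
  inv_hom_id := by
    ext1
    change planeMap (inv_mem hW) ≫ planeMap hW = 𝟙 (Plane k)
    rw [← planeMap_mul, planeMap_congr _ (inv_mul_cancel W), planeMap_one]

theorem planeAut_isGivenBy : (planeAut hW).IsGivenBy fun i => W (MvPolynomial.X i) :=
  ⟨gradedHom hW, irrelevant_le_map_gradedHom hW,
    gradedHom_C hW, fun _ => rfl, rfl⟩

theorem gradedRingHom_eq_aeval {Λ : GradedRingHom (grading k) (grading k)}
    {L : Fin 3 → MvPolynomial (Fin 3) k} (hC : ∀ c : k, Λ (MvPolynomial.C c) = MvPolynomial.C c)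
    (hX : ∀ i, Λ (MvPolynomial.X i) = L i) (F : MvPolynomial (Fin 3) k) :
    Λ F = MvPolynomial.aeval L F := by
  have h : Λ.toRingHom = (MvPolynomial.aeval L : _ →ₐ[k] MvPolynomial (Fin 3) k).toRingHom := by
    refine MvPolynomial.ringHom_ext (fun c => ?_) fun i => ?_
    · exact (hC c).trans (MvPolynomial.algHom_C _ _).symm
    · exact (hX i).trans (MvPolynomial.aeval_X _ _).symm
  exact RingHom.congr_fun h F

theorem comp_eq_comp_iff_of_mono {C : Type*} [Category* C] {S P T : C} {b : S ⟶ T} {a : T ⟶ P}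
    [Mono a] {i : S ⟶ P} (h : b ≫ a = i) {f : S ⟶ S} {φ : P ⟶ P} {γ : T ⟶ T}
    (hγ : a ≫ φ = γ ≫ a) : f ≫ i = i ≫ φ ↔ f ≫ b = b ≫ γ := by
  rw [← h, Category.assoc, hγ, ← cancel_mono a, Category.assoc, Category.assoc]

end ProjAut

namespace SmoothConic

variable (Q : SmoothConic k)

/-! ### Restriction of automorphisms to the complement of the conic -/

instance : IsOpenImmersion Q.compl.ι := inferInstance

theorem range_ι_comp_subset {φ : AutPlane k} (hφ : φ ∈ Q.autPair) :
    Set.range (Q.compl.ι ≫ φ.hom.left) ⊆ Set.range Q.compl.ι := by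
  rintro _ ⟨x, rfl⟩
  rw [Scheme.Opens.range_ι]
  exact (hφ (Q.compl.ι x)).mpr x.2

/-- The morphism that underlies the restriction of an automorphism to the complement. -/
def resLeft {φ : AutPlane k} (hφ : φ ∈ Q.autPair) : Q.compl.toScheme ⟶ Q.compl.toScheme :=
  IsOpenImmersion.lift Q.compl.ι (Q.compl.ι ≫ φ.hom.left) (Q.range_ι_comp_subset hφ)

theorem resLeft_ι {φ : AutPlane k} (hφ : φ ∈ Q.autPair) :
    Q.resLeft hφ ≫ Q.compl.ι = Q.compl.ι ≫ φ.hom.left :=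
  IsOpenImmersion.lift_fac _ _ _

theorem resLeft_comp {φ χ : AutPlane k} (hφ : φ ∈ Q.autPair) (hχ : χ ∈ Q.autPair)
    (h : φ.hom.left ≫ χ.hom.left = 𝟙 (Plane k)) : Q.resLeft hφ ≫ Q.resLeft hχ = 𝟙 _ := by
  rw [← cancel_mono Q.compl.ι, Category.assoc, resLeft_ι, ← Category.assoc, resLeft_ι,
    Category.assoc, h, Category.id_comp]
  exact Category.comp_id _

theorem exists_res {φ : AutPlane k} (hφ : φ ∈ Q.autPair) :
    ∃ ψ : Q.AutCompl, ψ.hom.left ≫ Q.compl.ι = Q.compl.ι ≫ φ.hom.left := by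
  have hw : ∀ {χ : AutPlane k} (hχ : χ ∈ Q.autPair),
      Q.resLeft hχ ≫ Q.compl.ι ≫ Plane.toSpec k = Q.compl.ι ≫ Plane.toSpec k := fun {χ} hχ => by
    rw [← Category.assoc, resLeft_ι, Category.assoc]
    exact congrArg _ (Over.w χ.hom)
  refine ⟨⟨Over.homMk (Q.resLeft hφ) (hw hφ), Over.homMk (Q.resLeft (inv_mem hφ)) (hw _), ?_, ?_⟩,
    Q.resLeft_ι hφ⟩
  · ext1
    refine Q.resLeft_comp hφ (inv_mem hφ) ?_
    change φ.hom.left ≫ φ.inv.left = _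
    rw [← Over.comp_left, φ.hom_inv_id]; rfl
  · ext1
    refine Q.resLeft_comp (inv_mem hφ) hφ ?_
    change φ.inv.left ≫ φ.hom.left = _
    rw [← Over.comp_left, φ.inv_hom_id]; rfl

variable {Q}

theorem mem_autPair_of_projMap {φ : AutPlane k} {Λ : GradedRingHom (grading k) (grading k)}
    {hΛ : HomogeneousIdeal.irrelevant (grading k) ≤
      (HomogeneousIdeal.irrelevant (grading k)).map Λ} (h : φ.hom.left = Proj.map Λ hΛ)
    (hq : Λ Q.q = Q.q) : φ ∈ Q.autPair := by
  intro x
  rw [h]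
  change x ∈ Proj.map Λ hΛ ⁻¹ᵁ Proj.basicOpen (grading k) Q.q ↔ _
  rw [Proj.map_preimage_basicOpen, hq]
  rfl

theorem isGivenBy_mem {φ : AutPlane k} {L : Fin 3 → MvPolynomial (Fin 3) k} (h : φ.IsGivenBy L)
    (hL : MvPolynomial.aeval L Q.q = Q.q) : φ ∈ Q.autPair := by
  obtain ⟨Λ, hΛ, hC, hX, hφ⟩ := h
  exact mem_autPair_of_projMap hφ ((gradedRingHom_eq_aeval hC hX _).trans hL)

namespace Frame

open Chart

variable {p : Fin 3 → k} (fr : Frame Q p)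

theorem hom_left_basicOpenToSpec_iff {ψ : Q.AutCompl}
    {g : Away (grading k) Q.q →+* Away (grading k) Q.q} :
    ψ.hom.left ≫ Proj.basicOpenToSpec (grading k) Q.q =
      Proj.basicOpenToSpec (grading k) Q.q ≫ Spec.map (CommRingCat.ofHom g) ↔
    ∀ f, (fr.model.autEquiv ψ).symm (fr.coordEquiv f) = fr.coordEquiv (g f) := by
  rw [← fr.model_iso_hom_comp]
  have e1 : ψ.hom.left ≫ fr.model.iso.hom ≫
      Spec.map (CommRingCat.ofHom (fr.coordEquiv : Away (grading k) Q.q →+* Coord k)) =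
      fr.model.iso.hom ≫ Spec.map (CommRingCat.ofHom
        (((fr.model.autEquiv ψ).symm : Coord k →+* Coord k).comp
          (fr.coordEquiv : Away (grading k) Q.q →+* Coord k))) := by
    rw [← Category.assoc, fr.model.hom_left_comp]
    exact comp_specMap_comp_specMap fr.model.iso.hom _ _
  refine (Eq.congr e1 (comp_specMap_comp_specMap fr.model.iso.hom _ _)).trans ?_
  rw [Iso.cancel_iso_hom_left, Spec.map_inj]
  constructor
  · intro h f
    exact RingHom.congr_fun (congrArg CommRingCat.Hom.hom h) f
  · intro h
    congr 1
    exact RingHom.ext h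

theorem basicOpenToSpec_awayι : Proj.basicOpenToSpec (grading k) Q.q ≫
    Proj.awayι (grading k) Q.q Q.mem two_pos = Q.compl.ι := by
  rw [Proj.awayι, ← Proj.basicOpenIsoSpec_hom (grading k) Q.q Q.mem two_pos,
    Iso.hom_inv_id_assoc]
  rfl

theorem comp_ι_iff {ψ : Q.AutCompl} {φ : AutPlane k}
    {g : Away (grading k) Q.q →+* Away (grading k) Q.q}
    (hg : Proj.awayι (grading k) Q.q Q.mem two_pos ≫ φ.hom.left =
      Spec.map (CommRingCat.ofHom g) ≫ Proj.awayι (grading k) Q.q Q.mem two_pos) :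
    ψ.hom.left ≫ Q.compl.ι = Q.compl.ι ≫ φ.hom.left ↔
      ∀ f, (fr.model.autEquiv ψ).symm (fr.coordEquiv f) = fr.coordEquiv (g f) := by
  exact (comp_eq_comp_iff_of_mono basicOpenToSpec_awayι hg).trans fr.hom_left_basicOpenToSpec_iff

/-- The effect of the restriction of a linear automorphism on functions. -/
theorem symm_ev_of_projMap {ψ : Q.AutCompl} {φ : AutPlane k}
    {Λ : GradedRingHom (grading k) (grading k)}
    {hΛ : HomogeneousIdeal.irrelevant (grading k) ≤
      (HomogeneousIdeal.irrelevant (grading k)).map Λ} (h : φ.hom.left = Proj.map Λ hΛ)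
    (hq : Λ Q.q = Q.q) :
    ψ.hom.left ≫ Q.compl.ι = Q.compl.ι ≫ φ.hom.left ↔
    ∀ (n : ℕ) (G : MvPolynomial (Fin 3) k) (hG : G.IsHomogeneous (2 * n)),
      toChart ((fr.model.autEquiv ψ).symm (ofChart (ev k G) (ev_mem hG))) =
        ev k (fr.W (Λ (fr.W.symm G))) := by
  obtain ⟨g, hg, hg'⟩ := awayι_comp_projMap hΛ two_pos Q.mem Q.mem hq
  rw [fr.comp_ι_iff (g := g) (by rw [h]; exact hg')]
  have key : ∀ (n : ℕ) (F : MvPolynomial (Fin 3) k) (hF : F ∈ grading k (n • 2)),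
      fr.coordEquiv (Away.mk (grading k) Q.mem n F hF) = ((fr.a : k)⁻¹ ^ n) •
        ofChart (ev k (fr.W F)) (ev_mem (n := n) (by rw [mul_comm]; exact fr.W_mem hF)) := by
    intro n F hF
    refine toChart_injective ?_
    rw [toChart_coordEquiv, awayEval_mk_q, map_smul, toChart_ofChart, evW_apply]
  constructor
  · intro H n G hG
    have hG' : fr.W.symm G ∈ grading k (n • 2) :=
      fr.W_symm_mem (by rw [smul_eq_mul, mul_comm]; exact hG)
    have := H (Away.mk (grading k) Q.mem n (fr.W.symm G) hG')
    rw [hg, key, key, map_smul] at this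
    have := congrArg toChart (smul_right_injective _ (pow_ne_zero n (inv_ne_zero fr.a.ne_zero)) this)
    simpa only [AlgEquiv.apply_symm_apply, toChart_ofChart] using this
  · intro H f
    obtain ⟨n, F, hF, rfl⟩ := Away.mk_surjective (grading k) Q.mem f
    rw [hg, key, key, map_smul]
    refine congrArg (((fr.a : k)⁻¹ ^ n) • ·) (toChart_injective ?_)
    rw [H n _ (by rw [mul_comm]; exact fr.W_mem hF), toChart_ofChart,
      AlgEquiv.symm_apply_apply]

end Frame

end SmoothConic

/-! ### The linear automorphisms of the model conic -/

theorem aeval_mem_of_linear {L : Fin 3 → MvPolynomial (Fin 3) k} (hL : ∀ i, (L i).IsHomogeneous 1)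
    {n : ℕ} {f : MvPolynomial (Fin 3) k} (hf : f ∈ grading k n) :
    MvPolynomial.aeval L f ∈ grading k n := by
  have h := MvPolynomial.IsHomogeneous.aeval (hφ := hf) L hL
  rw [one_mul] at h
  exact h

/-- A pair of mutually inverse substitutions. -/
def substEquiv (L L' : Fin 3 → MvPolynomial (Fin 3) k)
    (h : ∀ i, MvPolynomial.aeval L (L' i) = MvPolynomial.X i)
    (h' : ∀ i, MvPolynomial.aeval L' (L i) = MvPolynomial.X i) :
    MvPolynomial (Fin 3) k ≃ₐ[k] MvPolynomial (Fin 3) k :=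
  AlgEquiv.ofAlgHom (MvPolynomial.aeval L) (MvPolynomial.aeval L')
    (MvPolynomial.algHom_ext fun i => by
      rw [AlgHom.comp_apply, MvPolynomial.aeval_X, h, AlgHom.id_apply])
    (MvPolynomial.algHom_ext fun i => by
      rw [AlgHom.comp_apply, MvPolynomial.aeval_X, h', AlgHom.id_apply])

theorem substEquiv_mem {L L' : Fin 3 → MvPolynomial (Fin 3) k}
    {h : ∀ i, MvPolynomial.aeval L (L' i) = MvPolynomial.X i}
    {h' : ∀ i, MvPolynomial.aeval L' (L i) = MvPolynomial.X i} (hL : ∀ i, (L i).IsHomogeneous 1)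
    (hL' : ∀ i, (L' i).IsHomogeneous 1) : substEquiv L L' h h' ∈ gradedAut k :=
  fun _ _ hf => ⟨aeval_mem_of_linear hL hf, aeval_mem_of_linear hL' hf⟩

open SmoothConic

theorem shear_isHomogeneous (b : k) (i : Fin 3) : (shear b i).IsHomogeneous 1 := by
  have hX := MvPolynomial.isHomogeneous_X (σ := Fin 3) k
  have hC : ∀ (c : k) (F : MvPolynomial (Fin 3) k), F.IsHomogeneous 1 →
      (MvPolynomial.C c * F).IsHomogeneous 1 := fun c F hF => by
    simpa using (MvPolynomial.isHomogeneous_C (Fin 3) c).mul hF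
  fin_cases i
  · exact hX 0
  · exact (hX 1).add (hC b _ (hX 0))
  · have h : shear b 2 = MvPolynomial.X 2 - MvPolynomial.C (2 * b) * MvPolynomial.X 1 -
        MvPolynomial.C (b ^ 2) * MvPolynomial.X 0 := by
      simp only [shear, Matrix.cons_val, map_mul, map_pow, map_ofNat]
    change (shear b 2).IsHomogeneous 1
    rw [h]
    exact ((hX 2).sub (hC _ _ (hX 1))).sub (hC _ _ (hX 0))

theorem torus_isHomogeneous (a : kˣ) (i : Fin 3) : (torus a i).IsHomogeneous 1 := by
  have hX := MvPolynomial.isHomogeneous_X (σ := Fin 3) k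
  have hC : ∀ (c : k) (F : MvPolynomial (Fin 3) k), F.IsHomogeneous 1 →
      (MvPolynomial.C c * F).IsHomogeneous 1 := fun c F hF => by
    simpa using (MvPolynomial.isHomogeneous_C (Fin 3) c).mul hF
  fin_cases i
  · exact hC _ _ (hX 0)
  · exact hX 1
  · exact hC _ _ (hX 2)

theorem swap_isHomogeneous (i : Fin 3) : (SmoothConic.swap k i).IsHomogeneous 1 := by
  have hX := MvPolynomial.isHomogeneous_X (σ := Fin 3) k
  fin_cases i
  · exact hX 2
  · exact (hX 1).neg
  · exact hX 0

theorem aeval_shear_shear (b : k) (i : Fin 3) :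
    MvPolynomial.aeval (shear b) (shear (-b) i) = MvPolynomial.X i := by
  have hC : ∀ c : k, MvPolynomial.aeval (shear b) (MvPolynomial.C c) = MvPolynomial.C c :=
    fun c => MvPolynomial.algHom_C _ _
  have h2 : MvPolynomial.aeval (shear b) (2 : MvPolynomial (Fin 3) k) = 2 := map_ofNat _ 2
  have e : ∀ i : Fin 3, MvPolynomial.aeval (shear b) (MvPolynomial.X i : MvPolynomial (Fin 3) k) =
      shear b i :=
    fun i => MvPolynomial.aeval_X _ _
  fin_cases i
  · exact e 0
  · change MvPolynomial.aeval (shear b) (MvPolynomial.X 1 + MvPolynomial.C (-b) * MvPolynomial.X 0)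
      = MvPolynomial.X 1
    rw [map_add, map_mul, hC, e, e]
    simp only [shear, Matrix.cons_val, map_neg]
    ring
  · change MvPolynomial.aeval (shear b) (MvPolynomial.X 2 - 2 * MvPolynomial.C (-b) *
      MvPolynomial.X 1 - MvPolynomial.C (-b) ^ 2 * MvPolynomial.X 0) = MvPolynomial.X 2
    rw [map_sub, map_sub, map_mul, map_mul, map_mul, map_pow, hC, e, e, e, h2]
    simp only [shear, Matrix.cons_val, map_neg]
    ring

theorem C_mul_C_inv (a : kˣ) : (MvPolynomial.C (a : k) : MvPolynomial (Fin 3) k) *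
    MvPolynomial.C ((a⁻¹ : kˣ) : k) = 1 := by
  rw [← map_mul, Units.mul_inv, map_one]

theorem aeval_torus_torus (a : kˣ) (i : Fin 3) :
    MvPolynomial.aeval (torus a) (torus a⁻¹ i) = MvPolynomial.X i := by
  have hC : ∀ c : k, MvPolynomial.aeval (torus a) (MvPolynomial.C c) = MvPolynomial.C c :=
    fun c => MvPolynomial.algHom_C _ _
  have h := C_mul_C_inv a
  have e0 : torus a⁻¹ 0 = MvPolynomial.C ((a⁻¹ : kˣ) : k) * MvPolynomial.X 0 := rfl
  have e1 : torus a⁻¹ 1 = (MvPolynomial.X 1 : MvPolynomial (Fin 3) k) := rfl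
  have e2 : torus a⁻¹ 2 = MvPolynomial.C ((a⁻¹⁻¹ : kˣ) : k) * MvPolynomial.X 2 := rfl
  fin_cases i
  · change MvPolynomial.aeval (torus a) (torus a⁻¹ 0) = MvPolynomial.X 0
    rw [e0, map_mul, hC, MvPolynomial.aeval_X]
    change _ * (MvPolynomial.C (a : k) * MvPolynomial.X 0) = _
    linear_combination MvPolynomial.X 0 * h
  · change MvPolynomial.aeval (torus a) (torus a⁻¹ 1) = MvPolynomial.X 1
    rw [e1, MvPolynomial.aeval_X]
    rfl
  · change MvPolynomial.aeval (torus a) (torus a⁻¹ 2) = MvPolynomial.X 2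
    rw [e2, map_mul, hC, MvPolynomial.aeval_X, inv_inv]
    change _ * (MvPolynomial.C ((a⁻¹ : kˣ) : k) * MvPolynomial.X 2) = _
    linear_combination MvPolynomial.X 2 * h

theorem aeval_swap_swap (i : Fin 3) :
    MvPolynomial.aeval (SmoothConic.swap k) (SmoothConic.swap k i) = MvPolynomial.X i := by
  fin_cases i <;> simp [SmoothConic.swap]

theorem aeval_shear_conic (b : k) : MvPolynomial.aeval (shear b) (Chart.conic k) = Chart.conic k := by
  simp [Chart.conic_def, shear]
  ring

theorem aeval_torus_conic (a : kˣ) :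
    MvPolynomial.aeval (torus a) (Chart.conic k) = Chart.conic k := by
  have h := C_mul_C_inv a
  have e : MvPolynomial.aeval (torus a) (Chart.conic k) = MvPolynomial.C (a : k) * MvPolynomial.X 0 *
      (MvPolynomial.C ((a⁻¹ : kˣ) : k) * MvPolynomial.X 2) + MvPolynomial.X 1 ^ 2 := by
    simp [Chart.conic_def, torus]
  rw [e, Chart.conic_def]
  linear_combination MvPolynomial.X 0 * MvPolynomial.X 2 * h

theorem aeval_swap_conic :
    MvPolynomial.aeval (SmoothConic.swap k) (Chart.conic k) = Chart.conic k := by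
  simp [Chart.conic_def, SmoothConic.swap]
  ring

/-- The shear as an automorphism of `k[x, y, z]`. -/
def shearEquiv (b : k) : MvPolynomial (Fin 3) k ≃ₐ[k] MvPolynomial (Fin 3) k :=
  substEquiv (shear b) (shear (-b)) (aeval_shear_shear b)
    (fun i => by simpa using aeval_shear_shear (-b) i)

/-- The torus element as an automorphism of `k[x, y, z]`. -/
def torusEquiv (a : kˣ) : MvPolynomial (Fin 3) k ≃ₐ[k] MvPolynomial (Fin 3) k :=
  substEquiv (torus a) (torus a⁻¹) (aeval_torus_torus a)
    (fun i => by simpa using aeval_torus_torus a⁻¹ i)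

variable (k) in
/-- The swap as an automorphism of `k[x, y, z]`. -/
def swapEquiv : MvPolynomial (Fin 3) k ≃ₐ[k] MvPolynomial (Fin 3) k :=
  substEquiv (SmoothConic.swap k) (SmoothConic.swap k) aeval_swap_swap aeval_swap_swap

theorem shearEquiv_mem (b : k) : shearEquiv b ∈ gradedAut k :=
  substEquiv_mem (shear_isHomogeneous b) (shear_isHomogeneous (-b))

theorem torusEquiv_mem (a : kˣ) : torusEquiv a ∈ gradedAut k :=
  substEquiv_mem (torus_isHomogeneous a) (torus_isHomogeneous a⁻¹)

variable (k) in
theorem swapEquiv_mem : swapEquiv k ∈ gradedAut k :=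
  substEquiv_mem swap_isHomogeneous swap_isHomogeneous

theorem shear_isGivenBy (b : k) : (planeAut (shearEquiv_mem b)).IsGivenBy (shear b) := by
  have h := planeAut_isGivenBy (shearEquiv_mem b)
  have e : (fun i => shearEquiv b (MvPolynomial.X i)) = shear b :=
    funext fun i => MvPolynomial.aeval_X _ _
  rwa [e] at h

theorem torus_isGivenBy (a : kˣ) : (planeAut (torusEquiv_mem a)).IsGivenBy (torus a) := by
  have h := planeAut_isGivenBy (torusEquiv_mem a)
  have e : (fun i => torusEquiv a (MvPolynomial.X i)) = torus a :=
    funext fun i => MvPolynomial.aeval_X _ _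
  rwa [e] at h

variable (k) in
theorem swap_isGivenBy : (planeAut (swapEquiv_mem k)).IsGivenBy (SmoothConic.swap k) := by
  have h := planeAut_isGivenBy (swapEquiv_mem k)
  have e : (fun i => swapEquiv k (MvPolynomial.X i)) = SmoothConic.swap k :=
    funext fun i => MvPolynomial.aeval_X _ _
  rwa [e] at h

/-! ### The action of linear automorphisms on the coordinate ring -/

namespace Chart

theorem isHomogeneous_X_mul_X (i j : Fin 3) :
    (MvPolynomial.X i * MvPolynomial.X j : MvPolynomial (Fin 3) k).IsHomogeneous (2 * 1) :=
  (MvPolynomial.isHomogeneous_X k i).mul (MvPolynomial.isHomogeneous_X k j)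

theorem ofChart_ev_sq : ofChart (ev k (MvPolynomial.X 0 * MvPolynomial.X 0))
    (ev_mem (isHomogeneous_X_mul_X 0 0)) = t k :=
  toChart_injective (by rw [toChart_ofChart, toChart_t, map_mul, ev_X0, sq])

theorem ofChart_ev_mul : ofChart (ev k (MvPolynomial.X 0 * MvPolynomial.X 1))
    (ev_mem (isHomogeneous_X_mul_X 0 1)) = xy k :=
  toChart_injective (by rw [toChart_ofChart, toChart_xy, map_mul, ev_X0, ev_X1])

/-- The automorphism `σ` of the coordinate ring is the substitution of `L` in the quotients of
forms by powers of the equation of the conic. -/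
def ActsBy (σ : AutRing k) (L : Fin 3 → MvPolynomial (Fin 3) k) : Prop :=
  ∀ (n : ℕ) (G : MvPolynomial (Fin 3) k) (hG : G.IsHomogeneous (2 * n)),
    toChart (σ (ofChart (ev k G) (ev_mem hG))) = ev k (MvPolynomial.aeval L G)

theorem ActsBy.t {σ : AutRing k} {L : Fin 3 → MvPolynomial (Fin 3) k} (h : ActsBy σ L) :
    toChart (σ (t k)) = ev k (L 0) * ev k (L 0) := by
  have := h 1 _ (isHomogeneous_X_mul_X 0 0)
  rwa [ofChart_ev_sq, map_mul, MvPolynomial.aeval_X, map_mul] at this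

theorem ActsBy.xy {σ : AutRing k} {L : Fin 3 → MvPolynomial (Fin 3) k} (h : ActsBy σ L) :
    toChart (σ (xy k)) = ev k (L 0) * ev k (L 1) := by
  have := h 1 _ (isHomogeneous_X_mul_X 0 1)
  rwa [ofChart_ev_mul, map_mul, MvPolynomial.aeval_X, MvPolynomial.aeval_X, map_mul] at this

theorem ActsBy.ext {σ τ : AutRing k} {L : Fin 3 → MvPolynomial (Fin 3) k} (h : ActsBy σ L)
    (ht : toChart (τ (Chart.t k)) = ev k (L 0) * ev k (L 0))
    (hxy : toChart (τ (Chart.xy k)) = ev k (L 0) * ev k (L 1)) : σ = τ :=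
  autRing_ext (toChart_injective (h.t.trans ht.symm)) (toChart_injective (h.xy.trans hxy.symm))

theorem ActsBy.eq_fib {σ : AutRing k} {b : k} (h : ActsBy σ (shear b)) :
    σ = fib (C b) := by
  refine h.ext ?_ ?_
  · rw [fib_t, toChart_t]
    simp [shear, sq]
  · rw [fib_xy, map_add, map_mul, aeval_C, toChart_xy, toChart_t, AlgHom.commutes]
    have : ev k (MvPolynomial.C b) = algebraMap k _ b := MvPolynomial.algHom_C _ _
    simp [shear, this]
    ring

theorem ActsBy.eq_torusAut {σ : AutRing k} {a : kˣ} (h : ActsBy σ (torus a)) :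
    σ = torusAut a := by
  have hC : ev k (MvPolynomial.C (a : k)) = algebraMap k _ (a : k) := MvPolynomial.algHom_C _ _
  refine h.ext ?_ ?_
  · rw [torusAut_t, map_smul, toChart_t, Algebra.smul_def, map_pow]
    simp [torus, hC]
    ring
  · rw [torusAut_xy, map_smul, toChart_xy, Algebra.smul_def]
    simp [torus, hC]
    ring

theorem ActsBy.eq_swapAut {σ : AutRing k} (h : ActsBy σ (SmoothConic.swap k)) :
    σ = swapAut k := by
  refine h.ext ?_ ?_
  · rw [swapAut_t, toChart_el]
    simp [SmoothConic.swap, mono]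
    ring
  · rw [swapAut_xy, toChart_el]
    simp [SmoothConic.swap, mono]
    ring

end Chart

namespace SmoothConic

variable {Q : SmoothConic k} {p : Fin 3 → k} (fr : Frame Q p)

namespace Frame

open Chart

/-- A linear automorphism that preserves the standard equation acts on the complement. -/
theorem exists_actsBy {Λ : MvPolynomial (Fin 3) k ≃ₐ[k] MvPolynomial (Fin 3) k}
    (hΛ : Λ ∈ gradedAut k) (hq : Λ (conic k) = conic k) :
    ∃ ψ ∈ Q.restrictToCompl Q.autPair,
      ActsBy (fr.model.autEquiv ψ).symm fun i => Λ (MvPolynomial.X i) := by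
  have hmem : fr.W⁻¹ * Λ * fr.W ∈ gradedAut k := mul_mem (mul_mem (inv_mem fr.mem) hΛ) fr.mem
  have hq' : gradedHom hmem Q.q = Q.q := by
    change fr.W.symm (Λ (fr.W Q.q)) = Q.q
    have hC : Λ (MvPolynomial.C (fr.a : k)) = MvPolynomial.C (fr.a : k) := Λ.commutes _
    rw [fr.map_q, map_mul]
    change fr.W.symm (Λ (MvPolynomial.C (fr.a : k)) * Λ (conic k)) = Q.q
    rw [hq, hC]
    exact (congrArg fr.W.symm fr.map_q.symm).trans (fr.W.symm_apply_apply _)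
  have hφ : planeAut hmem ∈ Q.autPair := mem_autPair_of_projMap rfl hq'
  obtain ⟨ψ, hψ⟩ := Q.exists_res hφ
  refine ⟨ψ, ⟨_, hφ, hψ⟩, fun n G hG => ?_⟩
  rw [(fr.symm_ev_of_projMap (φ := planeAut hmem) rfl hq').mp hψ n G hG]
  change ev k (fr.W (fr.W.symm (Λ (fr.W (fr.W.symm G))))) = _
  rw [AlgEquiv.apply_symm_apply, AlgEquiv.apply_symm_apply]
  congr 1
  have : (Λ : MvPolynomial (Fin 3) k →ₐ[k] MvPolynomial (Fin 3) k) =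
      MvPolynomial.aeval fun i => Λ (MvPolynomial.X i) :=
    MvPolynomial.algHom_ext fun i => by simp
  exact congrArg (fun f => f G) this

/-- The generators of `degSub` are linear substitutions that fix the standard equation. Conjugated
by the change of coordinates they fix the equation of `Q`, so they come from the plane. -/
theorem degSub_le : degSub k ≤ (Q.restrictToCompl Q.autPair).map fr.model.autEquiv.toMonoidHom := by
  rw [← closure_linear_eq_degSub, Subgroup.closure_le]
  have key : ∀ {L : Fin 3 → MvPolynomial (Fin 3) k}
      {Λ : MvPolynomial (Fin 3) k ≃ₐ[k] MvPolynomial (Fin 3) k} {τ : AutRing k},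
      Λ ∈ gradedAut k → Λ (conic k) = conic k → (∀ i, Λ (MvPolynomial.X i) = L i) →
      (∀ σ, ActsBy σ L → σ = τ) →
      τ ∈ (Q.restrictToCompl Q.autPair).map fr.model.autEquiv.toMonoidHom := by
    intro L Λ τ hΛ hq hX hτ
    obtain ⟨ψ, hψ, h⟩ := fr.exists_actsBy hΛ hq
    simp only [hX] at h
    refine (hτ _ h) ▸ ⟨ψ⁻¹, inv_mem hψ, ?_⟩
    exact map_inv _ _
  rintro τ (⟨b, rfl⟩ | ⟨a, rfl⟩ | rfl)
  · exact key (shearEquiv_mem b) (aeval_shear_conic b) (fun i => MvPolynomial.aeval_X _ _)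
      fun σ h => h.eq_fib
  · exact key (torusEquiv_mem a) (aeval_torus_conic a) (fun i => MvPolynomial.aeval_X _ _)
      fun σ h => h.eq_torusAut
  · exact key (swapEquiv_mem k) aeval_swap_conic (fun i => MvPolynomial.aeval_X _ _)
      fun σ h => h.eq_swapAut

end Frame

end SmoothConic

end ConicComplement

/-! ### Plane automorphisms through their action on the function field -/

namespace ConicComplement

open Polynomial

variable {k : Type u} [Field k]

/-! ### The generic point of the plane -/

namespace Chart

/-- The function field of the plane. -/
abbrev CoordFrac (k : Type u) [Field k] : Type u := FractionRing (Coord k)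

/-- The inclusion of the regular functions on the complement into the function field. -/
def toCoordFrac (k : Type u) [Field k] : Coord k →ₐ[k] CoordFrac k :=
  Algebra.algHom k (Coord k) (CoordFrac k)

theorem toCoordFrac_injective : Function.Injective (toCoordFrac k) :=
  IsFractionRing.injective (Coord k) (CoordFrac k)

/-- The extension of `toChart` to the function field. -/
def fracToFrac (k : Type u) [Field k] : CoordFrac k →+* Frac k :=
  IsFractionRing.lift (A := Coord k) (K := CoordFrac k)
    (g := ((toFrac k).comp toChart : Coord k →+* Frac k))
    (toFrac_injective.comp toChart_injective)

theorem fracToFrac_toCoordFrac (f : Coord k) :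
    fracToFrac k (toCoordFrac k f) = toFrac k (toChart f) :=
  IsFractionRing.lift_algebraMap _ _

/-- The substitution of affine coordinates on the complement of the line `x = 0`. -/
def dehom (k : Type u) [Field k] : MvPolynomial (Fin 3) k →ₐ[k] CoordFrac k :=
  MvPolynomial.aeval ![1, toCoordFrac k (xy k) / toCoordFrac k (t k),
    -(toCoordFrac k (el k 1 2 (by decide)) / toCoordFrac k (t k))]

theorem aeval_smul_of_isHomogeneous {S : Type*} [CommRing S] [Algebra k S]
    {F : MvPolynomial (Fin 3) k} {n : ℕ} (hF : F.IsHomogeneous n) (c : S) (v : Fin 3 → S) :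
    MvPolynomial.aeval (fun i => v i * c) F = MvPolynomial.aeval v F * c ^ n := by
  have h : (Polynomial.eval₂RingHom (MvPolynomial.aeval v : MvPolynomial (Fin 3) k →ₐ[k] S).toRingHom
      c).comp (scaleHom k (Fin 3)).toRingHom =
      (MvPolynomial.aeval fun i => v i * c : MvPolynomial (Fin 3) k →ₐ[k] S).toRingHom := by
    refine MvPolynomial.ringHom_ext (fun a => ?_) fun i => ?_
    · have h1 : scaleHom k (Fin 3) (MvPolynomial.C a) = C (MvPolynomial.C a) :=
        MvPolynomial.algHom_C _ _
      refine (congrArg _ h1).trans ?_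
      simp
    · simp [scaleHom]
  refine (RingHom.congr_fun h F).symm.trans ?_
  refine (congrArg _ (scaleHom_of_isHomogeneous hF)).trans ?_
  simp

theorem fracToFrac_dehom (F : MvPolynomial (Fin 3) k) :
    fracToFrac k (dehom k F) = MvPolynomial.aeval ![1, toFrac k (y k) / toFrac k (x k),
      -(toFrac k (w k) / toFrac k (x k))] F := by
  have hx := toFrac_x_ne_zero (k := k)
  rw [dehom]
  have h : (fracToFrac k).comp (MvPolynomial.aeval
      ![1, toCoordFrac k (xy k) / toCoordFrac k (t k),
        -(toCoordFrac k (el k 1 2 (by decide)) / toCoordFrac k (t k))] :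
        MvPolynomial (Fin 3) k →ₐ[k] CoordFrac k).toRingHom =
      (MvPolynomial.aeval ![1, toFrac k (y k) / toFrac k (x k),
      -(toFrac k (w k) / toFrac k (x k))] : MvPolynomial (Fin 3) k →ₐ[k] Frac k).toRingHom := by
    refine MvPolynomial.ringHom_ext (fun c => ?_) fun i => ?_
    · have h1 : dehom k (MvPolynomial.C c) = toCoordFrac k (algebraMap k _ c) := by
        rw [AlgHom.commutes]; exact MvPolynomial.algHom_C _ _
      refine (congrArg (fracToFrac k) h1).trans ?_
      rw [fracToFrac_toCoordFrac, AlgHom.commutes, AlgHom.commutes]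
      exact (MvPolynomial.algHom_C _ _).symm
    · fin_cases i
      · simp
      · simp [fracToFrac_toCoordFrac, toChart_t, toChart_xy]
        field_simp
      · simp [fracToFrac_toCoordFrac, toChart_t, toChart_el, mono]
        field_simp
  exact RingHom.congr_fun h F

/-- In the affine coordinates with `x = 1` a form `F` of degree `2n` becomes `F / x^(2n) = F / t^n`.
-/
theorem toCoordFrac_t_pow_mul_dehom {F : MvPolynomial (Fin 3) k} {n : ℕ}
    (hF : F.IsHomogeneous (2 * n)) :
    dehom k F * toCoordFrac k (t k) ^ n = toCoordFrac k (ofChart (ev k F) (ev_mem hF)) := by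
  apply (fracToFrac k).injective
  rw [map_mul, map_pow, fracToFrac_dehom, fracToFrac_toCoordFrac, fracToFrac_toCoordFrac,
    toChart_ofChart, toChart_t, map_pow, ← pow_mul, ← aeval_smul_of_isHomogeneous hF, ev]
  have hx := toFrac_x_ne_zero (k := k)
  refine Eq.trans ?_ (MvPolynomial.comp_aeval_apply _ (toFrac k) F).symm
  congr 2
  funext i
  fin_cases i
  · simp
  · simp [hx]
  · simp [hx]

theorem dehom_ne_zero {F : MvPolynomial (Fin 3) k} {n : ℕ} (hF : F.IsHomogeneous n)
    (h0 : F ≠ 0) : dehom k F ≠ 0 := by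
  intro h
  have h2 := toCoordFrac_t_pow_mul_dehom (F := F ^ 2) (n := n) (by rw [mul_comm]; exact hF.pow 2)
  rw [map_pow, h, zero_pow two_ne_zero, zero_mul, eq_comm,
    map_eq_zero_iff _ toCoordFrac_injective] at h2
  have h3 : ev k (F ^ 2) = 0 := by
    have := congrArg toChart h2
    simpa using this
  exact h0 (pow_eq_zero_iff two_ne_zero |>.mp
    (eq_zero_of_ev_eq_zero (n := n) (by rw [mul_comm]; exact hF.pow 2) h3))

end Chart

namespace SmoothConic.Frame

open Chart

variable {Q : SmoothConic k} {p : Fin 3 → k} (fr : Frame Q p)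

/-- The value of a form at the generic point, in affine coordinates. -/
def genEval : MvPolynomial (Fin 3) k →ₐ[k] CoordFrac k := (dehom k).comp (fr.W : _ →ₐ[k] _)

theorem genEval_apply (F : MvPolynomial (Fin 3) k) : fr.genEval F = dehom k (fr.W F) := rfl

theorem isUnit_genEval {d : ℕ} {f : MvPolynomial (Fin 3) k} (hf : f ∈ grading k d) (h0 : f ≠ 0) :
    IsUnit (fr.genEval f) :=
  (dehom_ne_zero (fr.W_mem hf) ((map_ne_zero_iff _ fr.W.injective).mpr h0)).isUnit

/-- The generic point of the plane, in the chart where `f ≠ 0`. -/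
def genPoint {d : ℕ} (hd : 0 < d) {f : MvPolynomial (Fin 3) k} (hf : f ∈ grading k d)
    (h0 : f ≠ 0) : Spec (.of (CoordFrac k)) ⟶ Proj (grading k) :=
  Spec.map (CommRingCat.ofHom (awayEval fr.genEval (fr.isUnit_genEval hf h0))) ≫
    Proj.awayι (grading k) f hf hd

theorem genPoint_mul {d e m : ℕ} (hd : 0 < d) (hm : 0 < m) (hde : m = d + e)
    {f g x : MvPolynomial (Fin 3) k} (hf : f ∈ grading k d) (hg : g ∈ grading k e)
    (hx : x ∈ grading k m) (hf0 : f ≠ 0) (hx0 : x ≠ 0) (hfg : x = f * g) :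
    fr.genPoint hm hx hx0 = fr.genPoint hd hf hf0 := by
  subst hde
  rw [genPoint, genPoint, ← Proj.SpecMap_awayMap_awayι (grading k) hf hd hg hfg,
    ← Category.assoc, ← Spec.map_comp, ← CommRingCat.ofHom_comp]
  congr 3
  refine RingHom.ext fun y => ?_
  obtain ⟨n, F, hF, rfl⟩ := Away.mk_surjective (grading k) hf y
  have hFg : F * g ^ n ∈ grading k (n • (d + e)) := by
    rw [smul_add]; exact SetLike.mul_mem_graded hF (SetLike.pow_mem_graded n hg)
  have h1 := awayEval_mk fr.genEval (fr.isUnit_genEval hf hf0) hf n F hF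
  have h2 := awayEval_mk fr.genEval (fr.isUnit_genEval hx hx0) hx n (F * g ^ n) hFg
  rw [RingHom.comp_apply, awayMap_mk]
  refine mul_right_cancel₀ (pow_ne_zero n (fr.isUnit_genEval hx hx0).ne_zero) ?_
  refine h2.trans ?_
  rw [map_mul, ← h1, hfg, map_mul, mul_pow, map_pow, mul_assoc]

/-- Both charts are compared with the chart of the product `fg`. -/
theorem genPoint_eq {d e : ℕ} (hd : 0 < d) (he : 0 < e) {f g : MvPolynomial (Fin 3) k}
    (hf : f ∈ grading k d) (hg : g ∈ grading k e) (hf0 : f ≠ 0) (hg0 : g ≠ 0) :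
    fr.genPoint hd hf hf0 = fr.genPoint he hg hg0 :=
  (fr.genPoint_mul hd (by omega) rfl hf hg (SetLike.mul_mem_graded hf hg) hf0
    (mul_ne_zero hf0 hg0) rfl).symm.trans
    (fr.genPoint_mul he _ (add_comm d e) hg hf _ hg0 _ (mul_comm f g))

theorem q_ne_zero (fr : Frame Q p) : Q.q ≠ 0 := by
  intro h
  have := fr.map_q
  rw [h, map_zero, eq_comm, mul_eq_zero, map_eq_zero_iff _ (MvPolynomial.C_injective _ _)] at this
  exact this.elim fr.a.ne_zero conic_ne_zero

theorem awayEval_genEval_q (f : Away (grading k) Q.q) :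
    awayEval fr.genEval (fr.isUnit_genEval Q.mem fr.q_ne_zero) f =
      toCoordFrac k (fr.coordEquiv f) := by
  obtain ⟨n, F, hF, rfl⟩ := Away.mk_surjective (grading k) Q.mem f
  have hu := (fr.isUnit_genEval Q.mem fr.q_ne_zero).ne_zero
  have ht : toCoordFrac k (t k) ≠ 0 := (map_ne_zero_iff _ toCoordFrac_injective).mpr t_ne_zero
  refine mul_right_cancel₀ (pow_ne_zero n hu) ?_
  rw [awayEval_mk fr.genEval (fr.isUnit_genEval Q.mem fr.q_ne_zero) Q.mem n F hF]
  refine mul_right_cancel₀ (pow_ne_zero n ht) ?_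
  have hF' : (fr.W F).IsHomogeneous (2 * n) := by rw [mul_comm]; exact fr.W_mem hF
  have hq' : fr.genEval Q.q * toCoordFrac k (t k) = algebraMap k _ (fr.a : k) := by
    have h2 := toCoordFrac_t_pow_mul_dehom (F := fr.W Q.q) (n := 1) (fr.W_mem Q.mem)
    rw [pow_one] at h2
    rw [genEval_apply, h2, ← AlgHom.commutes (toCoordFrac k)]
    refine congrArg _ (toChart_injective ?_)
    rw [toChart_ofChart, AlgHom.commutes]
    exact fr.evW_q
  rw [genEval_apply, toCoordFrac_t_pow_mul_dehom hF', mul_assoc, ← mul_pow, hq', ← map_pow,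
    ← AlgHom.commutes (toCoordFrac k), ← map_mul]
  refine congrArg _ (toChart_injective ?_)
  rw [map_mul, toChart_coordEquiv, awayEval_mk_q, toChart_ofChart, AlgHom.commutes,
    Algebra.smul_def, mul_right_comm, ← map_mul, ← mul_pow, inv_mul_cancel₀ fr.a.ne_zero, one_pow,
    map_one, one_mul]
  rfl

/-! ### Restrictions and the generic point -/

theorem iso_inv_comp_comp {C : Type*} [Category* C] {S P T : C} (e : S ≅ T) {i : S ⟶ P}
    {f : S ⟶ S} {φ : P ⟶ P} {γ : T ⟶ T} (h : f ≫ i = i ≫ φ) (hb : f ≫ e.hom = e.hom ≫ γ) :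
    (e.inv ≫ i) ≫ φ = γ ≫ e.inv ≫ i := by
  rw [Category.assoc, ← h, Iso.inv_comp_eq, ← Category.assoc, ← hb, Category.assoc,
    Iso.hom_inv_id_assoc]

theorem comp_comp_of_intertwine {C : Type*} [Category* C] {K P T : C} {s : K ⟶ T} {a : T ⟶ P}
    {φ : P ⟶ P} {γ : T ⟶ T} {ρ : K ⟶ K} (h : a ≫ φ = γ ≫ a) (hs : s ≫ γ = ρ ≫ s) :
    (s ≫ a) ≫ φ = ρ ≫ s ≫ a := by
  rw [Category.assoc, h, ← Category.assoc, hs, Category.assoc]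

theorem awayι_comp_of_restrict {ψ : Q.AutCompl} {φ : AutPlane k}
    (h : ψ.hom.left ≫ Q.compl.ι = Q.compl.ι ≫ φ.hom.left)
    {g : Away (grading k) Q.q →+* Away (grading k) Q.q}
    (hg : ∀ f, (fr.model.autEquiv ψ).symm (fr.coordEquiv f) = fr.coordEquiv (g f)) :
    Proj.awayι (grading k) Q.q Q.mem two_pos ≫ φ.hom.left =
      Spec.map (CommRingCat.ofHom g) ≫ Proj.awayι (grading k) Q.q Q.mem two_pos := by
  have hb := fr.hom_left_basicOpenToSpec_iff.mpr hg
  rw [← Proj.basicOpenIsoSpec_hom (grading k) Q.q Q.mem two_pos] at hb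
  exact iso_inv_comp_comp _ h hb

/-- The automorphism of the function field defined by an automorphism of the complement. -/
def fracAut (σ : AutRing k) : CoordFrac k →+* CoordFrac k :=
  (IsFractionRing.ringEquivOfRingEquiv (σ : Coord k ≃+* Coord k) :
    CoordFrac k ≃+* CoordFrac k)

theorem fracAut_toCoordFrac (σ : AutRing k) (f : Coord k) :
    fracAut σ (toCoordFrac k f) = toCoordFrac k (σ f) :=
  IsFractionRing.ringEquivOfRingEquiv_algebraMap _ _

/-- The generic point lies in the complement, where `φ` is `ψ`. Since `genPoint` does not depend on
the chart, this identity can be carried to charts that meet the conic. -/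
theorem genPoint_comp_of_restrict {ψ : Q.AutCompl} {φ : AutPlane k}
    (h : ψ.hom.left ≫ Q.compl.ι = Q.compl.ι ≫ φ.hom.left) :
    fr.genPoint two_pos Q.mem fr.q_ne_zero ≫ φ.hom.left =
      Spec.map (CommRingCat.ofHom (fracAut (fr.model.autEquiv ψ).symm)) ≫
        fr.genPoint two_pos Q.mem fr.q_ne_zero := by
  set σ := (fr.model.autEquiv ψ).symm with hσ
  let g : Away (grading k) Q.q →+* Away (grading k) Q.q :=
    ((fr.coordEquiv.symm : Coord k →+* Away (grading k) Q.q).comp (σ : Coord k →+* Coord k)).comp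
      (fr.coordEquiv : Away (grading k) Q.q →+* Coord k)
  have hg : ∀ f, σ (fr.coordEquiv f) = fr.coordEquiv (g f) := fun f =>
    (fr.coordEquiv.apply_symm_apply _).symm
  have h1 := fr.awayι_comp_of_restrict h hg
  have h2 : (awayEval fr.genEval (fr.isUnit_genEval Q.mem fr.q_ne_zero)).comp g =
      (fracAut σ).comp (awayEval fr.genEval (fr.isUnit_genEval Q.mem fr.q_ne_zero)) := by
    refine RingHom.ext fun f => ?_
    refine (fr.awayEval_genEval_q (g f)).trans ?_
    rw [← hg]
    exact (fracAut_toCoordFrac σ _).symm.trans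
      (congrArg (fracAut σ) (fr.awayEval_genEval_q f).symm)
  refine comp_comp_of_intertwine h1 ?_
  rw [← Spec.map_comp, ← Spec.map_comp, ← CommRingCat.ofHom_comp, ← CommRingCat.ofHom_comp, h2]

end SmoothConic.Frame

/-! ### Restrictions of automorphisms of the plane preserve the degree -/

/-- The homogeneous basic open sets of positive degree form a basis. -/
theorem exists_basicOpen_le {U : (Plane k).Opens} {x : Plane k} (hx : x ∈ U) :
    ∃ (d : ℕ) (h : MvPolynomial (Fin 3) k), 0 < d ∧ h ∈ grading k d ∧
      x ∈ Proj.basicOpen (grading k) h ∧ Proj.basicOpen (grading k) h ≤ U := by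
  have hproj : ∀ f, x ∈ Proj.basicOpen (grading k) f →
      ∃ i, x ∈ Proj.basicOpen (grading k) (GradedRing.proj (grading k) i f) := by
    intro f hf
    rw [Proj.basicOpen_eq_iSup_proj] at hf
    exact TopologicalSpace.Opens.mem_iSup.mp hf
  obtain ⟨_, ⟨f, rfl⟩, hf, hfU⟩ :=
    TopologicalSpace.Opens.isBasis_iff_nbhd.mp (Proj.isBasis_basicOpen (grading k)) hx
  obtain ⟨i, hi⟩ := hproj f hf
  -- Multiplication by an element of the irrelevant ideal that does not vanish at `x` makes the
  -- degree positive.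
  obtain ⟨g, hg, hgx⟩ : ∃ g ∈ HomogeneousIdeal.irrelevant (grading k),
      x ∈ Proj.basicOpen (grading k) g := by
    obtain ⟨g, hg, hgx⟩ := SetLike.not_le_iff_exists.mp
      (show ProjectiveSpectrum (grading k) from x).not_irrelevant_le
    exact ⟨g, hg, hgx⟩
  obtain ⟨j, hj⟩ := hproj g hgx
  have hj0 : 0 < j := by
    rw [Nat.pos_iff_ne_zero]
    rintro rfl
    rw [(HomogeneousIdeal.mem_irrelevant_iff _ _).mp hg, Proj.basicOpen_zero] at hj
    exact hj
  refine ⟨i + j, GradedRing.proj (grading k) i f * GradedRing.proj (grading k) j g, by omega,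
    SetLike.mul_mem_graded (SetLike.coe_mem _) (SetLike.coe_mem _), ?_, ?_⟩
  · rw [Proj.basicOpen_mul]
    exact ⟨hi, hj⟩
  · rw [Proj.basicOpen_mul]
    refine inf_le_left.trans (le_trans ?_ hfU)
    rw [Proj.basicOpen_eq_iSup_proj (grading k) f]
    exact le_iSup (fun i => Proj.basicOpen (grading k) (GradedRing.proj (grading k) i f)) i

theorem exists_away_lift {d e : ℕ} (hd : 0 < d) (he : 0 < e) {s G : MvPolynomial (Fin 3) k}
    (hs : s ∈ grading k d) (hG : G ∈ grading k e) {φ : Proj (grading k) ⟶ Proj (grading k)}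
    (h : Proj.basicOpen (grading k) s ≤ φ ⁻¹ᵁ Proj.basicOpen (grading k) G) :
    ∃ a : Away (grading k) G →+* Away (grading k) s,
      Proj.awayι (grading k) s hs hd ≫ φ =
        Spec.map (CommRingCat.ofHom a) ≫ Proj.awayι (grading k) G hG he := by
  have hr : Set.range (Proj.awayι (grading k) s hs hd ≫ φ) ⊆
      Set.range (Proj.awayι (grading k) G hG he) := by
    rintro _ ⟨y, rfl⟩
    change _ ∈ (Proj.awayι (grading k) G hG he).opensRange
    rw [Proj.opensRange_awayι]
    refine h ?_
    rw [← Proj.opensRange_awayι (grading k) s hs hd]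
    exact ⟨y, rfl⟩
  refine ⟨(Spec.preimage (IsOpenImmersion.lift (Proj.awayι (grading k) G hG he)
    (Proj.awayι (grading k) s hs hd ≫ φ) hr)).hom, ?_⟩
  rw [CommRingCat.ofHom_hom, Spec.map_preimage, IsOpenImmersion.lift_fac]

theorem comp_eq_comp_of_mono {C : Type*} [Category* C] {K T T' P : C} {s : K ⟶ T} {a : T ⟶ P}
    {φ : P ⟶ P} {γ : T ⟶ T'} {b : T' ⟶ P} [Mono b] {ρ : K ⟶ K} {s' : K ⟶ T'}
    (h1 : a ≫ φ = γ ≫ b) (h2 : (s ≫ a) ≫ φ = ρ ≫ s' ≫ b) : s ≫ γ = ρ ≫ s' := by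
  rw [← cancel_mono b, Category.assoc, ← h1, ← Category.assoc, h2, Category.assoc]

namespace SmoothConic.Frame

open Chart

variable {Q : SmoothConic k} {p : Fin 3 → k} (fr : Frame Q p)

/-- The restriction of forms to the conic, which is parametrized by `[1 : X : -X²]`. -/
def conicEval : MvPolynomial (Fin 3) k →ₐ[k] k[X] :=
  (MvPolynomial.aeval ![1, (X : k[X]), -X ^ 2]).comp (fr.W : _ →ₐ[k] _)

theorem conicEval_apply (F : MvPolynomial (Fin 3) k) :
    fr.conicEval F = MvPolynomial.aeval ![1, (X : k[X]), -X ^ 2] (fr.W F) := rfl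

theorem conicEval_q : fr.conicEval Q.q = 0 := by
  rw [conicEval_apply, fr.map_q, map_mul]
  simp [SmoothConic.model]

theorem top_evW {F : MvPolynomial (Fin 3) k} {n : ℕ} (hF : F ∈ grading k n) :
    Top (fr.evW F) n (fr.conicEval F) :=
  top_ev (fr.W_mem hF)

/-- The generic point of the conic. -/
def conicPoint : Plane k :=
  show ProjectiveSpectrum (grading k) from
  { asHomogeneousIdeal := (RingHom.ker fr.conicEval).homogeneousCore (grading k)
    isPrime := (RingHom.ker_isPrime _).homogeneousCore
    not_irrelevant_le := by
      intro h
      have hX : fr.W.symm (MvPolynomial.X 0) ∈ grading k 1 :=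
        fr.W_symm_mem (MvPolynomial.isHomogeneous_X k 0)
      have h1 : fr.W.symm (MvPolynomial.X 0) ∈ HomogeneousIdeal.irrelevant (grading k) := by
        rw [HomogeneousIdeal.mem_irrelevant_iff, GradedRing.proj_apply,
          DirectSum.decompose_of_mem_ne (grading k) hX one_ne_zero]
      have h2 := Ideal.toIdeal_homogeneousCore_le (grading k) _ (h h1)
      rw [RingHom.mem_ker, conicEval_apply, AlgEquiv.apply_symm_apply] at h2
      simp at h2 }

theorem conicPoint_notMem_compl : fr.conicPoint ∉ Q.compl := by
  intro h
  exact h (Ideal.mem_homogeneousCore_of_homogeneous_of_mem ⟨2, Q.mem⟩ fr.conicEval_q)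

theorem conicPoint_mem_basicOpen {G : MvPolynomial (Fin 3) k} (h : fr.conicEval G ≠ 0) :
    fr.conicPoint ∈ Proj.basicOpen (grading k) G :=
  fun hG => h (Ideal.toIdeal_homogeneousCore_le (grading k) _ hG)

/-- A form that does not vanish at some point of the conic has full degree. -/
theorem natDegree_evW_eq {h : MvPolynomial (Fin 3) k} {d : ℕ} (hh : h ∈ grading k d)
    {x : Plane k} (hx : x ∉ Q.compl) (hxh : x ∈ Proj.basicOpen (grading k) h) :
    (fr.evW h).natDegree = d := by
  refine le_antisymm (fr.top_evW hh).1 ?_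
  by_contra! hlt
  -- Squaring gives an even degree, where a drop in degree means divisibility by the equation. Then
  -- `h` would vanish wherever `q` does, in particular at `x`.
  have hW : (fr.W (h ^ 2)).IsHomogeneous (2 * d) := by
    have := (fr.W_mem hh).pow 2
    rwa [← map_pow, mul_comm] at this
  have hdvd := conic_dvd_of_natDegree_lt hW (by
    rw [map_pow, map_pow, natDegree_pow]
    exact Nat.mul_lt_mul_of_pos_left hlt two_pos)
  have hq : Q.q ∣ h ^ 2 := by
    have h1 : fr.W Q.q ∣ fr.W (h ^ 2) := by
      rw [fr.map_q]
      exact (IsUnit.mul_left_dvd (fr.a.isUnit.map MvPolynomial.C)).mpr hdvd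
    obtain ⟨c, hc⟩ := h1
    refine ⟨fr.W.symm c, fr.W.injective ?_⟩
    rw [map_mul, AlgEquiv.apply_symm_apply, hc]
  refine hx ?_
  have h3 : x ∈ Proj.basicOpen (grading k) (h ^ 2) := by
    rwa [Proj.basicOpen_pow _ _ _ two_pos]
  exact Proj.basicOpen_mono (grading k) _ _ hq h3

/-- For `g ≠ 0`, `deg f ≤ deg g` means that `f / g` is regular at the generic point of the conic.
Its pullback is then regular at the preimage of this point, which lies outside the complement, so it
is `P / s^r` near there, with `s` of full degree. Comparing degrees gives the inequality. That `φ`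
is linear is not presupposed. -/
theorem deg_symm_le {ψ : Q.AutCompl} {φ : AutPlane k} (hφ : φ ∈ Q.autPair)
    (h : ψ.hom.left ≫ Q.compl.ι = Q.compl.ι ≫ φ.hom.left) {f g : Coord k} (hg : g ≠ 0)
    (hfg : deg f ≤ deg g) :
    deg ((fr.model.autEquiv ψ).symm f) ≤ deg ((fr.model.autEquiv ψ).symm g) := by
  set σ := (fr.model.autEquiv ψ).symm
  by_cases hg0 : deg g = 0
  · obtain ⟨c, hc⟩ := eq_algebraMap_of_natDegree_eq_zero (toChart_mem f)
      (Nat.le_zero.mp (hfg.trans hg0.le))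
    have hf : f = algebraMap k _ c := toChart_injective (by rw [AlgHom.commutes]; exact hc)
    rw [hf, AlgEquiv.commutes, deg_algebraMap]
    exact Nat.zero_le _
  obtain ⟨n, hn⟩ := even_natDegree (toChart_mem g)
  rw [← two_mul] at hn
  change deg g = 2 * n at hn
  -- Both functions are values of forms of the same degree `2n = deg g`, so `f / g` is `F / G`, and
  -- `G` does not vanish identically on the conic.
  obtain ⟨F', hF', rfl⟩ : ∃ (F : MvPolynomial (Fin 3) k) (hF : F.IsHomogeneous (2 * n)),
      ofChart (ev k F) (ev_mem hF) = f := by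
    obtain ⟨F, hF, hFf⟩ := exists_form (toChart_mem f) (n := n) (hfg.trans hn.le)
    exact ⟨F, hF, toChart_injective hFf⟩
  obtain ⟨G', hG', rfl⟩ : ∃ (F : MvPolynomial (Fin 3) k) (hF : F.IsHomogeneous (2 * n)),
      ofChart (ev k F) (ev_mem hF) = g := by
    obtain ⟨F, hF, hFf⟩ := exists_form (toChart_mem g) (n := n) hn.le
    exact ⟨F, hF, toChart_injective hFf⟩
  obtain ⟨F, rfl⟩ := fr.W.surjective F'
  obtain ⟨G, rfl⟩ := fr.W.surjective G'
  have hF : F ∈ grading k (2 * n) := by simpa using fr.W_symm_mem hF'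
  have hG : G ∈ grading k (2 * n) := by simpa using fr.W_symm_mem hG'
  have hn0 : 0 < 2 * n := by omega
  have hG0 : G ≠ 0 := by
    rintro rfl
    exact hg (toChart_injective (by simp))
  have hcG : fr.conicEval G ≠ 0 := by
    rw [← (fr.top_evW hG).2, ← hn]
    exact leadingCoeff_ne_zero.mpr fun h0 => hg (toChart_injective h0)
  -- a neighbourhood of the preimage of the generic point of the conic
  set x := φ.inv.left fr.conicPoint with hxdef
  have hφx : φ.hom.left x = fr.conicPoint := hom_left_inv_left_apply φ _
  have hx : x ∉ Q.compl := fun hx => fr.conicPoint_notMem_compl (hφx ▸ (hφ x).mpr hx)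
  obtain ⟨d, s, hd, hs, hxs, hsU⟩ := exists_basicOpen_le (x := x)
    (U := φ.hom.left ⁻¹ᵁ Proj.basicOpen (grading k) G)
    (by
      change φ.hom.left x ∈ Proj.basicOpen (grading k) G
      rw [hφx]
      exact fr.conicPoint_mem_basicOpen hcG)
  have hs0 : s ≠ 0 := by
    rintro rfl
    rw [Proj.basicOpen_zero] at hxs
    exact hxs
  have hdegs := fr.natDegree_evW_eq hs hx hxs
  -- the pullback of functions from the chart of `G` to the chart of `s`
  obtain ⟨a, ha⟩ := exists_away_lift (φ := φ.hom.left) hd hn0 hs hG hsU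
  have hgen := fr.genPoint_comp_of_restrict h
  rw [fr.genPoint_eq two_pos hn0 Q.mem hG fr.q_ne_zero hG0] at hgen
  have hgen' := (congrArg (· ≫ φ.hom.left)
    (fr.genPoint_eq hd hn0 hs hG hs0 hG0)).trans hgen
  have key : (awayEval fr.genEval (fr.isUnit_genEval hs hs0)).comp a =
      (fracAut σ).comp (awayEval fr.genEval (fr.isUnit_genEval hG hG0)) := by
    have h4 := comp_eq_comp_of_mono ha hgen'
    rw [← Spec.map_comp, ← Spec.map_comp, Spec.map_inj, ← CommRingCat.ofHom_comp,
      ← CommRingCat.ofHom_comp] at h4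
    exact congrArg CommRingCat.Hom.hom h4
  have hF1 : F ∈ grading k (1 • (2 * n)) := by rwa [one_smul]
  have h1 := RingHom.congr_fun key (Away.mk (grading k) hG 1 F hF1)
  obtain ⟨r, P, hP, hPa⟩ := Away.mk_surjective (grading k) hs (a (Away.mk (grading k) hG 1 F hF1))
  rw [RingHom.comp_apply, RingHom.comp_apply, ← hPa] at h1
  have h2 := awayEval_mk fr.genEval (fr.isUnit_genEval hs hs0) hs r P hP
  have h3 := awayEval_mk fr.genEval (fr.isUnit_genEval hG hG0) hG 1 F hF1
  rw [pow_one] at h3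
  rw [h1] at h2
  generalize awayEval fr.genEval (fr.isUnit_genEval hG hG0) (Away.mk (grading k) hG 1 F hF1) = c
    at h2 h3
  set f := ofChart (ev k (fr.W F)) (ev_mem hF') with hf
  set g := ofChart (ev k (fr.W G)) (ev_mem hG') with hg'
  have h5 : fracAut σ c * toCoordFrac k (σ g) = toCoordFrac k (σ f) := by
    rw [← fracAut_toCoordFrac, ← fracAut_toCoordFrac, ← map_mul, hf, hg',
      ← toCoordFrac_t_pow_mul_dehom hF', ← toCoordFrac_t_pow_mul_dehom hG', ← mul_assoc]
    exact congrArg (fun z => fracAut σ (z * _)) h3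
  -- The extra factor `s^r` makes the degrees even, so that both sides of `h6` are functions on the
  -- complement.
  have hPs : (fr.W (P * s ^ r)).IsHomogeneous (2 * (r * d)) := by
    have := (fr.W_mem hP).mul (fr.W_mem (SetLike.pow_mem_graded r hs))
    rwa [← map_mul, smul_eq_mul, ← two_mul] at this
  have hss : (fr.W (s ^ r * s ^ r)).IsHomogeneous (2 * (r * d)) := by
    have := (fr.W_mem (SetLike.pow_mem_graded r hs)).mul (fr.W_mem (SetLike.pow_mem_graded r hs))
    rwa [← map_mul, smul_eq_mul, ← two_mul] at this
  have h6 : ofChart (ev k (fr.W (P * s ^ r))) (ev_mem hPs) * σ g =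
      ofChart (ev k (fr.W (s ^ r * s ^ r))) (ev_mem hss) * σ f := by
    apply toCoordFrac_injective
    rw [map_mul (toCoordFrac k), map_mul (toCoordFrac k), ← h5, ← toCoordFrac_t_pow_mul_dehom hPs,
      ← toCoordFrac_t_pow_mul_dehom hss, ← genEval_apply, ← genEval_apply, map_mul, map_mul, ← h2,
      map_pow]
    ring
  by_cases hf0 : σ f = 0
  · rw [hf0, Chart.deg, map_zero, natDegree_zero]
    exact Nat.zero_le _
  have h7 := congrArg Chart.deg h6
  have hσg : σ g ≠ 0 := (map_ne_zero_iff _ σ.injective).mpr hg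
  have hevs : fr.evW s ≠ 0 := by
    rintro h0
    rw [h0, natDegree_zero] at hdegs
    omega
  have hss0 : ofChart (ev k (fr.W (s ^ r * s ^ r))) (ev_mem hss) ≠ 0 := by
    intro h0
    have := congrArg toChart h0
    rw [toChart_ofChart, map_mul, map_mul, map_pow, map_pow, map_zero] at this
    exact mul_ne_zero (pow_ne_zero r hevs) (pow_ne_zero r hevs) this
  have hdss : deg (ofChart (ev k (fr.W (s ^ r * s ^ r))) (ev_mem hss)) = 2 * (r * d) := by
    rw [Chart.deg, toChart_ofChart, map_mul, map_mul, map_pow, map_pow]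
    change natDegree (fr.evW s ^ r * fr.evW s ^ r) = _
    rw [natDegree_mul (pow_ne_zero r hevs) (pow_ne_zero r hevs), natDegree_pow, hdegs]
    ring
  have hdPs : deg (ofChart (ev k (fr.W (P * s ^ r))) (ev_mem hPs)) ≤ 2 * (r * d) :=
    (top_ev hPs).1
  have h8 := deg_mul_le (ofChart (ev k (fr.W (P * s ^ r))) (ev_mem hPs)) (σ g)
  rw [h7, deg_mul hss0 hf0, hdss] at h8
  omega

end SmoothConic.Frame

/-! ### Restrictions of automorphisms of the plane are the automorphisms of degree one -/

namespace Chart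

/-- By monotonicity the degree of `τ f` depends only on that of `f`; comparison with powers of `t`
shows that `τ` multiplies degrees by an integer `m`. Evaluated at `τ⁻¹(t)`, this shows that `m`
divides 1. -/
theorem mem_degSub_of_deg_mono {τ : AutRing k}
    (h : ∀ {f g : Coord k}, g ≠ 0 → Chart.deg f ≤ Chart.deg g → Chart.deg (τ f) ≤ Chart.deg (τ g)) :
    τ ∈ degSub k := by
  have heq : ∀ {f g : Coord k}, f ≠ 0 → g ≠ 0 → Chart.deg f = Chart.deg g →
      Chart.deg (τ f) = Chart.deg (τ g) :=
    fun hf hg hfg => (h hg hfg.le).antisymm (h hf hfg.ge)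
  have hmul : ∀ f : Coord k, f ≠ 0 → 2 * Chart.deg (τ f) = Chart.deg f * Chart.deg (τ (t k)) := by
    intro f hf
    obtain ⟨n, hn⟩ := even_natDegree (toChart_mem f)
    change Chart.deg f = n + n at hn
    rw [heq hf (pow_ne_zero n t_ne_zero) (by rw [deg_pow, deg_t, hn]; ring), map_pow, deg_pow, hn]
    ring
  obtain ⟨m, hm⟩ := even_natDegree (toChart_mem (τ (t k)))
  change Chart.deg (τ (t k)) = m + m at hm
  have h1 := hmul (τ.symm (t k)) ((map_ne_zero_iff _ τ.symm.injective).mpr t_ne_zero)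
  obtain ⟨j, hj⟩ := even_natDegree (toChart_mem (τ.symm (t k)))
  change Chart.deg (τ.symm (t k)) = j + j at hj
  rw [AlgEquiv.apply_symm_apply, deg_t, hm, hj] at h1
  have h2 : j * m = 1 := by nlinarith
  have hm1 : m = 1 := Nat.eq_one_of_mul_eq_one_left h2
  intro f
  by_cases hf : f = 0
  · rw [hf, map_zero]
  · have := hmul f hf
    rw [hm, hm1] at this
    omega

end Chart

namespace SmoothConic

variable {Q : SmoothConic k} {p : Fin 3 → k}

namespace Frame

open Chart

variable (fr : Frame Q p)

theorem autEquiv_mem_degSub {ψ : Q.AutCompl} (hψ : ψ ∈ Q.restrictToCompl Q.autPair) :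
    fr.model.autEquiv ψ ∈ degSub k := by
  obtain ⟨φ, hφ, h⟩ := hψ
  rw [← inv_mem_iff]
  exact mem_degSub_of_deg_mono fun hg hfg => fr.deg_symm_le hφ h hg hfg

theorem restrictToCompl_autPair :
    Q.restrictToCompl Q.autPair = (degSub k).comap fr.model.autEquiv.toMonoidHom := by
  ext ψ
  refine ⟨fr.autEquiv_mem_degSub, fun h => ?_⟩
  obtain ⟨ψ', hψ', h'⟩ := fr.degSub_le h
  rwa [← fr.model.autEquiv.injective h']

theorem autFibration_eq :
    Q.autFibration p = (fibSub k).comap fr.model.autEquiv.toMonoidHom := by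
  ext ψ
  exact fr.mem_autFibration_iff

end Frame

theorem isAmalgamOf_restrictToCompl (hp : p ≠ 0) (hq : MvPolynomial.eval p Q.q = 0) :
    IsAmalgamOf (Q.restrictToCompl Q.autPair) (Q.autFibration p) := by
  obtain ⟨fr⟩ := Q.nonempty_frame p hp hq
  rw [fr.restrictToCompl_autPair, fr.autFibration_eq]
  exact Chart.isAmalgamOf_comap fr.model.autEquiv

/-! ### An automorphism of the plane is determined by its restriction -/

theorem isReduced_away (s : MvPolynomial (Fin 3) k) : _root_.IsReduced (Away (grading k) s) :=
  isReduced_of_injective (algebraMap (Away (grading k) s) (Localization.Away s))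
    (val_injective _)

theorem mk_eq_zero_iff_exists {s F : MvPolynomial (Fin 3) k} {d n : ℕ} (hs : s ∈ grading k d)
    (hF : F ∈ grading k (n • d)) :
    Away.mk (grading k) hs n F hF = 0 ↔ ∃ m : ℕ, s ^ m * F = 0 := by
  rw [ext_iff_val, Away.val_mk, val_zero, Localization.mk_eq_mk', IsLocalization.mk'_eq_zero_iff]
  constructor
  · rintro ⟨⟨_, m, rfl⟩, h⟩
    exact ⟨m, h⟩
  · rintro ⟨m, h⟩
    exact ⟨⟨_, m, rfl⟩, h⟩

theorem comp_eq_comp_of_comp_eq {C : Type*} [Category C] {X Y Y' Z T : C} {a : X ⟶ Y}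
    {a' : X ⟶ Y'} {u : Y ⟶ Z} {v : Y' ⟶ Z} {w : X ⟶ Z} (h₁ : a ≫ u = w) (h₂ : a' ≫ v = w)
    {f g : Z ⟶ T} (h : v ≫ f = v ≫ g) : a ≫ u ≫ f = a ≫ u ≫ g := by
  rw [← Category.assoc, ← Category.assoc, h₁, ← h₂, Category.assoc, h, Category.assoc]

theorem precomp_comp_eq {C : Type*} [Category C] {X Y Z T : C} (e : X ⟶ Y) {i : Y ⟶ Z}
    {f g : Z ⟶ T} (h : i ≫ f = i ≫ g) : (e ≫ i) ≫ f = (e ≫ i) ≫ g := by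
  rw [Category.assoc, h, Category.assoc]

/-- Each chart is reduced and contains its intersection with the complement as a dense subset (the
localization map is injective); morphisms into the separated plane that agree there are equal. -/
theorem hom_ext_of_awayι {q : MvPolynomial (Fin 3) k} (hq : q ∈ grading k 2) (hq0 : q ≠ 0)
    {f g : Proj (grading k) ⟶ Proj (grading k)}
    (h : Proj.awayι (grading k) q hq two_pos ≫ f = Proj.awayι (grading k) q hq two_pos ≫ g) :
    f = g := by
  have key : ∀ {d : ℕ} (hd : 0 < d) {s : MvPolynomial (Fin 3) k} (hs : s ∈ grading k d),
      Proj.awayι (grading k) s hs hd ≫ f = Proj.awayι (grading k) s hs hd ≫ g := by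
    intro d hd s hs
    have := isReduced_away s
    have hinj : Function.Injective (awayMap (grading k) hq (rfl : s * q = s * q)) := by
      rw [injective_iff_map_eq_zero]
      intro y hy
      obtain ⟨n, F, hF, rfl⟩ := Away.mk_surjective (grading k) hs y
      rw [awayMap_mk, mk_eq_zero_iff_exists] at hy
      rw [mk_eq_zero_iff_exists]
      obtain ⟨m, hm⟩ := hy
      refine ⟨m, ?_⟩
      rw [mul_pow, show s ^ m * q ^ m * (F * q ^ n) = s ^ m * F * (q ^ m * q ^ n) by ring] at hm
      exact (mul_eq_zero.mp hm).resolve_right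
        (mul_ne_zero (pow_ne_zero m hq0) (pow_ne_zero n hq0))
    have hdom : IsDominant (Spec.map (CommRingCat.ofHom
        (awayMap (grading k) hq (rfl : s * q = s * q)))) := by
      refine ⟨?_⟩
      refine (PrimeSpectrum.denseRange_comap_iff_ker_le_nilRadical _).mpr ?_
      exact ((RingHom.injective_iff_ker_eq_bot _).mp hinj).le.trans bot_le
    refine ext_of_isDominant (Spec.map (CommRingCat.ofHom
      (awayMap (grading k) hq (rfl : s * q = s * q)))) ?_
    have h1 := Proj.SpecMap_awayMap_awayι (grading k) hs hd hq (rfl : s * q = s * q)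
    have h2 := Proj.SpecMap_awayMap_awayι (grading k) hq two_pos hs (mul_comm s q)
    exact comp_eq_comp_of_comp_eq h1 h2 h
  exact (Proj.affineOpenCover (grading k)).openCover.hom_ext _ _ fun s => key s.1.2 s.2.2

theorem exists_isRes (φ : Q.autPair) :
    ∃ ψ : Q.AutCompl, ψ.hom.left ≫ Q.compl.ι = Q.compl.ι ≫ (φ : AutPlane k).hom.left :=
  Q.exists_res φ.2

theorem mul_isRes {ψ χ : Q.AutCompl} {φ φ' : AutPlane k}
    (h : ψ.hom.left ≫ Q.compl.ι = Q.compl.ι ≫ φ.hom.left)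
    (h' : χ.hom.left ≫ Q.compl.ι = Q.compl.ι ≫ φ'.hom.left) :
    (ψ * χ).hom.left ≫ Q.compl.ι = Q.compl.ι ≫ (φ * φ').hom.left := by
  change (χ.hom.left ≫ ψ.hom.left) ≫ Q.compl.ι = Q.compl.ι ≫ φ'.hom.left ≫ φ.hom.left
  rw [Category.assoc, h, reassoc_of% h']

theorem isRes_ext {ψ χ : Q.AutCompl} (h : ψ.hom.left ≫ Q.compl.ι = χ.hom.left ≫ Q.compl.ι) :
    ψ = χ := by
  have := (cancel_mono Q.compl.ι).mp h
  exact Iso.ext (Over.OverMorphism.ext this)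

variable (Q) in
/-- The restriction of automorphisms of the plane to the complement of the conic. -/
def resHom : Q.autPair →* Q.AutCompl :=
  MonoidHom.mk' (fun φ => (exists_isRes φ).choose) fun φ χ => isRes_ext <|
    (exists_isRes (φ * χ)).choose_spec.trans
      (mul_isRes (exists_isRes φ).choose_spec (exists_isRes χ).choose_spec).symm

theorem resHom_comp_ι (φ : Q.autPair) :
    (Q.resHom φ).hom.left ≫ Q.compl.ι = Q.compl.ι ≫ (φ : AutPlane k).hom.left :=
  (exists_isRes φ).choose_spec

theorem resHom_injective (hq : Q.q ≠ 0) : Function.Injective Q.resHom := by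
  intro φ χ h
  have h1 := (resHom_comp_ι φ).symm.trans (h ▸ resHom_comp_ι χ)
  refine Subtype.ext (Iso.ext (Over.OverMorphism.ext ?_))
  refine hom_ext_of_awayι Q.mem hq ?_
  exact precomp_comp_eq (Proj.basicOpenIsoSpec (grading k) Q.q Q.mem two_pos).inv h1

end SmoothConic

/-! ### The group of the model conic -/

namespace SmoothConic

open Chart

variable (k) in
/-- The action of the automorphisms of the model conic on the coordinate ring. -/
def coordHom : (model k).autPair →* AutRing k :=
  (modelFrame k).model.autEquiv.toMonoidHom.comp (model k).resHom

theorem coordHom_injective : Function.Injective (coordHom k) :=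
  (modelFrame k).model.autEquiv.injective.comp (resHom_injective conic_ne_zero)

theorem range_coordHom : (coordHom k).range = degSub k := by
  ext σ
  constructor
  · rintro ⟨φ, rfl⟩
    exact (modelFrame k).autEquiv_mem_degSub ⟨φ, φ.2, resHom_comp_ι φ⟩
  · intro h
    obtain ⟨ψ, ⟨φ, hφ, hψ⟩, rfl⟩ := (modelFrame k).degSub_le h
    exact ⟨⟨φ, hφ⟩, congrArg (modelFrame k).model.autEquiv
      (isRes_ext ((resHom_comp_ι ⟨φ, hφ⟩).trans hψ.symm))⟩

variable (k) in
/-- The automorphisms of the model conic are the automorphisms of the coordinate ring that preserve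
the degree. -/
def autPairEquiv : (model k).autPair ≃* degSub k :=
  (MonoidHom.ofInjective coordHom_injective).trans (MulEquiv.subgroupCongr range_coordHom)

/-- The inverse appears because the group isomorphism transports functions by the inverse
automorphism. -/
theorem actsBy_coordHom {φ : AutPlane k} {L : Fin 3 → MvPolynomial (Fin 3) k}
    (h : φ.IsGivenBy L) (hφ : φ ∈ (model k).autPair)
    (hL : MvPolynomial.aeval L (conic k) = conic k) : ActsBy (coordHom k ⟨φ, hφ⟩)⁻¹ L := by
  obtain ⟨Λ, hΛ, hC, hX, h⟩ := h
  intro n G hG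
  have hq : Λ (model k).q = (model k).q := (gradedRingHom_eq_aeval hC hX _).trans hL
  refine (((modelFrame k).symm_ev_of_projMap h hq).mp (resHom_comp_ι ⟨φ, hφ⟩) n G hG).trans ?_
  exact congrArg (ev k) (gradedRingHom_eq_aeval hC hX _)

theorem coordHom_shear {φ : AutPlane k} {b : k} (h : φ.IsGivenBy (shear b))
    (hφ : φ ∈ (model k).autPair) : coordHom k ⟨φ, hφ⟩ = fib (C (-b)) := by
  rw [map_neg, fib_neg, ← (actsBy_coordHom h hφ (aeval_shear_conic b)).eq_fib, inv_inv]

theorem coordHom_torus {φ : AutPlane k} {a : kˣ} (h : φ.IsGivenBy (torus a))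
    (hφ : φ ∈ (model k).autPair) : coordHom k ⟨φ, hφ⟩ = torusAut a⁻¹ := by
  rw [← torusAut_inv, ← (actsBy_coordHom h hφ (aeval_torus_conic a)).eq_torusAut, inv_inv]

theorem coordHom_swap {φ : AutPlane k} (h : φ.IsGivenBy (swap k))
    (hφ : φ ∈ (model k).autPair) : coordHom k ⟨φ, hφ⟩ = swapAut k := by
  rw [← swapAut_inv, ← (actsBy_coordHom h hφ aeval_swap_conic).eq_swapAut, inv_inv]

/-- Generation of `degSub` by the linear automorphisms is carried back along the injective
homomorphism `coordHom`. -/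
theorem closure_isGivenBy : Subgroup.closure {φ : AutPlane k | (∃ b : k, φ.IsGivenBy (shear b)) ∨
    (∃ a : kˣ, φ.IsGivenBy (torus a)) ∨ φ.IsGivenBy (swap k)} = (model k).autPair := by
  apply le_antisymm
  · rw [Subgroup.closure_le]
    rintro φ (⟨b, h⟩ | ⟨a, h⟩ | h)
    exacts [isGivenBy_mem h (aeval_shear_conic b), isGivenBy_mem h (aeval_torus_conic a),
      isGivenBy_mem h aeval_swap_conic]
  · intro φ hφ
    set H := Subgroup.closure {φ : AutPlane k | (∃ b : k, φ.IsGivenBy (shear b)) ∨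
      (∃ a : kˣ, φ.IsGivenBy (torus a)) ∨ φ.IsGivenBy (swap k)}
    have hle : degSub k ≤ (H.subgroupOf (model k).autPair).map (coordHom k) := by
      rw [← closure_linear_eq_degSub, Subgroup.closure_le]
      rintro σ (⟨b, rfl⟩ | ⟨a, rfl⟩ | rfl)
      · have h := shear_isGivenBy (-b)
        have hm := isGivenBy_mem (Q := model k) h (aeval_shear_conic _)
        refine ⟨⟨_, hm⟩, Subgroup.subset_closure (Or.inl ⟨_, h⟩), ?_⟩
        rw [coordHom_shear h hm, neg_neg]
      · have h := torus_isGivenBy a⁻¹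
        have hm := isGivenBy_mem (Q := model k) h (aeval_torus_conic _)
        refine ⟨⟨_, hm⟩, Subgroup.subset_closure (Or.inr (Or.inl ⟨_, h⟩)), ?_⟩
        rw [coordHom_torus h hm, inv_inv]
      · have h := swap_isGivenBy k
        have hm := isGivenBy_mem (Q := model k) h aeval_swap_conic
        exact ⟨⟨_, hm⟩, Subgroup.subset_closure (Or.inr (Or.inr h)), coordHom_swap h hm⟩
    obtain ⟨χ, hχ, h⟩ := hle (range_coordHom.le ⟨⟨φ, hφ⟩, rfl⟩)
    obtain rfl := coordHom_injective h
    exact hχ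

end SmoothConic

end ConicComplement

/-! ### The isomorphism with the projective linear group -/

namespace ConicComplement

open MvPolynomial

variable {k : Type u} [Field k]

/-! ### Conjugation of trace zero matrices -/

/-- The entries `x`, `y`, `z` of the conjugate of the matrix `!![y, x; z, -y]` by
`!![a, b; c, d]`, if `e` is the inverse of the determinant. -/
def conj (a b c d e : k) : Fin 3 → MvPolynomial (Fin 3) k :=
  ![C (e * d ^ 2) * X 0 + C (e * (2 * b * d)) * X 1 - C (e * b ^ 2) * X 2,
    C (e * (c * d)) * X 0 + C (e * (a * d + b * c)) * X 1 - C (e * (a * b)) * X 2,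
    C (e * a ^ 2) * X 2 - C (e * (2 * a * c)) * X 1 - C (e * c ^ 2) * X 0]

theorem conj_isHomogeneous (a b c d e : k) (i : Fin 3) : (conj a b c d e i).IsHomogeneous 1 := by
  have h : ∀ (c : k) (j : Fin 3), (C c * X j : MvPolynomial (Fin 3) k).IsHomogeneous 1 :=
    fun c j => (isHomogeneous_X k j).C_mul c
  fin_cases i
  · exact ((h _ _).add (h _ _)).sub (h _ _)
  · exact ((h _ _).add (h _ _)).sub (h _ _)
  · exact ((h _ _).sub (h _ _)).sub (h _ _)

theorem aeval_conj_conj (a b c d e a' b' c' d' e' : k) (i : Fin 3) :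
    aeval (conj a b c d e) (conj a' b' c' d' e' i) =
      conj (a * a' + b * c') (a * b' + b * d') (c * a' + d * c') (c * b' + d * d') (e * e') i := by
  have key : ∀ (v : Fin 3 → MvPolynomial (Fin 3) k) (r₀ r₁ r₂ : k),
      aeval v (C r₀ * X 0 + C r₁ * X 1 - C r₂ * X 2) = C r₀ * v 0 + C r₁ * v 1 - C r₂ * v 2 ∧
      aeval v (C r₀ * X 2 - C r₁ * X 1 - C r₂ * X 0) = C r₀ * v 2 - C r₁ * v 1 - C r₂ * v 0 :=
    fun v r₀ r₁ r₂ => by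
      have hC : ∀ r : k, aeval v (C r) = C r := fun r => algHom_C _ _
      simp only [map_add, map_sub, map_mul, hC, aeval_X, and_self]
  fin_cases i
  · refine (key _ _ _ _).1.trans ?_
    simp only [conj, Fin.zero_eta, Matrix.cons_val, map_add, map_mul, map_pow, map_ofNat]
    ring
  · refine (key _ _ _ _).1.trans ?_
    simp only [conj, Fin.mk_one, Matrix.cons_val, map_add, map_mul, map_pow, map_ofNat]
    ring
  · refine (key _ _ _ _).2.trans ?_
    simp only [conj, Fin.reduceFinMk, Matrix.cons_val, map_add, map_mul, map_pow, map_ofNat]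
    ring

theorem conj_one (a e : k) (h : e * a ^ 2 = 1) : conj a 0 0 a e = X := by
  funext i
  fin_cases i <;> simp [conj, h, ← sq]

/-- The equation `xz + y²` is minus the determinant of a trace zero matrix, which conjugation
preserves. -/
theorem aeval_conj_conic {a b c d e : k} (h : e * (a * d - b * c) = 1) :
    aeval (conj a b c d e) (Chart.conic k) = Chart.conic k := by
  have h' : (C e * (C a * C d - C b * C c) : MvPolynomial (Fin 3) k) = 1 := by
    simpa using congrArg (C (σ := Fin 3)) h
  have e : aeval (conj a b c d e) (Chart.conic k) =
      (C e * (C a * C d - C b * C c)) ^ 2 * Chart.conic k := by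
    simp only [Chart.conic_def, conj, map_add, map_mul, map_pow, aeval_X, Matrix.cons_val, map_ofNat]
    ring
  rw [e, h', one_pow, one_mul]

/-- The coordinates of the conjugate of the matrix `!![y, x; z, -y]` by `g`. -/
def conjGL (g : GL (Fin 2) k) : Fin 3 → MvPolynomial (Fin 3) k :=
  conj (g.val 0 0) (g.val 0 1) (g.val 1 0) (g.val 1 1) (g.det⁻¹ : kˣ)

theorem det_inv_mul (g : GL (Fin 2) k) :
    ((g.det⁻¹ : kˣ) : k) * (g.val 0 0 * g.val 1 1 - g.val 0 1 * g.val 1 0) = 1 := by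
  rw [← Matrix.det_fin_two]
  exact g.det.inv_mul

theorem aeval_conjGL_conjGL (g h : GL (Fin 2) k) (i : Fin 3) :
    aeval (conjGL g) (conjGL h i) = conjGL (g * h) i := by
  rw [conjGL, conjGL, aeval_conj_conj, conjGL]
  simp [Matrix.mul_apply, Fin.sum_univ_two, mul_comm]

theorem conjGL_one : conjGL (1 : GL (Fin 2) k) = X := by
  rw [← conj_one (1 : k) 1 (by simp)]
  simp [conjGL]

/-- Conjugation by `g` as an automorphism of `k[x, y, z]`. -/
def conjEquiv (g : GL (Fin 2) k) : MvPolynomial (Fin 3) k ≃ₐ[k] MvPolynomial (Fin 3) k :=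
  substEquiv (conjGL g) (conjGL g⁻¹) (fun i => by rw [aeval_conjGL_conjGL, mul_inv_cancel, conjGL_one])
    (fun i => by rw [aeval_conjGL_conjGL, inv_mul_cancel, conjGL_one])

theorem exists_actsBy_conjGL (g : GL (Fin 2) k) :
    ∃ τ ∈ Chart.degSub k, Chart.ActsBy τ (conjGL g) := by
  have hm : conjEquiv g ∈ gradedAut k :=
    substEquiv_mem (conj_isHomogeneous _ _ _ _ _) (conj_isHomogeneous _ _ _ _ _)
  obtain ⟨ψ, hψ, h⟩ := (SmoothConic.modelFrame k).exists_actsBy hm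
    (aeval_conj_conic (det_inv_mul g))
  refine ⟨_, inv_mem ((SmoothConic.modelFrame k).autEquiv_mem_degSub hψ), ?_⟩
  have e : (fun i => conjEquiv g (X i)) = conjGL g := _root_.funext fun i => aeval_X _ _
  rwa [e] at h

open Chart in
variable (k) in
/-- The action of `GL₂` on the coordinate ring by conjugation. -/
def conjHom : GL (Fin 2) k →* AutRing k :=
  MonoidHom.mk' (fun g => (exists_actsBy_conjGL g).choose) fun g h => by
    have hg := (exists_actsBy_conjGL g).choose_spec.2
    have hh := (exists_actsBy_conjGL h).choose_spec.2
    have hgh := (exists_actsBy_conjGL (g * h)).choose_spec.2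
    -- The coordinate ring only sees forms of even degree, so the comparison is made on products of
    -- two coordinates.
    have key : ∀ i j : Fin 3, toChart (((exists_actsBy_conjGL g).choose *
        (exists_actsBy_conjGL h).choose : AutRing k)
          (ofChart (ev k (X i * X j)) (ev_mem (isHomogeneous_X_mul_X i j)))) =
        ev k (conjGL (g * h) i) * ev k (conjGL (g * h) j) := by
      intro i j
      have hL : (conjGL h i * conjGL h j).IsHomogeneous (2 * 1) :=
        (conj_isHomogeneous _ _ _ _ _ i).mul (conj_isHomogeneous _ _ _ _ _ j)
      have e : (exists_actsBy_conjGL h).choose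
          (ofChart (ev k (X i * X j)) (ev_mem (isHomogeneous_X_mul_X i j))) =
          ofChart (ev k (conjGL h i * conjGL h j)) (ev_mem hL) := by
        refine toChart_injective ((hh 1 _ (isHomogeneous_X_mul_X i j)).trans ?_)
        rw [toChart_ofChart, map_mul, aeval_X, aeval_X]
      rw [AlgEquiv.mul_apply, e, hg 1 _ hL, map_mul, aeval_conjGL_conjGL, aeval_conjGL_conjGL,
        map_mul]
    exact hgh.ext (by rw [← ofChart_ev_sq, key]) (by rw [← ofChart_ev_mul, key])

theorem actsBy_conjHom (g : GL (Fin 2) k) : Chart.ActsBy (conjHom k g) (conjGL g) :=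
  (exists_actsBy_conjGL g).choose_spec.2

/-- Lower unitriangular, diagonal and antidiagonal matrices induce the shears, the torus and the
swap. -/
theorem range_conjHom : (conjHom k).range = Chart.degSub k := by
  apply le_antisymm
  · rintro _ ⟨g, rfl⟩
    exact (exists_actsBy_conjGL g).choose_spec.1
  · rw [← Chart.closure_linear_eq_degSub, Subgroup.closure_le]
    have key : ∀ (a b c d e : k) (h : e * (a * d - b * c) = 1),
        ∃ g, Chart.ActsBy (conjHom k g) (conj a b c d e) := by
      intro a b c d e h
      have hdet : IsUnit (!![a, b; c, d] : Matrix (Fin 2) (Fin 2) k).det := by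
        rw [Matrix.det_fin_two_of]
        exact IsUnit.of_mul_eq_one_right _ h
      refine ⟨Matrix.GeneralLinearGroup.mk'' _ hdet, ?_⟩
      have := actsBy_conjHom (Matrix.GeneralLinearGroup.mk'' _ hdet)
      convert this using 1
      have he : e = (((Matrix.GeneralLinearGroup.mk'' !![a, b; c, d] hdet).det⁻¹ : kˣ) : k) := by
        refine mul_right_cancel₀ (right_ne_zero_of_mul_eq_one h) (h.trans ?_)
        exact (det_inv_mul (Matrix.GeneralLinearGroup.mk'' !![a, b; c, d] hdet)).symm
      rw [conjGL, ← he]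
      rfl
    rintro σ (⟨b, rfl⟩ | ⟨a, rfl⟩ | rfl)
    · obtain ⟨g, hg⟩ := key 1 0 b 1 1 (by ring)
      refine ⟨g, Chart.ActsBy.eq_fib ?_⟩
      convert hg using 1
      funext i
      fin_cases i <;> simp [SmoothConic.shear, conj, map_ofNat C, add_comm]
    · obtain ⟨g, hg⟩ := key 1 0 0 a (a⁻¹ : kˣ) (by simp)
      refine ⟨g, Chart.ActsBy.eq_torusAut ?_⟩
      convert hg using 1
      funext i
      fin_cases i <;> simp [SmoothConic.torus, conj, sq]
    · obtain ⟨g, hg⟩ := key 0 1 1 0 (-1) (by ring)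
      refine ⟨g, Chart.ActsBy.eq_swapAut ?_⟩
      convert hg using 1
      funext i
      fin_cases i <;> simp [SmoothConic.swap, conj]

theorem ker_conjHom : (conjHom k).ker = Subgroup.center (GL (Fin 2) k) := by
  ext g
  rw [MonoidHom.mem_ker, Matrix.GeneralLinearGroup.mem_center_iff_val_mem_range_scalar]
  have hdet := det_inv_mul g
  have hact := actsBy_conjHom g
  constructor
  · intro h
    rw [h] at hact
    have key : ∀ (i j : Fin 3) (v : Fin 3 → k),
        eval v (conjGL g i) * eval v (conjGL g j) = v i * v j := by
      intro i j v
      have hL : (conjGL g i * conjGL g j).IsHomogeneous (2 * 1) :=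
        (conj_isHomogeneous _ _ _ _ _ i).mul (conj_isHomogeneous _ _ _ _ _ j)
      have := hact 1 _ (Chart.isHomogeneous_X_mul_X i j)
      rw [AlgEquiv.one_apply, Chart.toChart_ofChart, map_mul (aeval _), aeval_X, aeval_X] at this
      simpa using (congrArg (eval v)
        (Chart.eq_of_ev_eq (Chart.isHomogeneous_X_mul_X i j) hL this)).symm
    -- The three evaluations force, in this order, `b = 0`, `c = 0` and `a = d`.
    have h1 := key 0 0 ![0, 0, 1]
    have h2 := key 0 1 ![1, 0, 0]
    have h3 := key 0 1 ![1, 1, 0]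
    have he : ((g.det⁻¹ : kˣ) : k) ≠ 0 := Units.ne_zero _
    simp only [conjGL, conj, Matrix.cons_val, map_add, map_sub, map_mul, eval_C, eval_X] at h1 h2 h3
    generalize ((g.det⁻¹ : kˣ) : k) = e at *
    have hb : g.val 0 1 = 0 := by simpa [he] using h1
    rw [hb] at h2 h3 hdet
    have hd : g.val 1 1 ≠ 0 := by
      rintro hd
      simp [hd] at hdet
    have hc : g.val 1 0 = 0 := by simpa [he, hd] using h2
    rw [hc] at h3 hdet
    have had : g.val 1 1 = g.val 0 0 := by
      have h4 : e * (g.val 0 0 * g.val 1 1) = 1 := by linear_combination hdet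
      have h5 : e * g.val 1 1 ^ 2 = 1 := by linear_combination h3 - e * g.val 1 1 ^ 2 * h4
      refine mul_left_cancel₀ (mul_ne_zero he hd) ?_
      linear_combination h5 - h4
    refine ⟨g.val 0 0, ?_⟩
    ext i j
    fin_cases i <;> fin_cases j <;> simp [hb, hc, had]
  · rintro ⟨a, ha⟩
    have e : conjGL g = conjGL 1 := by
      have h00 : g.val 0 0 = a := by simp [← ha]
      have h01 : g.val 0 1 = 0 := by simp [← ha]
      have h10 : g.val 1 0 = 0 := by simp [← ha]
      have h11 : g.val 1 1 = a := by simp [← ha]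
      rw [h00, h01, h10, h11] at hdet
      rw [conjGL_one, conjGL, h00, h01, h10, h11]
      exact conj_one _ _ (by linear_combination hdet)
    rw [e] at hact
    have h1 := actsBy_conjHom (1 : GL (Fin 2) k)
    rw [← map_one (conjHom k)]
    exact hact.ext h1.t h1.xy

theorem nonempty_autPair_equiv_PGL : Nonempty ((SmoothConic.model k).autPair ≃* PGL(2, k)) :=
  ⟨(SmoothConic.autPairEquiv k).trans <| (MulEquiv.subgroupCongr range_conjHom.symm).trans <|
    (QuotientGroup.quotientKerEquivRange (conjHom k)).symm.trans
      (QuotientGroup.quotientMulEquivOfEq ker_conjHom)⟩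

end ConicComplement

/-! ### Generators of the stabilizer of the model fibration -/

namespace ConicComplement

open Polynomial

variable {k : Type u} [Field k]

/-! ### The automorphisms that preserve the fibres of the model fibration -/

namespace Chart

theorem QuadricPoint.toChart_toEnd (P : QuadricPoint k) {n : ℕ} {G : MvPolynomial (Fin 3) k}
    (hG : G.IsHomogeneous (2 * n)) : toChart (P.toEnd (ofChart (ev k G) (ev_mem hG))) =
      MvPolynomial.aeval ![P.x', P.y', P.z'] G := by
  refine toFrac_injective ((toFrac_tripleEnd P.tripleHom_mem _).trans ?_)
  rw [toChart_ofChart, ← AlgHom.comp_apply, ← AlgHom.comp_apply]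
  congr 1
  refine MvPolynomial.algHom_ext fun i => ?_
  rw [AlgHom.comp_apply, AlgHom.comp_apply, MvPolynomial.aeval_X]
  fin_cases i
  · exact (congrArg _ ev_X0).trans (tripleHom_x _ _)
  · exact (congrArg _ ev_X1).trans P.tripleHom_y
  · exact (congrArg _ ev_X2).trans (by rw [map_neg, P.tripleHom_w, neg_neg]; rfl)

end Chart

namespace SmoothConic

open Chart

variable (k) in
/-- Evaluation of fractions on the double cover of the complement of the model conic where the
equation is constant. -/
def locEv : Localization.Away (model k).q →ₐ[k] Chart k where
  toRingHom := locEval (modelFrame k).evW (modelFrame k).isUnit_evW_q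
  commutes' c := by
    rw [IsScalarTower.algebraMap_apply k (MvPolynomial (Fin 3) k)]
    exact (locEval_algebraMap _ _ _).trans (AlgHom.commutes _ c)

theorem locEv_algebraMap (F : MvPolynomial (Fin 3) k) :
    locEv k (algebraMap _ (Localization.Away (model k).q) F) = ev k F :=
  locEval_algebraMap _ (modelFrame k).isUnit_evW_q F

theorem locEv_val (f : Away (grading k) (model k).q) :
    locEv k f.val = toChart ((modelFrame k).coordEquiv f) :=
  rfl

theorem locEv_q : locEv k (algebraMap _ (Localization.Away (model k).q) (model k).q) = 1 :=
  (locEv_algebraMap _).trans ev_conic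

theorem modelParam_mul : modelParam k * algebraMap _ _ (model k).q =
    algebraMap (MvPolynomial (Fin 3) k) _ (MvPolynomial.X 0 ^ 2) := by
  rw [modelParam, Localization.mk_eq_mk']
  exact IsLocalization.mk'_spec _ _ _

theorem locEv_modelParam : locEv k (modelParam k) = x k ^ 2 := by
  have h := congrArg (locEv k) modelParam_mul
  rwa [map_mul, locEv_q, mul_one, locEv_algebraMap, map_pow, ev_X0] at h

theorem locEv_fiberedMap (s : k[X]) :
    (fun i => locEv k (fiberedMap s i)) = ![(fibPoint (aeval (Chart.t k) s)).x',
      (fibPoint (aeval (Chart.t k) s)).y', (fibPoint (aeval (Chart.t k) s)).z'] := by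
  have hs : locEv k (aeval (modelParam k) s) = toChart (aeval (Chart.t k) s) := by
    rw [← Polynomial.aeval_algHom_apply, ← Polynomial.aeval_algHom_apply, locEv_modelParam,
      toChart_t]
  funext i
  fin_cases i
  · exact (locEv_algebraMap _).trans ev_X0
  · simp [fiberedMap, fibPoint, locEv_algebraMap, hs]
  · simp [fiberedMap, fibPoint, locEv_algebraMap, hs, map_ofNat (locEv k)]
    ring

theorem locEv_aeval_fiberedMap (s : k[X]) {n : ℕ} {f : MvPolynomial (Fin 3) k}
    (hf : f.IsHomogeneous (2 * n)) : locEv k (MvPolynomial.aeval (fiberedMap s) f) =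
      toChart (fib s (ofChart (ev k f) (ev_mem hf))) := by
  refine Eq.trans ?_ ((fibPoint (aeval (Chart.t k) s)).toChart_toEnd hf).symm
  rw [← locEv_fiberedMap]
  exact MvPolynomial.comp_aeval_apply _ _ _

theorem aeval_fiberedMap_q (s : k[X]) : MvPolynomial.aeval (fiberedMap s) (model k).q =
    algebraMap _ _ (model k).q := by
  have h : ∀ v : Fin 3 → Localization.Away (model k).q, MvPolynomial.aeval v (conic k) =
      v 0 * v 2 + v 1 ^ 2 := fun v => by
    rw [conic_def, map_add, map_mul, map_pow, MvPolynomial.aeval_X, MvPolynomial.aeval_X,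
      MvPolynomial.aeval_X]
  refine (h _).trans (Eq.trans ?_ (congrArg _ conic_def.symm))
  rw [map_add, map_mul, map_pow]
  simp only [fiberedMap, Matrix.cons_val]
  ring

theorem isUnit_q : IsUnit (algebraMap (MvPolynomial (Fin 3) k) (Localization.Away (model k).q)
    (model k).q) :=
  IsLocalization.Away.algebraMap_isUnit _

theorem exists_aeval_modelParam_mul (s : k[X]) : ∃ (m : ℕ) (T : MvPolynomial (Fin 3) k),
    T ∈ grading k (m • 2) ∧ aeval (modelParam k) s * algebraMap _ _ (model k).q ^ m =
      algebraMap _ _ T := by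
  induction s using Polynomial.induction_on' with
  | add s s' hs hs' =>
    obtain ⟨m, T, hT, h⟩ := hs
    obtain ⟨m', T', hT', h'⟩ := hs'
    have hq := fun j => SetLike.pow_mem_graded j (model k).mem
    refine ⟨m + m', T * (model k).q ^ m' + T' * (model k).q ^ m, add_mem ?_ ?_, ?_⟩
    · rw [add_smul]
      exact SetLike.mul_mem_graded hT (hq m')
    · rw [add_comm m m', add_smul]
      exact SetLike.mul_mem_graded hT' (hq m)
    · rw [map_add, map_add, map_mul, map_mul, ← h, ← h', map_pow, map_pow]
      ring
  | monomial n c =>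
    refine ⟨n, MvPolynomial.C c * (MvPolynomial.X 0 ^ 2) ^ n, ?_, ?_⟩
    · refine MvPolynomial.IsHomogeneous.C_mul ?_ c
      rw [smul_eq_mul, mul_comm]
      exact ((MvPolynomial.isHomogeneous_X k 0).pow 2).pow n
    · rw [aeval_monomial, mul_assoc, ← mul_pow, modelParam_mul, ← map_pow, map_mul,
        IsScalarTower.algebraMap_apply k (MvPolynomial (Fin 3) k)]
      rfl

theorem exists_fiberedMap_mul (s : k[X]) : ∃ (m : ℕ) (G : Fin 3 → MvPolynomial (Fin 3) k),
    (∀ i, (G i).IsHomogeneous (4 * m + 1)) ∧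
      ∀ i, fiberedMap s i * algebraMap _ _ (model k).q ^ (2 * m) = algebraMap _ _ (G i) := by
  obtain ⟨m, T, hT, h⟩ := exists_aeval_modelParam_mul s
  have hX : ∀ i, (MvPolynomial.X i : MvPolynomial (Fin 3) k).IsHomogeneous 1 :=
    MvPolynomial.isHomogeneous_X k
  have hq : ∀ j, ((model k).q ^ j).IsHomogeneous (2 * j) := fun j => (model k).mem.pow j
  have hT : T.IsHomogeneous (2 * m) := by rw [mul_comm]; exact hT
  have hd : ∀ {F : MvPolynomial (Fin 3) k} {d : ℕ}, F.IsHomogeneous d → d = 4 * m + 1 →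
      F.IsHomogeneous (4 * m + 1) := fun hF h => h ▸ hF
  refine ⟨m, ![MvPolynomial.X 0 * (model k).q ^ (2 * m),
    MvPolynomial.X 1 * (model k).q ^ (2 * m) + T * (model k).q ^ m * MvPolynomial.X 0,
    MvPolynomial.X 2 * (model k).q ^ (2 * m) -
      (MvPolynomial.X 1 * T * (model k).q ^ m + MvPolynomial.X 1 * T * (model k).q ^ m) -
      MvPolynomial.X 0 * T ^ 2], fun i => ?_, fun i => ?_⟩
  · fin_cases i
    · exact hd ((hX 0).mul (hq _)) (by ring)
    · exact (hd ((hX 1).mul (hq _)) (by ring)).add (hd ((hT.mul (hq m)).mul (hX 0)) (by ring))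
    · have h1 := hd (((hX 1).mul hT).mul (hq m)) (by ring)
      exact ((hd ((hX 2).mul (hq _)) (by ring)).sub (h1.add h1)).sub
        (hd ((hX 0).mul (hT.pow 2)) (by ring))
  · fin_cases i
    · simp [fiberedMap]
    · simp only [fiberedMap, Fin.mk_one, Matrix.cons_val, map_add, map_mul, map_pow, ← h]
      ring
    · simp only [fiberedMap, Fin.reduceFinMk, Matrix.cons_val, map_add, map_sub, map_mul, map_pow,
        ← h]
      ring

/-- The three coordinates have the common denominator `q^(2m)` and numerators of degree `4m + 1`, so
they have degree one; substitution preserves the degree of `f`, and division by `q^n` gives degree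
zero. -/
theorem exists_aeval_fiberedMap_eq (s : k[X]) {n : ℕ} {f : MvPolynomial (Fin 3) k}
    (hf : f ∈ grading k (n • 2)) : ∃ h : Away (grading k) (model k).q,
      h.val * algebraMap _ _ (model k).q ^ n = MvPolynomial.aeval (fiberedMap s) f := by
  obtain ⟨m, G, hG, h⟩ := exists_fiberedMap_mul s
  have hGf : MvPolynomial.aeval G f ∈ grading k ((n + 4 * m * n) • 2) := by
    have := MvPolynomial.IsHomogeneous.aeval (hφ := hf) G hG
    rw [show (n + 4 * m * n) • 2 = (4 * m + 1) * (n • 2) by simp only [smul_eq_mul]; ring]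
    exact this
  refine ⟨Away.mk (grading k) (model k).mem _ _ hGf, ?_⟩
  have h1 := val_mk_mul (model k).mem _ _ hGf
  have h2 := aeval_smul_of_isHomogeneous hf
    (algebraMap (MvPolynomial (Fin 3) k) (Localization.Away (model k).q) (model k).q ^ (2 * m))
    (fiberedMap s)
  simp only [h] at h2
  have h3 : MvPolynomial.aeval (fun i => algebraMap _ (Localization.Away (model k).q) (G i)) f =
      algebraMap _ _ (MvPolynomial.aeval G f) :=
    (MvPolynomial.comp_aeval_apply G
      (IsScalarTower.toAlgHom k (MvPolynomial (Fin 3) k) (Localization.Away (model k).q)) f).symm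
  rw [h3, ← h1, map_pow, pow_add, ← mul_assoc, ← pow_mul,
    show 2 * m * (n • 2) = 4 * m * n by simp only [smul_eq_mul]; ring] at h2
  exact (isUnit_q.pow _).mul_right_cancel h2

/-- The automorphisms of the complement of the model conic that are given by a polynomial. -/
theorem isGivenBy_fiberedMap_iff {ψ : (model k).AutCompl} {s : k[X]} :
    (model k).IsGivenBy ψ (fiberedMap s) ↔ ((modelFrame k).model.autEquiv ψ)⁻¹ = fib s := by
  have hmk : ∀ (n : ℕ) (f : MvPolynomial (Fin 3) k) (hf : f ∈ grading k (n • 2)),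
      (modelFrame k).coordEquiv (Away.mk (grading k) (model k).mem n f hf) =
        ofChart (ev k f) (ev_mem (n := n) (by rw [mul_comm]; exact hf)) := fun n f hf => by
    refine toChart_injective ?_
    have := congrArg (locEv k) (val_mk_mul (model k).mem n f hf)
    rwa [map_mul, map_pow, map_pow, locEv_q, one_pow, mul_one, locEv_algebraMap, locEv_val] at this
  unfold IsGivenBy
  simp only [aeval_fiberedMap_q, (modelFrame k).hom_left_basicOpenToSpec_iff]
  constructor
  · rintro ⟨-, g, hg, hψ⟩
    -- Only quadratic forms are needed, since an automorphism is determined by the images of `t` and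
    -- `xy`.
    have key : ∀ (f : MvPolynomial (Fin 3) k) (hf : f.IsHomogeneous (2 * 1)),
        ((modelFrame k).model.autEquiv ψ).symm (ofChart (ev k f) (ev_mem hf)) =
          fib s (ofChart (ev k f) (ev_mem hf)) := by
      intro f hf
      refine toChart_injective ?_
      rw [← locEv_aeval_fiberedMap s hf, ← hg 1 f hf, map_mul, map_pow, locEv_q, one_pow, mul_one,
        locEv_val, ← hψ]
      exact congrArg (fun c => toChart (((modelFrame k).model.autEquiv ψ).symm c)) (hmk 1 f hf).symm
    refine autRing_ext ?_ ?_
    · rw [← ofChart_ev_sq]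
      exact key _ (isHomogeneous_X_mul_X 0 0)
    · rw [← ofChart_ev_mul]
      exact key _ (isHomogeneous_X_mul_X 0 1)
  · intro h
    refine ⟨isUnit_q, ((modelFrame k).coordEquiv.symm : Coord k →+* _).comp
      ((fib s : Coord k →+* Coord k).comp ((modelFrame k).coordEquiv : _ →+* Coord k)),
      fun n f hf => ?_, fun f => ?_⟩
    · obtain ⟨y, hy⟩ := exists_aeval_fiberedMap_eq s hf
      rw [← hy]
      congr 2
      refine (modelFrame k).coordEquiv.injective (toChart_injective ?_)
      have h2 := congrArg (locEv k) hy
      rw [map_mul, map_pow, locEv_q, one_pow, mul_one, locEv_val, locEv_aeval_fiberedMap s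
        (n := n) (by rw [mul_comm]; exact hf)] at h2
      rw [h2, ← hmk n f hf]
      exact congrArg toChart ((modelFrame k).coordEquiv.apply_symm_apply _)
    · change ((modelFrame k).model.autEquiv ψ)⁻¹ _ = _
      rw [h]
      exact ((modelFrame k).coordEquiv.apply_symm_apply _).symm

theorem exists_isGivenBy_fiberedMap (s : k[X]) :
    ∃ ψ : (model k).AutCompl, (model k).IsGivenBy ψ (fiberedMap s) :=
  ⟨(modelFrame k).model.autEquiv.symm (fib s)⁻¹, isGivenBy_fiberedMap_iff.mpr (by
    rw [MulEquiv.apply_symm_apply, inv_inv])⟩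

end SmoothConic

/-! ### The stabilizer of a rational point of the model conic -/

theorem restrictToCone_smul (c : k) (p : Fin 3 → k) (F : MvPolynomial (Fin 3) k) :
    restrictToCone (c • p) F = aeval (C c * X : k[X]) (restrictToCone p F) := by
  rw [← AlgHom.comp_apply]
  congr 1
  refine MvPolynomial.algHom_ext fun i => ?_
  simp only [restrictToCone, MvPolynomial.aeval_X, AlgHom.comp_apply, map_mul, aeval_C, aeval_X,
    Pi.smul_apply, smul_eq_mul, Polynomial.algebraMap_eq]
  ring

theorem restrictToCone_units_smul_eq_zero_iff (c : kˣ) (p : Fin 3 → k)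
    (F : MvPolynomial (Fin 3) k) : restrictToCone ((c : k) • p) F = 0 ↔ restrictToCone p F = 0 := by
  refine ⟨fun h => ?_, fun h => by rw [restrictToCone_smul, h, map_zero]⟩
  have h1 : p = ((c⁻¹ : kˣ) : k) • ((c : k) • p) := by
    rw [smul_smul, Units.inv_mul, one_smul]
  rw [h1, restrictToCone_smul, h, map_zero]

theorem restrictToCone_aeval {L : Fin 3 → MvPolynomial (Fin 3) k} (hL : ∀ i, (L i).IsHomogeneous 1)
    (p : Fin 3 → k) (F : MvPolynomial (Fin 3) k) : restrictToCone p (MvPolynomial.aeval L F) =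
      restrictToCone (fun i => MvPolynomial.eval p (L i)) F := by
  rw [← AlgHom.comp_apply]
  congr 1
  refine MvPolynomial.algHom_ext fun i => ?_
  rw [AlgHom.comp_apply, MvPolynomial.aeval_X, restrictToCone_of_mem p (hL i), restrictToCone,
    MvPolynomial.aeval_X, pow_one]

theorem mem_hom_left_point_iff {φ : AutPlane k} {L : Fin 3 → MvPolynomial (Fin 3) k}
    (h : φ.IsGivenBy L) (hL : ∀ i, (L i).IsHomogeneous 1) {p : Fin 3 → k} (hp : p ≠ 0)
    (F : MvPolynomial (Fin 3) k) :
    F ∈ ProjectiveSpectrum.asHomogeneousIdeal (φ.hom.left (Plane.point p hp)) ↔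
      restrictToCone (fun i => MvPolynomial.eval p (L i)) F = 0 := by
  obtain ⟨f, hf, hC, hX, h⟩ := h
  rw [h, ← restrictToCone_aeval hL, ← gradedRingHom_eq_aeval hC hX]
  rfl

theorem hom_left_point_eq {φ : AutPlane k} {L : Fin 3 → MvPolynomial (Fin 3) k}
    (h : φ.IsGivenBy L) (hL : ∀ i, (L i).IsHomogeneous 1) {p : Fin 3 → k} (hp : p ≠ 0) (c : kˣ)
    (hc : (fun i => MvPolynomial.eval p (L i)) = (c : k) • p) :
    φ.hom.left (Plane.point p hp) = Plane.point p hp := by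
  refine ProjectiveSpectrum.ext (HomogeneousIdeal.ext ?_)
  ext F
  refine (mem_hom_left_point_iff h hL hp F).trans ?_
  rw [hc, restrictToCone_units_smul_eq_zero_iff]
  rfl

namespace SmoothConic

open Chart

variable (k) in
/-- The action on the coordinate ring of the automorphisms of the model conic that fix the
point `[0 : 0 : 1]`. -/
def pointSub : Subgroup (AutRing k) :=
  (((model k).autPairPoint (modelPoint k) (modelPoint_ne_zero k)).subgroupOf
    (model k).autPair).map (coordHom k)

theorem torusAut_mem_pointSub (a : kˣ) : torusAut a ∈ pointSub k := by
  have h := torus_isGivenBy a⁻¹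
  have hm := isGivenBy_mem (Q := model k) h (aeval_torus_conic _)
  refine ⟨⟨_, hm⟩, ⟨hm, hom_left_point_eq h (torus_isHomogeneous _) _ a ?_⟩, ?_⟩
  · funext i
    fin_cases i <;> simp [torus, modelPoint]
  · rw [coordHom_torus h hm, inv_inv]

theorem fib_C_mem_pointSub (b : k) : fib (C b) ∈ pointSub k := by
  have h := shear_isGivenBy (-b)
  have hm := isGivenBy_mem (Q := model k) h (aeval_shear_conic _)
  refine ⟨⟨_, hm⟩, ⟨hm, hom_left_point_eq h (shear_isHomogeneous _) _ 1 ?_⟩, ?_⟩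
  · funext i
    fin_cases i <;> simp [shear, modelPoint]
  · rw [coordHom_shear h hm, neg_neg]

/-- The coordinate `z` vanishes at the image of `p₀` under the swap, but not at `p₀`. -/
theorem swapAut_notMem_pointSub : swapAut k ∉ pointSub k := by
  have h := swap_isGivenBy k
  have hm := isGivenBy_mem (Q := model k) h aeval_swap_conic
  rintro ⟨χ, ⟨-, hχ⟩, e⟩
  obtain rfl := coordHom_injective (e.trans (coordHom_swap h hm).symm)
  have h1 := mem_hom_left_point_iff h swap_isHomogeneous (modelPoint_ne_zero k) (MvPolynomial.X 2)
  have h2 : (MvPolynomial.X 2 : MvPolynomial (Fin 3) k) ∈ ProjectiveSpectrum.asHomogeneousIdeal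
      (Plane.point (modelPoint k) (modelPoint_ne_zero k)) := by
    have h3 := h1.mpr (by simp [restrictToCone, swap, modelPoint])
    exact (congrArg (fun P => MvPolynomial.X 2 ∈ ProjectiveSpectrum.asHomogeneousIdeal P) hχ).mp h3
  have h3 : restrictToCone (modelPoint k) (MvPolynomial.X 2) = 0 := h2
  simp [restrictToCone, modelPoint] at h3

theorem degSub_inf_fibSub_le : degSub k ⊓ fibSub k ≤ pointSub k := by
  rintro σ ⟨hσ, hσ'⟩
  obtain ⟨a, s, rfl⟩ := exists_eq_torusAut_mul_fib hσ'
  have hs := fib_mem_degSub_iff.mp ((Subgroup.mul_mem_cancel_left _ (torusAut_mem_degSub a)).mp hσ)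
  rw [eq_C_of_natDegree_eq_zero hs]
  exact mul_mem (torusAut_mem_pointSub a) (fib_C_mem_pointSub _)

/-- If `σ` were not in `fibSub`, then `swapAut k * fib (C b) * σ` would lie in `degSub ⊓ fibSub` for
some `b`, hence in `pointSub`; as `σ` and `fib (C b)` lie there, so would the swap. -/
theorem pointSub_le_fibSub : pointSub k ≤ fibSub k := by
  intro σ hσ
  have hle : pointSub k ≤ degSub k := by
    rintro _ ⟨φ, -, rfl⟩
    exact range_coordHom.le ⟨φ, rfl⟩
  refine (degSub_cases (hle hσ)).resolve_right ?_
  rintro ⟨b, h⟩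
  have hd := mul_mem (mul_mem swapAut_mem_degSub (fib_C_mem_degSub b)) (hle hσ)
  have h1 := degSub_inf_fibSub_le ⟨hd, h⟩
  rw [Subgroup.mul_mem_cancel_right _ hσ,
    Subgroup.mul_mem_cancel_right _ (fib_C_mem_pointSub b)] at h1
  exact swapAut_notMem_pointSub h1

theorem mem_restrictToCompl_autPairPoint_iff {ψ : (model k).AutCompl} :
    ψ ∈ (model k).restrictToCompl
      ((model k).autPairPoint (modelPoint k) (modelPoint_ne_zero k)) ↔
    (modelFrame k).model.autEquiv ψ ∈ pointSub k := by
  constructor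
  · rintro ⟨φ, hφ, h⟩
    exact ⟨⟨φ, hφ.1⟩, hφ, congrArg (modelFrame k).model.autEquiv
      (isRes_ext ((resHom_comp_ι ⟨φ, hφ.1⟩).trans h.symm))⟩
  · rintro ⟨φ, hφ, h⟩
    obtain rfl := (modelFrame k).model.autEquiv.injective h
    exact ⟨φ, hφ, resHom_comp_ι φ⟩

/-- An element of `fibSub` is a torus element, which fixes `p₀`, times some `fib s`. -/
theorem closure_fiberedMap : Subgroup.closure ({ψ : (model k).AutCompl |
      ∃ s : k[X], (model k).IsGivenBy ψ (fiberedMap s)} ∪ (model k).restrictToCompl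
        ((model k).autPairPoint (modelPoint k) (modelPoint_ne_zero k))) =
    (model k).autFibration (modelPoint k) := by
  apply le_antisymm
  · rw [Subgroup.closure_le]
    rintro ψ (⟨s, h⟩ | h)
    · refine (modelFrame k).mem_autFibration_iff.mpr (inv_mem_iff.mp ?_)
      rw [isGivenBy_fiberedMap_iff.mp h]
      exact fib_mem_fibSub s
    · exact (modelFrame k).mem_autFibration_iff.mpr
        (pointSub_le_fibSub (mem_restrictToCompl_autPairPoint_iff.mp h))
  · intro ψ hψ
    obtain ⟨a, s, h⟩ := exists_eq_torusAut_mul_fib ((modelFrame k).mem_autFibration_iff.mp hψ)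
    rw [← (modelFrame k).model.autEquiv.symm_apply_apply ψ, h, map_mul]
    refine mul_mem (Subgroup.subset_closure (Or.inr ?_)) (Subgroup.subset_closure (Or.inl ⟨-s, ?_⟩))
    · refine mem_restrictToCompl_autPairPoint_iff.mpr ?_
      rw [MulEquiv.apply_symm_apply]
      exact torusAut_mem_pointSub a
    · rw [isGivenBy_fiberedMap_iff, MulEquiv.apply_symm_apply, fib_neg]

end SmoothConic

end ConicComplement

end

open ConicComplement SmoothConic in
theorem theorem2 (k : Type u) [Field k] :
    (∀ (Q : SmoothConic k) (p : Fin 3 → k), p ≠ 0 → MvPolynomial.eval p Q.q = 0 →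
      IsAmalgamOf (Q.restrictToCompl Q.autPair) (Q.autFibration p)) ∧
    (Nonempty ((model k).autPair ≃* PGL(2, k)) ∧
      (∀ b : k, ∃ φ : AutPlane k, φ.IsGivenBy (shear b)) ∧
      (∀ a : kˣ, ∃ φ : AutPlane k, φ.IsGivenBy (torus a)) ∧
      (∃ φ : AutPlane k, φ.IsGivenBy (swap k)) ∧
      Subgroup.closure {φ : AutPlane k | (∃ b : k, φ.IsGivenBy (shear b)) ∨
        (∃ a : kˣ, φ.IsGivenBy (torus a)) ∨ φ.IsGivenBy (swap k)} = (model k).autPair) ∧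
    ((∀ s : Polynomial k, ∃ ψ : (model k).AutCompl, (model k).IsGivenBy ψ (fiberedMap s)) ∧
      Subgroup.closure ({ψ : (model k).AutCompl |
          ∃ s : Polynomial k, (model k).IsGivenBy ψ (fiberedMap s)} ∪
        (model k).restrictToCompl
          ((model k).autPairPoint (modelPoint k) (modelPoint_ne_zero k))) =
        (model k).autFibration (modelPoint k)) := by
  refine ⟨fun Q p hp hq => isAmalgamOf_restrictToCompl hp hq,
    ⟨nonempty_autPair_equiv_PGL, fun b => ⟨_, shear_isGivenBy b⟩, fun a => ⟨_, torus_isGivenBy a⟩,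
      ⟨_, swap_isGivenBy k⟩, closure_isGivenBy⟩,
    exists_isGivenBy_fiberedMap, closure_fiberedMap⟩
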